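/- Write $\Gamma_{\mathbb R}(s)=\pi^{-s/2}\Gamma(s/2)$, let $n\ge 1$ and $b=(b_1,\dots,b_n)\in\mathbb C^n$. Let $\widehat W_{n,b}(y_1,\dots,y_n)$ ($y_j>0$) be the radial part of the class one Whittaker function on $SO_{2n+1}(\mathbb R)$, defined recursively by $\widehat W_{1,(b_1)}(y_1)=2K_{b_1}(2\pi y_1)$ ($K$ the $K$-Bessel function) and, for $n\ge 2$ and $\widetilde b=(b_1,\dots,b_{n-1})$, $$\begin{aligned}\widehat W_{n,b}(y)=\int_{(\mathbb R_+)^n}\int_{(\mathbb R_+)^{n-1}}&\widehat W_{n-1,\widetilde b}\Bigl(y_2\sqrt{\tfrac{t_2u_2}{t_3u_1}},\dots,y_{n-1}\sqrt{\tfrac{t_{n-1}u_{n-1}}{t_nu_{n-2}}},\,y_n\sqrt{\tfrac{t_n}{u_{n-1}}}\Bigr)\prod_{j=1}^n e^{-(\pi y_j)^2t_j-1/t_j}(\pi y_j)^{b_n}\\&\times\prod_{j=1}^{n-1}e^{-(\pi y_j)^2\frac{t_j}{t_{j+1}}u_j-1/u_j}(t_{j+1}u_j)^{b_n/2}\;\,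 t_1^{b_n}\prod_{j=1}^{n-1}\frac{du_j}{u_j}\prod_{j=1}^n\frac{dt_j}{t_j}.\end{aligned}$$ Let $V_{n,b}(s_1,\dots,s_n)$ denote the Mellin transform $\int_{(\mathbb R_+)^n}\widehat W_{n,b}(y)\prod_{j=1}^n y_j^{s_j}\frac{dy_j}{y_j}$ where this converges absolutely, and its meromorphic continuation to $\mathbb C^n$ elsewhere. **Proposition.** Let $\sigma\in\mathbb C$ and $p=(p_1,\dots,p_n)\in\mathbb C^n$ be such that none of $\sigma\pm b_j$ $(1\le j\le n)$ and $p_1+\sigma$ lies in $\{0,-2,-4,\dots\}$. Put $q_0=0$. Let the variables $q_1,\dots,q_{n-1}$ and $r_1,\dots,r_n$ run upwards over vertical lines in $\mathbb C$, indented on bounded parts if necessary so as to separate the increasing from the decreasing sequences of poles of the integrand below: in each variable the decreasing sequences (including the polar hyperplanes $r_j=\mathrm{const}$ of $V_{n,b}$) lie to the left of the path, the increasing ones to the right. Then $V_{n,b}$ is holomorphic at $p$ and at all points $r$ on the paths, the integral below converges absolutely, and $$\begin{aligned}V_{n,b}(p_1,\dots,p_n)={}&\frac{1}{\prod_{j=1}^n\Gamma_{\mathbb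 R}(\sigma+b_j)\Gamma_{\mathbb R}(\sigma-b_j)}\cdot\frac1{(4\pi i)^{2n-1}}\int_{\substack{q_1,\dots,q_{n-1}\\ r_1,\dots,r_n}}V_{n,b}(r_1,\dots,r_n)\Bigl[\prod_{j=1}^{n-1}\Gamma_{\mathbb R}(p_j-q_j)\Gamma_{\mathbb R}(q_j-r_j)\Bigr]\\&\times\Bigl[\prod_{j=1}^n\Gamma_{\mathbb R}(p_j-q_{j-1}+\sigma)\Gamma_{\mathbb R}(q_{j-1}-r_j+\sigma)\Bigr]\Gamma_{\mathbb R}(p_n-r_n)\,dr_1\cdots dr_n\,dq_1\cdots dq_{n-1}.\end{aligned}$$ -/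

import Mathlib

noncomputable section

namespace SOWhittaker

/-- The open orthant `(ℝ₊)ⁿ`. -/
def orthant (n : ℕ) : Set (Fin n → ℝ) := Set.univ.pi fun _ => Set.Ioi 0

/-- The `K`-Bessel function `K_ν(x) = (1/2) ∫₀^∞ exp(-(x/2)(t + 1/t)) t^ν dt/t`, for `x > 0`. -/
def besselK (ν : ℂ) (x : ℝ) : ℂ :=
  (1 / 2) * ∫ t in Set.Ioi (0 : ℝ),
    (Real.exp (-(x / 2) * (t + 1 / t)) : ℂ) * (t : ℂ) ^ ν / (t : ℂ)

/-- The (`ρ`-shifted) radial part `Ŵ_{n,b}(y₁, …, y_n)`, `y_j > 0`, of the class one Whittaker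
function on `SO_{2n+1}(ℝ)` with parameter `b ∈ ℂⁿ`, given by its recursive integral
representation. The coordinates are `y = β[y₁, …, y_n]`, numbered from `0` here. The arguments of
`Ŵ_{n-1}` are `y_{j+1} √(t_{j+1} u_{j+1} / (t_{j+2} u_j))` with the conventions
`t_{n+1} = u_n = 1`, which are implemented by appending a last entry `1` to `t` and `u`.
The value at `n = 0` is a convention and is never used. -/
def What : (n : ℕ) → (Fin n → ℂ) → (Fin n → ℝ) → ℂ
  | 0, _, _ => 1
  | 1, b, y => 2 * besselK (b 0) (2 * Real.pi * y 0)
  | m + 2, b, y =>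
    ∫ t in orthant (m + 2), ∫ u in orthant (m + 1),
      What (m + 1) (fun j => b j.castSucc)
        (fun j => y j.succ *
          Real.sqrt (t j.succ * (Fin.snoc (α := fun _ => ℝ) u 1 : Fin (m + 2) → ℝ) j.succ /
            ((Fin.snoc (α := fun _ => ℝ) t 1 : Fin (m + 3) → ℝ) j.succ.succ * u j)))
      * (∏ j : Fin (m + 2),
          (Real.exp (-(Real.pi * y j) ^ 2 * t j - 1 / t j) : ℂ) *
            ((Real.pi * y j : ℝ) : ℂ) ^ b (Fin.last (m + 1)))
      * (∏ j : Fin (m + 1),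
          (Real.exp (-(Real.pi * y j.castSucc) ^ 2 * (t j.castSucc / t j.succ) * u j
              - 1 / u j) : ℂ) *
            ((t j.succ * u j : ℝ) : ℂ) ^ (b (Fin.last (m + 1)) / 2))
      * ((t 0 : ℝ) : ℂ) ^ b (Fin.last (m + 1))
      * (∏ j : Fin (m + 1), ((u j : ℝ) : ℂ)⁻¹)
      * (∏ j : Fin (m + 2), ((t j : ℝ) : ℂ)⁻¹)

/-- The integrand `Ŵ_{n,b}(y) ∏ y_j^{s_j} / y_j` of the Mellin transform. -/
def mellinIntegrand {n : ℕ} (b s : Fin n → ℂ) (y : Fin n → ℝ) : ℂ :=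
  What n b y * ∏ j : Fin n, ((y j : ℂ) ^ s j / (y j : ℂ))

/-- Absolute convergence of the Mellin transform at `s`. -/
def MellinConverges {n : ℕ} (b s : Fin n → ℂ) : Prop :=
  MeasureTheory.IntegrableOn (mellinIntegrand b s) (orthant n)

/-- The Mellin transform `∫_{(ℝ₊)ⁿ} Ŵ_{n,b}(y) ∏ y_j^{s_j} dy_j / y_j`. -/
def mellinW {n : ℕ} (b s : Fin n → ℂ) : ℂ :=
  ∫ y in orthant n, mellinIntegrand b s y

/-- The pair of entire functions `F`, `G` represents the Mellin transform as the meromorphic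
function `F / G` on `ℂⁿ`, and `G` does not vanish at `s`. -/
def Represents {n : ℕ} (b s : Fin n → ℂ) (F G : (Fin n → ℂ) → ℂ) : Prop :=
  Differentiable ℂ F ∧ Differentiable ℂ G ∧ G s ≠ 0 ∧
    ∀ z, MellinConverges b z → F z = G z * mellinW b z

/-- The Mellin transform continues to a meromorphic function on `ℂⁿ` which is holomorphic at `s`.
(Every meromorphic function on `ℂⁿ` is a quotient of two entire functions without common
factor, so that the denominator vanishes exactly at the points where the function fails to be
holomorphic.) -/
def Regular {n : ℕ} (b s : Fin n → ℂ) : Prop := ∃ F G, Represents b s F G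

open Classical in
/-- `V_{n,b}(s)`: the Mellin transform of `Ŵ_{n,b}` where it converges absolutely, and its
meromorphic continuation elsewhere (with the value `0` where the continuation is not
holomorphic). -/
def V {n : ℕ} (b s : Fin n → ℂ) : ℂ :=
  if MellinConverges b s then mellinW b s
  else if h : Regular b s then h.choose s / h.choose_spec.choose s
  else 0

/-- The hyperplane `s_j = x` is a polar hyperplane of `V_{n,b}`. -/
def PolarHyperplane {n : ℕ} (b : Fin n → ℂ) (j : Fin n) (x : ℂ) : Prop :=
  ∀ s : Fin n → ℂ, s j = x → ¬ Regular b s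

/-- A path of integration: an upward vertical line, indented on a bounded part. It is a piecewise
continuously differentiable Lipschitz curve `ℝ → ℂ`, equal to `t ↦ c + i t` for large `|t|`. -/
structure IndentedLine where
  path : ℝ → ℂ
  lipschitz : ∃ K, LipschitzWith K path
  piecewise : ∃ S : Finset ℝ, ∀ t, t ∉ S → ContDiffAt ℝ 1 path t
  vertical : ∃ c T : ℝ, ∀ t : ℝ, T ≤ |t| → path t = (c : ℂ) + (t : ℂ) * Complex.I

/-- `z` lies to the left of the curve: off the curve, `z` can be joined to a real point lying to
the left of the whole curve. -/
def IndentedLine.HasOnLeft (γ : IndentedLine) (z : ℂ) : Prop :=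
  ∃ x : ℝ, (∀ t, x < (γ.path t).re) ∧ JoinedIn (Set.range γ.path)ᶜ z (x : ℂ)

/-- `z` lies to the right of the curve. -/
def IndentedLine.HasOnRight (γ : IndentedLine) (z : ℂ) : Prop :=
  ∃ x : ℝ, (∀ t, (γ.path t).re < x) ∧ JoinedIn (Set.range γ.path)ᶜ z (x : ℂ)

/-- The integrand of the Barnes integral, with `n = m + 1`:
`V_{n,b}(r) ∏_{j<n} Γ_ℝ(p_j - q_j) Γ_ℝ(q_j - r_j)
  ∏_{j≤n} Γ_ℝ(p_j - q_{j-1} + σ) Γ_ℝ(q_{j-1} - r_j + σ) · Γ_ℝ(p_n - r_n)`, where `q_0 = 0`. The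
tuple `(q_0, q_1, …, q_{n-1})` is `Fin.cons 0 q`. -/
def barnesIntegrand {m : ℕ} (b : Fin (m + 1) → ℂ) (σ : ℂ) (p : Fin (m + 1) → ℂ)
    (q : Fin m → ℂ) (r : Fin (m + 1) → ℂ) : ℂ :=
  V b r
    * (∏ j : Fin m, Complex.Gammaℝ (p j.castSucc - q j) * Complex.Gammaℝ (q j - r j.castSucc))
    * (∏ j : Fin (m + 1),
        Complex.Gammaℝ (p j - (Fin.cons (α := fun _ => ℂ) 0 q : Fin (m + 1) → ℂ) j + σ) *
        Complex.Gammaℝ ((Fin.cons (α := fun _ => ℂ) 0 q : Fin (m + 1) → ℂ) j - r j + σ))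
    * Complex.Gammaℝ (p (Fin.last m) - r (Fin.last m))

/-- The paths `γq j` for `q_j` and `γr j` for `r_j` separate the increasing from the decreasing
sequences of poles of the integrand: in each variable, the decreasing sequences are on the left
and the increasing ones on the right. -/
structure Separates {m : ℕ} (b : Fin (m + 1) → ℂ) (σ : ℂ) (p : Fin (m + 1) → ℂ)
    (γq : Fin m → IndentedLine) (γr : Fin (m + 1) → IndentedLine) : Prop where
  /-- the poles of `V_{n,b}(r)` -/
  polar : ∀ j x, PolarHyperplane b j x → (γr j).HasOnLeft x
  /-- the poles of `Γ_ℝ(q_0 - r_1 + σ) = Γ_ℝ(σ - r_1)` -/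
  sigma_sub_r : ∀ k : ℕ, (γr 0).HasOnRight (σ + 2 * k)
  /-- the poles of `Γ_ℝ(p_n - r_n)` -/
  p_sub_r : ∀ k : ℕ, (γr (Fin.last m)).HasOnRight (p (Fin.last m) + 2 * k)
  /-- the poles of `Γ_ℝ(p_j - q_j)` -/
  p_sub_q : ∀ (j : Fin m) (k : ℕ), (γq j).HasOnRight (p j.castSucc + 2 * k)
  /-- the poles of `Γ_ℝ(p_{j+1} - q_j + σ)` -/
  p_sub_q' : ∀ (j : Fin m) (k : ℕ), (γq j).HasOnRight (p j.succ + σ + 2 * k)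
  /-- the poles in `q_j` of `Γ_ℝ(q_j - r_j)` (equivalently: the poles `q_j + 2 k` in `r_j` are to
  the right of `γr j` for every `q_j` on `γq j`) -/
  q_sub_r : ∀ (j : Fin m) (k : ℕ) (t : ℝ),
    (γq j).HasOnLeft ((γr j.castSucc).path t - 2 * k)
  /-- the poles in `q_j` of `Γ_ℝ(q_j - r_{j+1} + σ)` -/
  q_sub_r' : ∀ (j : Fin m) (k : ℕ) (t : ℝ),
    (γq j).HasOnLeft ((γr j.succ).path t - σ - 2 * k)

/-- The Barnes integrand pulled back to the real parameters of the `2n - 1 = 2m + 1` paths, that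
is, multiplied by `∏ γq_j'(t_j) ∏ γr_j'(t'_j)`. -/
def pulledBack {m : ℕ} (b : Fin (m + 1) → ℂ) (σ : ℂ) (p : Fin (m + 1) → ℂ)
    (γq : Fin m → IndentedLine) (γr : Fin (m + 1) → IndentedLine)
    (x : (Fin m → ℝ) × (Fin (m + 1) → ℝ)) : ℂ :=
  barnesIntegrand b σ p (fun j => (γq j).path (x.1 j)) (fun j => (γr j).path (x.2 j))
    * (∏ j, deriv (γq j).path (x.1 j)) * (∏ j, deriv (γr j).path (x.2 j))

end SOWhittaker

end

noncomputable section
open MeasureTheory Filter Topology Set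
open Real (exp exp_add exp_pos exp_le_exp exp_neg exp_log pi_ne_zero)
open Complex (I Gamma add_re sub_re mul_re ofReal_re add_im sub_im mul_im ofReal_im abs_re_le_norm continuous_re norm_exp ofReal_ne_zero)
open Finset (prod_mul_distrib sum_add_distrib sum_sub_distrib prod_congr prod_ne_zero_iff sum_congr card_univ prod_const)
namespace SOWhittaker

/-! ### Holomorphic functions of several variables -/

section Holo
variable {E : Type*} [NormedAddCommGroup E] [NormedSpace ℂ E]

/-! In the coordinates `(π y_j)² = e^{x_j - x_{j+1}}` (with a zero after the last `x`) and with `β =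
b / 2`, the defining recursion becomes `w_{n+1}(x) = ∫∫ kl(x, z, a) w_n(z)`, where `kl` is the
exponential of a linear form minus a sum of exponentials. Beside it stands a Baxter kernel `kq σ`,
acting on functions of a fixed number of variables. The two kernels satisfy an intertwining
relation: `kq σ` after `kl τ` equals `Γ(σ+τ) Γ(σ-τ)` times `kl τ` after `kq σ`.

The relation holds already on the level of integrands. An expression `A e^z + B e^{-z}` is unchanged
by the reflection `z ↦ log (B / A) - z`. Three rounds of such reflections, each with centres
depending only on the variables held fixed, preserve Lebesgue measure and carry one integrand to the
other, while two variables split off as Gamma integrals (`flip_E`, `flip_lin`,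
`measurePreserving_flip`). Induction then shows that `w` is an eigenfunction of the Baxter operator
with eigenvalue `∏ Γ(σ+β_j) Γ(σ-β_j)` (`integral_kq_w`).

Next comes the Mellin transform. Writing part of the factors `e^{-e^y}` as Mellin–Barnes integrals
decouples the sites, and each site integrates to a Gamma function times a Beta function
(`mb_expansion`). Applied to the eigenvalue equation this gives `star_identity`, an identity between
`v(p)` and an integral of `v(r)` over vertical lines. Applied to the recursion kernel it gives
`rec_identity`, a Barnes recursion in the number of variables.

`star_identity` is the asserted formula with the variables `q` integrated out: each `q`-integral is
an instance of Barnes' first lemma (`barnes`). That lemma is itself `star_identity` for `n = 1`,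
where `v` is a product of two Gamma functions.

It remains to pass from straight lines and large parameters to the given paths and parameters. From
`rec_identity`, `tame` derives the meromorphic continuation of `v`, with poles on hyperplanes `s_j =
const` and subexponential growth. The engine, here and for the identity, is `splitIntegral_spec`. A
Bézout identity `R = α A + β B`, where `A` vanishes on the left poles and `B` on the right poles,
writes `R / (A B)` as `α / B + β / A`. The first summand is moved to a far left line and the second
to a far right line. The outcome no longer depends on the path and is holomorphic in the parameters.
In `contour_eq` the parameters are translated by `η`; the formula holds for large `η` and is
continued to `η = 0`.

Two facts about paths are used throughout: no point lies on both sides of an indented line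
(`IndentedLine.not_left_and_right`), and separation by the `q`-paths implies the separation needed
on the `r`-paths alone (`IndentedLine.HasOnRight.of_left_translates`). Absolute convergence comes
from the exponential decay of `Γ` along vertical lines against the subexponential growth of the
continued transform. -/

theorem aestronglyMeasurable_clm_of_apply [FiniteDimensional ℂ E] {X : Type*} [MeasurableSpace X]
    {μ : Measure X} {L : X → E →L[ℂ] ℂ} (h : ∀ v, AEStronglyMeasurable (fun x => L x v) μ) :
    AEStronglyMeasurable L μ := by
  classical
  let b := Module.finBasis ℂ E
  have : L = fun x => ∑ i, (L x (b i)) • LinearMap.toContinuousLinearMap (b.coord i) := by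
    funext x
    ext v
    conv_lhs => rw [← b.sum_repr v]
    simp only [map_sum, map_smul, sum_apply, smul_eq_mul, FunLike.coe_smul, Pi.smul_apply,
      LinearMap.coe_toContinuousLinearMap', Module.Basis.coord_apply]
    exact sum_congr rfl fun i _ => mul_comm _ _
  rw [this]
  exact Finset.aestronglyMeasurable_fun_sum _ fun i _ => (h (b i)).smul_const _

/-- An integral depending holomorphically on a parameter, with local domination. -/
theorem differentiableOn_integral_of_dominated [FiniteDimensional ℂ E] {X : Type*}
    [MeasurableSpace X] {μ : Measure X} {U : Set E} (hU : IsOpen U) {f : E → X → ℂ}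
    (hm : ∀ s ∈ U, AEStronglyMeasurable (f s) μ)
    (hd : ∀ x, DifferentiableOn ℂ (fun s => f s x) U)
    (hb : ∀ s ∈ U, ∃ ε > 0, ∃ g : X → ℝ, Integrable g μ ∧
      ∀ s' ∈ Metric.ball s ε, s' ∈ U → ∀ x, ‖f s' x‖ ≤ g x) :
    DifferentiableOn ℂ (fun s => ∫ x, f s x ∂μ) U := by
  intro s hs
  obtain ⟨ε, hε, g, hg, hfg⟩ := hb s hs
  obtain ⟨δ, hδ, hδU⟩ := Metric.isOpen_iff.1 hU s hs
  set r := min ε δ with hr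
  have hr0 : 0 < r := lt_min hε hδ
  have hball : ∀ s' ∈ Metric.ball s (r / 2), Metric.ball s' (r / 2) ⊆ Metric.ball s r := by
    intro s' hs'
    apply Metric.ball_subset_ball'
    have := Metric.mem_ball.1 hs'
    linarith
  have hsub : Metric.ball s r ⊆ U := (Metric.ball_subset_ball (min_le_right _ _)).trans hδU
  have hg' : ∀ s' ∈ Metric.ball s r, ∀ x, ‖f s' x‖ ≤ g x := fun s' hs' x =>
    hfg s' (Metric.ball_subset_ball (min_le_left _ _) hs') (hsub hs') x
  have hD : ∀ x, ∀ s' ∈ Metric.ball s (r / 2),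
      HasFDerivAt (fun s => f s x) (fderiv ℂ (fun s => f s x) s') s' := fun x s' hs' =>
    ((hd x).differentiableAt (hU.mem_nhds
      (hsub (Metric.ball_subset_ball (by linarith) hs')))).hasFDerivAt
  have hs0 : s ∈ Metric.ball s (r / 2) := Metric.mem_ball_self (by positivity)
  refine (hasFDerivAt_integral_of_dominated_of_fderiv_le
    (F' := fun s x => fderiv ℂ (fun s => f s x) s) (bound := fun x => 2 * g x / (r / 2))
    (Metric.ball_mem_nhds s (by positivity : 0 < r / 2)) ?_ ?_ ?_ ?_ ?_ ?_).differentiableAt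
      |>.differentiableWithinAt
  · filter_upwards [hU.mem_nhds hs] with s' hs' using hm s' hs'
  · exact hg.mono' (hm s hs) (Eventually.of_forall fun x => hg' s (Metric.mem_ball_self hr0) x)
  · apply aestronglyMeasurable_clm_of_apply
    intro v
    -- A directional derivative is a pointwise limit of difference quotients of the measurable
    -- functions `f s`, which gives measurability of the derivative in `x`.
    have hl : Tendsto (fun n : ℕ => s + (((n : ℂ) + 1)⁻¹) • v) atTop (𝓝 s) := by
      have h0 : Tendsto (fun n : ℕ => (((n : ℂ) + 1)⁻¹)) atTop (𝓝 0) := by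
        have := tendsto_one_div_add_atTop_nhds_zero_nat (𝕜 := ℂ)
        simpa using this
      simpa using (tendsto_const_nhds (x := s)).add (h0.smul_const v)
    obtain ⟨N, hN⟩ := eventually_atTop.1 (hl.eventually (hU.mem_nhds hs))
    refine aestronglyMeasurable_of_tendsto_ae (u := atTop)
      (f := fun (n : ℕ) x => (((n + N : ℕ) : ℂ) + 1) •
        (f (s + ((((n + N : ℕ) : ℂ) + 1)⁻¹) • v) x - f s x)) ?_ ?_
    · intro n
      exact ((hm _ (hN (n + N) (Nat.le_add_left N n))).sub (hm s hs)).const_smul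
        (((n + N : ℕ) : ℂ) + 1)
    · refine Eventually.of_forall fun x => ?_
      have h := (hD x s hs0)
      have hc : Tendsto (fun n : ℕ => ‖(((n + N : ℕ) : ℂ) + 1)‖) atTop atTop := by
        have : (fun n : ℕ => ‖(((n + N : ℕ) : ℂ) + 1)‖) = fun n : ℕ => ((n + N + 1 : ℕ) : ℝ) := by
          funext n
          have : (((n + N : ℕ) : ℂ) + 1) = ((n + N + 1 : ℕ) : ℂ) := by push_cast; ring
          rw [this, Complex.norm_natCast]
        rw [this]
        exact tendsto_natCast_atTop_atTop.comp (tendsto_atTop_mono (fun n => by simp only [id]; omega) tendsto_id)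
      exact h.lim v hc
  · refine Eventually.of_forall fun x s' hs' => ?_
    -- Cauchy's estimate on a ball of radius `r / 2`: values there differ by at most `2 g x`, so the
    -- derivative is dominated by a multiple of the same `g`.
    refine Complex.norm_fderiv_le_div_of_mapsTo_ball ((hd x).mono ((hball s' hs').trans hsub))
      ?_ (by positivity)
    intro z hz
    have h1 := hg' z (hball s' hs' hz) x
    have h2 := hg' s' (Metric.ball_subset_ball (by linarith) hs') x
    rw [mem_closedBall_iff_norm]
    exact (norm_sub_le _ _).trans (by linarith)
  · exact (hg.const_mul 2).div_const _
  · exact Eventually.of_forall hD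

/-- Identity theorem along a complex line through a point of a convex set. -/
theorem eq_of_eventuallyEq_convex {U : Set E} (hU : IsOpen U) (hc : Convex ℝ U)
    {f g : E → ℂ} (hf : DifferentiableOn ℂ f U) (hg : DifferentiableOn ℂ g U) {a b : E}
    (ha : a ∈ U) (hb : b ∈ U) (h : ∀ᶠ s in 𝓝 a, f s = g s) : f b = g b := by
  let ℓ : ℂ → E := fun τ => a + τ • (b - a)
  have hℓ : Differentiable ℂ ℓ := by fun_prop
  let W : Set ℂ := ℓ ⁻¹' U
  have hW : IsOpen W := hU.preimage hℓ.continuous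
  have hWc : Convex ℝ W := by
    intro x hx y hy p q hp hq hpq
    have : ℓ (p • x + q • y) = p • ℓ x + q • ℓ y := by
      simp only [ℓ, smul_add, add_smul, smul_assoc]
      have : a = p • a + q • a := by rw [← add_smul, hpq, one_smul]
      nth_rw 1 [this]
      abel
    change ℓ _ ∈ U
    rw [this]
    exact hc hx hy hp hq hpq
  have h1 : AnalyticOnNhd ℂ (f ∘ ℓ) W :=
    (hf.comp hℓ.differentiableOn (fun _ h => h)).analyticOnNhd hW
  have h2 : AnalyticOnNhd ℂ (g ∘ ℓ) W :=
    (hg.comp hℓ.differentiableOn (fun _ h => h)).analyticOnNhd hW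
  have h0 : ℓ 0 = a := by simp [ℓ]
  have h1' : ℓ 1 = b := by simp [ℓ]
  have key := h1.eqOn_of_preconnected_of_eventuallyEq h2 hWc.isPreconnected
    (z₀ := 0) (by change ℓ 0 ∈ U; rwa [h0]) (by
      have : Tendsto ℓ (𝓝 0) (𝓝 a) := by
        have := hℓ.continuous.tendsto 0
        rwa [h0] at this
      exact this.eventually h)
  have := key (show (1 : ℂ) ∈ W by change ℓ 1 ∈ U; rwa [h1'])
  simpa [h1'] using this

end Holo

/-- Division of a holomorphic function vanishing on a coordinate hyperplane. -/
theorem exists_differentiableOn_div {n : ℕ} {U : Set (Fin n → ℂ)} (hU : IsOpen U)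
    {f : (Fin n → ℂ) → ℂ} (hf : DifferentiableOn ℂ f U) (j : Fin n) (x : ℂ)
    (h0 : ∀ s ∈ U, s j = x → f s = 0) :
    ∃ q : (Fin n → ℂ) → ℂ, DifferentiableOn ℂ q U ∧ ∀ s ∈ U, f s = (s j - x) * q s := by
  classical
  -- With the partial derivative as value on the hyperplane, `q` is the divided difference of `f` in
  -- the `j`-th variable.
  let q : (Fin n → ℂ) → ℂ := fun s =>
    if s j = x then deriv (fun z => f (Function.update s j z)) x else f s / (s j - x)
  refine ⟨q, ?_, ?_⟩
  swap
  · intro s hs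
    by_cases h : s j = x
    · simp [h, h0 s hs h]
    · have : s j - x ≠ 0 := sub_ne_zero.2 h
      simp [q, h]
      field_simp
  intro s₁ hs₁
  by_cases h : s₁ j = x
  swap
  · have hev : ∀ᶠ s in 𝓝 s₁, s j ≠ x :=
      (continuous_apply j).continuousAt.eventually_ne h
    have h2 : q =ᶠ[𝓝 s₁] fun s => f s / (s j - x) := by
      filter_upwards [hev] with s hs
      simp [q, hs]
    refine (DifferentiableAt.congr_of_eventuallyEq ?_ h2).differentiableWithinAt
    have hd : DifferentiableAt ℂ (fun s : Fin n → ℂ => s j - x) s₁ := by fun_prop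
    simp only [div_eq_mul_inv]
    exact (hf.differentiableAt (hU.mem_nhds hs₁)).fun_mul (hd.fun_inv (sub_ne_zero.2 h))
  obtain ⟨ε, hε, hεU⟩ := Metric.isOpen_iff.1 hU s₁ hs₁
  have hupd : ∀ s ∈ Metric.ball s₁ (ε / 2), ∀ z ∈ Metric.closedBall x (ε / 2),
      Function.update s j z ∈ Metric.closedBall s₁ (ε / 2) := by
    intro s hs z hz
    rw [Metric.mem_closedBall, dist_pi_le_iff (by positivity)]
    intro i
    by_cases hi : i = j
    · subst hi; simpa [h] using hz
    · simp only [Function.update_of_ne hi]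
      exact (dist_le_pi_dist s s₁ i).trans (Metric.mem_ball.1 hs).le
  have hcU : Metric.closedBall s₁ (ε / 2) ⊆ U :=
    (Metric.closedBall_subset_ball (by linarith)).trans hεU
  obtain ⟨C, hC⟩ := (isCompact_closedBall s₁ (ε / 2)).exists_bound_of_continuousOn
    (hf.continuousOn.mono hcU)
  have hφ : ∀ s ∈ Metric.ball s₁ (ε / 2),
      DifferentiableOn ℂ (fun z => f (Function.update s j z)) (Metric.closedBall x (ε / 2)) := by
    intro s hs
    refine hf.comp (t := U) ?_ (fun z hz => hcU (hupd s hs z hz))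
    intro z _
    exact (hasFDerivAt_update s z).differentiableAt.differentiableWithinAt
  -- Cauchy's formula for the divided difference. The circle avoids both `x` and `s j`, so the right
  -- side is visibly holomorphic in `s`, across the hyperplane as well.
  have hrep : ∀ s ∈ Metric.ball s₁ (ε / 2), q s = (2 * Real.pi * I : ℂ)⁻¹ •
      ∮ z in C(x, ε / 2), (z - s j)⁻¹ • (f (Function.update s j z) / (z - x)) := by
    intro s hs
    have hsj : s j ∈ Metric.ball x (ε / 2) := by
      rw [← h]
      exact Metric.mem_ball.2 ((dist_le_pi_dist s s₁ j).trans_lt (Metric.mem_ball.1 hs))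
    have hx0 : f (Function.update s j x) = 0 :=
      h0 _ (hcU (hupd s hs x (Metric.mem_closedBall_self (by positivity)))) (by simp)
    have hds : DifferentiableOn ℂ (dslope (fun z => f (Function.update s j z)) x)
        (Metric.closedBall x (ε / 2)) :=
      (Complex.differentiableOn_dslope (Metric.closedBall_mem_nhds x (by positivity))).2 (hφ s hs)
    have hq : q s = dslope (fun z => f (Function.update s j z)) x (s j) := by
      by_cases hx : s j = x
      · simp [q, hx, dslope_same]
      · rw [dslope_of_ne _ hx, slope_def_field]
        simp [q, hx, hx0]
    have hcauchy := (DiffContOnCl.two_pi_i_inv_smul_circleIntegral_sub_inv_smul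
      (hds.diffContOnCl_ball subset_rfl) hsj)
    rw [hq, ← hcauchy]
    congr 1
    refine circleIntegral.integral_congr (by positivity) ?_
    intro z hz
    have hzx : z ≠ x := by
      rintro rfl
      simp at hz
      linarith
    simp only [dslope_of_ne _ hzx, slope_def_field, hx0, sub_zero]
  have hdiff : DifferentiableOn ℂ (fun s : Fin n → ℂ => (2 * Real.pi * I : ℂ)⁻¹ •
      ∮ z in C(x, ε / 2), (z - s j)⁻¹ • (f (Function.update s j z) / (z - x)))
      (Metric.ball s₁ (ε / 4)) := by
    unfold circleIntegral
    refine DifferentiableOn.fun_const_smul ?_ _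
    simp_rw [intervalIntegral.integral_of_le Real.two_pi_pos.le]
    have hcirc : ∀ θ : ℝ, circleMap x (ε / 2) θ ∈ Metric.closedBall x (ε / 2) := fun θ =>
      circleMap_mem_closedBall x (by positivity) θ
    have hne : ∀ s ∈ Metric.ball s₁ (ε / 4), ∀ θ : ℝ,
        ε / 4 ≤ ‖circleMap x (ε / 2) θ - s j‖ := by
      intro s hs θ
      have h1 : ‖s j - x‖ ≤ ε / 4 := by
        rw [← h, ← dist_eq_norm]
        exact (dist_le_pi_dist s s₁ j).trans (Metric.mem_ball.1 hs).le
      have h2 : ‖circleMap x (ε / 2) θ - x‖ = ε / 2 := by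
        simp [circleMap, abs_of_pos hε]
      have h3 := norm_sub_norm_le (circleMap x (ε / 2) θ - x) (s j - x)
      have h4 : circleMap x (ε / 2) θ - x - (s j - x) = circleMap x (ε / 2) θ - s j := by ring
      rw [h4] at h3
      linarith
    have hsub : Metric.ball s₁ (ε / 4) ⊆ Metric.ball s₁ (ε / 2) :=
      Metric.ball_subset_ball (by linarith)
    have hne0 : ∀ θ : ℝ, circleMap x (ε / 2) θ - x ≠ 0 := by
      intro θ
      have := circleMap_ne_center (c := x) (R := ε / 2) (θ := θ) (by positivity)
      exact sub_ne_zero.2 this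
    refine differentiableOn_integral_of_dominated Metric.isOpen_ball ?_ ?_ ?_
    · intro s hs
      refine Continuous.aestronglyMeasurable ?_
      have c1 : Continuous fun θ => circleMap x (ε / 2) θ := continuous_circleMap _ _
      have c2 : Continuous fun θ => f (Function.update s j (circleMap x (ε / 2) θ)) := by
        have := (hφ s (hsub hs)).continuousOn
        exact this.comp_continuous c1 hcirc
      have c3 : Continuous fun θ => (circleMap x (ε / 2) θ - s j)⁻¹ := by
        refine Continuous.inv₀ (c1.sub continuous_const) ?_
        intro θ hθ
        have := hne s hs θ
        rw [hθ, norm_zero] at this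
        linarith
      have c4 : Continuous fun θ => deriv (circleMap x (ε / 2)) θ := by
        simp only [deriv_circleMap]
        fun_prop
      exact c4.smul (c3.smul (c2.div (c1.sub continuous_const) hne0))
    · intro θ
      refine DifferentiableOn.fun_const_smul ?_ _
      refine DifferentiableOn.fun_smul ?_ ?_
      · refine DifferentiableOn.fun_inv ?_ ?_
        · exact (differentiableOn_const _).sub (by fun_prop)
        · intro s hs hθ
          have := hne s hs θ
          rw [hθ, norm_zero] at this
          linarith
      · simp only [div_eq_mul_inv]
        refine DifferentiableOn.mul_const ?_ _
        refine hf.comp (t := U) ?_ (fun s hs => hcU (hupd s (hsub hs) _ (hcirc θ)))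
        refine Differentiable.differentiableOn ?_
        rw [differentiable_pi]
        intro i
        by_cases hi : i = j
        · subst hi; simp
        · simp only [Function.update_of_ne hi]; fun_prop
    · intro s hs
      refine ⟨1, one_pos, fun _ => ε / 2 * ((ε / 4)⁻¹ * (C / (ε / 2))), ?_, ?_⟩
      · exact integrable_const _
      · intro s' _ hs' θ
        rw [norm_smul, norm_smul, norm_div, norm_inv]
        have e1 : ‖deriv (circleMap x (ε / 2)) θ‖ = ε / 2 := by
          simp [deriv_circleMap, circleMap, abs_of_pos hε]
        have e2 : ‖circleMap x (ε / 2) θ - x‖ = ε / 2 := by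
          simp [circleMap, abs_of_pos hε]
        rw [e1, e2]
        have := hne s' hs' θ
        have := hC _ (hupd s' (hsub hs') _ (hcirc θ))
        beta_reduce
        gcongr
  have hmem : Metric.ball s₁ (ε / 4) ∈ 𝓝 s₁ := Metric.ball_mem_nhds _ (by positivity)
  refine (DifferentiableAt.congr_of_eventuallyEq (hdiff.differentiableAt hmem)
    ?_).differentiableWithinAt
  filter_upwards [hmem] with s hs
  exact hrep s (Metric.ball_subset_ball (by linarith) hs)

/-! ### Entire functions of polynomial growth -/

/-- Entire functions of polynomial growth (that is, polynomials). -/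
def PolyLike {E : Type*} [NormedAddCommGroup E] [NormedSpace ℂ E] (f : E → ℂ) : Prop :=
  Differentiable ℂ f ∧ ∃ (C : ℝ) (d : ℕ), ∀ x, ‖f x‖ ≤ C * (1 + ‖x‖) ^ d

namespace PolyLike
variable {E : Type*} [NormedAddCommGroup E] [NormedSpace ℂ E] {f g : E → ℂ}

theorem const (c : ℂ) : PolyLike (fun _ : E => c) :=
  ⟨differentiable_const _, ‖c‖, 0, fun x => by simp⟩

theorem clm (L : E →L[ℂ] ℂ) : PolyLike (fun x => L x) := by
  refine ⟨L.differentiable, ‖L‖, 1, fun x => (L.le_opNorm x).trans ?_⟩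
  rw [pow_one]
  gcongr
  linarith

theorem add (hf : PolyLike f) (hg : PolyLike g) : PolyLike (fun x => f x + g x) := by
  obtain ⟨hf, C, d, hC⟩ := hf
  obtain ⟨hg, C', d', hC'⟩ := hg
  refine ⟨hf.add hg, |C| + |C'|, d + d', fun x => (norm_add_le _ _).trans ?_⟩
  have h1 : (1 : ℝ) ≤ 1 + ‖x‖ := by linarith [norm_nonneg x]
  have e1 : (1 + ‖x‖) ^ d ≤ (1 + ‖x‖) ^ (d + d') := pow_le_pow_right₀ h1 (by omega)
  have e2 : (1 + ‖x‖) ^ d' ≤ (1 + ‖x‖) ^ (d + d') := pow_le_pow_right₀ h1 (by omega)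
  calc ‖f x‖ + ‖g x‖ ≤ |C| * (1 + ‖x‖) ^ d + |C'| * (1 + ‖x‖) ^ d' := by
        refine add_le_add ((hC x).trans ?_) ((hC' x).trans ?_)
        · gcongr; exact le_abs_self _
        · gcongr; exact le_abs_self _
    _ ≤ |C| * (1 + ‖x‖) ^ (d + d') + |C'| * (1 + ‖x‖) ^ (d + d') := by gcongr
    _ = _ := by ring

theorem mul (hf : PolyLike f) (hg : PolyLike g) : PolyLike (fun x => f x * g x) := by
  obtain ⟨hf, C, d, hC⟩ := hf
  obtain ⟨hg, C', d', hC'⟩ := hg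
  refine ⟨hf.mul hg, C * C', d + d', fun x => ?_⟩
  rw [norm_mul, pow_add]
  calc ‖f x‖ * ‖g x‖ ≤ (C * (1 + ‖x‖) ^ d) * (C' * (1 + ‖x‖) ^ d') :=
        mul_le_mul (hC x) (hC' x) (norm_nonneg _) ((norm_nonneg _).trans (hC x))
    _ = _ := by ring

theorem neg (hf : PolyLike f) : PolyLike (fun x => - f x) := by
  simpa using (const (-1 : ℂ)).mul hf

theorem sub (hf : PolyLike f) (hg : PolyLike g) : PolyLike (fun x => f x - g x) := by
  simpa [sub_eq_add_neg] using hf.add hg.neg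

theorem prod {ι : Type*} (s : Finset ι) {f : ι → E → ℂ} (hf : ∀ i ∈ s, PolyLike (f i)) :
    PolyLike (fun x => ∏ i ∈ s, f i x) := by
  classical
  induction s using Finset.induction_on with
  | empty => simpa using const (1 : ℂ)
  | insert i s hi ih =>
    simp only [Finset.prod_insert hi]
    exact (hf i (by simp)).mul (ih fun k hk => hf k (by simp [hk]))

end PolyLike

/-! ### Gamma integrals in logarithmic coordinates -/

theorem integral_Ioi_eq_integral_exp (g : ℝ → ℂ) :
    ∫ t in Ioi (0 : ℝ), g t = ∫ x : ℝ, (exp x : ℂ) * g (exp x) := by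
  have := integral_image_eq_integral_abs_deriv_smul (s := univ) (f := exp) (f' := exp)
    MeasurableSet.univ (fun x _ => (Real.hasDerivAt_exp x).hasDerivWithinAt)
    Real.exp_injective.injOn g
  rw [image_univ, Real.range_exp, Measure.restrict_univ] at this
  rw [this]
  simp [abs_of_pos (exp_pos _)]

theorem integrableOn_Ioi_iff_integrable_exp (g : ℝ → ℂ) :
    IntegrableOn g (Ioi (0 : ℝ)) ↔
      Integrable fun x : ℝ => (exp x : ℂ) * g (exp x) := by
  have := integrableOn_image_iff_integrableOn_abs_deriv_smul (s := univ) (f := exp)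
    (f' := exp) MeasurableSet.univ (fun x _ => (Real.hasDerivAt_exp x).hasDerivWithinAt)
    Real.exp_injective.injOn g
  rw [image_univ, Real.range_exp, integrableOn_univ] at this
  rw [this]
  simp [abs_of_pos (exp_pos _)]

theorem ofReal_exp_cpow (x : ℝ) (s : ℂ) : ((exp x : ℝ) : ℂ) ^ s = Complex.exp (s * x) := by
  rw [Complex.cpow_def_of_ne_zero (by exact_mod_cast (exp_pos x).ne'),
    ← Complex.ofReal_log (exp_pos x).le, Real.log_exp, mul_comm]

theorem gammaIntegrand_exp (s : ℂ) (x : ℝ) :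
    (exp x : ℂ) * (((exp (-exp x) : ℝ) : ℂ) * ((exp x : ℝ) : ℂ) ^ (s - 1)) =
      Complex.exp (s * x - exp x) := by
  rw [ofReal_exp_cpow]
  push_cast
  rw [← Complex.exp_add, ← Complex.exp_add]
  ring_nf

theorem integrable_exp_mul_sub_exp {s : ℂ} (hs : 0 < s.re) :
    Integrable fun x : ℝ => Complex.exp (s * x - exp x) := by
  have h := Complex.GammaIntegral_convergent hs
  rw [integrableOn_Ioi_iff_integrable_exp] at h
  refine h.congr (Eventually.of_forall fun x => ?_)
  exact gammaIntegrand_exp s x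

theorem integral_exp_mul_sub_exp {s : ℂ} (hs : 0 < s.re) :
    ∫ x : ℝ, Complex.exp (s * x - exp x) = Gamma s := by
  rw [Complex.Gamma_eq_integral hs, Complex.GammaIntegral, integral_Ioi_eq_integral_exp]
  exact integral_congr_ae (Eventually.of_forall fun x => (gammaIntegrand_exp s x).symm)

theorem integrable_exp_mul_sub_mul_exp {s : ℂ} (hs : 0 < s.re) {r : ℂ} (hr : 0 < r.re) :
    Integrable fun x : ℝ => Complex.exp (s * x - r * exp x) := by
  have h := ((integrable_exp_mul_sub_exp hs).comp_add_right (Real.log r.re)).const_mul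
    (Complex.exp (-s * Real.log r.re))
  refine h.mono (by fun_prop) (Eventually.of_forall fun x => le_of_eq ?_)
  rw [norm_mul, norm_exp, norm_exp, norm_exp, ← exp_add]
  congr 1
  simp [exp_add, exp_log hr, Complex.exp_ofReal_re]
  ring

/-- For `r > 0` this is a translation by `log r` in the Gamma integral; both sides are holomorphic
in `Re r > 0`, so the identity theorem extends it. Complex `r` is what permits rotating the ray of
integration in `exists_norm_Gamma_le`. -/
theorem integral_exp_mul_sub_mul_exp {s : ℂ} (hs : 0 < s.re) {r : ℂ} (hr : 0 < r.re) :
    ∫ x : ℝ, Complex.exp (s * x - r * exp x) =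
      Complex.exp (-s * Complex.log r) * Gamma s := by
  have hreal : ∀ r : ℝ, 0 < r → ∫ x : ℝ, Complex.exp (s * x - r * exp x) =
      Complex.exp (-s * Complex.log r) * Gamma s := by
    intro r hr
    rw [← integral_exp_mul_sub_exp hs, ← integral_const_mul,
      ← integral_add_right_eq_self _ (-Real.log r)]
    refine integral_congr_ae (Eventually.of_forall fun x => ?_)
    simp only []
    rw [← Complex.exp_add, exp_add, exp_neg, exp_log hr, ← Complex.ofReal_log hr.le]
    have hr0 : (r : ℂ) ≠ 0 := by exact_mod_cast hr.ne'
    congr 1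
    push_cast
    field_simp
    ring
  let U : Set ℂ := {r | 0 < r.re}
  have hU : IsOpen U := isOpen_lt continuous_const continuous_re
  have hUc : Convex ℝ U := convex_halfSpace_re_gt 0
  have hd1 : DifferentiableOn ℂ (fun r : ℂ => ∫ x : ℝ, Complex.exp (s * x - r * exp x)) U := by
    refine differentiableOn_integral_of_dominated hU ?_ ?_ ?_
    · intro r _
      exact Continuous.aestronglyMeasurable (by fun_prop)
    · intro x
      fun_prop
    · intro r hr
      have hr2 : 0 < r.re / 2 := half_pos hr
      refine ⟨r.re / 2, hr2, fun x => ‖Complex.exp (s * x - ((r.re / 2 : ℝ) : ℂ) * exp x)‖,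
        (integrable_exp_mul_sub_mul_exp hs (by rwa [ofReal_re])).norm, ?_⟩
      intro r' hr' _ x
      beta_reduce
      rw [norm_exp, norm_exp, exp_le_exp]
      have h1 : r.re / 2 ≤ r'.re := by
        have h2 := (abs_re_le_norm (r' - r)).trans (mem_ball_iff_norm.1 hr').le
        rw [sub_re] at h2
        have := (abs_le.1 h2).1
        linarith
      have := mul_le_mul_of_nonneg_right h1 (exp_pos x).le
      simp only [sub_re, mul_re, ofReal_re, ofReal_im, mul_zero,
        sub_zero]
      linarith
  have hd2 : DifferentiableOn ℂ
      (fun r : ℂ => Complex.exp (-s * Complex.log r) * Gamma s) U := by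
    intro r hr
    have : DifferentiableAt ℂ Complex.log r := Complex.differentiableAt_log (Or.inl hr)
    refine DifferentiableAt.differentiableWithinAt ?_
    fun_prop
  have h1 := hd1.analyticOnNhd hU
  have h2 := hd2.analyticOnNhd hU
  refine h1.eqOn_of_preconnected_of_frequently_eq h2 hUc.isPreconnected
    (z₀ := 1) (by simp [U]) ?_ hr
  have ht : Tendsto (fun n : ℕ => ((1 + 1 / ((n : ℝ) + 1) : ℝ) : ℂ)) atTop (𝓝[≠] 1) := by
    refine tendsto_nhdsWithin_iff.2 ⟨?_, Eventually.of_forall fun n => ?_⟩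
    · have := (tendsto_const_nhds (x := (1 : ℝ))).add
        (tendsto_one_div_add_atTop_nhds_zero_nat (𝕜 := ℝ))
      have h3 := (Complex.continuous_ofReal.tendsto _).comp this
      simpa [Function.comp_def] using h3
    · have : (0 : ℝ) < 1 / ((n : ℝ) + 1) := by positivity
      intro h
      have h4 : (1 + 1 / ((n : ℝ) + 1) : ℝ) = 1 := Complex.ofReal_injective h
      linarith
  exact ht.frequently (Frequently.of_forall fun n => hreal _ (by positivity))

theorem integrable_exp_neg_mul_abs {δ : ℝ} (hδ : 0 < δ) :
    Integrable fun t : ℝ => exp (-δ * |t|) := by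
  have h1 : IntegrableOn (fun t : ℝ => exp (-δ * |t|)) (Ioi 0) :=
    (integrableOn_exp_mul_Ioi (neg_lt_zero.2 hδ) 0).congr_fun
      (fun t ht => by rw [abs_of_pos ht]) measurableSet_Ioi
  have h2 : IntegrableOn (fun t : ℝ => exp (-δ * |t|)) (Iic 0) :=
    (integrableOn_exp_mul_Iic hδ 0).congr_fun
      (fun t ht => by rw [abs_of_nonpos ht]; ring_nf) measurableSet_Iic
  rw [← integrableOn_univ, ← Iic_union_Ioi (a := (0 : ℝ))]
  exact h2.union h1

/-- Exponential decay of the Gamma function in vertical strips. -/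
theorem exists_norm_Gamma_le {a b : ℝ} (ha : 0 < a) :
    ∃ C, 0 < C ∧ ∀ z : ℂ, a ≤ z.re → z.re ≤ b →
      ‖Gamma z‖ ≤ C * exp (-(Real.pi / 4) * |z.im|) := by
  obtain ⟨M, hM⟩ := (isCompact_Icc (a := a) (b := b)).exists_bound_of_continuousOn (f := Real.Gamma)
    (fun x hx => (Real.differentiableAt_Gamma fun m h => by
      have := hx.1
      have : (0 : ℝ) ≤ m := Nat.cast_nonneg m
      linarith).continuousAt.continuousWithinAt)
  refine ⟨|M| * exp (|b|) + 1, by positivity, fun z hza hzb => ?_⟩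
  have hz : 0 < z.re := ha.trans_le hza
  -- rotate the ray of integration by an angle `θ` with the sign of `z.im`
  obtain ⟨θ, hθ, hθz⟩ : ∃ θ : ℝ, |θ| = Real.pi / 4 ∧ θ * z.im = (Real.pi / 4) * |z.im| := by
    rcases le_total 0 z.im with h | h
    · exact ⟨Real.pi / 4, abs_of_pos (by positivity), by rw [abs_of_nonneg h]⟩
    · exact ⟨-(Real.pi / 4), by rw [abs_neg, abs_of_pos (by positivity)],
        by rw [abs_of_nonpos h]; ring⟩
  have hcos : Real.cos θ = √2 / 2 := by rw [← Real.cos_abs, hθ, Real.cos_pi_div_four]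
  set r : ℂ := Complex.exp (θ * I) with hr
  have hrre : r.re = √2 / 2 := by rw [hr, Complex.exp_ofReal_mul_I_re, hcos]
  have hr0 : 0 < r.re := by rw [hrre]; positivity
  have hlog : Complex.log r = θ * I := by
    have h1 := abs_le.1 hθ.le
    refine Complex.log_exp ?_ ?_ <;> simp <;> linarith [Real.pi_pos]
  have h1 := integral_exp_mul_sub_mul_exp hz hr0
  have h2 : Gamma z = Complex.exp (z * (θ * I)) *
      ∫ x : ℝ, Complex.exp (z * x - r * exp x) := by
    rw [h1, hlog, ← mul_assoc, ← Complex.exp_add]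
    simp
  -- Taking norms inside replaces `z` by `z.re` and `r` by `r.re = √2 / 2`, and the result is an
  -- integral of the same form, evaluated exactly.
  have h3 : ‖∫ x : ℝ, Complex.exp (z * x - r * exp x)‖ ≤
      exp (-z.re * Real.log (√2 / 2)) * Real.Gamma z.re := by
    refine (norm_integral_le_integral_norm _).trans (le_of_eq ?_)
    have h4 := integral_exp_mul_sub_mul_exp (s := (z.re : ℂ)) (by simpa) (r := ((√2 / 2 : ℝ) : ℂ))
      (by rw [ofReal_re]; positivity)
    rw [← Complex.ofReal_log (by positivity), Complex.Gamma_ofReal] at h4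
    have h5 : ∀ x : ℝ, Complex.exp ((z.re : ℂ) * x - ((√2 / 2 : ℝ) : ℂ) * exp x) =
        ((‖Complex.exp (z * x - r * exp x)‖ : ℝ) : ℂ) := by
      intro x
      rw [norm_exp, Complex.ofReal_exp]
      rw [← hrre]
      simp
    simp_rw [h5] at h4
    rw [integral_complex_ofReal] at h4
    exact_mod_cast h4
  have hlog2 : -Real.log (√2 / 2) ≤ 1 := by
    have h6 : exp (-1) ≤ √2 / 2 := by
      have : (1 : ℝ) ≤ √2 := by rw [Real.one_le_sqrt]; norm_num
      have h7 : exp (-1) ≤ 1 / 2 := by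
        have := Real.exp_one_gt_d9
        rw [exp_neg, inv_le_comm₀ (exp_pos _) (by norm_num)]
        linarith
      linarith
    have := Real.log_le_log (exp_pos _) h6
    rw [Real.log_exp] at this
    linarith
  have hn : ‖Complex.exp (z * (θ * I))‖ = exp (-(Real.pi / 4) * |z.im|) := by
    rw [norm_exp]
    congr 1
    simp
    linarith
  have hGam : Real.Gamma z.re ≤ |M| := (le_abs_self _).trans ((hM _ ⟨hza, hzb⟩).trans (le_abs_self _))
  have hexp : exp (-z.re * Real.log (√2 / 2)) ≤ exp |b| := by
    rw [exp_le_exp]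
    have : z.re ≤ |b| := hzb.trans (le_abs_self _)
    nlinarith
  have hG0 : 0 ≤ Real.Gamma z.re := (Real.Gamma_pos_of_pos hz).le
  rw [h2, norm_mul, hn]
  calc _ ≤ exp (-(Real.pi / 4) * |z.im|) * (exp |b| * |M|) := by
        gcongr
        exact h3.trans (by gcongr)
    _ ≤ _ := by
        have := exp_pos (-(Real.pi / 4) * |z.im|)
        nlinarith

/-! ### The functions `Γ(z/2)` and the corresponding Beta function -/

/-- `Γ(z/2)`. -/
def G (z : ℂ) : ℂ := Gamma (z / 2)

/-- `Γ(x/2) Γ(y/2) / Γ((x+y)/2)`. -/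
def Bt (x y : ℂ) : ℂ := G x * G y * (G (x + y))⁻¹

/-- `∏_{k<N} (z/2 + k)`. -/
def poch (N : ℕ) (z : ℂ) : ℂ := ∏ k ∈ Finset.range N, (z / 2 + k)

theorem poch_succ (N : ℕ) (z : ℂ) : poch (N + 1) z = poch N z * (z / 2 + N) := by
  simp [poch, Finset.prod_range_succ]

theorem poch_add (M N : ℕ) (z : ℂ) : poch (M + N) z = poch M z * poch N (z + 2 * M) := by
  induction N with
  | zero => simp [poch]
  | succ N ih =>
    rw [← add_assoc, poch_succ, ih, poch_succ]
    push_cast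
    ring

theorem poch_eq_zero_iff {N : ℕ} {z : ℂ} : poch N z = 0 ↔ ∃ k < N, z = -(2 * k) := by
  simp only [poch, Finset.prod_eq_zero_iff, Finset.mem_range]
  refine exists_congr fun k => and_congr_right fun _ => ?_
  constructor
  · intro h; linear_combination 2 * h
  · intro h; rw [h]; ring

/-- In reciprocal form the functional equation has no exceptions: at a pole the default value `0` of
`Gamma` makes `(G z)⁻¹` the true value of the entire function `1 / Γ`. -/
theorem G_inv_eq (N : ℕ) (z : ℂ) : (G z)⁻¹ = poch N z * (G (z + 2 * N))⁻¹ := by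
  induction N with
  | zero => simp [poch]
  | succ N ih =>
    rw [ih, poch_succ]
    have := Complex.one_div_Gamma_eq_self_mul_one_div_Gamma_add_one (z / 2 + N)
    have e1 : (z + 2 * N) / 2 = z / 2 + N := by ring
    have e2 : (z + 2 * (N + 1 : ℕ)) / 2 = z / 2 + N + 1 := by push_cast; ring
    rw [G, G, e1, e2, this]
    ring

theorem G_add {z : ℂ} (N : ℕ) (h : ∀ k : ℕ, z ≠ -(2 * k)) : G (z + 2 * N) = poch N z * G z := by
  have h1 := G_inv_eq N z
  have h2 : poch N z ≠ 0 := by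
    rw [Ne, poch_eq_zero_iff]
    push Not
    exact fun k _ => h k
  have h3 : G z = (poch N z)⁻¹ * G (z + 2 * N) := by
    rw [← inv_inv (G z), h1, mul_inv, inv_inv]
  rw [h3, ← mul_assoc, mul_inv_cancel₀ h2, one_mul]

theorem ne_neg_two_mul_of_re_pos {z : ℂ} (hz : 0 < z.re) (k : ℕ) : z ≠ -(2 * k) := by
  intro h
  have := congrArg Complex.re h
  simp at this
  have : (0 : ℝ) ≤ k := Nat.cast_nonneg k
  linarith

theorem differentiableAt_G {z : ℂ} (h : ∀ k : ℕ, z ≠ -(2 * k)) : DifferentiableAt ℂ G z := by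
  have : DifferentiableAt ℂ Gamma (z / 2) := by
    refine Complex.differentiableAt_Gamma _ fun m hm => h m ?_
    linear_combination 2 * hm
  exact this.comp z (differentiableAt_id.div_const 2)

theorem differentiable_G_inv : Differentiable ℂ fun z => (G z)⁻¹ :=
  Complex.differentiable_one_div_Gamma.comp (differentiable_id.div_const 2)

theorem G_ne_zero {z : ℂ} (h : ∀ k : ℕ, z ≠ -(2 * k)) : G z ≠ 0 := by
  refine Complex.Gamma_ne_zero fun m hm => h m ?_
  linear_combination 2 * hm

theorem exists_norm_G_le {a b : ℝ} (ha : 0 < a) :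
    ∃ C, 0 < C ∧ ∀ z : ℂ, a ≤ z.re → z.re ≤ b → ‖G z‖ ≤ C * exp (-(1 / 4) * |z.im|) := by
  obtain ⟨C, hC, h⟩ := exists_norm_Gamma_le (a := a / 2) (b := b / 2) (by positivity)
  refine ⟨C, hC, fun z hza hzb => (h (z / 2) ?_ ?_).trans ?_⟩
  · simp; linarith
  · simp; linarith
  · refine mul_le_mul_of_nonneg_left (Real.exp_le_exp.2 ?_) hC.le
    have e : (z / 2).im = z.im / 2 := by simp
    rw [e, abs_div, abs_two]
    have := Real.pi_gt_three
    nlinarith [abs_nonneg z.im]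

/-- On the unit interval powers decrease as the exponent grows, so the integrand with both exponents
at their least real part dominates, uniformly in the imaginary parts. -/
theorem norm_betaIntegral_le {δ : ℝ} (hδ : 0 < δ) {x y : ℂ} (hx : δ ≤ x.re) (hy : δ ≤ y.re) :
    ‖Complex.betaIntegral x y‖ ≤ ∫ t in (0 : ℝ)..1, ‖(t : ℂ) ^ ((δ : ℂ) - 1) *
      (1 - (t : ℂ)) ^ ((δ : ℂ) - 1)‖ := by
  have hint := (Complex.betaIntegral_convergent (u := δ) (v := δ) (by simpa) (by simpa)).norm
  rw [Complex.betaIntegral]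
  refine intervalIntegral.norm_integral_le_of_norm_le zero_le_one ?_ hint
  -- The norm formula for powers needs a positive base, and `1 - t` vanishes at the right end point.
  have : ∀ᵐ t : ℝ, t ≠ 1 := by simp [ae_iff, measure_singleton]
  filter_upwards [this] with t ht1 ht
  have ht' : t < 1 := lt_of_le_of_ne ht.2 ht1
  have e : (1 - (t : ℂ)) = ((1 - t : ℝ) : ℂ) := by push_cast; rfl
  rw [norm_mul, norm_mul, e, Complex.norm_cpow_eq_rpow_re_of_pos ht.1,
    Complex.norm_cpow_eq_rpow_re_of_pos (by linarith), Complex.norm_cpow_eq_rpow_re_of_pos ht.1,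
    Complex.norm_cpow_eq_rpow_re_of_pos (by linarith)]
  refine mul_le_mul ?_ ?_ (by positivity [sub_pos.2 ht']) (by positivity [ht.1])
  · exact Real.rpow_le_rpow_of_exponent_ge ht.1 ht.2 (by simp [hx])
  · exact Real.rpow_le_rpow_of_exponent_ge (by linarith) (by linarith [ht.1]) (by simp [hy])

theorem Bt_eq_betaIntegral {x y : ℂ} (hx : 0 < x.re) (hy : 0 < y.re) :
    Bt x y = Complex.betaIntegral (x / 2) (y / 2) := by
  have h := Complex.Gamma_mul_Gamma_eq_betaIntegral (s := x / 2) (t := y / 2)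
    (by simpa using hx) (by simpa using hy)
  have hne : G (x + y) ≠ 0 := G_ne_zero (ne_neg_two_mul_of_re_pos (by simp; linarith))
  rw [Bt, G, G, h, ← add_div, mul_comm, ← mul_assoc, ← G, inv_mul_cancel₀ hne, one_mul]

/-- This is why `Bt` is kept as one block: estimating its three Gamma functions separately would
leave the exponential growth of the reciprocal one, which the Beta integral shows to be compensated.
-/
theorem exists_norm_Bt_le {δ : ℝ} (hδ : 0 < δ) :
    ∃ C, 0 < C ∧ ∀ x y : ℂ, δ ≤ x.re → δ ≤ y.re → ‖Bt x y‖ ≤ C := by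
  refine ⟨max (∫ t in (0 : ℝ)..1, ‖(t : ℂ) ^ (((δ / 2 : ℝ) : ℂ) - 1) *
      (1 - (t : ℂ)) ^ (((δ / 2 : ℝ) : ℂ) - 1)‖) 1, lt_of_lt_of_le one_pos (le_max_right _ _), fun x y hx hy => ?_⟩
  rw [Bt_eq_betaIntegral (hδ.trans_le hx) (hδ.trans_le hy)]
  exact (norm_betaIntegral_le (half_pos hδ) (by simpa using by linarith)
    (by simpa using by linarith)).trans (le_max_left _ _)

theorem poch_ne_zero_of_ne {z : ℂ} (h : ∀ k : ℕ, z ≠ -(2 * k)) (N : ℕ) : poch N z ≠ 0 := by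
  rw [Ne, poch_eq_zero_iff]
  push Not
  exact fun k _ => h k

/-- Once the arguments are moved far to the right, all poles sit in two finite products. The
numerator comes from the Gamma function in the denominator of `Bt`, whose argument moves by `4 N`.
-/
theorem Bt_eq_shift {x y : ℂ} (N : ℕ) (hx : ∀ k : ℕ, x ≠ -(2 * k)) (hy : ∀ k : ℕ, y ≠ -(2 * k)) :
    Bt x y = Bt (x + 2 * N) (y + 2 * N) * poch (N + N) (x + y) *
      ((poch N x)⁻¹ * (poch N y)⁻¹) := by
  have h1 := poch_ne_zero_of_ne hx N
  have h2 := poch_ne_zero_of_ne hy N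
  rw [Bt, Bt, G_add N hx, G_add N hy, G_inv_eq (N + N) (x + y)]
  have e : x + 2 * (N : ℂ) + (y + 2 * N) = x + y + 2 * ((N + N : ℕ) : ℂ) := by push_cast; ring
  rw [e]
  field_simp

/-- The Mellin–Barnes representation of `exp(-e^y)`. -/
theorem exp_neg_exp_eq_integral {c : ℝ} (hc : 0 < c) (y : ℝ) :
    Complex.exp (-(exp y : ℂ)) = 1 / (4 * Real.pi) *
      ∫ t : ℝ, G (c + t * I) * Complex.exp (-((c + t * I) / 2) * y) := by
  have hc2 : 0 < c / 2 := half_pos hc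
  have hmel : ∀ z : ℂ, 0 < z.re → mellin (fun x : ℝ => (exp (-x) : ℂ)) z = Gamma z := by
    intro z hz
    rw [← Complex.GammaIntegral_eq_mellin, Complex.Gamma_eq_integral hz]
  have hre : ∀ y : ℝ, 0 < (((c / 2 : ℝ) : ℂ) + y * I).re := by intro y; simp [hc]
  obtain ⟨C, hC, hb⟩ := exists_norm_Gamma_le (a := c / 2) (b := c / 2) hc2
  have hcont : Continuous fun y : ℝ => Gamma (((c / 2 : ℝ) : ℂ) + y * I) := by
    refine continuous_iff_continuousAt.2 fun y => ?_
    have h1 : ContinuousAt Gamma (((c / 2 : ℝ) : ℂ) + y * I) :=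
      (Complex.differentiableAt_Gamma _ fun m hm => by
        have := hre y
        rw [hm] at this
        simp at this
        have : (0 : ℝ) ≤ m := Nat.cast_nonneg m
        linarith).continuousAt
    exact ContinuousAt.comp (f := fun y : ℝ => ((c / 2 : ℝ) : ℂ) + y * I) h1 (by fun_prop)
  have hvert : Complex.VerticalIntegrable Gamma (c / 2) := by
    have hi : Integrable fun t : ℝ => C * exp (-(Real.pi / 4) * |t|) :=
      (integrable_exp_neg_mul_abs (by positivity)).const_mul C
    refine hi.mono' hcont.aestronglyMeasurable (Eventually.of_forall fun t => ?_)
    have := hb (((c / 2 : ℝ) : ℂ) + t * I) (by simp) (by simp)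
    simpa using this
  have hinv := mellinInv_mellin_eq (c / 2) (fun x : ℝ => (exp (-x) : ℂ)) (exp_pos y)
    (by
      have := Complex.GammaIntegral_convergent (s := ((c / 2 : ℝ) : ℂ)) (by simpa)
      rw [MellinConvergent]
      refine this.congr_fun (fun x _ => ?_) measurableSet_Ioi
      simp [mul_comm])
    (by
      refine hvert.congr (Eventually.of_forall fun t => ?_)
      exact (hmel _ (hre t)).symm)
    (by fun_prop)
  rw [mellinInv] at hinv
  simp only [hmel _ (hre _)] at hinv
  have h2 : (fun x : ℝ => (exp (-x) : ℂ)) (exp y) = Complex.exp (-(exp y : ℂ)) := by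
    push_cast; rfl
  rw [← h2]
  beta_reduce
  rw [← hinv]
  -- Halving the integration variable passes from `Gamma` to `G` and turns the constant `1 / (2π)`
  -- of Mellin inversion into `1 / (4π)`.
  have hscale := Measure.integral_comp_mul_left (fun t : ℝ => ((exp y : ℝ) : ℂ) ^
    (-(((c / 2 : ℝ) : ℂ) + t * I)) • Gamma (((c / 2 : ℝ) : ℂ) + t * I))
    (1 / 2)
  have h3 : ∀ t : ℝ, G (c + t * I) * Complex.exp (-((c + t * I) / 2) * y) =
      ((exp y : ℝ) : ℂ) ^ (-(((c / 2 : ℝ) : ℂ) + (1 / 2 * t : ℝ) * I)) •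
        Gamma (((c / 2 : ℝ) : ℂ) + (1 / 2 * t : ℝ) * I) := by
    intro t
    rw [ofReal_exp_cpow, G, smul_eq_mul, mul_comm]
    push_cast
    ring_nf
  simp_rw [h3]
  rw [hscale]
  simp only [Complex.real_smul]
  push_cast
  rw [← mul_assoc]
  congr 1
  norm_num
  ring

section
/-! ### The intertwining relation in logarithmic coordinates -/

section Shear
variable {X Y : Type*} [MeasureSpace X] [SFinite (volume : Measure X)] [MeasureSpace Y]
  [SFinite (volume : Measure Y)]

/-- All reflections `y ↦ c - y` preserve the volume. -/
def ReflInvariant (Y : Type*) [MeasureSpace Y] [Sub Y] : Prop :=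
  ∀ c : Y, MeasurePreserving (fun y => c - y)

theorem ReflInvariant.prod [Sub X] [Sub Y] (hX : ReflInvariant X) (hY : ReflInvariant Y) :
    ReflInvariant (X × Y) := fun c => (hX c.1).prod (hY c.2)

theorem reflInvariant_real : ReflInvariant ℝ := Measure.measurePreserving_sub_left volume

theorem reflInvariant_pi (n : ℕ) : ReflInvariant (Fin n → ℝ) := fun c =>
  measurePreserving_pi (fun _ => volume) (fun _ => volume) fun i =>
    Measure.measurePreserving_sub_left volume (c i)

/-- The flips below reflect one block of variables in a centre depending on another block;
fibrewise, only the invariance of the measure under each single reflection matters. -/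
theorem measurePreserving_sub_snd [Sub Y] [MeasurableSub₂ Y] (hY : ReflInvariant Y)
    {f : X → Y} (hf : Measurable f) :
    MeasurePreserving (fun p : X × Y => (p.1, f p.1 - p.2)) := by
  refine MeasurePreserving.skew_product (f := id) (g := fun x y => f x - y)
    (MeasurePreserving.id _) ?_ ?_
  · exact (hf.comp measurable_fst).sub measurable_snd
  · exact Eventually.of_forall fun x => (hY (f x)).map_eq

theorem measurePreserving_sub_fst [Sub X] [MeasurableSub₂ X] (hX : ReflInvariant X)
    {f : Y → X} (hf : Measurable f) :
    MeasurePreserving (fun p : X × Y => (f p.2 - p.1, p.2)) :=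
  (Measure.measurePreserving_swap (μ := volume) (ν := volume)).comp
    ((measurePreserving_sub_snd hX hf).comp
      (Measure.measurePreserving_swap (μ := volume) (ν := volume)))

end Shear

variable {n : ℕ}

/-- `S_j = e^{-x_j} + e^{-z_j}` for `j < n`, and `S_n = 1`. -/
def Sl (x z : Fin n → ℝ) : Fin (n + 1) → ℝ :=
  Fin.snoc (α := fun _ => ℝ) (fun j => exp (-x j) + exp (-z j)) 1

/-- `T_j = e^{x_j} + e^{z_j}`. -/
def Tu (x z : Fin n → ℝ) (j : Fin n) : ℝ := exp (x j) + exp (z j)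

/-- `e^{x_0}`, followed by `e^{x_{j+1}} + e^{z_j}`. -/
def Tc (x : Fin (n + 1) → ℝ) (z : Fin n → ℝ) : Fin (n + 1) → ℝ :=
  Fin.cons (α := fun _ => ℝ) (exp (x 0)) (Tu (Fin.tail x) z)

@[simp] theorem Sl_castSucc (x z : Fin n → ℝ) (j : Fin n) :
    Sl x z j.castSucc = exp (-x j) + exp (-z j) := by simp [Sl]

@[simp] theorem Sl_last (x z : Fin n → ℝ) : Sl x z (Fin.last n) = 1 := by simp [Sl]

@[simp] theorem Tc_zero (x : Fin (n + 1) → ℝ) (z : Fin n → ℝ) : Tc x z 0 = exp (x 0) := rfl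

@[simp] theorem Tc_succ (x : Fin (n + 1) → ℝ) (z : Fin n → ℝ) (j : Fin n) :
    Tc x z j.succ = exp (x j.succ) + exp (z j) := rfl

/-- The linear part of the exponent of the Baxter kernel. -/
def qlin (x z a : Fin n → ℝ) : ℝ := ∑ j, (x j + z j - 2 * a j)

/-- The exponential part of the exponent of the Baxter kernel. -/
def qE (x z a : Fin n → ℝ) : ℝ :=
  ∑ j, (Tu x z j * exp (-a j) + Sl x z j.succ * exp (a j))

/-- The linear part of the exponent of the recursion kernel. -/
def llin (x : Fin (n + 1) → ℝ) (z : Fin n → ℝ) (a : Fin (n + 1) → ℝ) : ℝ :=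
  ∑ j, x j + ∑ j, z j - 2 * ∑ j, a j

/-- The exponential part of the exponent of the recursion kernel. -/
def lE (x : Fin (n + 1) → ℝ) (z : Fin n → ℝ) (a : Fin (n + 1) → ℝ) : ℝ :=
  ∑ j, (Tc x z j * exp (-a j) + Sl (Fin.tail x) z j * exp (a j))

/-- The variables `((a, b₀, b'), (z₀, z'))`. -/
abbrev FlipSpace (n : ℕ) : Type :=
  ((Fin (n + 1) → ℝ) × ℝ × (Fin n → ℝ)) × (ℝ × (Fin n → ℝ))

/-- `log (e^a + e^b)`. -/
def lse (a b : ℝ) : ℝ := Real.log (exp a + exp b)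

theorem exp_lse (a b : ℝ) : exp (lse a b) = exp a + exp b :=
  exp_log (by positivity)

theorem lse_neg (a b : ℝ) : lse (-a) (-b) = lse a b - a - b := by
  apply Real.exp_injective
  rw [exp_lse, Real.exp_sub, Real.exp_sub, exp_lse, exp_neg, exp_neg]
  field_simp
  ring

@[fun_prop]
theorem measurable_lse {X : Type*} [MeasurableSpace X] {f g : X → ℝ} (hf : Measurable f)
    (hg : Measurable g) : Measurable fun x => lse (f x) (g x) := by
  unfold lse
  fun_prop

/-- First flip: `z` is replaced by `c`. -/
def flipOne (p : FlipSpace n) : FlipSpace n :=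
  let a := p.1.1
  let b : Fin (n + 1) → ℝ := Fin.cons (α := fun _ => ℝ) p.1.2.1 p.1.2.2
  (p.1, ((lse (a (Fin.last n)) (b (Fin.last n)) - lse (-a 0) (-b 0),
    fun j => lse (a j.castSucc) (b j.castSucc) - lse (-a j.succ) (-b j.succ)) : ℝ × (Fin n → ℝ))
      - p.2)

/-- The logarithm of the coefficients of `e^{-a_j}` in the second flip. -/
def logEm (x : Fin (n + 1) → ℝ) (c : Fin n → ℝ) : Fin (n + 1) → ℝ :=
  Fin.cons (α := fun _ => ℝ) (x 0) (fun j => lse (x j.succ) (c j))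

/-- The logarithm of the coefficients of `e^{a_j}` in the second flip. -/
def logEp (x : Fin n → ℝ) (c₀ : ℝ) (c : Fin n → ℝ) : Fin (n + 1) → ℝ :=
  Fin.snoc (α := fun _ => ℝ) (fun j => lse (-x j) (-c j)) (lse 0 (-c₀))

/-- Second flip: `a`, `b` are inverted. -/
def flipTwo (x : Fin (n + 1) → ℝ) (y : Fin n → ℝ) (p : FlipSpace n) : FlipSpace n :=
  let c₀ := p.2.1
  let c := p.2.2
  (((fun j => logEm x c j - logEp (Fin.tail x) c₀ c j, -logEp y c₀ c 0,
    fun j => lse (y j) (c j) - logEp y c₀ c j.succ) : (Fin (n + 1) → ℝ) × ℝ × (Fin n → ℝ)) - p.1,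
    p.2)

/-- The sums `e^{a_0}, e^{a_{j+1}} + e^{b_j}`. -/
def Msum (a : Fin (n + 1) → ℝ) (b : Fin n → ℝ) : Fin (n + 1) → ℝ :=
  Fin.cons (α := fun _ => ℝ) (exp (a 0)) (fun j => exp (a j.succ) + exp (b j))

theorem Msum_pos (a : Fin (n + 1) → ℝ) (b : Fin n → ℝ) (j : Fin (n + 1)) : 0 < Msum a b j := by
  refine Fin.cases ?_ (fun j => ?_) j
  · exact exp_pos _
  · simp only [Msum, Fin.cons_succ]; positivity

/-- Third flip: `c` is replaced by the new `z`. -/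
def flipThree (p : FlipSpace n) : FlipSpace n :=
  let a := p.1.1
  let b := p.1.2.2
  (p.1, ((Real.log (Msum a b (Fin.last n)),
    fun j => Real.log (Msum a b j.castSucc) - lse (-a j.succ) (-b j)) : ℝ × (Fin n → ℝ)) - p.2)

/-- The composition of the three flips. -/
def flip (x : Fin (n + 1) → ℝ) (y : Fin n → ℝ) (p : FlipSpace n) : FlipSpace n :=
  flipThree (flipTwo x y (flipOne p))

theorem measurable_cons_apply {X : Type*} [MeasurableSpace X] {f : X → ℝ} {g : X → Fin n → ℝ}
    (hf : Measurable f) (hg : Measurable g) (j : Fin (n + 1)) :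
    Measurable fun x => (Fin.cons (α := fun _ => ℝ) (f x) (g x) : Fin (n + 1) → ℝ) j := by
  refine Fin.cases ?_ (fun j => ?_) j
  · simpa using hf
  · simpa [Function.comp_def] using (measurable_pi_apply j).comp hg

theorem measurable_snoc_apply {X : Type*} [MeasurableSpace X] {f : X → ℝ} {g : X → Fin n → ℝ}
    (hf : Measurable f) (hg : Measurable g) (j : Fin (n + 1)) :
    Measurable fun x => (Fin.snoc (α := fun _ => ℝ) (g x) (f x) : Fin (n + 1) → ℝ) j := by
  refine Fin.lastCases ?_ (fun j => ?_) j
  · simpa using hf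
  · simpa [Function.comp_def] using (measurable_pi_apply j).comp hg

theorem measurePreserving_flip (x : Fin (n + 1) → ℝ) (y : Fin n → ℝ) :
    MeasurePreserving (flip x y) := by
  refine MeasurePreserving.comp (g := flipThree) (μb := volume) ?_
    (MeasurePreserving.comp (g := flipTwo x y) (μb := volume) ?_ (f := flipOne) ?_)
  · refine measurePreserving_sub_snd (reflInvariant_real.prod (reflInvariant_pi n)) (f := fun u : (Fin (n + 1) → ℝ) × ℝ × (Fin n → ℝ) =>
      ((Real.log (Msum u.1 u.2.2 (Fin.last n)), fun j => Real.log (Msum u.1 u.2.2 j.castSucc) -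
        lse (-u.1 j.succ) (-u.2.2 j)) : ℝ × (Fin n → ℝ))) ?_
    have h : ∀ j, Measurable fun u : (Fin (n + 1) → ℝ) × ℝ × (Fin n → ℝ) => Msum u.1 u.2.2 j := by
      intro j
      exact measurable_cons_apply (by fun_prop) (by fun_prop) j
    refine (h _).log.prodMk (measurable_pi_lambda _ fun j => (h _).log.sub ?_)
    fun_prop
  · refine measurePreserving_sub_fst ((reflInvariant_pi _).prod
      (reflInvariant_real.prod (reflInvariant_pi n))) (f := fun v : ℝ × (Fin n → ℝ) =>
      ((fun j => logEm x v.2 j - logEp (Fin.tail x) v.1 v.2 j, -logEp y v.1 v.2 0,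
    fun j => lse (y j) (v.2 j) - logEp y v.1 v.2 j.succ) :
      (Fin (n + 1) → ℝ) × ℝ × (Fin n → ℝ))) ?_
    have h : ∀ (x : Fin n → ℝ) j, Measurable fun v : ℝ × (Fin n → ℝ) => logEp x v.1 v.2 j := by
      intro x j
      exact measurable_snoc_apply (by fun_prop) (by fun_prop) j
    have h' : ∀ j, Measurable fun v : ℝ × (Fin n → ℝ) => logEm x v.2 j := by
      intro j
      exact measurable_cons_apply (by fun_prop) (by fun_prop) j
    refine (measurable_pi_lambda _ fun j => (h' j).sub (h _ j)).prodMk ((h _ 0).neg.prodMk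
      (measurable_pi_lambda _ fun j => Measurable.sub ?_ (h _ _)))
    fun_prop
  · refine measurePreserving_sub_snd (reflInvariant_real.prod (reflInvariant_pi n)) (f := fun u : (Fin (n + 1) → ℝ) × ℝ × (Fin n → ℝ) =>
      ((lse (u.1 (Fin.last n)) ((Fin.cons (α := fun _ => ℝ) u.2.1 u.2.2 : Fin (n + 1) → ℝ)
        (Fin.last n)) - lse (-u.1 0) (-(Fin.cons (α := fun _ => ℝ) u.2.1 u.2.2 :
          Fin (n + 1) → ℝ) 0),
    fun j => lse (u.1 j.castSucc) ((Fin.cons (α := fun _ => ℝ) u.2.1 u.2.2 :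
      Fin (n + 1) → ℝ) j.castSucc) - lse (-u.1 j.succ) (-(Fin.cons (α := fun _ => ℝ) u.2.1 u.2.2 :
        Fin (n + 1) → ℝ) j.succ)) : ℝ × (Fin n → ℝ))) ?_
    have h : ∀ j, Measurable fun u : (Fin (n + 1) → ℝ) × ℝ × (Fin n → ℝ) =>
        (Fin.cons (α := fun _ => ℝ) u.2.1 u.2.2 : Fin (n + 1) → ℝ) j := fun j =>
      measurable_cons_apply (by fun_prop) (by fun_prop) j
    refine Measurable.prodMk ?_ (measurable_pi_lambda _ fun j => ?_)
    · exact (measurable_lse (by fun_prop) (h _)).sub (measurable_lse (by fun_prop) (h _).neg)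
    · exact (measurable_lse (by fun_prop) (h _)).sub (measurable_lse (by fun_prop) (h _).neg)

section FlipIdentities
variable (x : Fin (n + 1) → ℝ) (y : Fin n → ℝ) (p : FlipSpace n)

/-- The exponential part before the flips. -/
def flipE₀ : ℝ :=
  qE x (Fin.cons (α := fun _ => ℝ) p.2.1 p.2.2) p.1.1 +
    lE (Fin.cons (α := fun _ => ℝ) p.2.1 p.2.2) y (Fin.cons (α := fun _ => ℝ) p.1.2.1 p.1.2.2)

/-- The exponential part after the first flip. -/
def flipE₁ : ℝ :=
  ∑ j, (exp (logEm x p.2.2 j) * exp (-p.1.1 j) +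
      exp (logEp (Fin.tail x) p.2.1 p.2.2 j) * exp (p.1.1 j)) +
    (∑ j, (exp (y j) + exp (p.2.2 j)) * exp (-p.1.2.2 j)) +
    ∑ j, exp (logEp y p.2.1 p.2.2 j) *
      exp ((Fin.cons (α := fun _ => ℝ) p.1.2.1 p.1.2.2 : Fin (n + 1) → ℝ) j)

/-- The exponential part after the second flip. -/
def flipE₂ : ℝ :=
  ∑ j, (exp (logEm x p.2.2 j) * exp (-p.1.1 j) +
      exp (logEp (Fin.tail x) p.2.1 p.2.2 j) * exp (p.1.1 j)) +
    (∑ j, (exp (y j) + exp (p.2.2 j)) * exp (-p.1.2.2 j)) +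
    ∑ j : Fin n, exp (logEp y p.2.1 p.2.2 j.succ) * exp (p.1.2.2 j) + exp (-p.1.2.1)

/-- The exponential part after the three flips. -/
def flipE₃ : ℝ :=
  lE x p.2.2 p.1.1 + qE p.2.2 y p.1.2.2 + exp p.2.1 + exp (-p.1.2.1)

@[simp] theorem exp_logEm_zero (c : Fin n → ℝ) : exp (logEm x c 0) = exp (x 0) := rfl

@[simp] theorem exp_logEm_succ (c : Fin n → ℝ) (j : Fin n) :
    exp (logEm x c j.succ) = exp (x j.succ) + exp (c j) := exp_lse _ _

@[simp] theorem exp_logEp_castSucc (c₀ : ℝ) (c : Fin n → ℝ) (j : Fin n) :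
    exp (logEp y c₀ c j.castSucc) = exp (-y j) + exp (-c j) := by
  simp [logEp, exp_lse]

@[simp] theorem exp_logEp_last (c₀ : ℝ) (c : Fin n → ℝ) :
    exp (logEp y c₀ c (Fin.last n)) = 1 + exp (-c₀) := by simp [logEp, exp_lse]

theorem qE_succ (x z a : Fin (n + 1) → ℝ) : qE x z a =
    exp (x 0) * exp (-a 0) + exp (z 0) * exp (-a 0) +
    ∑ j : Fin n, exp (x j.succ) * exp (-a j.succ) +
    ∑ j : Fin n, exp (z j.succ) * exp (-a j.succ) +
    ∑ j : Fin n, exp (-x j.succ) * exp (a j.castSucc) +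
    ∑ j : Fin n, exp (-z j.succ) * exp (a j.castSucc) + exp (a (Fin.last n)) := by
  simp only [qE, sum_add_distrib, Tu, add_mul]
  rw [Fin.sum_univ_castSucc (fun j => Sl x z _ * _), Fin.sum_univ_succ, Fin.sum_univ_succ]
  simp only [Fin.succ_castSucc, Sl_castSucc, Fin.succ_last, Sl_last, add_mul,
    sum_add_distrib]
  ring

theorem lE_expand (a : Fin (n + 1) → ℝ) : lE x y a =
    exp (x 0) * exp (-a 0) +
    ∑ j : Fin n, exp (x j.succ) * exp (-a j.succ) +
    ∑ j : Fin n, exp (y j) * exp (-a j.succ) +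
    ∑ j : Fin n, exp (-x j.succ) * exp (a j.castSucc) +
    ∑ j : Fin n, exp (-y j) * exp (a j.castSucc) + exp (a (Fin.last n)) := by
  simp only [lE, sum_add_distrib]
  rw [Fin.sum_univ_castSucc (fun j => Sl _ _ _ * _), Fin.sum_univ_succ]
  simp only [Sl_castSucc, Sl_last, Tc_zero, Tc_succ, add_mul, sum_add_distrib, Fin.tail]
  ring

theorem qE_expand (z b : Fin n → ℝ) : qE z y b =
    ∑ j : Fin n, exp (z j) * exp (-b j) + ∑ j : Fin n, exp (y j) * exp (-b j) +
    ∑ j : Fin n, Sl z y j.succ * exp (b j) := by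
  simp only [qE, sum_add_distrib, Tu, add_mul]

theorem sum_exp_logEm (c : Fin n → ℝ) (a : Fin (n + 1) → ℝ) :
    ∑ j, exp (logEm x c j) * exp (-a j) =
    exp (x 0) * exp (-a 0) +
    ∑ j : Fin n, exp (x j.succ) * exp (-a j.succ) +
    ∑ j : Fin n, exp (c j) * exp (-a j.succ) := by
  rw [Fin.sum_univ_succ]
  simp only [exp_logEm_zero, exp_logEm_succ, add_mul, sum_add_distrib]
  ring

theorem sum_exp_logEp (c₀ : ℝ) (c : Fin n → ℝ) (e : Fin (n + 1) → ℝ) :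
    ∑ j, exp (logEp y c₀ c j) * e j =
    ∑ j : Fin n, exp (-y j) * e j.castSucc + ∑ j : Fin n, exp (-c j) * e j.castSucc +
    e (Fin.last n) + exp (-c₀) * e (Fin.last n) := by
  rw [Fin.sum_univ_castSucc]
  simp only [exp_logEp_castSucc, exp_logEp_last, add_mul, sum_add_distrib]
  ring

/-- Every entry of `z` but the first occurs as `A e^z + B e^{-z}` with `A`, `B` depending on `a`,
`b`, and the reflection exchanges the two terms. The first entry occurs only in `A e^z`; its
reflection turns this into `B e^{-c₀}` with `B` the sum of the two boundary terms `e^{a_n} +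
e^{b_n}`. Collecting the coefficients of `e^{±a}` and `e^{±b}` gives `flipE₁`. -/
theorem flipE₀_eq : flipE₀ x y p = flipE₁ x y (flipOne p) := by
  obtain ⟨⟨a, b₀, b'⟩, ⟨z₀, z⟩⟩ := p
  set b : Fin (n + 1) → ℝ := Fin.cons (α := fun _ => ℝ) b₀ b' with hb
  set c₀ := lse (a (Fin.last n)) (b (Fin.last n)) - lse (-a 0) (-b 0) - z₀ with hc₀
  set c : Fin n → ℝ := fun j =>
    lse (a j.castSucc) (b j.castSucc) - lse (-a j.succ) (-b j.succ) - z j with hc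
  have e1 : flipOne ((a, b₀, b'), (z₀, z)) = ((a, b₀, b'), (c₀, c)) := rfl
  have h0 : exp z₀ * (exp (-a 0) + exp (-b 0)) =
      exp (-c₀) * (exp (a (Fin.last n)) + exp (b (Fin.last n))) := by
    rw [← exp_lse, ← exp_lse, ← exp_add, ← exp_add, hc₀]
    ring_nf
  have h1 : ∀ j, exp (z j) * (exp (-a j.succ) + exp (-b j.succ)) =
      exp (-c j) * (exp (a j.castSucc) + exp (b j.castSucc)) := by
    intro j
    rw [← exp_lse, ← exp_lse, ← exp_add, ← exp_add]
    simp only [hc]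
    ring_nf
  have h2 : ∀ j, exp (c j) * (exp (-a j.succ) + exp (-b j.succ)) =
      exp (-z j) * (exp (a j.castSucc) + exp (b j.castSucc)) := by
    intro j
    rw [← exp_lse, ← exp_lse, ← exp_add, ← exp_add]
    simp only [hc]
    ring_nf
  have H1 := sum_congr (rfl : (Finset.univ : Finset (Fin n)) = Finset.univ)
    (fun j _ => h1 j)
  have H2 := sum_congr (rfl : (Finset.univ : Finset (Fin n)) = Finset.univ)
    (fun j _ => h2 j)
  simp only [mul_add, sum_add_distrib] at H1 H2 h0
  rw [e1]
  simp only [flipE₀, flipE₁]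
  rw [qE_succ, lE_expand, sum_add_distrib, sum_exp_logEm, sum_exp_logEp, ← hb,
    sum_exp_logEp (e := fun j => exp (b j))]
  have e2 : ∀ j, b j.succ = b' j := fun j => by simp [hb]
  simp only [Fin.cons_zero, Fin.cons_succ, Fin.tail, add_mul, sum_add_distrib] at *
  simp only [e2] at *
  linarith

/-- Now each `a j`, and each entry of `b` but the first, has an expression `A e^{-a} + B e^{a}`
invariant under its reflection. The first entry of `b` has lost its term in `e^{-b₀}`, so its
reflection leaves a bare `e^{-h}` decoupled from all other variables. -/
theorem flipE₁_eq : flipE₁ x y p = flipE₂ x y (flipTwo x y p) := by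
  obtain ⟨⟨a, b₀, b⟩, ⟨c₀, c⟩⟩ := p
  have e1 : flipTwo x y ((a, b₀, b), (c₀, c)) = ((fun j => logEm x c j -
      logEp (Fin.tail x) c₀ c j - a j, -logEp y c₀ c 0 - b₀,
      fun j => lse (y j) (c j) - logEp y c₀ c j.succ - b j), (c₀, c)) := rfl
  rw [e1]
  simp only [flipE₁, flipE₂]
  rw [Fin.sum_univ_succ (fun j => exp (logEp y _ _ _) * _)]
  simp only [← exp_add, Fin.cons_zero, Fin.cons_succ, ← exp_lse (y _) (c _)]
  have e2 : ∀ j, logEm x c j + -(logEm x c j - logEp (Fin.tail x) c₀ c j - a j) =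
      logEp (Fin.tail x) c₀ c j + a j := fun j => by ring
  have e3 : ∀ j, logEp (Fin.tail x) c₀ c j + (logEm x c j - logEp (Fin.tail x) c₀ c j - a j) =
      logEm x c j + -a j := fun j => by ring
  have e4 : ∀ j : Fin n, lse (y j) (c j) + -(lse (y j) (c j) - logEp y c₀ c j.succ - b j) =
      logEp y c₀ c j.succ + b j := fun j => by ring
  have e5 : ∀ j : Fin n, logEp y c₀ c j.succ + (lse (y j) (c j) - logEp y c₀ c j.succ - b j) =
      lse (y j) (c j) + - b j := fun j => by ring
  have e6 : -(-logEp y c₀ c 0 - b₀) = logEp y c₀ c 0 + b₀ := by ring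
  simp only [e2, e3, e4, e5, e6, sum_add_distrib]
  ring

/-- The mechanism of the first flip, now for `c`; this time `c₀` occurs only through `e^{-c₀}` and
becomes the decoupled term `e^g`. -/
theorem flipE₂_eq : flipE₂ x y p = flipE₃ x y (flipThree p) := by
  obtain ⟨⟨a, h, b⟩, ⟨c₀, c⟩⟩ := p
  set g := Real.log (Msum a b (Fin.last n)) - c₀ with hg
  set z : Fin n → ℝ := fun j =>
    Real.log (Msum a b j.castSucc) - lse (-a j.succ) (-b j) - c j with hz
  have e1 : flipThree ((a, h, b), (c₀, c)) = ((a, h, b), (g, z)) := rfl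
  -- The missing first entry of `b` counts as `e^{-∞} = 0`, so that all coefficients can be treated
  -- uniformly.
  let B : Fin (n + 1) → ℝ := Fin.cons (α := fun _ => ℝ) 0 (fun j => exp (b j))
  have hM : ∀ j, Msum a b j = exp (a j) + B j := by
    intro j
    refine Fin.cases ?_ (fun j => ?_) j
    · simp [Msum, B]
    · simp [Msum, B]
  have h0 : exp g = exp (-c₀) * (exp (a (Fin.last n)) + B (Fin.last n)) := by
    rw [← hM, hg, sub_eq_add_neg, exp_add, exp_log (Msum_pos _ _ _), mul_comm]
  have h1 : ∀ j, exp (z j) * (exp (-a j.succ) + exp (-b j)) =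
      exp (-c j) * (exp (a j.castSucc) + B j.castSucc) := by
    intro j
    rw [← hM, ← exp_lse, ← exp_log (Msum_pos a b j.castSucc), ← exp_add, ← exp_add]
    simp only [hz]
    ring_nf
  have h2 : ∀ j, exp (c j) * (exp (-a j.succ) + exp (-b j)) =
      exp (-z j) * (exp (a j.castSucc) + B j.castSucc) := by
    intro j
    rw [← hM, ← exp_lse, ← exp_log (Msum_pos a b j.castSucc), ← exp_add, ← exp_add]
    simp only [hz]
    ring_nf
  have H1 := sum_congr (rfl : (Finset.univ : Finset (Fin n)) = Finset.univ)
    (fun j _ => h1 j)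
  have H2 := sum_congr (rfl : (Finset.univ : Finset (Fin n)) = Finset.univ)
    (fun j _ => h2 j)
  simp only [mul_add, sum_add_distrib] at H1 H2 h0
  rw [e1]
  simp only [flipE₃, flipE₂]
  have e3 : ∑ j : Fin n, exp (logEp y c₀ c j.succ) * exp (b j) =
      ∑ j, exp (logEp y c₀ c j) * B j := by
    rw [Fin.sum_univ_succ]
    simp [B]
  have e4 : ∑ j : Fin n, Sl z y j.succ * exp (b j) = ∑ j, Sl z y j * B j := by
    rw [Fin.sum_univ_succ]
    simp [B]
  rw [lE_expand, qE_expand, sum_add_distrib, sum_exp_logEm, sum_exp_logEp, e3, e4,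
    sum_exp_logEp (e := B), Fin.sum_univ_castSucc (fun j => Sl z y j * B j)]
  simp only [Sl_castSucc, Sl_last, Fin.tail, add_mul, sum_add_distrib] at *
  linarith

theorem flip_E : flipE₀ x y p = flipE₃ x y (flip x y p) := by
  rw [flipE₀_eq, flipE₁_eq, flipE₂_eq, flip]

/-- The logarithmic terms telescope because `lse (-a) (-b)` and `lse a b` differ by a linear
expression. -/
theorem sum_lse (a b : Fin (n + 1) → ℝ) :
    lse (a (Fin.last n)) (b (Fin.last n)) - lse (-a 0) (-b 0) +
      ∑ j : Fin n, (lse (a j.castSucc) (b j.castSucc) - lse (-a j.succ) (-b j.succ)) =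
    ∑ j, a j + ∑ j, b j := by
  have h1 := Fin.sum_univ_castSucc (fun j => lse (a j) (b j))
  have h2 := Fin.sum_univ_succ (fun j => lse (-a j) (-b j))
  have h3 : ∑ j, lse (-a j) (-b j) = ∑ j, lse (a j) (b j) - ∑ j, a j - ∑ j, b j := by
    rw [← sum_sub_distrib, ← sum_sub_distrib]
    exact sum_congr rfl fun j _ => lse_neg _ _
  rw [sum_sub_distrib]
  linarith

/-- The effect of the flips on the linear part of the exponent. -/
theorem flip_lin :
    let z := (Fin.cons (α := fun _ => ℝ) p.2.1 p.2.2 : Fin (n + 1) → ℝ)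
    let b := (Fin.cons (α := fun _ => ℝ) p.1.2.1 p.1.2.2 : Fin (n + 1) → ℝ)
    let p' := flip x y p
    qlin x z p.1.1 = qlin p'.2.2 y p'.1.2.2 + p'.2.1 - p'.1.2.1 ∧
      llin z y b = llin x p'.2.2 p'.1.1 + p'.2.1 + p'.1.2.1 := by
  obtain ⟨⟨a, b₀, b'⟩, ⟨z₀, z⟩⟩ := p
  intro zz b p'
  set c₀ := lse (a (Fin.last n)) (b (Fin.last n)) - lse (-a 0) (-b 0) - z₀ with hc₀
  set c : Fin n → ℝ := fun j =>
    lse (a j.castSucc) (b j.castSucc) - lse (-a j.succ) (-b j.succ) - z j with hc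
  set A : Fin (n + 1) → ℝ := fun j => logEm x c j - logEp (Fin.tail x) c₀ c j - a j with hA
  set h := -logEp y c₀ c 0 - b₀ with hh
  set B : Fin n → ℝ := fun j => lse (y j) (c j) - logEp y c₀ c j.succ - b' j with hB
  set g := Real.log (Msum A B (Fin.last n)) - c₀ with hg
  set Z : Fin n → ℝ := fun j =>
    Real.log (Msum A B j.castSucc) - lse (-A j.succ) (-B j) - c j with hZ
  have e1 : p' = ((A, h, B), (g, Z)) := rfl
  have hb : ∑ j, b j = b₀ + ∑ j, b' j := by rw [Fin.sum_univ_succ]; simp [b]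
  have hzz : ∑ j, zz j = z₀ + ∑ j, z j := by rw [Fin.sum_univ_succ]; simp [zz]
  -- first flip
  have s1 : c₀ + ∑ j, c j = ∑ j, a j + ∑ j, b j - (z₀ + ∑ j, z j) := by
    have := sum_lse a b
    rw [hc₀, hc, sum_sub_distrib]
    linarith
  -- second flip
  have hEp : ∀ y : Fin n → ℝ, ∑ j, logEp y c₀ c j = ∑ j, lse (-y j) (-c j) + lse 0 (-c₀) := by
    intro y
    rw [Fin.sum_univ_castSucc]
    simp [logEp]
  have hEm : ∑ j, logEm x c j = x 0 + ∑ j : Fin n, lse (x j.succ) (c j) := by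
    rw [Fin.sum_univ_succ]
    simp [logEm]
  have hls : ∀ y : Fin n → ℝ, ∑ j, lse (-y j) (-c j) =
      ∑ j, lse (y j) (c j) - ∑ j, y j - ∑ j, c j := by
    intro y
    rw [← sum_sub_distrib, ← sum_sub_distrib]
    exact sum_congr rfl fun j _ => lse_neg _ _
  have s2 : ∑ j, A j = ∑ j, x j + ∑ j, c j - lse 0 (-c₀) - ∑ j, a j := by
    rw [hA, sum_sub_distrib, sum_sub_distrib, hEm, hEp, hls, Fin.sum_univ_succ x]
    simp only [Fin.tail]
    ring
  have s3 : h + ∑ j, B j = ∑ j, y j + ∑ j, c j - lse 0 (-c₀) - ∑ j, b j := by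
    have := hEp y
    rw [Fin.sum_univ_succ, hls] at this
    rw [hB, sum_sub_distrib, sum_sub_distrib, hh, hb]
    linarith
  -- third flip
  have s4 : g + ∑ j, Z j = ∑ j, A j + ∑ j, B j - (c₀ + ∑ j, c j) := by
    have h1 := Fin.sum_univ_castSucc (fun j => Real.log (Msum A B j))
    rw [Fin.sum_univ_succ] at h1
    have h2 : Real.log (Msum A B 0) = A 0 := by simp [Msum]
    have h3 : ∀ j : Fin n, Real.log (Msum A B j.succ) = lse (-A j.succ) (-B j) + A j.succ + B j := by
      intro j
      rw [lse_neg]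
      simp only [Msum, Fin.cons_succ, lse]
      ring
    simp only [h2, h3, sum_add_distrib] at h1
    have h4 := Fin.sum_univ_succ A
    rw [hZ, sum_sub_distrib, sum_sub_distrib, hg]
    linarith
  rw [e1]
  simp only [qlin, llin, sum_add_distrib, sum_sub_distrib, ← Finset.mul_sum]
  constructor
  · rw [hzz]; linarith
  · rw [hzz]; linarith

end FlipIdentities
end

section
open scoped ENNReal
/-! ### The Whittaker function in logarithmic coordinates and its Baxter eigenvalue -/

theorem integral_comp_of_measurePreserving {X Y E : Type*} [MeasurableSpace X] [MeasurableSpace Y]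
    [NormedAddCommGroup E] [NormedSpace ℝ E] {μ : Measure X} {ν : Measure Y} {φ : X → Y}
    (hφ : MeasurePreserving φ μ ν) {f : Y → E} (hf : AEStronglyMeasurable f ν) :
    ∫ x, f (φ x) ∂μ = ∫ y, f y ∂ν := by
  rw [← hφ.map_eq, integral_map hφ.aemeasurable (by rwa [hφ.map_eq])]

section Shuffle
variable {A B C D : Type*} [MeasureSpace A] [MeasureSpace B] [MeasureSpace C] [MeasureSpace D]
  [SFinite (volume : Measure A)] [SFinite (volume : Measure B)] [SFinite (volume : Measure C)]
  [SFinite (volume : Measure D)]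

omit [SFinite (volume : Measure A)] in
theorem measurePreserving_prodAssoc' :
    MeasurePreserving (fun q : (A × B) × C => (q.1.1, (q.1.2, q.2))) :=
  measurePreserving_prodAssoc volume volume volume

omit [SFinite (volume : Measure A)] in
theorem measurePreserving_prodAssoc_symm' :
    MeasurePreserving (fun q : A × (B × C) => ((q.1, q.2.1), q.2.2)) :=
  (measurePreserving_prodAssoc (volume : Measure A) (volume : Measure B)
    (volume : Measure C)).symm MeasurableEquiv.prodAssoc

theorem measurePreserving_swap' : MeasurePreserving (fun q : A × B => (q.2, q.1)) :=
  Measure.measurePreserving_swap (μ := volume) (ν := volume)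

theorem measurePreserving_swap_left :
    MeasurePreserving (fun q : A × (B × C) => (q.2.1, (q.1, q.2.2))) :=
  measurePreserving_prodAssoc'.comp (((measurePreserving_swap' (A := A) (B := B)).prod
    (MeasurePreserving.id (volume : Measure C))).comp measurePreserving_prodAssoc_symm')

theorem measurePreserving_shuffle :
    MeasurePreserving (fun q : D × ((A × B) × C) => ((q.2.1.1, q.2.2), (q.2.1.2, q.1))) := by
  have h1 : MeasurePreserving (fun q : D × ((A × B) × C) => (q.2.1.1, (q.2.1.2, (q.2.2, q.1)))) :=
    (measurePreserving_prodAssoc' (A := A) (B := B) (C := C × D)).comp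
      ((measurePreserving_prodAssoc' (A := A × B) (B := C) (C := D)).comp measurePreserving_swap')
  have h2 : MeasurePreserving (fun q : A × (B × (C × D)) => (q.1, (q.2.2.1, (q.2.1, q.2.2.2)))) :=
    (MeasurePreserving.id (volume : Measure A)).prod
      (measurePreserving_swap_left (A := B) (B := C) (C := D))
  exact (measurePreserving_prodAssoc_symm' (A := A) (B := C) (C := B × D)).comp (h2.comp h1)

theorem integral_prod_mul_left (u : A → ℂ) {v : B × C → ℂ} (hu : AEStronglyMeasurable u)
    (hv : AEStronglyMeasurable v) :
    ∫ q : (A × B) × C, u q.1.1 * v (q.1.2, q.2) = (∫ x, u x) * ∫ q, v q := by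
  rw [← integral_prod_mul]
  exact integral_comp_of_measurePreserving (measurePreserving_prodAssoc' (A := A) (B := B) (C := C))
    (f := fun q => u q.1 * v q.2) (hu.comp_fst.mul hv.comp_snd)

omit [SFinite (volume : Measure A)] in
theorem lintegral_prod_mul_left {u : A → ℝ≥0∞} {v : B × C → ℝ≥0∞} (hu : Measurable u)
    (hv : Measurable v) :
    ∫⁻ q : (A × B) × C, u q.1.1 * v (q.1.2, q.2) = (∫⁻ x, u x) * ∫⁻ q, v q := by
  rw [← lintegral_prod_mul hu.aemeasurable hv.aemeasurable]
  exact (measurePreserving_prodAssoc' (A := A) (B := B) (C := C)).lintegral_comp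
    (f := fun q => u q.1 * v q.2) (by fun_prop)

theorem integral_prod_mul_mid (u : B → ℂ) {v : A × C → ℂ} (hu : AEStronglyMeasurable u)
    (hv : AEStronglyMeasurable v) :
    ∫ q : A × (B × C), u q.2.1 * v (q.1, q.2.2) = (∫ x, u x) * ∫ q, v q := by
  rw [← integral_prod_mul]
  exact integral_comp_of_measurePreserving (measurePreserving_swap_left (A := A) (B := B) (C := C))
    (f := fun q => u q.1 * v q.2) (hu.comp_fst.mul hv.comp_snd)

theorem lintegral_prod_mul_mid {u : B → ℝ≥0∞} {v : A × C → ℝ≥0∞} (hu : Measurable u)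
    (hv : Measurable v) :
    ∫⁻ q : A × (B × C), u q.2.1 * v (q.1, q.2.2) = (∫⁻ x, u x) * ∫⁻ q, v q := by
  rw [← lintegral_prod_mul hu.aemeasurable hv.aemeasurable]
  exact (measurePreserving_swap_left (A := A) (B := B) (C := C)).lintegral_comp
    (f := fun q => u q.1 * v q.2) (by fun_prop)

end Shuffle

variable {n : ℕ}

theorem measurePreserving_cons :
    MeasurePreserving (fun q : ℝ × (Fin n → ℝ) =>
      (Fin.cons (α := fun _ => ℝ) q.1 q.2 : Fin (n + 1) → ℝ)) := by
  have := (volume_preserving_piFinSuccAbove (fun _ : Fin (n + 1) => ℝ) 0).symm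
  convert this using 1
  ext q j
  simp [MeasurableEquiv.piFinSuccAbove, Fin.insertNthEquiv]

section Measurability
variable {X : Type*} [MeasurableSpace X]

@[fun_prop]
theorem measurable_qlin {f g h : X → Fin n → ℝ} (hf : Measurable f) (hg : Measurable g)
    (hh : Measurable h) : Measurable fun x => qlin (f x) (g x) (h x) := by
  unfold qlin; fun_prop

@[fun_prop]
theorem measurable_llin {f : X → Fin (n + 1) → ℝ} {g : X → Fin n → ℝ} {h : X → Fin (n + 1) → ℝ}
    (hf : Measurable f) (hg : Measurable g) (hh : Measurable h) :
    Measurable fun x => llin (f x) (g x) (h x) := by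
  unfold llin; fun_prop

theorem measurable_Sl {f g : X → Fin n → ℝ} (hf : Measurable f) (hg : Measurable g)
    (j : Fin (n + 1)) : Measurable fun x => Sl (f x) (g x) j :=
  measurable_snoc_apply (f := fun _ => (1 : ℝ)) measurable_const
    (g := fun x j => exp (-f x j) + exp (-g x j)) (by fun_prop) j

@[fun_prop]
theorem measurable_qE {f g h : X → Fin n → ℝ} (hf : Measurable f) (hg : Measurable g)
    (hh : Measurable h) : Measurable fun x => qE (f x) (g x) (h x) := by
  unfold qE Tu
  refine Finset.measurable_sum _ fun j _ => ?_
  have := measurable_Sl hf hg j.succ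
  fun_prop

@[fun_prop]
theorem measurable_lE {f : X → Fin (n + 1) → ℝ} {g : X → Fin n → ℝ} {h : X → Fin (n + 1) → ℝ}
    (hf : Measurable f) (hg : Measurable g) (hh : Measurable h) :
    Measurable fun x => lE (f x) (g x) (h x) := by
  unfold lE
  refine Finset.measurable_sum _ fun j _ => ?_
  have h1 : Measurable fun x => Fin.tail (f x) := measurable_pi_lambda _ fun i => by
    simp only [Fin.tail]; fun_prop
  have h2 := measurable_Sl h1 hg j
  have h3 : Measurable fun x => Tc (f x) (g x) j := by
    refine Fin.cases ?_ (fun j => ?_) j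
    · simp only [Tc_zero]; fun_prop
    · simp only [Tc_succ]; fun_prop
  fun_prop

theorem measurable_flipOne : Measurable (flipOne (n := n)) := by
  have h : ∀ j, Measurable fun u : FlipSpace n =>
      (Fin.cons (α := fun _ => ℝ) u.1.2.1 u.1.2.2 : Fin (n + 1) → ℝ) j := fun j =>
    measurable_cons_apply measurable_fst.snd.fst measurable_fst.snd.snd j
  have h' : ∀ j, Measurable fun u : FlipSpace n => u.1.1 j := fun j =>
    (measurable_pi_apply j).comp measurable_fst.fst
  refine measurable_fst.prodMk (Measurable.sub (Measurable.prodMk ?_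
    (measurable_pi_lambda _ fun j => ?_)) measurable_snd)
  · exact (measurable_lse (h' _) (h _)).sub (measurable_lse (h' _).neg (h _).neg)
  · exact (measurable_lse (h' _) (h _)).sub (measurable_lse (h' _).neg (h _).neg)

theorem measurable_flipThree : Measurable (flipThree (n := n)) := by
  have h : ∀ j, Measurable fun u : FlipSpace n => Msum u.1.1 u.1.2.2 j := fun j =>
    measurable_cons_apply ((measurable_pi_apply 0).comp measurable_fst.fst).exp
      (measurable_pi_lambda _ fun j => ((measurable_pi_apply j.succ).comp measurable_fst.fst).exp.add
        ((measurable_pi_apply j).comp measurable_fst.snd.snd).exp) j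
  refine measurable_fst.prodMk (Measurable.sub ((h _).log.prodMk
    (measurable_pi_lambda _ fun j => (h _).log.sub (measurable_lse ?_ ?_))) measurable_snd)
  · exact ((measurable_pi_apply j.succ).comp measurable_fst.fst).neg
  · exact ((measurable_pi_apply j).comp measurable_fst.snd.snd).neg

theorem measurable_flipTwo (x : Fin (n + 1) → ℝ) :
    Measurable fun q : (Fin n → ℝ) × FlipSpace n => flipTwo x q.1 q.2 := by
  have hc₀ : Measurable fun q : (Fin n → ℝ) × FlipSpace n => q.2.2.1 := measurable_snd.snd.fst
  have hc : ∀ j, Measurable fun q : (Fin n → ℝ) × FlipSpace n => q.2.2.2 j := fun j =>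
    (measurable_pi_apply j).comp measurable_snd.snd.snd
  have hy : ∀ j, Measurable fun q : (Fin n → ℝ) × FlipSpace n => q.1 j := fun j =>
    (measurable_pi_apply j).comp measurable_fst
  have e : ∀ j, Measurable fun q : (Fin n → ℝ) × FlipSpace n =>
      logEp (Fin.tail x) q.2.2.1 q.2.2.2 j := fun j =>
    measurable_snoc_apply (measurable_lse measurable_const hc₀.neg)
      (measurable_pi_lambda _ fun j => measurable_lse measurable_const (hc j).neg) j
  have e' : ∀ j, Measurable fun q : (Fin n → ℝ) × FlipSpace n =>
      logEp q.1 q.2.2.1 q.2.2.2 j := fun j =>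
    measurable_snoc_apply (measurable_lse measurable_const hc₀.neg)
      (measurable_pi_lambda _ fun j => measurable_lse (hy j).neg (hc j).neg) j
  have e'' : ∀ j, Measurable fun q : (Fin n → ℝ) × FlipSpace n => logEm x q.2.2.2 j := fun j =>
    measurable_cons_apply measurable_const
      (measurable_pi_lambda _ fun j => measurable_lse measurable_const (hc j)) j
  exact Measurable.prodMk (Measurable.sub ((measurable_pi_lambda _ fun j =>
    (e'' j).sub (e j)).prodMk ((e' 0).neg.prodMk
    (measurable_pi_lambda _ fun j => Measurable.sub (measurable_lse (hy j) (hc j)) (e' _))))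
    measurable_snd.fst) measurable_snd.snd

theorem measurable_flip (x : Fin (n + 1) → ℝ) :
    Measurable fun q : (Fin n → ℝ) × FlipSpace n => flip x q.1 q.2 := by
  have h1 : Measurable fun q : (Fin n → ℝ) × FlipSpace n => (q.1, flipOne q.2) :=
    measurable_fst.prodMk (Measurable.comp (g := flipOne) measurable_flipOne measurable_snd)
  have h2 : Measurable fun q : (Fin n → ℝ) × FlipSpace n => flipTwo x q.1 (flipOne q.2) :=
    Measurable.comp (g := fun q : (Fin n → ℝ) × FlipSpace n => flipTwo x q.1 q.2)
      (f := fun q : (Fin n → ℝ) × FlipSpace n => (q.1, flipOne q.2)) (measurable_flipTwo x) h1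
  exact Measurable.comp (g := flipThree)
    (f := fun q : (Fin n → ℝ) × FlipSpace n => flipTwo x q.1 (flipOne q.2)) measurable_flipThree h2

end Measurability

/-- The Baxter kernel. -/
def kq (σ : ℂ) (x z a : Fin n → ℝ) : ℂ := Complex.exp (σ * qlin x z a - qE x z a)

/-- The recursion kernel. -/
def kl (τ : ℂ) (x : Fin (n + 1) → ℝ) (z : Fin n → ℝ) (a : Fin (n + 1) → ℝ) : ℂ :=
  Complex.exp (τ * llin x z a - lE x z a)

/-- The absolute value of the Baxter kernel. -/
def kqAbs (σ : ℝ) (x z a : Fin n → ℝ) : ℝ≥0∞ := ENNReal.ofReal (exp (σ * qlin x z a - qE x z a))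

/-- The absolute value of the recursion kernel. -/
def klAbs (τ : ℝ) (x : Fin (n + 1) → ℝ) (z : Fin n → ℝ) (a : Fin (n + 1) → ℝ) : ℝ≥0∞ :=
  ENNReal.ofReal (exp (τ * llin x z a - lE x z a))

theorem enorm_cexp (z : ℂ) : ‖Complex.exp z‖ₑ = ENNReal.ofReal (exp z.re) := by
  rw [← ofReal_norm, norm_exp]

theorem enorm_kq (σ : ℂ) (x z a : Fin n → ℝ) : ‖kq σ x z a‖ₑ = kqAbs σ.re x z a := by
  simp [kq, kqAbs, enorm_cexp]

theorem enorm_kl (τ : ℂ) (x : Fin (n + 1) → ℝ) (z : Fin n → ℝ) (a : Fin (n + 1) → ℝ) :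
    ‖kl τ x z a‖ₑ = klAbs τ.re x z a := by
  simp [kl, klAbs, enorm_cexp]

/-- The Whittaker function in logarithmic coordinates. -/
def w : (n : ℕ) → (Fin n → ℂ) → (Fin n → ℝ) → ℂ
  | 0, _, _ => 1
  | n + 1, β, x => ∫ p : (Fin (n + 1) → ℝ) × (Fin n → ℝ),
      kl (-β (Fin.last n)) x p.2 p.1 * w n (fun j => β j.castSucc) p.2

/-- The absolute integral bounding the Whittaker function. -/
def wAbs : (n : ℕ) → (Fin n → ℝ) → (Fin n → ℝ) → ℝ≥0∞
  | 0, _, _ => 1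
  | n + 1, β, x => ∫⁻ p : (Fin (n + 1) → ℝ) × (Fin n → ℝ),
      klAbs (-β (Fin.last n)) x p.2 p.1 * wAbs n (fun j => β j.castSucc) p.2

section Measurability
variable {X : Type*} [MeasurableSpace X]

@[fun_prop]
theorem measurable_kq (σ : ℂ) {f g h : X → Fin n → ℝ} (hf : Measurable f) (hg : Measurable g)
    (hh : Measurable h) : Measurable fun x => kq σ (f x) (g x) (h x) := by
  unfold kq; fun_prop

@[fun_prop]
theorem measurable_kqAbs (σ : ℝ) {f g h : X → Fin n → ℝ} (hf : Measurable f) (hg : Measurable g)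
    (hh : Measurable h) : Measurable fun x => kqAbs σ (f x) (g x) (h x) := by
  unfold kqAbs; fun_prop

@[fun_prop]
theorem measurable_kl (τ : ℂ) {f : X → Fin (n + 1) → ℝ} {g : X → Fin n → ℝ}
    {h : X → Fin (n + 1) → ℝ} (hf : Measurable f) (hg : Measurable g) (hh : Measurable h) :
    Measurable fun x => kl τ (f x) (g x) (h x) := by
  unfold kl; fun_prop

@[fun_prop]
theorem measurable_klAbs (τ : ℝ) {f : X → Fin (n + 1) → ℝ} {g : X → Fin n → ℝ}
    {h : X → Fin (n + 1) → ℝ} (hf : Measurable f) (hg : Measurable g) (hh : Measurable h) :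
    Measurable fun x => klAbs τ (f x) (g x) (h x) := by
  unfold klAbs; fun_prop

@[fun_prop]
theorem measurable_w (β : Fin n → ℂ) : Measurable (w n β) := by
  induction n with
  | zero => exact measurable_const
  | succ n ih =>
    have := ih (fun j => β j.castSucc)
    simp only [w]
    refine StronglyMeasurable.measurable ?_
    refine StronglyMeasurable.integral_prod_right' (f := fun q : (Fin (n + 1) → ℝ) ×
      ((Fin (n + 1) → ℝ) × (Fin n → ℝ)) => kl (-β (Fin.last n)) q.1 q.2.2 q.2.1 *
        w n (fun j => β j.castSucc) q.2.2) ?_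
    exact Measurable.stronglyMeasurable (by fun_prop)

@[fun_prop]
theorem measurable_wAbs (β : Fin n → ℝ) : Measurable (wAbs n β) := by
  induction n with
  | zero => exact measurable_const
  | succ n ih =>
    have := ih (fun j => β j.castSucc)
    simp only [wAbs]
    refine Measurable.lintegral_prod_right' (f := fun q : (Fin (n + 1) → ℝ) ×
      ((Fin (n + 1) → ℝ) × (Fin n → ℝ)) => klAbs (-β (Fin.last n)) q.1 q.2.2 q.2.1 *
        wAbs n (fun j => β j.castSucc) q.2.2) ?_
    fun_prop

end Measurability

theorem enorm_w_le (β : Fin n → ℂ) (x : Fin n → ℝ) :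
    ‖w n β x‖ₑ ≤ wAbs n (fun j => (β j).re) x := by
  induction n with
  | zero => simp [w, wAbs]
  | succ n ih =>
    simp only [w, wAbs]
    refine (enorm_integral_le_lintegral_enorm _).trans (lintegral_mono fun p => ?_)
    rw [enorm_mul, enorm_kl]
    simp only [Complex.neg_re]
    gcongr
    exact ih _ _

/-- The map regrouping the variables before the flips. -/
theorem measurePreserving_regroup : MeasurePreserving (fun q : (Fin n → ℝ) × FlipSpace n =>
    (((q.2.1.1, Fin.cons (α := fun _ => ℝ) q.2.2.1 q.2.2.2),
      (Fin.cons (α := fun _ => ℝ) q.2.1.2.1 q.2.1.2.2, q.1)) :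
      ((Fin (n + 1) → ℝ) × (Fin (n + 1) → ℝ)) × ((Fin (n + 1) → ℝ) × (Fin n → ℝ)))) :=
  (((MeasurePreserving.id (volume : Measure (Fin (n + 1) → ℝ))).prod measurePreserving_cons).prod
    (measurePreserving_cons.prod (MeasurePreserving.id (volume : Measure (Fin n → ℝ))))).comp
    (measurePreserving_shuffle (D := Fin n → ℝ) (A := Fin (n + 1) → ℝ) (B := ℝ × (Fin n → ℝ))
      (C := ℝ × (Fin n → ℝ)))

/-- The flips followed by a regrouping. -/
theorem measurePreserving_flip_regroup (x : Fin (n + 1) → ℝ) :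
    MeasurePreserving (fun q : (Fin n → ℝ) × FlipSpace n =>
    ((((flip x q.1 q.2).1.1, (flip x q.1 q.2).2), ((flip x q.1 q.2).1.2, q.1)) :
      ((Fin (n + 1) → ℝ) × (ℝ × (Fin n → ℝ))) × ((ℝ × (Fin n → ℝ)) × (Fin n → ℝ)))) :=
  (measurePreserving_shuffle (D := Fin n → ℝ) (A := Fin (n + 1) → ℝ) (B := ℝ × (Fin n → ℝ))
      (C := ℝ × (Fin n → ℝ))).comp
    (MeasurePreserving.skew_product (f := id) (g := fun y p => flip x y p)
      (MeasurePreserving.id _) (measurable_flip x)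
      (Eventually.of_forall fun y => (measurePreserving_flip x y).map_eq))

/-- Pointwise form of the intertwining relation. In the new variables two coordinates appear only in
one-dimensional Gamma integrands with parameters `σ + τ` and `σ - τ`, and the kernels stand in the
opposite order. -/
theorem kq_mul_kl_flip (σ τ : ℂ) (x : Fin (n + 1) → ℝ) (y : Fin n → ℝ) (p : FlipSpace n) :
    kq σ x (Fin.cons (α := fun _ => ℝ) p.2.1 p.2.2) p.1.1 *
      kl τ (Fin.cons (α := fun _ => ℝ) p.2.1 p.2.2) y (Fin.cons (α := fun _ => ℝ) p.1.2.1 p.1.2.2)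
    = (Complex.exp ((σ + τ) * (flip x y p).2.1 - exp (flip x y p).2.1) *
        kl τ x (flip x y p).2.2 (flip x y p).1.1) *
      (Complex.exp (-((σ - τ) * (flip x y p).1.2.1) - exp (-(flip x y p).1.2.1)) *
        kq σ (flip x y p).2.2 y (flip x y p).1.2.2) := by
  obtain ⟨h1, h2⟩ := flip_lin x y p
  have h3 := flip_E x y p
  simp only [kq, kl, ← Complex.exp_add]
  rw [h1, h2]
  simp only [flipE₀, flipE₃] at h3
  have h4 := congrArg (fun r : ℝ => (r : ℂ)) h3
  push_cast at h4 ⊢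
  congr 1
  linear_combination -h4

theorem kqAbs_mul_klAbs_flip (σ τ : ℝ) (x : Fin (n + 1) → ℝ) (y : Fin n → ℝ) (p : FlipSpace n) :
    kqAbs σ x (Fin.cons (α := fun _ => ℝ) p.2.1 p.2.2) p.1.1 *
      klAbs τ (Fin.cons (α := fun _ => ℝ) p.2.1 p.2.2) y
        (Fin.cons (α := fun _ => ℝ) p.1.2.1 p.1.2.2)
    = (ENNReal.ofReal (exp ((σ + τ) * (flip x y p).2.1 - exp (flip x y p).2.1)) *
        klAbs τ x (flip x y p).2.2 (flip x y p).1.1) *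
      (ENNReal.ofReal
        (exp (-((σ - τ) * (flip x y p).1.2.1) - exp (-(flip x y p).1.2.1))) *
        kqAbs σ (flip x y p).2.2 y (flip x y p).1.2.2) := by
  have := congrArg enorm (kq_mul_kl_flip (σ : ℂ) (τ : ℂ) x y p)
  simp only [enorm_mul, enorm_kq, enorm_kl, enorm_cexp] at this
  simpa [← Complex.ofReal_exp, ← Complex.ofReal_neg, Complex.exp_ofReal_re] using this

theorem integral_exp_mul_sub_exp_neg {s : ℂ} (hs : 0 < s.re) :
    ∫ h : ℝ, Complex.exp (-(s * h) - exp (-h)) = Gamma s := by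
  rw [← integral_exp_mul_sub_exp hs, ← integral_neg_eq_self]
  simp

theorem lintegral_exp_mul_sub_exp {s : ℝ} (hs : 0 < s) :
    ∫⁻ g : ℝ, ENNReal.ofReal (exp (s * g - exp g)) = ENNReal.ofReal (Real.Gamma s) := by
  have h1 : Integrable fun g : ℝ => Complex.exp ((s : ℂ) * g - exp g) :=
    integrable_exp_mul_sub_exp (by simpa using hs)
  have h2 : ∫ g : ℝ, Complex.exp ((s : ℂ) * g - exp g) = Gamma s :=
    integral_exp_mul_sub_exp (by simpa using hs)
  have h3 : ∀ g : ℝ, Complex.exp ((s : ℂ) * g - exp g) =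
      ((exp (s * g - exp g) : ℝ) : ℂ) := fun g => by push_cast; rfl
  simp only [h3] at h1 h2
  rw [integral_complex_ofReal, Complex.Gamma_ofReal] at h2
  rw [← Complex.ofReal_injective h2, ofReal_integral_eq_lintegral_ofReal]
  · simpa only [Complex.reCLM_apply, ofReal_re] using Complex.reCLM.integrable_comp h1
  · exact Eventually.of_forall fun g => (exp_pos _).le

theorem lintegral_exp_mul_sub_exp_neg {s : ℝ} (hs : 0 < s) :
    ∫⁻ g : ℝ, ENNReal.ofReal (exp (-(s * g) - exp (-g))) =
      ENNReal.ofReal (Real.Gamma s) := by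
  rw [← lintegral_exp_mul_sub_exp hs,
    ← (Measure.measurePreserving_neg (volume : Measure ℝ)).lintegral_comp (by fun_prop)]
  simp

/-- Induction on `n` by the intertwining relation. For absolute values Tonelli requires no
integrability, and the finite value found here supplies the integrability needed for the complex
version. -/
theorem lintegral_kqAbs_wAbs (β : Fin n → ℝ) (σ : ℝ) (hσ : ∀ j, |β j| < σ) (x : Fin n → ℝ) :
    ∫⁻ p : (Fin n → ℝ) × (Fin n → ℝ), kqAbs σ x p.2 p.1 * wAbs n β p.2 =
      ENNReal.ofReal (∏ j, Real.Gamma (σ + β j) * Real.Gamma (σ - β j)) * wAbs n β x := by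
  induction n with
  | zero =>
    have : ∀ p : (Fin 0 → ℝ) × (Fin 0 → ℝ), kqAbs σ x p.2 p.1 * wAbs 0 β p.2 = 1 := fun p => by
      simp [wAbs, kqAbs, qlin, qE]
    simp only [this]
    rw [Measure.volume_eq_prod, lintegral_prod _ (by fun_prop)]
    simp [wAbs, volume_pi]
  | succ n ih =>
    set τ := -β (Fin.last n) with hτ
    have hl := abs_lt.1 (hσ (Fin.last n))
    have h1 : 0 < σ + τ := by linarith
    have h2 : 0 < σ - τ := by linarith
    set β' : Fin n → ℝ := fun j => β j.castSucc with hβ'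
    have ih' := ih β' (fun j => hσ j.castSucc)
    have e1 : ∀ p : (Fin (n + 1) → ℝ) × (Fin (n + 1) → ℝ), kqAbs σ x p.2 p.1 * wAbs (n + 1) β p.2 =
        ∫⁻ q : (Fin (n + 1) → ℝ) × (Fin n → ℝ), kqAbs σ x p.2 p.1 * klAbs τ p.2 q.2 q.1 *
          wAbs n β' q.2 := by
      intro p
      simp only [wAbs, mul_assoc]
      rw [lintegral_const_mul _ (by fun_prop)]
    simp only [e1]
    -- Both integrals are merged into one, the flips are applied as a change of variables, and the
    -- product is integrated in the opposite order, the two decoupled variables giving Gamma values.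
    rw [← lintegral_prod (f := fun r : ((Fin (n + 1) → ℝ) × (Fin (n + 1) → ℝ)) ×
      ((Fin (n + 1) → ℝ) × (Fin n → ℝ)) => kqAbs σ x r.1.2 r.1.1 * klAbs τ r.1.2 r.2.2 r.2.1 *
        wAbs n β' r.2.2) (by fun_prop), ← Measure.volume_eq_prod,
      ← measurePreserving_regroup.lintegral_comp (by fun_prop)]
    simp only [kqAbs_mul_klAbs_flip]
    rw [(measurePreserving_flip_regroup x).lintegral_comp (f := fun r : ((Fin (n + 1) → ℝ) ×
      (ℝ × (Fin n → ℝ))) × ((ℝ × (Fin n → ℝ)) × (Fin n → ℝ)) =>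
      (ENNReal.ofReal (exp ((σ + τ) * r.1.2.1 - exp r.1.2.1)) * klAbs τ x r.1.2.2 r.1.1)
        * (ENNReal.ofReal (exp (-((σ - τ) * r.2.1.1) - exp (-r.2.1.1))) *
          kqAbs σ r.1.2.2 r.2.2 r.2.1.2) * wAbs n β' r.2.2) (by fun_prop), Measure.volume_eq_prod,
      lintegral_prod _ (by fun_prop)]
    have e2 : ∀ u : (Fin (n + 1) → ℝ) × (ℝ × (Fin n → ℝ)),
        ∫⁻ r : (ℝ × (Fin n → ℝ)) × (Fin n → ℝ),
        (ENNReal.ofReal (exp ((σ + τ) * u.2.1 - exp u.2.1)) * klAbs τ x u.2.2 u.1)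
        * (ENNReal.ofReal (exp (-((σ - τ) * r.1.1) - exp (-r.1.1))) *
          kqAbs σ u.2.2 r.2 r.1.2) * wAbs n β' r.2 =
        ENNReal.ofReal (exp ((σ + τ) * u.2.1 - exp u.2.1)) *
          (klAbs τ x u.2.2 u.1 * (ENNReal.ofReal (Real.Gamma (σ - τ)) *
          (ENNReal.ofReal (∏ j, Real.Gamma (σ + β' j) * Real.Gamma (σ - β' j)) *
            wAbs n β' u.2.2))) := by
      intro u
      rw [← ih' u.2.2, ← lintegral_exp_mul_sub_exp_neg h2, ← lintegral_prod_mul_left (by fun_prop)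
        (by fun_prop), ← lintegral_const_mul _ (by fun_prop), ← lintegral_const_mul _ (by fun_prop)]
      simp only [mul_assoc]
    simp only [e2]
    rw [lintegral_prod_mul_mid (u := fun g : ℝ =>
      ENNReal.ofReal (exp ((σ + τ) * g - exp g))) (v := fun u : (Fin (n + 1) → ℝ) ×
        (Fin n → ℝ) => klAbs τ x u.2 u.1 * (ENNReal.ofReal (Real.Gamma (σ - τ)) *
          (ENNReal.ofReal (∏ j, Real.Gamma (σ + β' j) * Real.Gamma (σ - β' j)) *
            wAbs n β' u.2))) (by fun_prop) (by fun_prop), lintegral_exp_mul_sub_exp h1]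
    have e3 : ∀ u : (Fin (n + 1) → ℝ) × (Fin n → ℝ), klAbs τ x u.2 u.1 *
        (ENNReal.ofReal (Real.Gamma (σ - τ)) * (ENNReal.ofReal
          (∏ j, Real.Gamma (σ + β' j) * Real.Gamma (σ - β' j)) * wAbs n β' u.2)) =
        ENNReal.ofReal (Real.Gamma (σ - τ)) * ENNReal.ofReal
          (∏ j, Real.Gamma (σ + β' j) * Real.Gamma (σ - β' j)) *
          (klAbs τ x u.2 u.1 * wAbs n β' u.2) := fun u => by ring
    simp only [e3]
    rw [lintegral_const_mul _ (by fun_prop), Fin.prod_univ_castSucc, ← mul_assoc, ← mul_assoc]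
    have hp : 0 ≤ ∏ j, Real.Gamma (σ + β' j) * Real.Gamma (σ - β' j) := by
      refine Finset.prod_nonneg fun j _ => ?_
      have := abs_lt.1 (hσ j.castSucc)
      exact mul_nonneg (Real.Gamma_nonneg_of_nonneg (by simp only [β']; linarith))
        (Real.Gamma_nonneg_of_nonneg (by simp only [β']; linarith))
    have hm : Real.Gamma (σ + β (Fin.last n)) * Real.Gamma (σ - β (Fin.last n)) =
        Real.Gamma (σ + τ) * Real.Gamma (σ - τ) := by
      rw [hτ, sub_neg_eq_add, ← sub_eq_add_neg, mul_comm]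
    rw [hm, ENNReal.ofReal_mul hp, ENNReal.ofReal_mul (Real.Gamma_nonneg_of_nonneg h1.le)]
    simp only [wAbs, ← hτ, ← hβ']
    ring

theorem integral_kq_w (β : Fin n → ℂ) (σ : ℂ) (hσ : ∀ j, |(β j).re| < σ.re) (x : Fin n → ℝ)
    (hx : wAbs n (fun j => (β j).re) x ≠ ∞) :
    Integrable (fun p : (Fin n → ℝ) × (Fin n → ℝ) => kq σ x p.2 p.1 * w n β p.2) ∧
    ∫ p : (Fin n → ℝ) × (Fin n → ℝ), kq σ x p.2 p.1 * w n β p.2 =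
      (∏ j, Gamma (σ + β j) * Gamma (σ - β j)) * w n β x := by
  have hint : Integrable (fun p : (Fin n → ℝ) × (Fin n → ℝ) => kq σ x p.2 p.1 * w n β p.2) := by
    refine ⟨by fun_prop, lt_of_le_of_lt (lintegral_mono (g := fun p =>
      kqAbs σ.re x p.2 p.1 * wAbs n (fun j => (β j).re) p.2) fun p => ?_) ?_⟩
    · rw [enorm_mul, enorm_kq]
      exact mul_le_mul' le_rfl (enorm_w_le _ _)
    · rw [lintegral_kqAbs_wAbs _ _ hσ]
      exact ENNReal.mul_lt_top ENNReal.ofReal_lt_top hx.lt_top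
  refine ⟨hint, ?_⟩
  clear hint
  induction n with
  | zero =>
    have : ∀ p : (Fin 0 → ℝ) × (Fin 0 → ℝ), kq σ x p.2 p.1 * w 0 β p.2 = 1 := fun p => by
      simp [w, kq, qlin, qE]
    simp only [this]
    simp only [w, integral_const, Measure.real, Measure.volume_eq_prod]
    rw [← univ_prod_univ, Measure.prod_prod]
    simp [volume_pi]
  | succ n ih =>
    set τ := -β (Fin.last n) with hτ
    have hl := abs_lt.1 (hσ (Fin.last n))
    have h1 : 0 < (σ + τ).re := by simp [hτ]; linarith
    have h2 : 0 < (σ - τ).re := by simp [hτ]; linarith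
    set β' : Fin n → ℂ := fun j => β j.castSucc with hβ'
    have ih' := fun z h => ih β' (fun j => hσ j.castSucc) z h
    have hx' : ∫⁻ p : (Fin (n + 1) → ℝ) × (Fin n → ℝ), klAbs τ.re x p.2 p.1 *
        wAbs n (fun j => (β' j).re) p.2 ≠ ∞ := by
      simpa only [wAbs, hτ, Complex.neg_re] using hx
    have hI : Integrable (fun r : ((Fin (n + 1) → ℝ) × (Fin (n + 1) → ℝ)) ×
        ((Fin (n + 1) → ℝ) × (Fin n → ℝ)) => kq σ x r.1.2 r.1.1 * kl τ r.1.2 r.2.2 r.2.1 *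
          w n β' r.2.2) := by
      refine ⟨by fun_prop, lt_of_le_of_lt (lintegral_mono (g := fun r =>
        kqAbs σ.re x r.1.2 r.1.1 * klAbs τ.re r.1.2 r.2.2 r.2.1 *
          wAbs n (fun j => (β' j).re) r.2.2) fun r => ?_) ?_⟩
      · rw [enorm_mul, enorm_mul, enorm_kq, enorm_kl]
        exact mul_le_mul' le_rfl (enorm_w_le _ _)
      · rw [Measure.volume_eq_prod, lintegral_prod _ (by fun_prop)]
        have := lintegral_kqAbs_wAbs (fun j => (β j).re) σ.re hσ x
        simp only [wAbs] at this
        refine lt_of_eq_of_lt ?_ (this.trans_lt (ENNReal.mul_lt_top ENNReal.ofReal_lt_top hx.lt_top))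
        refine lintegral_congr fun p => ?_
        rw [← lintegral_const_mul _ (by fun_prop)]
        simp only [mul_assoc, hτ, Complex.neg_re, hβ']
    have e1 : ∀ p : (Fin (n + 1) → ℝ) × (Fin (n + 1) → ℝ), kq σ x p.2 p.1 * w (n + 1) β p.2 =
        ∫ q : (Fin (n + 1) → ℝ) × (Fin n → ℝ), kq σ x p.2 p.1 * kl τ p.2 q.2 q.1 *
          w n β' q.2 := by
      intro p
      simp only [w, mul_assoc]
      rw [integral_const_mul]
    simp only [e1]
    rw [← integral_prod (f := fun r : ((Fin (n + 1) → ℝ) × (Fin (n + 1) → ℝ)) ×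
      ((Fin (n + 1) → ℝ) × (Fin n → ℝ)) => kq σ x r.1.2 r.1.1 * kl τ r.1.2 r.2.2 r.2.1 *
        w n β' r.2.2) hI, ← Measure.volume_eq_prod,
      ← integral_comp_of_measurePreserving measurePreserving_regroup hI.1]
    have hI1 := (measurePreserving_regroup.integrable_comp hI.1).2 hI
    simp only [Function.comp_def] at hI1
    simp only [kq_mul_kl_flip] at hI1 ⊢
    have hI2 := ((measurePreserving_flip_regroup x).integrable_comp (g := fun r : ((Fin (n + 1) → ℝ)
      × (ℝ × (Fin n → ℝ))) × ((ℝ × (Fin n → ℝ)) × (Fin n → ℝ)) =>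
      (Complex.exp ((σ + τ) * r.1.2.1 - exp r.1.2.1) * kl τ x r.1.2.2 r.1.1)
        * (Complex.exp (-((σ - τ) * r.2.1.1) - exp (-r.2.1.1)) *
          kq σ r.1.2.2 r.2.2 r.2.1.2) * w n β' r.2.2) (by fun_prop)).1 hI1
    rw [integral_comp_of_measurePreserving (measurePreserving_flip_regroup x) (f := fun r :
      ((Fin (n + 1) → ℝ) × (ℝ × (Fin n → ℝ))) × ((ℝ × (Fin n → ℝ)) × (Fin n → ℝ)) =>
      (Complex.exp ((σ + τ) * r.1.2.1 - exp r.1.2.1) * kl τ x r.1.2.2 r.1.1)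
        * (Complex.exp (-((σ - τ) * r.2.1.1) - exp (-r.2.1.1)) *
          kq σ r.1.2.2 r.2.2 r.2.1.2) * w n β' r.2.2) hI2.1, Measure.volume_eq_prod,
      integral_prod _ hI2]
    -- The induction hypothesis applies only where the inner absolute integral is finite. That is
    -- almost everywhere, because `klAbs` never vanishes and the total integral is finite.
    have hfin : ∀ᵐ u : (Fin (n + 1) → ℝ) × (ℝ × (Fin n → ℝ)),
        wAbs n (fun j => (β' j).re) u.2.2 ≠ ∞ := by
      have h := ae_lt_top (by fun_prop) hx'
      have hq : Measure.QuasiMeasurePreserving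
          (fun u : (Fin (n + 1) → ℝ) × (ℝ × (Fin n → ℝ)) => (u.1, u.2.2)) :=
        Measure.quasiMeasurePreserving_snd.comp
          (measurePreserving_swap_left (A := Fin (n + 1) → ℝ) (B := ℝ)
            (C := Fin n → ℝ)).quasiMeasurePreserving
      filter_upwards [hq.ae h] with u hu htop
      rw [htop, ENNReal.mul_top] at hu
      · exact absurd hu (lt_irrefl _)
      · simp only [klAbs, ne_eq, ENNReal.ofReal_eq_zero, not_le]
        exact exp_pos _
    have e2 : ∀ᵐ u : (Fin (n + 1) → ℝ) × (ℝ × (Fin n → ℝ)),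
        ∫ r : (ℝ × (Fin n → ℝ)) × (Fin n → ℝ),
        (Complex.exp ((σ + τ) * u.2.1 - exp u.2.1) * kl τ x u.2.2 u.1)
        * (Complex.exp (-((σ - τ) * r.1.1) - exp (-r.1.1)) *
          kq σ u.2.2 r.2 r.1.2) * w n β' r.2 =
        Complex.exp ((σ + τ) * u.2.1 - exp u.2.1) *
          (kl τ x u.2.2 u.1 * (Gamma (σ - τ) *
          ((∏ j, Gamma (σ + β' j) * Gamma (σ - β' j)) * w n β' u.2.2))) := by
      filter_upwards [hfin] with u hu
      rw [← ih' u.2.2 hu, ← integral_exp_mul_sub_exp_neg h2, ← integral_prod_mul_left _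
        (by fun_prop) (by fun_prop), ← integral_const_mul, ← integral_const_mul]
      simp only [mul_assoc]
    rw [integral_congr_ae e2, integral_prod_mul_mid (fun g : ℝ =>
      Complex.exp ((σ + τ) * g - exp g)) (v := fun u : (Fin (n + 1) → ℝ) ×
        (Fin n → ℝ) => kl τ x u.2 u.1 * (Gamma (σ - τ) *
          ((∏ j, Gamma (σ + β' j) * Gamma (σ - β' j)) *
            w n β' u.2))) (by fun_prop) (by fun_prop), integral_exp_mul_sub_exp h1]
    have e3 : ∀ u : (Fin (n + 1) → ℝ) × (Fin n → ℝ), kl τ x u.2 u.1 *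
        (Gamma (σ - τ) * ((∏ j, Gamma (σ + β' j) * Gamma (σ - β' j)) *
          w n β' u.2)) = Gamma (σ - τ) *
          (∏ j, Gamma (σ + β' j) * Gamma (σ - β' j)) *
          (kl τ x u.2 u.1 * w n β' u.2) := fun u => by ring
    simp only [e3]
    rw [integral_const_mul, Fin.prod_univ_castSucc]
    simp only [w, ← hτ, ← hβ']
    have hm : Gamma (σ + β (Fin.last n)) * Gamma (σ - β (Fin.last n)) =
        Gamma (σ + τ) * Gamma (σ - τ) := by
      rw [hτ, sub_neg_eq_add, ← sub_eq_add_neg, mul_comm]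
    rw [hm]
    ring
end

section
open scoped ENNReal
/-! ### Mellin–Barnes expansion -/

theorem measurable_G : Measurable G := by
  have h := differentiable_G_inv.continuous.measurable.inv
  convert h using 1
  ext z
  simp

@[fun_prop]
theorem measurable_G_comp {X : Type*} [MeasurableSpace X] {f : X → ℂ} (hf : Measurable f) :
    Measurable fun x => G (f x) := measurable_G.comp hf

/-- The Beta integral in logarithmic coordinates. -/
theorem integrable_beta_lse {A B : ℂ} (hA : 0 < A.re) (hB : 0 < B.re) (z : ℝ) :
    Integrable (fun x : ℝ => Complex.exp (A * x - (A + B) * lse x z)) ∧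
    ∫ x : ℝ, Complex.exp (A * x - (A + B) * lse x z) =
      Complex.exp (-(B * z)) * (Gamma A * Gamma B / Gamma (A + B)) := by
  have hAB : 0 < (A + B).re := by simpa using add_pos hA hB
  have hG : Gamma (A + B) ≠ 0 := Complex.Gamma_ne_zero_of_re_pos hAB
  have hI := (integrable_exp_mul_sub_exp hA).mul_prod (integrable_exp_mul_sub_exp hB)
  -- Shear the double integral for `Γ(A) Γ(B)`: the inner integral becomes a Gamma integral with
  -- rate `e^x + 1`, hence `Γ(A + B)` times the integrand in question at `z = 0`.
  have hmp : MeasurePreserving (fun p : ℝ × ℝ => (p.1 + p.2, p.2)) :=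
    measurePreserving_add_prod (volume : Measure ℝ) volume
  have hI2 := (hmp.integrable_comp hI.1).2 hI
  have e : ∀ x y : ℝ, Complex.exp (A * (x + y : ℝ) - exp (x + y)) *
      Complex.exp (B * y - exp y) =
      Complex.exp ((A * x)) * Complex.exp ((A + B) * y - (exp (lse x 0) : ℂ) * exp y) := by
    intro x y
    rw [← Complex.exp_add, ← Complex.exp_add, exp_lse, exp_add]
    push_cast
    congr 1
    simp
    ring
  have e2 : ∀ x : ℝ, ∫ y : ℝ, Complex.exp (A * (x + y : ℝ) - exp (x + y)) *
      Complex.exp (B * y - exp y) =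
      Gamma (A + B) * Complex.exp (A * x - (A + B) * lse x 0) := by
    intro x
    simp only [e]
    rw [integral_const_mul, integral_exp_mul_sub_mul_exp hAB
      (by rw [ofReal_re]; exact exp_pos _), ← Complex.ofReal_log (exp_pos _).le,
      Real.log_exp, sub_eq_add_neg, Complex.exp_add]
    ring_nf
  have hI3 : Integrable (fun x : ℝ => Complex.exp (A * x - (A + B) * lse x 0)) := by
    have := hI2.integral_prod_left
    simp only [Function.comp_def, e2] at this
    have h := this.const_mul (Gamma (A + B))⁻¹
    simpa only [inv_mul_cancel_left₀ hG] using h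
  have hv : ∫ x : ℝ, Complex.exp (A * x - (A + B) * lse x 0) =
      Gamma A * Gamma B / Gamma (A + B) := by
    rw [eq_div_iff hG, mul_comm, ← integral_const_mul, ← integral_exp_mul_sub_exp hA,
      ← integral_exp_mul_sub_exp hB, ← integral_prod_mul]
    have h := integral_comp_of_measurePreserving hmp hI.1
    have h5 := integral_prod _ hI2
    simp only [Function.comp_def, e2] at h5
    exact h5.symm.trans h
  have hs : ∀ x : ℝ, Complex.exp (A * x - (A + B) * lse x z) = Complex.exp (-(B * z)) *
      Complex.exp (A * (x - z : ℝ) - (A + B) * lse (x - z) 0) := by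
    intro x
    have : lse x z = lse (x - z) 0 + z := by
      apply Real.exp_injective
      rw [exp_lse, exp_add, exp_lse, add_mul, ← exp_add]
      simp
    rw [this, ← Complex.exp_add]
    push_cast
    ring_nf
  simp only [hs]
  constructor
  · exact (hI3.comp_sub_right z).const_mul _
  · rw [integral_const_mul, integral_sub_right_eq_self
      (fun x : ℝ => Complex.exp (A * x - (A + B) * lse x 0)), hv]

/-- The integrand of one site. -/
def site (e κ ρ : ℂ) (z : ℝ) (q : ℝ × ℝ) : ℂ :=
  Complex.exp (e * q.1 - κ * q.2 - (exp (lse q.1 z) * exp (-q.2) : ℝ) -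
    ρ * (lse q.1 z - q.1 - z : ℝ))

/-- The value of the integral over one site, without the exponential factor. -/
def siteC (e κ ρ : ℂ) : ℂ :=
  Gamma κ * (Gamma (e + ρ) * Gamma (κ - e) / Gamma (κ + ρ))

/-- Reflecting the second variable in `lse q.1 z` splits it off as a Gamma integral with parameter
`κ`; what remains is the Beta integral. -/
theorem integral_site {e κ ρ : ℂ} (h1 : 0 < κ.re) (h2 : 0 < (e + ρ).re) (h3 : 0 < (κ - e).re)
    (z : ℝ) : Integrable (site e κ ρ z) ∧
    ∫ q, site e κ ρ z q = Complex.exp (z * (e - κ + ρ)) * siteC e κ ρ := by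
  obtain ⟨b1, b2⟩ := integrable_beta_lse h2 h3 z
  have hmp : MeasurePreserving (fun q : ℝ × ℝ => (q.1, lse q.1 z - q.2)) :=
    measurePreserving_sub_snd reflInvariant_real (f := fun x => lse x z) (by fun_prop)
  have hI := ((b1.const_mul (Complex.exp (ρ * z))).mul_prod (integrable_exp_mul_sub_exp h1))
  have e1 : ∀ q : ℝ × ℝ, site e κ ρ z q = Complex.exp (ρ * z) * Complex.exp ((e + ρ) * q.1 -
      ((e + ρ) + (κ - e)) * lse q.1 z) * Complex.exp (κ * (lse q.1 z - q.2 : ℝ) -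
        exp (lse q.1 z - q.2)) := by
    intro q
    rw [site, ← Complex.exp_add, ← Complex.exp_add, show exp (lse q.1 z - q.2) =
      exp (lse q.1 z) * exp (-q.2) by rw [sub_eq_add_neg, exp_add]]
    push_cast
    congr 1
    ring
  have hI2 := (hmp.integrable_comp hI.1).2 hI
  have e2 : site e κ ρ z = (fun p : ℝ × ℝ => Complex.exp (ρ * z) * Complex.exp ((e + ρ) * p.1 -
      ((e + ρ) + (κ - e)) * lse p.1 z) * Complex.exp (κ * p.2 - exp p.2)) ∘
      (fun q : ℝ × ℝ => (q.1, lse q.1 z - q.2)) := funext e1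
  refine ⟨by rw [e2]; exact hI2, ?_⟩
  have h := integral_comp_of_measurePreserving hmp hI.1
  rw [e2]
  simp only [Function.comp_def]
  rw [h, Measure.volume_eq_prod, integral_prod_mul
    (fun x : ℝ => Complex.exp (ρ * z) * Complex.exp ((e + ρ) * x -
      ((e + ρ) + (κ - e)) * lse x z)) (fun y : ℝ => Complex.exp (κ * y - exp y)),
    integral_const_mul, b2, integral_exp_mul_sub_exp h1, siteC]
  have : Complex.exp (z * (e - κ + ρ)) = Complex.exp (ρ * z) * Complex.exp (-((κ - e) * z)) := by
    rw [← Complex.exp_add]; ring_nf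
  rw [this, show e + ρ + (κ - e) = κ + ρ by ring]
  ring

/-- The norm of a site integrand belongs to the same family with real parameters, so absolute
convergence comes with an exact value. -/
theorem norm_site (e κ ρ : ℂ) (z : ℝ) (q : ℝ × ℝ) :
    ((‖site e κ ρ z q‖ : ℝ) : ℂ) = site e.re κ.re ρ.re z q := by
  rw [site, site, norm_exp, Complex.ofReal_exp]
  congr 1
  simp only [sub_re, mul_re, ofReal_re, ofReal_im, mul_zero,
    sub_zero]
  push_cast
  ring

theorem integral_norm_site {e κ ρ : ℂ} (h1 : 0 < κ.re) (h2 : 0 < (e + ρ).re)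
    (h3 : 0 < (κ - e).re) (z : ℝ) :
    ∫ q, ‖site e κ ρ z q‖ = exp (z * (e - κ + ρ).re) * ‖siteC e.re κ.re ρ.re‖ := by
  have h := (integral_site (e := e.re) (κ := κ.re) (ρ := ρ.re) (by simpa using h1)
    (by simpa using h2) (by simpa using h3) z).2
  simp only [← norm_site] at h
  rw [integral_complex_ofReal] at h
  have h' := congrArg norm h
  rw [Complex.norm_real, Real.norm_of_nonneg (integral_nonneg fun q => norm_nonneg _), norm_mul,
    norm_exp] at h'
  simpa using h'

@[fun_prop]
theorem measurable_site {X : Type*} [MeasurableSpace X] {e κ ρ : X → ℂ} {z : X → ℝ} {q : X → ℝ × ℝ}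
    (he : Measurable e) (hκ : Measurable κ) (hρ : Measurable ρ) (hz : Measurable z)
    (hq : Measurable q) : Measurable fun x => site (e x) (κ x) (ρ x) (z x) (q x) := by
  unfold site
  fun_prop

variable {n : ℕ}

/-- The preceding entry, with `0` before the first entry. -/
def sh (s : Fin n → ℂ) (j : Fin n) : ℂ := (Fin.cons (α := fun _ => ℂ) 0 s : Fin (n + 1) → ℂ) j.castSucc

/-- Half of the difference of consecutive entries. -/
def dlt (s : Fin n → ℂ) (j : Fin n) : ℂ := (s j - sh s j) / 2

@[simp] theorem sh_zero (s : Fin (n + 1) → ℂ) : sh s 0 = 0 := rfl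

@[simp] theorem sh_succ (s : Fin (n + 1) → ℂ) (j : Fin n) : sh s j.succ = s j.castSucc := by
  simp [sh]

/-- The point of the vertical lines through `c`. -/
def vpt (c t : Fin n → ℝ) (j : Fin n) : ℂ := c j + t j * I

theorem exp_neg_exp_eq_integral_reflect {m : ℂ} {c : ℝ} (hc : c < m.re) (y : ℝ) :
    ∫ t : ℝ, G (m - (c + t * I)) * Complex.exp (-((m - (c + t * I)) / 2) * y) =
      4 * Real.pi * Complex.exp (-(exp y : ℂ)) := by
  rw [exp_neg_exp_eq_integral (sub_pos.2 hc) y, ← integral_sub_left_eq_self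
    (fun t : ℝ => G (m - (c + t * I)) *
      Complex.exp (-((m - (c + t * I)) / 2) * y)) volume m.im]
  have : ∀ t : ℝ, m - (c + (m.im - t : ℝ) * I) = ((m.re - c : ℝ) : ℂ) + t * I := by
    intro t
    apply Complex.ext <;> simp
  simp only [this]
  have hpi : (4 * Real.pi : ℂ) ≠ 0 := by simp [pi_ne_zero]
  rw [← mul_assoc, mul_one_div_cancel hpi, one_mul]

theorem integrable_G_vertical {m : ℂ} {c : ℝ} (hc : c < m.re) :
    Integrable fun t : ℝ => G (m - (c + t * I)) := by
  obtain ⟨C, hC, h⟩ := exists_norm_G_le (a := m.re - c) (b := m.re - c) (sub_pos.2 hc)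
  have h1 := ((integrable_exp_neg_mul_abs (δ := 1 / 4) (by norm_num)).comp_sub_right m.im).const_mul C
  refine h1.mono' (Measurable.aestronglyMeasurable (by fun_prop)) (Eventually.of_forall fun t => ?_)
  refine (h _ (by simp) (by simp)).trans (le_of_eq ?_)
  simp [abs_sub_comm]

section MB

/-- The exponents `ρ_0, …, ρ_n` of the Mellin–Barnes expansion. -/
def rho (M : Fin (n + 1) → ℂ) (r : Fin n → ℂ) (i : Fin (n + 1)) : ℂ :=
  (M i - (Fin.cons (α := fun _ => ℂ) 0 r : Fin (n + 1) → ℂ) i) / 2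

@[simp] theorem rho_zero (M : Fin (n + 1) → ℂ) (r : Fin n → ℂ) : rho M r 0 = M 0 / 2 := by simp [rho]

@[simp] theorem rho_succ (M : Fin (n + 1) → ℂ) (r : Fin n → ℂ) (j : Fin n) :
    rho M r j.succ = (M j.succ - r j) / 2 := by simp [rho]

/-- The integrand before the Mellin–Barnes expansion. -/
def mbL (W : (Fin n → ℝ) → ℂ) (e : Fin n → ℂ) (f κ ρ₀ : ℂ) (p : (Fin n → ℝ) × (Fin n → ℝ × ℝ)) : ℂ :=
  W p.1 * (∏ j, Complex.exp (f * p.1 j)) *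
    (∏ j, Complex.exp (e j * (p.2 j).1 - κ * (p.2 j).2 -
      (exp (lse (p.2 j).1 (p.1 j)) * exp (-(p.2 j).2) : ℝ))) *
    (∏ j : Fin n, Complex.exp (-(exp (Real.log (Sl (fun j => (p.2 j).1) p.1 j.succ) + (p.2 j).2) : ℂ))) *
    Complex.exp (-(ρ₀ * Real.log (Sl (fun j => (p.2 j).1) p.1 0)))

variable {W : (Fin n → ℝ) → ℂ} {e : Fin n → ℂ} {f κ : ℂ} {M : Fin (n + 1) → ℂ}
  {c : Fin n → ℝ}

theorem rho_re (t : Fin n → ℝ) (i : Fin (n + 1)) : (rho M (vpt c t) i).re =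
    (rho M (fun j => (c j : ℂ)) i).re := by
  refine Fin.cases ?_ (fun j => ?_) i
  · simp
  · simp [vpt]

@[fun_prop]
theorem measurable_vpt {X : Type*} [MeasurableSpace X] (c : Fin n → ℝ) {t : X → Fin n → ℝ}
    (ht : Measurable t) (j : Fin n) : Measurable fun x => vpt c (t x) j := by
  unfold vpt; fun_prop

@[fun_prop]
theorem measurable_rho_vpt {X : Type*} [MeasurableSpace X] {t : X → Fin n → ℝ}
    (ht : Measurable t) (i : Fin (n + 1)) : Measurable fun x => rho M (vpt c (t x)) i := by
  refine Fin.cases ?_ (fun j => ?_) i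
  · simp only [rho_zero]; fun_prop
  · simp only [rho_succ]; fun_prop

/-- The Mellin–Barnes expansion of a product of exponentials, followed by the integration over
the sites. -/
theorem mb_expansion (hW : Measurable W)
    (h0 : ∀ j : Fin n, c j < (M j.succ).re)
    (h1 : ∀ j : Fin n, 0 < (κ + rho M (fun j => (c j : ℂ)) j.succ).re)
    (h2 : ∀ j : Fin n, 0 < (e j + rho M (fun j => (c j : ℂ)) j.castSucc).re)
    (h3 : ∀ j : Fin n, 0 < (κ + rho M (fun j => (c j : ℂ)) j.succ - e j).re)
    (hfin : ∫⁻ z, ‖W z‖ₑ * ENNReal.ofReal (exp (∑ j, z j * (f + (e j -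
      (κ + rho M (fun j => (c j : ℂ)) j.succ) + rho M (fun j => (c j : ℂ)) j.castSucc)).re)) ≠ ∞) :
    Integrable (mbL W e f κ (M 0 / 2)) ∧
    ∫ p, mbL W e f κ (M 0 / 2) p = 1 / (4 * Real.pi : ℂ) ^ n *
      ∫ t : Fin n → ℝ, (∏ j, G (M j.succ - vpt c t j) *
        siteC (e j) (κ + rho M (vpt c t) j.succ) (rho M (vpt c t) j.castSucc)) *
        ∫ z, W z * Complex.exp (∑ j, z j * (f + (e j -
      (κ + rho M (vpt c t) j.succ) + rho M (vpt c t) j.castSucc))) := by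
  set ρ := fun t => rho M (vpt c t) with hρ
  set ρ' := rho M (fun j => (c j : ℂ)) with hρ'
  have hre : ∀ t i, (ρ t i).re = (ρ' i).re := fun t i => rho_re t i
  let U : (Fin n → ℝ) → ℂ := fun t => ∏ j, G (M j.succ - vpt c t j)
  let Y : (Fin n → ℝ) → (Fin n → ℝ) × (Fin n → ℝ × ℝ) → ℂ := fun t p =>
    W p.1 * ∏ j, (Complex.exp (f * p.1 j) *
      site (e j) (κ + ρ t j.succ) (ρ t j.castSucc) (p.1 j) (p.2 j))
  let Y' : (Fin n → ℝ) × (Fin n → ℝ × ℝ) → ℂ := fun p =>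
    W p.1 * ∏ j, (Complex.exp (f * p.1 j) *
      site (e j) (κ + ρ' j.succ) (ρ' j.castSucc) (p.1 j) (p.2 j))
  -- Norms do not depend on the heights `t` on the contours. One majorant `Y'` therefore serves all
  -- `t`, and integrability in `t` is carried by `U` alone.
  have hns : ∀ t j z q, ‖site (e j) (κ + ρ t j.succ) (ρ t j.castSucc) z q‖ =
      ‖site (e j) (κ + ρ' j.succ) (ρ' j.castSucc) z q‖ := by
    intro t j z q
    apply Complex.ofReal_injective
    rw [norm_site, norm_site]
    simp [hre]
  have hYn : ∀ t p, ‖Y t p‖ = ‖Y' p‖ := by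
    intro t p
    simp only [Y, Y', norm_mul, norm_prod, hns]
  have hU : Integrable U := by
    refine Integrable.fintype_prod (f := fun j (t : ℝ) => G (M (Fin.succ j) - (c j + t * I)))
      fun j => integrable_G_vertical (h0 j)
  have hYm : Measurable Y' := by
    simp only [Y']
    fun_prop
  have hY : Integrable Y' := by
    rw [Measure.volume_eq_prod, integrable_prod_iff hYm.aestronglyMeasurable]
    constructor
    · refine Eventually.of_forall fun z => ?_
      simp only [Y']
      refine Integrable.const_mul ?_ _
      exact Integrable.fintype_prod (f := fun j q => Complex.exp (f * z j) *
        site (e j) (κ + ρ' j.succ) (ρ' j.castSucc) (z j) q)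
        fun j => (integral_site (h1 j) (h2 j) (h3 j) (z j)).1.const_mul _
    · have e1 : ∀ z : Fin n → ℝ, ∫ q, ‖Y' (z, q)‖ = ‖W z‖ * (exp (∑ j, z j * (f + (e j -
          (κ + ρ' j.succ) + ρ' j.castSucc)).re) *
          ∏ j, ‖siteC (e j).re (κ + ρ' j.succ).re (ρ' j.castSucc).re‖) := by
        intro z
        simp only [Y', norm_mul, norm_prod]
        rw [integral_const_mul, integral_fintype_prod_volume_eq_prod (f := fun j q =>
          ‖Complex.exp (f * z j)‖ * ‖site (e j) (κ + ρ' j.succ) (ρ' j.castSucc) (z j) q‖)]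
        congr 1
        rw [Real.exp_sum, ← prod_mul_distrib]
        refine prod_congr rfl fun j _ => ?_
        rw [integral_const_mul, integral_norm_site (h1 j) (h2 j) (h3 j), norm_exp,
          ← mul_assoc, ← exp_add]
        congr 2
        simp
        ring
      simp only [e1, ← mul_assoc]
      refine Integrable.mul_const ⟨by fun_prop, lt_of_le_of_lt (lintegral_mono fun z => ?_)
        hfin.lt_top⟩ _
      rw [enorm_mul, enorm_norm, Real.enorm_eq_ofReal (exp_pos _).le]
  let Ψ : (Fin n → ℝ) × ((Fin n → ℝ) × (Fin n → ℝ × ℝ)) → ℂ := fun x => U x.1 * Y x.1 x.2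
  have hΨm : Measurable Ψ := by
    simp only [Ψ, U, Y, hρ]
    fun_prop
  have hΨ : Integrable Ψ := by
    refine (hU.mul_prod hY).mono hΨm.aestronglyMeasurable (Eventually.of_forall fun x => ?_)
    simp only [Ψ, norm_mul, hYn, le_refl]
  have hinner : ∀ p, ∫ t, Ψ (t, p) = (4 * Real.pi : ℂ) ^ n * mbL W e f κ (M 0 / 2) p := by
    intro p
    obtain ⟨z, q⟩ := p
    set ls : Fin (n + 1) → ℝ := fun i => Real.log (Sl (fun j => (q j).1) z i) with hls
    have hls1 : ∀ j : Fin n, ls j.castSucc = lse (q j).1 (z j) - (q j).1 - z j := by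
      intro j
      simp only [hls, Sl_castSucc]
      rw [← lse_neg, lse]
    have hls2 : ls (Fin.last n) = 0 := by simp [hls]
    have key : ∀ t, Ψ (t, (z, q)) = (W z * (∏ j, Complex.exp (f * z j)) *
        (∏ j, Complex.exp (e j * (q j).1 - κ * (q j).2 -
          (exp (lse (q j).1 (z j)) * exp (-(q j).2) : ℝ))) *
        Complex.exp (-(M 0 / 2 * ls 0))) *
        ∏ j : Fin n, (G (M j.succ - (c j + t j * I)) *
          Complex.exp (-((M j.succ - (c j + t j * I)) / 2) * (ls j.succ + (q j).2 : ℝ))) := by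
      intro t
      -- A shift of index: the sum over all `n + 1` logarithms is read once without its last term,
      -- which vanishes since `S_n = 1`, and once with its first term `M 0 / 2 * ls 0` split off.
      have hsum : ∑ j : Fin n, ρ t j.castSucc * ls j.castSucc = M 0 / 2 * ls 0 +
          ∑ j : Fin n, ρ t j.succ * ls j.succ := by
        have h1 := Fin.sum_univ_castSucc (fun i => ρ t i * ls i)
        have h2 := Fin.sum_univ_succ (fun i => ρ t i * ls i)
        rw [hls2] at h1
        simp only [hρ, rho_zero] at h1 h2 ⊢
        rw [← h2, h1]
        simp
      simp only [Ψ, U, Y, site, ← hls1]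
      simp only [prod_mul_distrib, ← Complex.exp_sum]
      have hM : ∀ j : Fin n, (M j.succ - (c j + t j * I)) / 2 = ρ t j.succ := by
        intro j; simp [hρ, vpt]
      simp only [hM]
      have hG : ∀ j : Fin n, M j.succ - vpt c t j = M j.succ - (c j + t j * I) :=
        fun j => rfl
      simp only [hG]
      have : Complex.exp (∑ j : Fin n, (e j * (q j).1 - (κ + ρ t j.succ) * (q j).2 -
          (exp (lse (q j).1 (z j)) * exp (-(q j).2) : ℝ) - ρ t j.castSucc * ls j.castSucc)) =
          Complex.exp (∑ j : Fin n, (e j * (q j).1 - κ * (q j).2 -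
          (exp (lse (q j).1 (z j)) * exp (-(q j).2) : ℝ))) *
          Complex.exp (-(M 0 / 2 * ls 0)) *
          Complex.exp (∑ j : Fin n, -ρ t j.succ * (ls j.succ + (q j).2 : ℝ)) := by
        rw [← Complex.exp_add, ← Complex.exp_add]
        congr 1
        rw [sum_sub_distrib, hsum]
        push_cast
        simp only [add_mul, mul_add, neg_mul, sum_add_distrib, sum_sub_distrib,
          Finset.sum_neg_distrib]
        ring
      rw [this]
      ring
    simp only [key]
    rw [integral_const_mul, integral_fintype_prod_volume_eq_prod (f := fun j (t : ℝ) =>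
      G (M (Fin.succ j) - (c j + t * I)) * Complex.exp (-((M (Fin.succ j) -
        (c j + t * I)) / 2) * (ls (Fin.succ j) + (q j).2 : ℝ)))]
    simp only [exp_neg_exp_eq_integral_reflect (h0 _), prod_mul_distrib, prod_const,
      card_univ, Fintype.card_fin, mbL]
    ring
  have hpi : (4 * Real.pi : ℂ) ^ n ≠ 0 := by simp [pi_ne_zero]
  constructor
  · have h := (hΨ.integral_prod_right).const_mul ((4 * Real.pi : ℂ) ^ n)⁻¹
    simpa only [hinner, inv_mul_cancel_left₀ hpi] using h
  · have hsw : ∫ p, ∫ t, Ψ (t, p) = ∫ t, ∫ p, Ψ (t, p) :=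
      (integral_integral_swap (f := fun t p => Ψ (t, p)) hΨ).symm
    simp only [hinner] at hsw
    rw [integral_const_mul] at hsw
    have : ∫ p, mbL W e f κ (M 0 / 2) p = 1 / (4 * Real.pi : ℂ) ^ n * ∫ t, ∫ p, Ψ (t, p) := by
      rw [← hsw]; field_simp
    rw [this]
    congr 1
    refine integral_congr_ae (Eventually.of_forall fun t => ?_)
    simp only [Ψ]
    rw [integral_const_mul]
    have hYt : Integrable (Y t) := by
      refine hY.mono (Measurable.aestronglyMeasurable ?_) (Eventually.of_forall fun p => (hYn t p).le)
      simp only [Y]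
      fun_prop
    rw [Measure.volume_eq_prod, integral_prod _ hYt, prod_mul_distrib, mul_assoc]
    congr 1
    rw [← integral_const_mul]
    refine integral_congr_ae (Eventually.of_forall fun z => ?_)
    simp only [Y]
    rw [integral_const_mul, integral_fintype_prod_volume_eq_prod (f := fun j q =>
        Complex.exp (f * z j) * site (e j) (κ + ρ t j.succ) (ρ t j.castSucc) (z j) q)]
    have hv : ∀ j : Fin n, ∫ q, Complex.exp (f * z j) *
        site (e j) (κ + ρ t j.succ) (ρ t j.castSucc) (z j) q =
        siteC (e j) (κ + ρ t j.succ) (ρ t j.castSucc) *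
        Complex.exp (z j * (f + (e j - (κ + ρ t j.succ) + ρ t j.castSucc))) := by
      intro j
      have g1 := h1 j
      have g2 := h2 j
      have g3 := h3 j
      simp only [add_re, sub_re] at g1 g2 g3
      rw [integral_const_mul, (integral_site (by simpa [hre] using g1)
        (by simpa [hre] using g2) (by simpa [hre] using g3) (z j)).2]
      have : Complex.exp (z j * (f + (e j - (κ + ρ t j.succ) + ρ t j.castSucc))) =
          Complex.exp (f * z j) * Complex.exp (z j * (e j - (κ + ρ t j.succ) + ρ t j.castSucc)) := by
        rw [← Complex.exp_add]; ring_nf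
      rw [this]
      ring
    simp only [hv, prod_mul_distrib, ← Complex.exp_sum]
    ring

end MB
end

section
open scoped ENNReal
/-! ### The Barnes recursion and the Baxter identity for the Mellin transform -/

variable {n : ℕ}

/-- The Mellin kernel in logarithmic coordinates. -/
def vexp (s : Fin n → ℂ) (x : Fin n → ℝ) : ℂ := Complex.exp (∑ j, x j * dlt s j)

/-- The Mellin transform of the Whittaker function in logarithmic coordinates. -/
def v (β s : Fin n → ℂ) : ℂ := ∫ x, w n β x * vexp s x

/-- Absolute convergence of the Mellin transform of `W`. -/
def ConvAbs (W : (Fin n → ℝ) → ℝ≥0∞) (s : Fin n → ℂ) : Prop :=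
  ∫⁻ x, W x * ENNReal.ofReal (exp (∑ j, x j * (dlt s j).re)) ≠ ∞

theorem enorm_vexp (s : Fin n → ℂ) (x : Fin n → ℝ) :
    ‖vexp s x‖ₑ = ENNReal.ofReal (exp (∑ j, x j * (dlt s j).re)) := by
  rw [vexp, enorm_cexp]
  simp

@[fun_prop]
theorem measurable_vexp {X : Type*} [MeasurableSpace X] (s : Fin n → ℂ) {f : X → Fin n → ℝ}
    (hf : Measurable f) : Measurable fun x => vexp s (f x) := by
  unfold vexp; fun_prop

theorem siteC_eq (e κ ρ : ℂ) :
    siteC e κ ρ = G (2 * κ) * Bt (2 * (e + ρ)) (2 * (κ - e)) := by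
  have h : ∀ z : ℂ, 2 * z / 2 = z := fun z => by ring
  rw [siteC, Bt, G, G, G, G, h, h, h, show (2 * (e + ρ) + 2 * (κ - e)) / 2 = κ + ρ by ring]
  ring

theorem sh_re (s : Fin n → ℂ) (j : Fin n) : (sh s j).re =
    (Fin.cons (α := fun _ => ℝ) 0 (fun i => (s i).re) : Fin (n + 1) → ℝ) j.castSucc := by
  cases n with
  | zero => exact j.elim0
  | succ n =>
    refine Fin.cases ?_ (fun j => ?_) j
    · simp
    · rw [sh_succ, ← Fin.succ_castSucc, Fin.cons_succ]

theorem measurePreserving_unzip : MeasurePreserving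
    (fun p : (Fin n → ℝ) × (Fin n → ℝ × ℝ) =>
      ((fun j => (p.2 j).1, (fun j => (p.2 j).2, p.1)) :
        (Fin n → ℝ) × ((Fin n → ℝ) × (Fin n → ℝ)))) :=
  measurePreserving_prodAssoc'.comp (measurePreserving_swap'.comp
    ((MeasurePreserving.id (volume : Measure (Fin n → ℝ))).prod
      (volume_measurePreserving_arrowProdEquivProdArrow ℝ ℝ (Fin n))))

theorem Sl_pos (x z : Fin n → ℝ) (j : Fin (n + 1)) : 0 < Sl x z j := by
  refine Fin.lastCases ?_ (fun j => ?_) j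
  · simp
  · simp only [Sl_castSucc]; positivity

/-! ### The Baxter identity for Mellin transforms -/

section Star

/-- The kernel of the Baxter identity. -/
def starK (σ : ℂ) (p r : Fin n → ℂ) : ℂ :=
  ∏ j, G (p j - r j) * (G (p j - r j + 2 * σ) * Bt (p j - sh r j + σ) (sh p j - r j + σ))

variable {W : (Fin n → ℝ) → ℂ} {σ : ℂ} {p : Fin n → ℂ} {c : Fin n → ℝ}

/-- The data of `mb_expansion` are chosen so that the exponent left in `z` is that of `vexp r`
(`hexp`). Prefixing `p` by `0` makes `ρ_0` vanish, so that no power of `S_0` is left over; `e` and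
`κ` absorb the Mellin weight of `p` and the parameter `σ`. -/
theorem star_expansion (hW : Measurable W) (h0 : ∀ j, c j < (p j).re)
    (h1 : ∀ j, 0 < (p j).re - c j + 2 * σ.re)
    (h2 : ∀ j, 0 < (p j).re - (sh (fun j => (c j : ℂ)) j).re + σ.re)
    (h3 : ∀ j, 0 < (sh p j).re - c j + σ.re)
    (hfin : ConvAbs (fun x => ‖W x‖ₑ) (fun j => (c j : ℂ))) :
    Integrable (fun q : (Fin n → ℝ) × ((Fin n → ℝ) × (Fin n → ℝ)) =>
      kq (σ / 2) q.1 q.2.2 q.2.1 * W q.2.2 * vexp p q.1) ∧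
    ∫ q : (Fin n → ℝ) × ((Fin n → ℝ) × (Fin n → ℝ)),
      kq (σ / 2) q.1 q.2.2 q.2.1 * W q.2.2 * vexp p q.1 =
    1 / (4 * Real.pi : ℂ) ^ n * ∫ t, starK σ p (vpt c t) * ∫ z, W z * vexp (vpt c t) z := by
  set M : Fin (n + 1) → ℂ := Fin.cons 0 p with hM
  have hMs : ∀ j : Fin n, M j.succ = p j := fun j => by simp [hM]
  have hMc : ∀ (r : Fin n → ℂ) (j : Fin n), rho M r j.castSucc = (sh p j - sh r j) / 2 :=
    fun r j => rfl
  have hM0 : M 0 / 2 = 0 := by simp [hM]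
  have hexp : ∀ r : Fin n → ℂ, ∀ j : Fin n, σ / 2 + ((dlt p j + σ / 2) -
      (2 * (σ / 2) + rho M r j.succ) + rho M r j.castSucc) = dlt r j := by
    intro r j
    rw [hMc, rho_succ, hMs, dlt, dlt]
    ring
  have key := mb_expansion (W := W) (e := fun j => dlt p j + σ / 2) (f := σ / 2) (κ := 2 * (σ / 2))
    (M := M) (c := c) hW (fun j => by rw [hMs]; exact h0 j)
    (fun j => by
      rw [rho_succ, hMs]
      have := h1 j
      simp
      linarith)
    (fun j => by
      rw [hMc, dlt]
      have := h2 j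
      simp
      linarith)
    (fun j => by
      rw [rho_succ, hMs, dlt]
      have := h3 j
      simp
      linarith)
    (by
      have h := hfin
      unfold ConvAbs at h
      simpa only [hexp] using h)
  have e1 : mbL W (fun j => dlt p j + σ / 2) (σ / 2) (2 * (σ / 2)) (M 0 / 2) =
      (fun q : (Fin n → ℝ) × ((Fin n → ℝ) × (Fin n → ℝ)) =>
        kq (σ / 2) q.1 q.2.2 q.2.1 * W q.2.2 * vexp p q.1) ∘
      (fun p : (Fin n → ℝ) × (Fin n → ℝ × ℝ) =>
      ((fun j => (p.2 j).1, (fun j => (p.2 j).2, p.1)) :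
        (Fin n → ℝ) × ((Fin n → ℝ) × (Fin n → ℝ)))) := by
    funext u
    obtain ⟨z, q⟩ := u
    have hS : ∀ j : Fin n, exp (Real.log (Sl (fun j => (q j).1) z j.succ) + (q j).2) =
        Sl (fun j => (q j).1) z j.succ * exp ((q j).2) := by
      intro j
      rw [exp_add, exp_log (Sl_pos _ _ _)]
    simp only [mbL, Function.comp_apply, hM0, zero_mul, neg_zero, Complex.exp_zero, mul_one, kq,
      vexp, hS, exp_lse, qlin, qE, Tu]
    have : ∀ A B C D E W' : ℂ, Complex.exp (A + B + C) = Complex.exp (D + E) →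
        W' * Complex.exp A * Complex.exp B * Complex.exp C =
        Complex.exp D * W' * Complex.exp E := by
      intro A B C D E W' h
      rw [Complex.exp_add, Complex.exp_add, Complex.exp_add] at h
      linear_combination W' * h
    simp only [← Complex.exp_sum]
    apply this
    congr 1
    push_cast
    rw [Finset.mul_sum, ← sum_sub_distrib, ← sum_add_distrib,
      ← sum_add_distrib, ← sum_add_distrib]
    refine sum_congr rfl fun j _ => ?_
    ring
  have hFm : Measurable (fun q : (Fin n → ℝ) × ((Fin n → ℝ) × (Fin n → ℝ)) =>
      kq (σ / 2) q.1 q.2.2 q.2.1 * W q.2.2 * vexp p q.1) := by fun_prop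
  rw [e1] at key
  refine ⟨(measurePreserving_unzip.integrable_comp hFm.aestronglyMeasurable).1 key.1, ?_⟩
  have h5 := integral_comp_of_measurePreserving measurePreserving_unzip
    hFm.aestronglyMeasurable
  simp only [Function.comp_def] at key
  rw [← h5, key.2]
  congr 1
  refine integral_congr_ae (Eventually.of_forall fun t => ?_)
  simp only [hexp, vexp, starK, siteC_eq, hMs]
  congr 1
  refine prod_congr rfl fun j _ => ?_
  rw [rho_succ, hMs, hMc, dlt]
  ring_nf

/-- The Baxter identity. -/
theorem star_identity {β : Fin n → ℂ} (hσ : ∀ j, |(β j).re| < σ.re / 2) (h0 : ∀ j, c j < (p j).re)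
    (h2 : ∀ j, 0 < (p j).re - (sh (fun j => (c j : ℂ)) j).re + σ.re)
    (h3 : ∀ j, 0 < (sh p j).re - c j + σ.re) (hσ0 : 0 ≤ σ.re)
    (hfin : ConvAbs (wAbs n fun j => (β j).re) (fun j => (c j : ℂ)))
    (hfin' : ConvAbs (wAbs n fun j => (β j).re) p) :
    (∏ j, Gamma (σ / 2 + β j) * Gamma (σ / 2 - β j)) * v β p =
    1 / (4 * Real.pi : ℂ) ^ n * ∫ t, starK σ p (vpt c t) * v β (vpt c t) := by
  have hc : ConvAbs (fun x => ‖w n β x‖ₑ) (fun j => (c j : ℂ)) :=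
    ne_top_of_le_ne_top hfin (lintegral_mono fun x => mul_le_mul' (enorm_w_le _ _) le_rfl)
  obtain ⟨k1, k2⟩ := star_expansion (σ := σ) (p := p) (by fun_prop) h0
    (fun j => by have := h0 j; linarith) h2 h3 hc
  simp only [v]
  rw [← k2, Measure.volume_eq_prod, integral_prod _ k1, ← integral_const_mul]
  -- The eigenvalue equation is available only where `wAbs` is finite; convergence of the Mellin
  -- transform at `p` makes this almost every `x`.
  have hae : ∀ᵐ x, wAbs n (fun j => (β j).re) x ≠ ∞ := by
    filter_upwards [ae_lt_top (by fun_prop) hfin'] with x hx htop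
    rw [htop, ENNReal.top_mul] at hx
    · exact absurd hx (lt_irrefl _)
    · simp only [ne_eq, ENNReal.ofReal_eq_zero, not_le]
      exact exp_pos _
  refine integral_congr_ae ?_
  filter_upwards [hae] with x hx
  rw [integral_mul_const, (integral_kq_w β (σ / 2) (fun j => by simpa using hσ j) x hx).2]
  ring

end Star

/-! ### The Barnes recursion in the number of variables -/

section Rec

/-- The kernel of the Barnes recursion. -/
def recK (τ : ℂ) (s : Fin (n + 1) → ℂ) (r : Fin n → ℂ) : ℂ :=
  ∏ j : Fin n, G (s j.succ - r j - τ) * (G (s j.succ - r j + τ) *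
    Bt (s j.succ - sh r j) (s j.castSucc - r j))

theorem integrable_exp_mul_sub_exp_neg {s : ℂ} (hs : 0 < s.re) :
    Integrable fun h : ℝ => Complex.exp (-(s * h) - exp (-h)) := by
  have := (integrable_exp_mul_sub_exp hs).comp_neg
  simpa using this

/-- The change of variables splitting off the first site. -/
def splitFirst (p : ℝ × (ℝ × ((Fin n → ℝ) × (Fin n → ℝ × ℝ)))) :
    (Fin (n + 1) → ℝ) × ((Fin (n + 1) → ℝ) × (Fin n → ℝ)) :=
  let x' : Fin n → ℝ := fun j => (p.2.2.2 j).1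
  let a₀ := -Real.log (Sl x' p.2.2.1 0) - p.2.1
  (Fin.cons (α := fun _ => ℝ) (a₀ - p.1) x', (Fin.cons (α := fun _ => ℝ) a₀ fun j => (p.2.2.2 j).2,
    p.2.2.1))

theorem measurePreserving_splitFirst : MeasurePreserving (splitFirst (n := n)) := by
  have hl : Measurable fun p : (Fin n → ℝ) × (Fin n → ℝ × ℝ) =>
      -Real.log (Sl (fun j => (p.2 j).1) p.1 0) := by
    have := measurable_Sl (X := (Fin n → ℝ) × (Fin n → ℝ × ℝ)) (f := fun p j => (p.2 j).1)
      (g := fun p => p.1) (by fun_prop) (by fun_prop) 0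
    fun_prop
  have h1 : MeasurePreserving (fun p : ℝ × (ℝ × ((Fin n → ℝ) × (Fin n → ℝ × ℝ))) =>
      (p.1, (-Real.log (Sl (fun j => (p.2.2.2 j).1) p.2.2.1 0) - p.2.1, p.2.2))) :=
    (MeasurePreserving.id (volume : Measure ℝ)).prod
      (measurePreserving_sub_fst (X := ℝ) reflInvariant_real hl)
  have h2 : MeasurePreserving (fun p : ℝ × (ℝ × ((Fin n → ℝ) × (Fin n → ℝ × ℝ))) =>
      (p.2.1 - p.1, p.2)) :=
    measurePreserving_sub_fst (X := ℝ) reflInvariant_real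
      (f := fun q : ℝ × ((Fin n → ℝ) × (Fin n → ℝ × ℝ)) => q.1) measurable_fst
  have h3 : MeasurePreserving (fun p : ℝ × (ℝ × ((Fin n → ℝ) × (Fin n → ℝ × ℝ))) =>
      (p.1, (p.2.1, ((fun j => (p.2.2.2 j).1, (fun j => (p.2.2.2 j).2, p.2.2.1)) :
        (Fin n → ℝ) × ((Fin n → ℝ) × (Fin n → ℝ)))))) :=
    (MeasurePreserving.id (volume : Measure ℝ)).prod
      ((MeasurePreserving.id (volume : Measure ℝ)).prod measurePreserving_unzip)
  have h4 : MeasurePreserving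
      (fun p : ℝ × (ℝ × ((Fin n → ℝ) × ((Fin n → ℝ) × (Fin n → ℝ)))) =>
      ((p.1, p.2.2.1), ((p.2.1, p.2.2.2.1), p.2.2.2.2))) :=
    ((MeasurePreserving.id (volume : Measure (ℝ × (Fin n → ℝ)))).prod
      measurePreserving_prodAssoc_symm').comp
    (measurePreserving_prodAssoc_symm'.comp
      ((MeasurePreserving.id (volume : Measure ℝ)).prod measurePreserving_swap_left))
  have h5 : MeasurePreserving (fun p : (ℝ × (Fin n → ℝ)) × ((ℝ × (Fin n → ℝ)) × (Fin n → ℝ)) =>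
      ((Fin.cons (α := fun _ => ℝ) p.1.1 p.1.2, (Fin.cons (α := fun _ => ℝ) p.2.1.1 p.2.1.2, p.2.2)) :
      (Fin (n + 1) → ℝ) × ((Fin (n + 1) → ℝ) × (Fin n → ℝ)))) :=
    measurePreserving_cons.prod (measurePreserving_cons.prod
      (MeasurePreserving.id (volume : Measure (Fin n → ℝ))))
  exact h5.comp (h4.comp (h3.comp (h2.comp h1)))

variable {W : (Fin n → ℝ) → ℂ} {τ : ℂ} {s : Fin (n + 1) → ℂ} {c : Fin n → ℝ}

/-- After the substitution `splitFirst` the first entries of `x` and `a` are free variables giving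
the two Gamma factors in `s 0 ± τ`, and a power of `S_0` with exponent `(s 0 - τ) / 2` is left
behind. The other `n` sites together with this power are an instance of `mb_expansion`. -/
theorem rec_expansion (hW : Measurable W) (h0 : ∀ j, 0 < (s j.succ).re - c j - τ.re)
    (h1 : ∀ j, 0 < (s j.succ).re - c j + τ.re)
    (h2 : ∀ j, 0 < (s j.succ).re - (sh (fun j => (c j : ℂ)) j).re)
    (h3 : ∀ j, 0 < (s j.castSucc).re - c j)
    (h4 : 0 < (s 0).re + τ.re) (h5 : 0 < (s 0).re - τ.re)
    (hfin : ConvAbs (fun x => ‖W x‖ₑ) (fun j => (c j : ℂ))) :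
    Integrable (fun q : (Fin (n + 1) → ℝ) × ((Fin (n + 1) → ℝ) × (Fin n → ℝ)) =>
      kl (τ / 2) q.1 q.2.2 q.2.1 * W q.2.2 * vexp s q.1) ∧
    ∫ q : (Fin (n + 1) → ℝ) × ((Fin (n + 1) → ℝ) × (Fin n → ℝ)),
      kl (τ / 2) q.1 q.2.2 q.2.1 * W q.2.2 * vexp s q.1 =
    G (s 0 + τ) * G (s 0 - τ) * (1 / (4 * Real.pi : ℂ) ^ n *
      ∫ t, recK τ s (vpt c t) * ∫ z, W z * vexp (vpt c t) z) := by
  set M : Fin (n + 1) → ℂ := fun i => s i - τ with hM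
  have hMc : ∀ (r : Fin n → ℂ) (j : Fin n), rho M r j.castSucc = (s j.castSucc - τ - sh r j) / 2 :=
    fun r j => rfl
  have hexp : ∀ r : Fin n → ℂ, ∀ j : Fin n, τ / 2 + (((s j.succ - s j.castSucc) / 2 + τ / 2) -
      (2 * (τ / 2) + rho M r j.succ) + rho M r j.castSucc) = dlt r j := by
    intro r j
    rw [hMc, rho_succ, dlt]
    ring
  have key := mb_expansion (W := W) (e := fun j : Fin n => (s j.succ - s j.castSucc) / 2 + τ / 2)
    (f := τ / 2) (κ := 2 * (τ / 2)) (M := M) (c := c) hW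
    (fun j => by have := h0 j; simp [hM]; linarith)
    (fun j => by
      rw [rho_succ]
      have := h1 j
      simp [hM]
      linarith)
    (fun j => by
      rw [hMc]
      have := h2 j
      simp
      linarith)
    (fun j => by
      rw [rho_succ]
      have := h3 j
      simp [hM]
      linarith)
    (by
      have h := hfin
      unfold ConvAbs at h
      simpa only [hexp] using h)
  have g4 : 0 < (s 0 / 2 + τ / 2).re := by simp; linarith
  have g5 : 0 < (s 0 / 2 - τ / 2).re := by simp; linarith
  set mb := mbL W (fun j : Fin n => (s j.succ - s j.castSucc) / 2 + τ / 2) (τ / 2) (2 * (τ / 2))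
    (M 0 / 2) with hmb
  set F := fun q : (Fin (n + 1) → ℝ) × ((Fin (n + 1) → ℝ) × (Fin n → ℝ)) =>
      kl (τ / 2) q.1 q.2.2 q.2.1 * W q.2.2 * vexp s q.1 with hF
  have e1 : F ∘ splitFirst = fun u =>
      Complex.exp (-((s 0 / 2 + τ / 2) * u.1) - exp (-u.1)) *
      (Complex.exp (-((s 0 / 2 - τ / 2) * u.2.1) - exp (-u.2.1)) * mb u.2.2) := by
    funext u
    obtain ⟨h, y, z, q⟩ := u
    set l := Real.log (Sl (fun j => (q j).1) z 0) with hl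
    have hS : ∀ j : Fin n, exp (Real.log (Sl (fun j => (q j).1) z j.succ) + (q j).2) =
        Sl (fun j => (q j).1) z j.succ * exp ((q j).2) := by
      intro j
      rw [exp_add, exp_log (Sl_pos _ _ _)]
    have hS0 : Sl (fun j => (q j).1) z 0 * exp (-l - y) = exp (-y) := by
      rw [sub_eq_add_neg, exp_add, exp_neg l, hl, exp_log (Sl_pos _ _ _),
        mul_inv_cancel_left₀ (Sl_pos _ _ _).ne']
    have hT0 : exp (-l - y - h) * exp (-(-l - y)) = exp (-h) := by
      rw [← exp_add]; ring_nf
    have hE : lE (Fin.cons (α := fun _ => ℝ) (-l - y - h) fun j => (q j).1) z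
        (Fin.cons (α := fun _ => ℝ) (-l - y) fun j => (q j).2) = exp (-h) + exp (-y) +
        ∑ j : Fin n, ((exp (q j).1 + exp (z j)) * exp (-(q j).2) +
          Sl (fun j => (q j).1) z j.succ * exp (q j).2) := by
      rw [lE, Fin.sum_univ_succ]
      simp only [Tc_zero, Tc_succ, Fin.cons_zero, Fin.cons_succ, Fin.tail_cons, hS0, hT0]
    have hlin : ∀ (x₀ a₀ : ℝ), llin (Fin.cons (α := fun _ => ℝ) x₀ fun j => (q j).1) z
        (Fin.cons (α := fun _ => ℝ) a₀ fun j => (q j).2) = x₀ - 2 * a₀ +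
        ∑ j : Fin n, ((q j).1 + z j - 2 * (q j).2) := by
      intro x₀ a₀
      simp only [llin, Fin.sum_univ_succ, Fin.cons_zero, Fin.cons_succ, sum_add_distrib,
        sum_sub_distrib, ← Finset.mul_sum]
      ring
    have hsf : splitFirst (h, y, z, q) = (Fin.cons (α := fun _ => ℝ) (-l - y - h) fun j => (q j).1,
      (Fin.cons (α := fun _ => ℝ) (-l - y) fun j => (q j).2, z)) := rfl
    have hd0 : dlt s 0 = s 0 / 2 := by simp [dlt]
    have hds : ∀ j : Fin n, dlt s j.succ = (s j.succ - s j.castSucc) / 2 := fun j => by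
      simp [dlt]
    simp only [Function.comp_apply, hF, hsf, kl, vexp, hlin, hE, hmb, mbL, hS, exp_lse, hM, ← hl]
    rw [Fin.sum_univ_succ]
    simp only [Fin.cons_zero, Fin.cons_succ, hd0, hds]
    simp only [← Complex.exp_sum]
    have : ∀ A B C D E V X Y W' : ℂ, D + E = X + Y + A + B + C + V →
        Complex.exp D * W' * Complex.exp E = Complex.exp X * (Complex.exp Y *
        (W' * Complex.exp A * Complex.exp B * Complex.exp C * Complex.exp V)) := by
      intro A B C D E V X Y W' h
      have h' := congrArg Complex.exp h
      simp only [Complex.exp_add] at h'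
      linear_combination W' * h'
    apply this
    push_cast
    have hsum : ∑ x : Fin n, ((((s x.succ - s x.castSucc) / 2 + τ / 2) * ((q x).1 : ℂ) -
        2 * (τ / 2) * ((q x).2 : ℂ)) - (Complex.exp (q x).1 + Complex.exp (z x)) *
          Complex.exp (-(q x).2)) + ∑ x : Fin n, -((Sl (fun j => (q j).1) z x.succ : ℂ) *
            Complex.exp (q x).2) + ∑ x : Fin n, τ / 2 * (z x : ℂ) =
        τ / 2 * ∑ x : Fin n, (((q x).1 : ℂ) + z x - 2 * (q x).2) - ∑ x : Fin n,
        ((Complex.exp (q x).1 + Complex.exp (z x)) * Complex.exp (-(q x).2) +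
          (Sl (fun j => (q j).1) z x.succ : ℂ) * Complex.exp (q x).2) +
        ∑ x : Fin n, ((q x).1 : ℂ) * ((s x.succ - s x.castSucc) / 2) := by
      rw [Finset.mul_sum, ← sum_sub_distrib, ← sum_add_distrib,
        ← sum_add_distrib, ← sum_add_distrib]
      refine sum_congr rfl fun j _ => ?_
      ring
    linear_combination -hsum
  have hFm : Measurable F := by rw [hF]; fun_prop
  have hI := (integrable_exp_mul_sub_exp_neg g4).mul_prod
    ((integrable_exp_mul_sub_exp_neg g5).mul_prod key.1)
  constructor
  · refine (measurePreserving_splitFirst.integrable_comp hFm.aestronglyMeasurable).1 ?_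
    rw [e1]
    exact hI
  · have h6 := integral_comp_of_measurePreserving measurePreserving_splitFirst
      hFm.aestronglyMeasurable
    have e1' : ∀ u, F (splitFirst u) = _ := fun u => congrFun e1 u
    simp only [e1'] at h6
    rw [← h6, Measure.volume_eq_prod, integral_prod_mul
      (fun h : ℝ => Complex.exp (-((s 0 / 2 + τ / 2) * h) - exp (-h)))
      (fun u : ℝ × ((Fin n → ℝ) × (Fin n → ℝ × ℝ)) =>
        Complex.exp (-((s 0 / 2 - τ / 2) * u.1) - exp (-u.1)) * mb u.2),
      Measure.volume_eq_prod, integral_prod_mul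
      (fun h : ℝ => Complex.exp (-((s 0 / 2 - τ / 2) * h) - exp (-h))) mb,
      integral_exp_mul_sub_exp_neg g4, integral_exp_mul_sub_exp_neg g5, key.2, ← mul_assoc]
    congr 1
    · rw [G, G]; ring_nf
    · congr 1
      refine integral_congr_ae (Eventually.of_forall fun t => ?_)
      simp only [hexp, vexp, recK, siteC_eq]
      congr 1
      refine prod_congr rfl fun j _ => ?_
      rw [rho_succ, hMc]
      simp only [hM]
      ring_nf

/-- `rec_expansion` is applied to `wAbs` itself, made complex valued by `toReal`; its integrability
clause is the convergence wanted with one more variable. Infinite values of `wAbs` occupy a null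
set. -/
theorem convAbs_wAbs_succ {β : Fin (n + 1) → ℝ} (h0 : ∀ j, 0 < (s j.succ).re - c j + 2 * β (Fin.last n))
    (h1 : ∀ j, 0 < (s j.succ).re - c j - 2 * β (Fin.last n))
    (h2 : ∀ j, 0 < (s j.succ).re - (sh (fun j => (c j : ℂ)) j).re)
    (h3 : ∀ j, 0 < (s j.castSucc).re - c j)
    (h4 : 0 < (s 0).re - 2 * β (Fin.last n)) (h5 : 0 < (s 0).re + 2 * β (Fin.last n))
    (hfin : ConvAbs (wAbs n fun j => β j.castSucc) (fun j => (c j : ℂ))) :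
    ConvAbs (wAbs (n + 1) β) s := by
  set W : (Fin n → ℝ) → ℂ := fun x => ((wAbs n (fun j => β j.castSucc) x).toReal : ℂ) with hWd
  have hae : ∀ᵐ x, ‖W x‖ₑ = wAbs n (fun j => β j.castSucc) x := by
    filter_upwards [ae_lt_top (by fun_prop) hfin] with x hx
    have : wAbs n (fun j => β j.castSucc) x ≠ ∞ := by
      intro htop
      rw [htop, ENNReal.top_mul] at hx
      · exact absurd hx (lt_irrefl _)
      · simp only [ne_eq, ENNReal.ofReal_eq_zero, not_le]
        exact exp_pos _
    rw [hWd]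
    simp only
    rw [← ofReal_norm, Complex.norm_real, Real.norm_of_nonneg ENNReal.toReal_nonneg,
      ENNReal.ofReal_toReal this]
  have hW : Measurable W := by
    rw [hWd]
    have := measurable_wAbs (fun j => β j.castSucc)
    fun_prop
  have hfin' : ConvAbs (fun x => ‖W x‖ₑ) (fun j => (c j : ℂ)) := by
    unfold ConvAbs at hfin ⊢
    have h : ∫⁻ x, ‖W x‖ₑ * ENNReal.ofReal (exp (∑ j, x j * (dlt (fun j => (c j : ℂ)) j).re)) =
        ∫⁻ x, wAbs n (fun j => β j.castSucc) x *
          ENNReal.ofReal (exp (∑ j, x j * (dlt (fun j => (c j : ℂ)) j).re)) :=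
      lintegral_congr_ae (hae.mono fun x hx => by simp only [hx])
    rwa [h]
  have key := (rec_expansion (τ := -(2 * β (Fin.last n) : ℝ)) (s := s) hW
    (fun j => by have := h0 j; simp at this ⊢; linarith)
    (fun j => by have := h1 j; simp at this ⊢; linarith) h2 h3
    (by simp at h4 ⊢; linarith) (by simp at h5 ⊢; linarith) hfin').1.2
  rw [HasFiniteIntegral, Measure.volume_eq_prod, lintegral_prod _ (by fun_prop)] at key
  refine ne_of_lt (lt_of_eq_of_lt (lintegral_congr fun x => ?_) key)
  simp only [wAbs]
  rw [← lintegral_mul_const _ (by fun_prop)]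
  refine lintegral_congr_ae ?_
  filter_upwards [Measure.quasiMeasurePreserving_snd.ae hae] with q hq
  rw [enorm_mul, enorm_mul, enorm_kl, enorm_vexp, hq]
  congr 4
  simp
  ring

/-- The Barnes recursion. -/
theorem rec_identity {β : Fin (n + 1) → ℂ} (hτ : τ = -(2 * β (Fin.last n)))
    (h0 : ∀ j, 0 < (s j.succ).re - c j - τ.re)
    (h1 : ∀ j, 0 < (s j.succ).re - c j + τ.re)
    (h2 : ∀ j, 0 < (s j.succ).re - (sh (fun j => (c j : ℂ)) j).re)
    (h3 : ∀ j, 0 < (s j.castSucc).re - c j)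
    (h4 : 0 < (s 0).re + τ.re) (h5 : 0 < (s 0).re - τ.re)
    (hfin : ConvAbs (wAbs n fun j => (β j.castSucc).re) (fun j => (c j : ℂ))) :
    v β s = G (s 0 + τ) * G (s 0 - τ) * (1 / (4 * Real.pi : ℂ) ^ n *
      ∫ t, recK τ s (vpt c t) * v (fun j => β j.castSucc) (vpt c t)) := by
  have hc : ConvAbs (fun x => ‖w n (fun j => β j.castSucc) x‖ₑ) (fun j => (c j : ℂ)) :=
    ne_top_of_le_ne_top hfin (lintegral_mono fun x => mul_le_mul' (enorm_w_le _ _) le_rfl)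
  obtain ⟨k1, k2⟩ := rec_expansion (τ := τ) (s := s) (by fun_prop) h0 h1 h2 h3 h4 h5 hc
  simp only [v]
  rw [← k2, Measure.volume_eq_prod, integral_prod _ k1]
  refine integral_congr_ae (Eventually.of_forall fun x => ?_)
  simp only [w]
  rw [integral_mul_const, hτ]
  congr 3
  funext p
  congr 2
  ring

end Rec

/-- The abscissa of absolute convergence used for the Mellin transform. -/
def absc : (n : ℕ) → (Fin n → ℝ) → ℝ
  | 0, _ => 0
  | n + 1, β => absc n (fun j => β j.castSucc) + 1 + 2 * |β (Fin.last n)|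

theorem absc_nonneg (β : Fin n → ℝ) : 0 ≤ absc n β := by
  induction n with
  | zero => exact le_rfl
  | succ n ih =>
    have := ih (fun j => β j.castSucc)
    simp only [absc]
    positivity

theorem sh_const_re_le (c : ℝ) (hc : 0 ≤ c) (j : Fin n) : (sh (fun _ => (c : ℂ)) j).re ≤ c := by
  rw [sh_re]
  cases n with
  | zero => exact j.elim0
  | succ n =>
    refine Fin.cases ?_ (fun j => ?_) j
    · simpa
    · rw [← Fin.succ_castSucc, Fin.cons_succ]; simp

theorem convAbs_wAbs (β : Fin n → ℝ) (s : Fin n → ℂ) (hs : ∀ j, absc n β < (s j).re) :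
    ConvAbs (wAbs n β) s := by
  induction n with
  | zero =>
    simp [ConvAbs, wAbs, volume_pi]
  | succ n ih =>
    set m := absc n (fun j => β j.castSucc) with hm
    have hm0 : 0 ≤ m := absc_nonneg _
    have hs' : ∀ j, m + 1 + 2 * |β (Fin.last n)| < (s j).re := fun j => hs j
    have ha := abs_nonneg (β (Fin.last n))
    have ha1 := le_abs_self (β (Fin.last n))
    have ha2 := neg_abs_le (β (Fin.last n))
    -- The abscissa rises by `1 + 2 |β|` at each step: contours half a unit above the old abscissa
    -- `m` leave room for both shifts `± 2 β`.
    refine convAbs_wAbs_succ (c := fun _ => m + 1 / 2) (fun j => ?_) (fun j => ?_) (fun j => ?_)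
      (fun j => ?_) ?_ ?_ (ih _ _ fun j => ?_)
    · have := hs' j.succ; linarith
    · have := hs' j.succ; linarith
    · have := hs' j.succ
      have h2 := sh_const_re_le (m + 1 / 2) (by linarith) j
      linarith
    · have := hs' j.castSucc; linarith
    · have := hs' 0; linarith
    · have := hs' 0; linarith
    · simp only [ofReal_re]; linarith
end

/-! ### Integrals along indented lines -/

namespace IndentedLine
variable (γ : IndentedLine)

theorem continuous_path : Continuous γ.path := by
  obtain ⟨K, hK⟩ := γ.lipschitz
  exact hK.continuous

theorem exists_norm_deriv_le : ∃ K : ℝ, 0 ≤ K ∧ ∀ t, ‖deriv γ.path t‖ ≤ K := by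
  obtain ⟨K, hK⟩ := γ.lipschitz
  exact ⟨K, K.2, fun t => norm_deriv_le_of_lipschitz hK⟩

theorem exists_bound : ∃ B : ℝ, 0 ≤ B ∧ ∀ t, |(γ.path t).re| ≤ B ∧ |(γ.path t).im - t| ≤ B := by
  obtain ⟨c, T, h⟩ := γ.vertical
  obtain ⟨B, hB⟩ := (isCompact_Icc (a := -|T|) (b := |T|)).exists_bound_of_continuousOn
    γ.continuous_path.continuousOn
  have hB0 : 0 ≤ B := (norm_nonneg _).trans (hB 0 ⟨by simp, by simp⟩)
  refine ⟨B + |T| + |c|, by positivity, fun t => ?_⟩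
  rcases le_total T |t| with ht | ht
  · rw [h t ht]
    simp
    constructor <;> [nlinarith [abs_nonneg T, abs_nonneg c]; positivity]
  · have ht' : |t| ≤ |T| := ht.trans (le_abs_self T)
    have := hB t (abs_le.1 ht')
    have h1 := abs_re_le_norm (γ.path t)
    have h2 := Complex.abs_im_le_norm (γ.path t)
    have h3 := abs_sub (γ.path t).im t
    constructor <;> linarith [abs_nonneg c, abs_nonneg T]

theorem isClosed_range : IsClosed (range γ.path) := by
  obtain ⟨B, hB0, hB⟩ := γ.exists_bound
  have h : Tendsto (fun t => ‖γ.path t‖) (cocompact ℝ) atTop := by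
    refine tendsto_atTop_mono (f := fun t : ℝ => ‖t‖ + -B) (fun t => ?_)
      (tendsto_atTop_add_const_right _ _ tendsto_norm_cocompact_atTop)
    have h1 := Complex.abs_im_le_norm (γ.path t)
    have h2 := (hB t).2
    have h3 := abs_sub_abs_le_abs_sub t (γ.path t).im
    rw [abs_sub_comm] at h3
    rw [Real.norm_eq_abs]
    linarith
  have hp : IsProperMap γ.path :=
    isProperMap_iff_tendsto_cocompact.2 ⟨γ.continuous_path, tendsto_cocompact_of_tendsto_dist_comp_atTop
      (0 : ℂ) (by simpa [dist_zero_right] using h)⟩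
  exact hp.isClosedMap.isClosed_range

theorem exists_dist_le {a : ℂ} (ha : a ∉ range γ.path) : ∃ ε > 0, ∀ t, ε ≤ ‖γ.path t - a‖ := by
  obtain ⟨ε, hε, h⟩ := Metric.isOpen_iff.1 γ.isClosed_range.isOpen_compl a ha
  refine ⟨ε, hε, fun t => ?_⟩
  by_contra hlt
  exact h (by simpa [dist_eq_norm] using hlt : γ.path t ∈ Metric.ball a ε) ⟨t, rfl⟩

/-- The integral along an indented line. -/
def cint (f : ℂ → ℂ) : ℂ := ∫ t, f (γ.path t) * deriv γ.path t

theorem integrable_of_bound {f : ℂ → ℂ} (hf : Continuous fun t => f (γ.path t)) {C δ : ℝ} (hδ : 0 < δ)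
    (h : ∀ t, ‖f (γ.path t)‖ ≤ C * exp (-δ * |t|)) :
    Integrable fun t => f (γ.path t) * deriv γ.path t := by
  obtain ⟨K, hK0, hK⟩ := γ.exists_norm_deriv_le
  refine (((integrable_exp_neg_mul_abs hδ).const_mul C).mul_const K).mono'
    (hf.aestronglyMeasurable.mul (measurable_deriv _).aestronglyMeasurable)
    (Eventually.of_forall fun t => ?_)
  rw [norm_mul]
  exact mul_le_mul (h t) (hK t) (norm_nonneg _) ((norm_nonneg _).trans (h t))

theorem intervalIntegral_eq_sub {f F : ℂ → ℂ} (hF : ∀ t, HasDerivAt F (f (γ.path t)) (γ.path t))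
    (hint : Integrable fun t => f (γ.path t) * deriv γ.path t) (a b : ℝ) :
    ∫ t in a..b, f (γ.path t) * deriv γ.path t = F (γ.path b) - F (γ.path a) := by
  obtain ⟨S, hS⟩ := γ.piecewise
  refine integral_eq_of_hasDerivAt_off_countable (fun t => F (γ.path t)) _ S.countable_toSet ?_ ?_
    hint.intervalIntegrable
  · exact (continuous_iff_continuousAt.2 fun t => ((hF t).continuousAt).comp
      γ.continuous_path.continuousAt).continuousOn
  · intro t ht
    exact (hF t).comp t ((hS t ht.2).differentiableAt (by norm_num)).hasDerivAt

end IndentedLine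

/-- The vertical line through `c`. -/
def vline (c : ℝ) : IndentedLine where
  path t := c + t * I
  lipschitz := ⟨1, LipschitzWith.of_dist_le_mul fun x y => by
    rw [dist_eq_norm, dist_eq_norm, add_sub_add_left_eq_sub, ← sub_mul, ← Complex.ofReal_sub,
      norm_mul, Complex.norm_I, Complex.norm_real]
    simp⟩
  piecewise := ⟨∅, fun t _ => by
    have : ContDiff ℝ 1 fun t : ℝ => (c : ℂ) + t * I :=
      contDiff_const.add (Complex.ofRealCLM.contDiff.mul contDiff_const)
    exact this.contDiffAt⟩
  vertical := ⟨c, 0, fun _ _ => rfl⟩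

theorem vline_path (c t : ℝ) : (vline c).path t = c + t * I := rfl

@[simp] theorem vline_path_re (c t : ℝ) : ((vline c).path t).re = c := by simp [vline_path]

@[simp] theorem deriv_vline (c t : ℝ) : deriv (vline c).path t = I := by
  have : HasDerivAt (fun t : ℝ => (c : ℂ) + t * I) I t := by
    simpa using ((Complex.ofRealCLM.hasDerivAt (x := t)).mul_const I).const_add (c : ℂ)
  exact this.deriv

/-- Holomorphic functions on a vertical strip with exponential decay. -/
structure Dec (l c : ℝ) (g : ℂ → ℂ) : Prop where
  diff : DifferentiableOn ℂ g {z | l < z.re ∧ z.re < c}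
  bound : ∃ C δ : ℝ, 0 ≤ C ∧ 0 < δ ∧ ∀ z : ℂ, l < z.re → z.re < c →
    ‖g z‖ ≤ C * exp (-δ * |z.im|)

theorem isOpen_strip (l c : ℝ) : IsOpen {z : ℂ | l < z.re ∧ z.re < c} :=
  (isOpen_lt continuous_const continuous_re).inter
    (isOpen_lt continuous_re continuous_const)

theorem convex_strip (l c : ℝ) : Convex ℝ {z : ℂ | l < z.re ∧ z.re < c} :=
  (convex_halfSpace_re_gt l).inter (convex_halfSpace_re_lt c)

namespace Dec
variable {l c l' c' : ℝ} {g h : ℂ → ℂ}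

theorem mul_bounded (hg : Dec l c g) (hh : DifferentiableOn ℂ h {z | l < z.re ∧ z.re < c})
    {K : ℝ} (hK : ∀ z : ℂ, l < z.re → z.re < c → ‖h z‖ ≤ K) : Dec l c (fun z => g z * h z) := by
  obtain ⟨C, δ, hC, hδ, hb⟩ := hg.bound
  refine ⟨hg.diff.mul hh, C * |K|, δ, by positivity, hδ, fun z h1 h2 => ?_⟩
  rw [norm_mul, mul_right_comm]
  exact mul_le_mul (hb z h1 h2) ((hK z h1 h2).trans (le_abs_self K)) (norm_nonneg _) (by positivity)

/-- A test function: entire, non-zero at `a`, and decaying in every vertical strip because the real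
part of `(z - a) ^ 2` is bounded above by a constant minus the square of `z.im - a.im`. -/
theorem gauss (a : ℂ) (l c : ℝ) : Dec l c (fun z => Complex.exp ((z - a) ^ 2)) := by
  refine ⟨by fun_prop, exp ((|l| + |c| + |a.re|) ^ 2 + |a.im| + 1), 1, (exp_pos _).le,
    one_pos, fun z h1 h2 => ?_⟩
  rw [norm_exp, ← exp_add, exp_le_exp]
  have e : ((z - a) ^ 2).re = (z.re - a.re) ^ 2 - (z.im - a.im) ^ 2 := by
    simp [sq, mul_re]
  have h5 : |z.re - a.re| ≤ |l| + |c| + |a.re| := by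
    rw [abs_le]
    constructor <;> linarith [neg_abs_le l, neg_abs_le c, le_abs_self c, le_abs_self l,
      abs_nonneg l, abs_nonneg c, neg_abs_le a.re, le_abs_self a.re]
  have h6 := sq_le_sq' (by linarith [neg_abs_le (z.re - a.re)]) ((le_abs_self _).trans h5)
  have h7 : |z.im| ≤ |z.im - a.im| + |a.im| := by
    have := abs_add_le (z.im - a.im) a.im
    simpa using this
  have h8 : |z.im - a.im| ≤ (z.im - a.im) ^ 2 + 1 := by
    rw [← sq_abs]; nlinarith [sq_nonneg (|z.im - a.im| - 1)]
  rw [e]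
  linarith

theorem div_sub (hg : Dec l c g) {a : ℂ} {ε : ℝ} (hε : 0 < ε)
    (ha : ∀ z : ℂ, l < z.re → z.re < c → ε ≤ ‖z - a‖) : Dec l c (fun z => g z * (z - a)⁻¹) := by
  refine hg.mul_bounded ?_ (K := ε⁻¹) fun z h1 h2 => ?_
  · intro z hz
    refine DifferentiableAt.differentiableWithinAt ?_
    have : z - a ≠ 0 := fun h => by
      have := ha z hz.1 hz.2
      rw [h, norm_zero] at this
      linarith
    exact (differentiableAt_id.sub_const a).inv this
  · rw [norm_inv]
    exact inv_anti₀ hε (ha z h1 h2)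

theorem exists_bound_path (hg : Dec l c g) (γ : IndentedLine) (h1 : ∀ t, l < (γ.path t).re)
    (h2 : ∀ t, (γ.path t).re < c) :
    ∃ C δ : ℝ, 0 ≤ C ∧ 0 < δ ∧ ∀ t, ‖g (γ.path t)‖ ≤ C * exp (-δ * |t|) := by
  obtain ⟨C, δ, hC, hδ, hb⟩ := hg.bound
  obtain ⟨B, hB0, hB⟩ := γ.exists_bound
  refine ⟨C * exp (δ * B), δ, by positivity, hδ, fun t => (hb _ (h1 t) (h2 t)).trans ?_⟩
  rw [mul_assoc, ← exp_add]
  have h3 := (hB t).2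
  have h4 : |t| ≤ |(γ.path t).im| + B := by
    have := abs_sub_abs_le_abs_sub t (γ.path t).im
    rw [abs_sub_comm] at this
    linarith
  have : -δ * |(γ.path t).im| ≤ δ * B + -δ * |t| := by nlinarith
  gcongr

theorem continuous_path (hg : Dec l c g) (γ : IndentedLine) (h1 : ∀ t, l < (γ.path t).re)
    (h2 : ∀ t, (γ.path t).re < c) : Continuous fun t => g (γ.path t) :=
  hg.diff.continuousOn.comp_continuous γ.continuous_path fun t => ⟨h1 t, h2 t⟩

theorem integrable_path (hg : Dec l c g) (γ : IndentedLine) (h1 : ∀ t, l < (γ.path t).re)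
    (h2 : ∀ t, (γ.path t).re < c) : Integrable fun t => g (γ.path t) * deriv γ.path t := by
  obtain ⟨C, δ, hC, hδ, hb⟩ := hg.exists_bound_path γ h1 h2
  exact γ.integrable_of_bound (hg.continuous_path γ h1 h2) hδ hb

/-- Cauchy's theorem for two indented lines in a strip. -/
theorem cint_eq (hg : Dec l c g) (γ₁ γ₂ : IndentedLine) (h1 : ∀ t, l < (γ₁.path t).re)
    (h1' : ∀ t, (γ₁.path t).re < c) (h2 : ∀ t, l < (γ₂.path t).re)
    (h2' : ∀ t, (γ₂.path t).re < c) : γ₁.cint g = γ₂.cint g := by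
  -- A primitive on the convex strip reduces both truncated integrals to end point values. End
  -- points at equal height are joined by a horizontal segment of fixed length on which `g` is
  -- exponentially small.
  obtain ⟨F, hF⟩ := (convex_strip l c).exists_forall_hasDerivWithinAt hg.diff
  have hF' : ∀ z : ℂ, l < z.re → z.re < c → HasDerivAt F (g z) z := fun z hz1 hz2 =>
    (hF z ⟨hz1, hz2⟩).hasDerivAt ((isOpen_strip l c).mem_nhds ⟨hz1, hz2⟩)
  obtain ⟨C, δ, hC, hδ, hb⟩ := hg.bound
  obtain ⟨c₁, T₁, hv₁⟩ := γ₁.vertical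
  obtain ⟨c₂, T₂, hv₂⟩ := γ₂.vertical
  have t1 := intervalIntegral_tendsto_integral (hg.integrable_path γ₁ h1 h1')
    tendsto_neg_atTop_atBot tendsto_id
  have t2 := intervalIntegral_tendsto_integral (hg.integrable_path γ₂ h2 h2')
    tendsto_neg_atTop_atBot tendsto_id
  have hd : Tendsto (fun T : ℝ => (∫ t in (-T)..(id T), g (γ₁.path t) * deriv γ₁.path t) -
      ∫ t in (-T)..(id T), g (γ₂.path t) * deriv γ₂.path t) atTop (𝓝 0) := by
    have hz : Tendsto (fun T : ℝ => 2 * (C * exp (-δ * |T|) * |c₁ - c₂|)) atTop (𝓝 0) := by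
      have : Tendsto (fun t : ℝ => exp (-δ * |t|)) atTop (𝓝 0) := by
        refine Real.tendsto_exp_atBot.comp ?_
        exact (tendsto_abs_atTop_atTop).const_mul_atTop_of_neg (neg_lt_zero.2 hδ)
      simpa using ((this.const_mul C).mul_const |c₁ - c₂|).const_mul 2
    refine squeeze_zero_norm' ?_ hz
    filter_upwards [eventually_ge_atTop (max T₁ T₂)] with T hT
    rw [γ₁.intervalIntegral_eq_sub (fun t => hF' _ (h1 t) (h1' t)) (hg.integrable_path γ₁ h1 h1'),
      γ₂.intervalIntegral_eq_sub (fun t => hF' _ (h2 t) (h2' t)) (hg.integrable_path γ₂ h2 h2')]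
    have key : ∀ s : ℝ, |s| = |T| → T ≤ |s| → ‖F (γ₁.path s) - F (γ₂.path s)‖ ≤
        C * exp (-δ * |T|) * |c₁ - c₂| := by
      intro s hs hs'
      have e1 := hv₁ s (((le_max_left _ _).trans hT).trans hs')
      have e2 := hv₂ s (((le_max_right _ _).trans hT).trans hs')
      have i1 := h1 s
      have i1' := h1' s
      have i2 := h2 s
      have i2' := h2' s
      rw [e1, e2] at *
      have hcv : Convex ℝ ({z : ℂ | l < z.re ∧ z.re < c} ∩ {z : ℂ | z.im = s}) := by
        refine (convex_strip l c).inter ?_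
        exact convex_hyperplane Complex.imLm.isLinear s
      have := hcv.norm_image_sub_le_of_norm_hasDerivWithin_le (f := F) (f' := g)
        (C := C * exp (-δ * |T|)) (x := c₂ + s * I) (y := c₁ + s * I)
        (fun z hz => (hF' z hz.1.1 hz.1.2).hasDerivWithinAt)
        (fun z hz => by
          have := hb z hz.1.1 hz.1.2
          rwa [show z.im = s from hz.2, hs] at this)
        ⟨⟨i2, i2'⟩, by simp⟩ ⟨⟨i1, i1'⟩, by simp⟩
      refine this.trans (le_of_eq ?_)
      rw [add_sub_add_right_eq_sub, ← Complex.ofReal_sub, Complex.norm_real, Real.norm_eq_abs]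
    have k1 := key T rfl (le_abs_self T)
    have k2 := key (-T) (abs_neg T) (by rw [abs_neg]; exact le_abs_self T)
    calc _ = ‖(F (γ₁.path T) - F (γ₂.path T)) - (F (γ₁.path (-T)) - F (γ₂.path (-T)))‖ := by
          simp only [id]; congr 1; ring
      _ ≤ _ := norm_sub_le _ _
      _ ≤ _ := by linarith
  have := tendsto_nhds_unique (t1.sub t2) hd
  exact sub_eq_zero.1 this

end Dec

/-! ### Moving indented lines past poles -/

namespace IndentedLine

theorem integrable_comp_div {γ : IndentedLine} {h : ℝ → ℂ} (hh : Integrable h) {a : ℂ}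
    (ha : a ∉ range γ.path) : Integrable fun t => h t * (γ.path t - a)⁻¹ := by
  obtain ⟨ε, hε, hb⟩ := γ.exists_dist_le ha
  refine hh.mul_bdd (c := ε⁻¹) ?_ (Eventually.of_forall fun t => ?_)
  · refine (Continuous.inv₀ (γ.continuous_path.sub continuous_const) fun t h0 => ?_).aestronglyMeasurable
    exact ha ⟨t, sub_eq_zero.1 h0⟩
  · rw [norm_inv]
    exact inv_anti₀ hε (hb t)

theorem differentiableOn_cauchy (γ : IndentedLine) {h : ℝ → ℂ} (hh : Integrable h) :
    DifferentiableOn ℂ (fun a => ∫ t, h t * (γ.path t - a)⁻¹) (range γ.path)ᶜ := by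
  refine differentiableOn_integral_of_dominated γ.isClosed_range.isOpen_compl
    (fun a ha => (integrable_comp_div hh ha).aestronglyMeasurable) (fun t => ?_) fun a ha => ?_
  · intro a ha
    refine DifferentiableAt.differentiableWithinAt ?_
    have : γ.path t - a ≠ 0 := fun h0 => ha ⟨t, sub_eq_zero.1 h0⟩
    exact ((differentiableAt_const _).sub differentiableAt_id).inv this |>.const_mul _
  · obtain ⟨ε, hε, hb⟩ := γ.exists_dist_le ha
    refine ⟨ε / 2, half_pos hε, fun t => ‖h t‖ * (ε / 2)⁻¹, hh.norm.mul_const _,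
      fun a' ha' _ t => ?_⟩
    rw [norm_mul, norm_inv]
    refine mul_le_mul_of_nonneg_left (inv_anti₀ (half_pos hε) ?_) (norm_nonneg _)
    have h1 := hb t
    have h2 : ‖a' - a‖ < ε / 2 := by simpa [dist_eq_norm] using ha'
    have h3 := norm_add_le (γ.path t - a') (a' - a)
    rw [sub_add_sub_cancel] at h3
    linarith

end IndentedLine

/-- `a` can be joined in the complement of the two curves to a point outside the closed strip. -/
def Off (γ₁ γ₂ : IndentedLine) (l c : ℝ) (a : ℂ) : Prop :=
  ∃ X : ℂ, (c < X.re ∨ X.re < l) ∧ JoinedIn (range γ₁.path ∪ range γ₂.path)ᶜ a X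

/-- Products of linear factors whose roots lie off the two curves, outside the region between
them. -/
inductive Divisor (γ₁ γ₂ : IndentedLine) (l c : ℝ) : (ℂ → ℂ) → Prop
  | one : Divisor γ₁ γ₂ l c fun _ => 1
  | mul_sub {f : ℂ → ℂ} (u a : ℂ) (hu : u ≠ 0) (ha : Off γ₁ γ₂ l c a) (hf : Divisor γ₁ γ₂ l c f) :
      Divisor γ₁ γ₂ l c fun z => u * (z - a) * f z

namespace Divisor
variable {γ₁ γ₂ : IndentedLine} {l c : ℝ} {f g : ℂ → ℂ}

theorem mul (hf : Divisor γ₁ γ₂ l c f) (hg : Divisor γ₁ γ₂ l c g) :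
    Divisor γ₁ γ₂ l c fun z => f z * g z := by
  induction hf with
  | one => simpa using hg
  | mul_sub u a hu ha _ ih => simpa only [mul_assoc] using mul_sub u a hu ha ih

theorem prod {ι : Type*} (s : Finset ι) {f : ι → ℂ → ℂ} (h : ∀ i ∈ s, Divisor γ₁ γ₂ l c (f i)) :
    Divisor γ₁ γ₂ l c fun z => ∏ i ∈ s, f i z := by
  classical
  induction s using Finset.induction_on with
  | empty => simpa using one
  | insert a s ha ih =>
    simp only [Finset.prod_insert ha]
    exact (h a (by simp)).mul (ih fun i hi => h i (by simp [hi]))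

theorem exists_le (hf : Divisor γ₁ γ₂ l c f) :
    ∃ ε > 0, ∀ t, ε ≤ ‖f (γ₁.path t)‖ ∧ ε ≤ ‖f (γ₂.path t)‖ := by
  induction hf with
  | one => exact ⟨1, one_pos, by simp⟩
  | mul_sub u a hu ha _ ih =>
    obtain ⟨ε, hε, h⟩ := ih
    obtain ⟨X, -, hX⟩ := ha
    have h0 := hX.source_mem
    obtain ⟨ε₁, hε₁, h₁⟩ := γ₁.exists_dist_le fun h => h0 (Or.inl h)
    obtain ⟨ε₂, hε₂, h₂⟩ := γ₂.exists_dist_le fun h => h0 (Or.inr h)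
    have hu' := norm_pos_iff.2 hu
    refine ⟨‖u‖ * min ε₁ ε₂ * ε, by positivity, fun t => ?_⟩
    simp only [norm_mul]
    have a1 := h t
    have a2 := (min_le_left ε₁ ε₂).trans (h₁ t)
    have a3 := (min_le_right ε₁ ε₂).trans (h₂ t)
    constructor <;> [have := a1.1; have := a1.2] <;> gcongr

theorem differentiable (hf : Divisor γ₁ γ₂ l c f) : Differentiable ℂ f := by
  induction hf with
  | one => fun_prop
  | mul_sub u a hu ha _ ih => fun_prop

theorem ne_zero (hf : Divisor γ₁ γ₂ l c f) (t : ℝ) : f (γ₁.path t) ≠ 0 ∧ f (γ₂.path t) ≠ 0 := by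
  obtain ⟨ε, hε, h⟩ := hf.exists_le
  exact ⟨norm_pos_iff.1 (hε.trans_le (h t).1), norm_pos_iff.1 (hε.trans_le (h t).2)⟩

theorem integrable_div (hf : Divisor γ₁ γ₂ l c f) {h₁ h₂ : ℝ → ℂ} (hh₁ : Integrable h₁)
    (hh₂ : Integrable h₂) : Integrable (fun t => h₁ t * (f (γ₁.path t))⁻¹) ∧
      Integrable (fun t => h₂ t * (f (γ₂.path t))⁻¹) := by
  obtain ⟨ε, hε, h⟩ := hf.exists_le
  have hc := hf.differentiable.continuous
  constructor
  · refine hh₁.mul_bdd (c := ε⁻¹) ((hc.comp γ₁.continuous_path).inv₀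
      fun t => (hf.ne_zero t).1).aestronglyMeasurable (Eventually.of_forall fun t => ?_)
    rw [norm_inv]
    exact inv_anti₀ hε (h t).1
  · refine hh₂.mul_bdd (c := ε⁻¹) ((hc.comp γ₂.continuous_path).inv₀
      fun t => (hf.ne_zero t).2).aestronglyMeasurable (Eventually.of_forall fun t => ?_)
    rw [norm_inv]
    exact inv_anti₀ hε (h t).2

end Divisor

/-- Cauchy's theorem for the quotient of a decaying function on a strip by a product of linear
factors with roots outside the region between the two lines. -/
theorem Divisor.cint_eq {γ₁ γ₂ : IndentedLine} {l c : ℝ} {f : ℂ → ℂ}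
    (h1 : ∀ t, l < (γ₁.path t).re) (h1' : ∀ t, (γ₁.path t).re < c)
    (h2 : ∀ t, l < (γ₂.path t).re) (h2' : ∀ t, (γ₂.path t).re < c)
    (hf : Divisor γ₁ γ₂ l c f) : ∀ g, Dec l c g →
      γ₁.cint (fun z => g z * (f z)⁻¹) = γ₂.cint (fun z => g z * (f z)⁻¹) := by
  induction hf with
  | one =>
    intro g hg
    simpa using hg.cint_eq γ₁ γ₂ h1 h1' h2 h2'
  | @mul_sub f u a hu ha hf ih =>
    intro g hg
    obtain ⟨X, hX, hJ⟩ := ha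
    set W : Set ℂ := (range γ₁.path ∪ range γ₂.path)ᶜ with hW
    have hWo : IsOpen W := (γ₁.isClosed_range.union γ₂.isClosed_range).isOpen_compl
    obtain ⟨i1, i2⟩ := hf.integrable_div (hg.integrable_path γ₁ h1 h1')
      (hg.integrable_path γ₂ h2 h2')
    set k₁ : ℝ → ℂ := fun t => g (γ₁.path t) * deriv γ₁.path t * (f (γ₁.path t))⁻¹
    set k₂ : ℝ → ℂ := fun t => g (γ₂.path t) * deriv γ₂.path t * (f (γ₂.path t))⁻¹
    -- The root `a` is now allowed to move. `Φ` is holomorphic off both curves, and vanishes outside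
    -- the closed strip, where `(z - a)⁻¹` can be absorbed into `g`; the identity theorem along the
    -- path furnished by `Off` transports this to the given root.
    let Φ : ℂ → ℂ := fun a => (∫ t, k₁ t * (γ₁.path t - a)⁻¹) - ∫ t, k₂ t * (γ₂.path t - a)⁻¹
    have hΦ : DifferentiableOn ℂ Φ W :=
      ((γ₁.differentiableOn_cauchy i1).mono (compl_subset_compl.2 subset_union_left)).sub
        ((γ₂.differentiableOn_cauchy i2).mono (compl_subset_compl.2 subset_union_right))
    have hfar : ∀ a : ℂ, (c < a.re ∨ a.re < l) → Φ a = 0 := by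
      intro a ha
      have hd : Dec l c fun z => g z * (z - a)⁻¹ := by
        rcases ha with ha | ha
        · refine hg.div_sub (sub_pos.2 ha) fun z _ hz => ?_
          have := abs_re_le_norm (z - a)
          rw [sub_re, abs_sub_comm] at this
          linarith [le_abs_self (a.re - z.re)]
        · refine hg.div_sub (sub_pos.2 ha) fun z hz _ => ?_
          have := abs_re_le_norm (z - a)
          rw [sub_re] at this
          linarith [le_abs_self (z.re - a.re)]
      have := ih _ hd
      rw [IndentedLine.cint, IndentedLine.cint] at this
      simp only [Φ, sub_eq_zero]
      convert this using 3 <;> simp only [k₁, k₂] <;> ring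
    have hXo : ∀ᶠ z in 𝓝 X, Φ z = 0 := by
      have : IsOpen {a : ℂ | c < a.re ∨ a.re < l} :=
        (isOpen_lt continuous_const continuous_re).union
          (isOpen_lt continuous_re continuous_const)
      filter_upwards [this.mem_nhds hX] with z hz using hfar z hz
    have hpre : IsPreconnected (range hJ.somePath) :=
      isPreconnected_range hJ.somePath.continuous
    have han : AnalyticOnNhd ℂ Φ (range hJ.somePath) := by
      rintro _ ⟨t, rfl⟩
      exact hΦ.analyticAt (hWo.mem_nhds (hJ.somePath_mem t))
    have hz := han.eqOn_zero_of_preconnected_of_eventuallyEq_zero hpre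
      ⟨1, hJ.somePath.target⟩ hXo ⟨0, hJ.somePath.source⟩
    have hz' : Φ a = 0 := hz
    simp only [Φ, sub_eq_zero] at hz'
    rw [IndentedLine.cint, IndentedLine.cint]
    have e : ∀ γ : IndentedLine, (∫ t, g (γ.path t) * (u * (γ.path t - a) * f (γ.path t))⁻¹ *
        deriv γ.path t) = u⁻¹ * ∫ t, g (γ.path t) * deriv γ.path t * (f (γ.path t))⁻¹ *
          (γ.path t - a)⁻¹ := by
      intro γ
      rw [← integral_const_mul]
      congr 1; funext t
      rw [mul_inv, mul_inv]; ring
    rw [e, e]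
    exact congrArg _ hz'

/-! ### Sides of an indented line -/

namespace IndentedLine
variable {γ : IndentedLine}

/-- Common description of the two sides: `ε = 1` for the right side, `ε = -1` for the left side. -/
def OnSide (γ : IndentedLine) (ε : ℝ) (z : ℂ) : Prop :=
  ∃ x : ℝ, (∀ t, ε * (γ.path t).re < ε * x) ∧ JoinedIn (Set.range γ.path)ᶜ z (x : ℂ)

theorem HasOnRight.onSide {z : ℂ} (h : γ.HasOnRight z) : γ.OnSide 1 z := by
  simpa [OnSide, HasOnRight] using h

theorem HasOnLeft.onSide {z : ℂ} (h : γ.HasOnLeft z) : γ.OnSide (-1) z := by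
  simpa [OnSide, HasOnLeft] using h

theorem exists_re_bound (γ : IndentedLine) (ε : ℝ) (hε : ε = 1 ∨ ε = -1) :
    ∃ B : ℝ, ∀ t, |ε * (γ.path t).re| ≤ B := by
  obtain ⟨B, -, h⟩ := γ.exists_bound
  refine ⟨B, fun t => ?_⟩
  rcases hε with rfl | rfl <;> simpa using (h t).1

theorem joinedIn_far {ε : ℝ} (hε : ε = 1 ∨ ε = -1) {a : ℂ} (ha : ∀ t, ε * (γ.path t).re < ε * a.re)
    {l : ℝ} (hl : ε * l < ε * a.re) (c : ℝ) :
    ∃ X : ℂ, c < ε * X.re ∧ JoinedIn (range γ.path ∪ range (vline l).path)ᶜ a X := by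
  have hε2 : ε * ε = 1 := by rcases hε with rfl | rfl <;> norm_num
  set M := |c| + |a.re| + 1
  refine ⟨a + (ε * M : ℝ), ?_, JoinedIn.of_segment_subset ?_⟩
  · rw [add_re, ofReal_re, mul_add, ← mul_assoc, hε2, one_mul]
    have : |ε * a.re| = |a.re| := by rcases hε with rfl | rfl <;> simp
    have := neg_abs_le (ε * a.re)
    have := le_abs_self c
    simp only [M]; linarith
  · intro z hz
    rw [segment_eq_image'] at hz
    obtain ⟨θ, hθ, rfl⟩ := hz
    have hre : ε * (a + θ • (a + (ε * M : ℝ) - a)).re = ε * a.re + θ * M := by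
      simp only [add_sub_cancel_left, add_re, Complex.real_smul, Complex.re_ofReal_mul,
        ofReal_re]
      linear_combination θ * M * hε2
    have h0 : 0 ≤ θ * M := mul_nonneg hθ.1 (by positivity)
    rintro (⟨t, ht⟩ | ⟨t, ht⟩)
    · have := ha t
      rw [ht, hre] at this
      linarith
    · have := congrArg (fun z : ℂ => ε * z.re) ht
      simp only [vline_path_re] at this
      rw [hre] at this
      linarith

/-- The witnessing path is compact, so every vertical line far enough on the opposite side misses
it; from its end point one continues horizontally as far as required. The bound on the line does not
depend on how far that is. -/
theorem OnSide.exists_joinedIn {ε : ℝ} (hε : ε = 1 ∨ ε = -1) {a : ℂ} (h : γ.OnSide ε a) :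
    ∃ l₀ : ℝ, ∀ l, ε * l ≤ l₀ → ∀ c : ℝ,
      ∃ X : ℂ, c < ε * X.re ∧ JoinedIn (range γ.path ∪ range (vline l).path)ᶜ a X := by
  obtain ⟨x, hx, hJ⟩ := h
  have hcont : Continuous fun s => ε * (hJ.somePath s).re :=
    continuous_const.mul (Complex.continuous_re.comp hJ.somePath.continuous)
  obtain ⟨s₀, -, hs₀⟩ := isCompact_univ.exists_isMinOn univ_nonempty hcont.continuousOn
  refine ⟨min (ε * (hJ.somePath s₀).re) (ε * x) - 1, fun l hl c => ?_⟩
  have m1 := min_le_left (ε * (hJ.somePath s₀).re) (ε * x)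
  have m2 := min_le_right (ε * (hJ.somePath s₀).re) (ε * x)
  obtain ⟨X, hX, hJX⟩ := joinedIn_far (γ := γ) hε (a := x) (by simpa using hx) (l := l)
    (by simp only [ofReal_re]; linarith) c
  refine ⟨X, hX, JoinedIn.trans ⟨hJ.somePath, fun s => ?_⟩ hJX⟩
  rintro (h | ⟨t, ht⟩)
  · exact hJ.somePath_mem s h
  · have h1 := isMinOn_iff.1 hs₀ s (mem_univ _)
    have h2 := congrArg (fun z : ℂ => ε * z.re) ht
    simp only [vline_path_re] at h1 h2
    linarith

/-- A uniform version along an arithmetic progression moving away from the line. -/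
theorem exists_joinedIn_progression {ε : ℝ} (hε : ε = 1 ∨ ε = -1) (a : ℂ) (Q : ℕ → Prop)
    (h : ∀ k, Q k → γ.OnSide ε (a + ε * (2 * k))) :
    ∃ l₀ : ℝ, ∀ l, ε * l ≤ l₀ → ∀ (c : ℝ) (k : ℕ), Q k →
      ∃ X : ℂ, c < ε * X.re ∧
        JoinedIn (range γ.path ∪ range (vline l).path)ᶜ (a + ε * (2 * k)) X := by
  have hε2 : ε * ε = 1 := by rcases hε with rfl | rfl <;> norm_num
  obtain ⟨B, hB⟩ := γ.exists_re_bound ε hε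
  have : ∀ k, ∃ l₀ : ℝ, Q k → ∀ l, ε * l ≤ l₀ → ∀ c : ℝ, ∃ X : ℂ, c < ε * X.re ∧
        JoinedIn (range γ.path ∪ range (vline l).path)ᶜ (a + ε * (2 * k)) X := by
    intro k
    by_cases hk : Q k
    · obtain ⟨l₀, h0⟩ := (h k hk).exists_joinedIn hε
      exact ⟨l₀, fun _ => h0⟩
    · exact ⟨0, fun h => absurd h hk⟩
  choose f hf using this
  -- From index `K` on the points lie beyond the whole curve and can move horizontally; only
  -- finitely many terms restrict the line.
  obtain ⟨K, hK⟩ := exists_nat_gt (B - ε * a.re)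
  obtain ⟨M, hM⟩ := ((Finset.range K).image fun k => -f k).exists_le
  refine ⟨min (-M) (-B - 1), fun l hl c k hk => ?_⟩
  by_cases hkK : k < K
  · exact hf k hk l (hl.trans ((min_le_left _ _).trans (by
      linarith [hM _ (Finset.mem_image_of_mem (fun k => -f k) (Finset.mem_range.2 hkK))]))) c
  · have hk' : (K : ℝ) ≤ k := by exact_mod_cast not_lt.1 hkK
    have hre : ε * (a + ε * (2 * k) : ℂ).re = ε * a.re + 2 * k := by
      have : ((ε : ℂ) * (2 * k)).re = ε * (2 * k) := by
        rw [Complex.re_ofReal_mul]; simp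
      rw [add_re, this]
      linear_combination (2 * k : ℝ) * hε2
    have hk0 : (0 : ℝ) ≤ k := Nat.cast_nonneg k
    have hlt : B < ε * (a + ε * (2 * k) : ℂ).re := by rw [hre]; linarith
    have hB0 : -B ≤ B := by linarith [hB 0, abs_nonneg (ε * (γ.path 0).re)]
    refine joinedIn_far hε (fun t => ?_) ?_ c
    · exact ((le_abs_self _).trans (hB t)).trans_lt hlt
    · linarith [min_le_right (-M) (-B - 1)]

end IndentedLine

theorem Off.of_right {γ : IndentedLine} {l₁ l c : ℝ} {a X : ℂ} (hX : c < 1 * X.re)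
    (h : JoinedIn (range γ.path ∪ range (vline l₁).path)ᶜ a X) : Off γ (vline l₁) l c a :=
  ⟨X, Or.inl (by simpa using hX), h⟩

theorem Off.of_left {γ : IndentedLine} {l₁ l c : ℝ} {a X : ℂ} (hX : -l < -1 * X.re)
    (h : JoinedIn (range γ.path ∪ range (vline l₁).path)ᶜ a X) : Off γ (vline l₁) l c a :=
  ⟨X, Or.inr (by linarith), h⟩

/-! ### The two sides are disjoint -/

/-- By the symmetry `z ↦ -z` the second integral is the negative of the first, so it is enough that
the first does not vanish. After division by `I` its real part is bounded below by a positive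
difference of Gaussian integrals. -/
theorem gauss_residue_ne_zero :
    (vline (1 / 8)).cint (fun z => Complex.exp (z ^ 2) * z⁻¹) ≠
      (vline (-(1 / 8))).cint (fun z => Complex.exp (z ^ 2) * z⁻¹) := by
  set h : ℝ → ℂ := fun t => Complex.exp ((((1 / 8 : ℝ) : ℂ) + t * I) ^ 2) *
    (((1 / 8 : ℝ) : ℂ) + t * I)⁻¹ with hh
  have e1 : (vline (1 / 8)).cint (fun z => Complex.exp (z ^ 2) * z⁻¹) = (∫ t, h t) * I := by
    simp only [IndentedLine.cint, deriv_vline, vline_path]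
    rw [integral_mul_const]
  have e2 : (vline (-(1 / 8))).cint (fun z => Complex.exp (z ^ 2) * z⁻¹) =
      -(∫ t, h t) * I := by
    simp only [IndentedLine.cint, deriv_vline, vline_path]
    rw [integral_mul_const, ← integral_neg, ← integral_neg_eq_self]
    congr 2; funext t
    have : ((-(1 / 8) : ℝ) : ℂ) + ((-t : ℝ) : ℂ) * I =
        -(((1 / 8 : ℝ) : ℂ) + t * I) := by push_cast; ring
    rw [this, neg_sq, inv_neg, hh]
    ring
  have hd : Dec (1 / 16) 1 fun z => Complex.exp (z ^ 2) * z⁻¹ := by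
    simpa using (Dec.gauss 0 (1 / 16) 1).div_sub (a := 0) (ε := 1 / 16) (by norm_num)
      fun z hz _ => by
        have := abs_re_le_norm z
        simp only [sub_zero]; linarith [le_abs_self z.re]
  have hint : Integrable h := by
    have := (hd.integrable_path (vline (1 / 8)) (by intro t; simp; norm_num)
      (by intro t; simp; norm_num)).mul_const (-I)
    refine this.congr (Eventually.of_forall fun t => ?_)
    simp only [deriv_vline, vline_path, hh]
    rw [mul_assoc _ I, mul_neg, Complex.I_mul_I, neg_neg, mul_one]
  -- From `cos (t/4) ≥ 1 - t²/32` and `t sin (t/4) ≥ -t²/4` the numerator is at least `1/8 - 65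
  -- t²/256`; the denominator is `(1 + 64 t²) / 64`, and `1 / (1 + 64 t²) ≥ e^{-64 t²}`.
  have hre : ∀ t : ℝ, exp (1 / 64) * (8 * exp (-65 * t ^ 2) -
      65 / 256 * exp (-1 * t ^ 2)) ≤ (h t).re := by
    intro t
    have hw : ((((1 / 8 : ℝ) : ℂ) + t * I) ^ 2) =
        ((1 / 64 - t ^ 2 : ℝ) : ℂ) + ((t / 4 : ℝ) : ℂ) * I := by
      push_cast; linear_combination (t ^ 2 : ℂ) * Complex.I_sq
    have hval : (h t).re = exp (1 / 64 - t ^ 2) *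
        ((1 / 8 * Real.cos (t / 4) + t * Real.sin (t / 4)) / (1 / 64 + t ^ 2)) := by
      simp only [hh]
      rw [hw, Complex.exp_add, Complex.exp_mul_I, ← Complex.ofReal_exp, ← Complex.ofReal_cos,
        ← Complex.ofReal_sin, mul_assoc, Complex.re_ofReal_mul, mul_re, Complex.inv_re,
        Complex.inv_im]
      simp only [Complex.normSq_apply, add_re, add_im, ofReal_re,
        ofReal_im, mul_re, mul_im, Complex.I_re, Complex.I_im]
      have : (1 / 64 + t ^ 2 : ℝ) ≠ 0 := by positivity
      ring_nf
    have hpos : (0 : ℝ) < 1 / 64 + t ^ 2 := by positivity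
    have h1 := Real.one_sub_sq_div_two_le_cos (x := t / 4)
    have h2 : -(t ^ 2 / 4) ≤ t * Real.sin (t / 4) := by
      have h3 : |t * Real.sin (t / 4)| ≤ |t| * |t / 4| := by
        rw [abs_mul]; exact mul_le_mul_of_nonneg_left Real.abs_sin_le_abs (abs_nonneg _)
      rw [← abs_mul] at h3
      have h4 : |t * (t / 4)| = t ^ 2 / 4 := by rw [abs_of_nonneg] <;> nlinarith [sq_nonneg t]
      linarith [neg_abs_le (t * Real.sin (t / 4))]
    have h5 : 8 * exp (-64 * t ^ 2) - 65 / 256 ≤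
        (1 / 8 * Real.cos (t / 4) + t * Real.sin (t / 4)) / (1 / 64 + t ^ 2) := by
      rw [le_div_iff₀ hpos]
      have h6 : exp (-64 * t ^ 2) * (1 + 64 * t ^ 2) ≤ 1 := by
        have := Real.add_one_le_exp (64 * t ^ 2)
        calc _ ≤ exp (-64 * t ^ 2) * exp (64 * t ^ 2) := by gcongr; linarith
          _ = 1 := by rw [← exp_add]; simp
      nlinarith [sq_nonneg t]
    rw [hval]
    calc _ = exp (1 / 64 - t ^ 2) * (8 * exp (-64 * t ^ 2) - 65 / 256) := by
          rw [mul_sub, mul_sub, mul_left_comm, mul_left_comm (exp (1 / 64 - t ^ 2)), ← exp_add,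
            ← exp_add, mul_left_comm, ← exp_add]
          ring_nf
      _ ≤ _ := by gcongr
  have hpos : 0 < (∫ t, h t).re := by
    have e3 : (∫ t, h t).re = ∫ t, (h t).re := (integral_re hint).symm
    have g1 := (integrable_exp_neg_mul_sq (b := 65) (by norm_num)).const_mul 8
    have g2 := (integrable_exp_neg_mul_sq (b := 1) (by norm_num)).const_mul (65 / 256)
    rw [e3]
    refine lt_of_lt_of_le ?_ (integral_mono ((g1.sub g2).const_mul (exp (1 / 64))) hint.re hre)
    rw [integral_const_mul]
    refine mul_pos (exp_pos _) ?_
    -- Evaluating the Gaussian integrals reduces positivity to `65 / 256 < 8 / √65`.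
    rw [integral_sub' g1 g2, integral_const_mul, integral_const_mul, integral_gaussian,
      integral_gaussian, div_one, Real.sqrt_div Real.pi_pos.le, sub_pos]
    have h65 : Real.sqrt 65 < 9 := by
      rw [Real.sqrt_lt' (by norm_num)]; norm_num
    have hs : 0 < Real.sqrt 65 := by positivity
    have hp := Real.sqrt_pos.2 Real.pi_pos
    rw [mul_div_assoc', lt_div_iff₀ hs]
    nlinarith
  rw [e1, e2]
  intro he
  have := mul_right_cancel₀ Complex.I_ne_zero he
  have h3 := congrArg Complex.re this
  rw [Complex.neg_re] at h3
  linarith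

/-- Were `a` on both sides, the integral of `exp ((z - a) ^ 2) / (z - a)` along `γ` could be moved,
without crossing the pole, both to a line far left and to a line far right of `a`. These two values
differ by `gauss_residue_ne_zero`. -/
theorem IndentedLine.not_left_and_right {γ : IndentedLine} {a : ℂ} (hl : γ.HasOnLeft a)
    (hr : γ.HasOnRight a) : False := by
  obtain ⟨l₀, hl₀⟩ := hr.onSide.exists_joinedIn (Or.inl rfl)
  obtain ⟨c₀, hc₀⟩ := hl.onSide.exists_joinedIn (Or.inr rfl)
  obtain ⟨B, hB0, hB⟩ := γ.exists_bound
  set l := min l₀ (-(B + |a.re| + 1))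
  set c := max (-c₀) (B + |a.re| + 1)
  have hl1 : l ≤ -(B + |a.re| + 1) := min_le_right _ _
  have hc1 : B + |a.re| + 1 ≤ c := le_max_right _ _
  have hl2 : l ≤ l₀ := min_le_left _ _
  have hc2 : -c₀ ≤ c := le_max_left _ _
  obtain ⟨X, hX, hJ⟩ := hl₀ l (by simpa using hl2) (c + 1)
  obtain ⟨Y, hY, hJ'⟩ := hc₀ c (by linarith) (-(l - 1))
  have d1 : Divisor γ (vline l) (l - 1) (c + 1) fun z => z - a := by
    simpa using Divisor.mul_sub 1 a one_ne_zero (Off.of_right hX hJ) Divisor.one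
  have d2 : Divisor γ (vline c) (l - 1) (c + 1) fun z => z - a := by
    simpa using Divisor.mul_sub 1 a one_ne_zero (Off.of_left hY hJ') Divisor.one
  have ha1 := neg_abs_le a.re
  have ha2 := le_abs_self a.re
  have ha0 := abs_nonneg a.re
  have hγ : ∀ t, l - 1 < (γ.path t).re ∧ (γ.path t).re < c + 1 := fun t => by
    have := abs_le.1 (hB t).1
    constructor <;> linarith
  have hg := Dec.gauss a (l - 1) (c + 1)
  have e1 := d1.cint_eq (fun t => (hγ t).1) (fun t => (hγ t).2) (fun t => by simp)
    (fun t => by simp; linarith) _ hg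
  have e2 := d2.cint_eq (fun t => (hγ t).1) (fun t => (hγ t).2) (fun t => by simp; linarith)
    (fun t => by simp) _ hg
  -- Translation by `a` and a move within one half-plane bring either line to abscissa `± 1/8`, the
  -- case already computed.
  have shift : ∀ x : ℝ, ∀ ε : ℝ, (ε = 1 ∨ ε = -1) → 0 < ε * (x - a.re) →
      (vline x).cint (fun z => Complex.exp ((z - a) ^ 2) * (z - a)⁻¹) =
        (vline (ε / 8)).cint (fun z => Complex.exp (z ^ 2) * z⁻¹) := by
    intro x ε hε hx
    have h1 : (vline x).cint (fun z => Complex.exp ((z - a) ^ 2) * (z - a)⁻¹) =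
        (vline (x - a.re)).cint (fun z => Complex.exp (z ^ 2) * z⁻¹) := by
      simp only [IndentedLine.cint, deriv_vline, vline_path]
      rw [← integral_add_right_eq_self _ a.im]
      congr 1; funext t
      have : (x : ℂ) + ((t + a.im : ℝ) : ℂ) * I - a =
          ((x - a.re : ℝ) : ℂ) + t * I := by
        have := Complex.re_add_im a
        push_cast; linear_combination this
      rw [this]
    rw [h1]
    have hε2 : ε * ε = 1 := by rcases hε with rfl | rfl <;> norm_num
    set y := x - a.re
    set u := min (ε * y) (1 / 8) / 2
    set v := max (ε * y) (1 / 8) + 1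
    have hu : 0 < u := half_pos (lt_min hx (by norm_num))
    have u1 : u < ε * y := by
      have := min_le_left (ε * y) (1 / 8); simp only [u] at *; linarith
    have u2 : u < 1 / 8 := by
      have := min_le_right (ε * y) (1 / 8); simp only [u] at *; linarith
    have v1 : ε * y < v := by have := le_max_left (ε * y) (1 / 8); simp only [v]; linarith
    have v2 : 1 / 8 < v := by have := le_max_right (ε * y) (1 / 8); simp only [v]; linarith
    rcases hε with rfl | rfl
    · have hd : Dec u v fun z => Complex.exp (z ^ 2) * z⁻¹ := by
        simpa using (Dec.gauss 0 u v).div_sub (a := 0) hu fun z hz _ => by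
          have := abs_re_le_norm z
          simp only [sub_zero]; linarith [le_abs_self z.re]
      rw [one_mul] at *
      exact hd.cint_eq _ _ (by simpa using u1) (by simpa using v1) (by simpa using u2)
        (by simpa using v2)
    · have hd : Dec (-v) (-u) fun z => Complex.exp (z ^ 2) * z⁻¹ := by
        simpa using (Dec.gauss 0 (-v) (-u)).div_sub (a := 0) hu fun z _ hz => by
          have := abs_re_le_norm z
          simp only [sub_zero]; linarith [neg_abs_le z.re]
      exact hd.cint_eq _ _ (by simp; linarith) (by simp; linarith) (by simp; linarith)
        (by simp; linarith)
  rw [shift l (-1) (Or.inr rfl) (by linarith)] at e1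
  rw [shift c 1 (Or.inl rfl) (by linarith)] at e2
  refine gauss_residue_ne_zero ?_
  rw [← e2, e1, neg_div]

/-! ### Replacing the cycles of a multiple contour integral -/

/-- The product of `n` copies of a strip. -/
def stripPi (n : ℕ) (l c : ℝ) : Set (Fin n → ℂ) := {z | ∀ j, l < (z j).re ∧ (z j).re < c}

theorem isOpen_stripPi (n : ℕ) (l c : ℝ) : IsOpen (stripPi n l c) := by
  have : stripPi n l c = univ.pi fun _ => {z : ℂ | l < z.re ∧ z.re < c} := by
    ext z; simp [stripPi]
  rw [this]
  exact isOpen_set_pi finite_univ fun _ _ => isOpen_strip l c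

/-- A weighted family of points of a strip, with the weight integrable against exponential decay. -/
structure Cycle (l c : ℝ) {X : Type*} [MeasurableSpace X] (μ : Measure X) (z ω : X → ℂ) : Prop where
  meas_z : Measurable z
  meas_ω : Measurable ω
  mem : ∀ x, l < (z x).re ∧ (z x).re < c
  int : ∀ δ : ℝ, 0 < δ → Integrable (fun x => exp (-δ * |(z x).im|) * ‖ω x‖) μ

theorem measurable_comp_of_continuousOn {X Y : Type*} [MeasurableSpace X] [TopologicalSpace Y]
    [MeasurableSpace Y] [BorelSpace Y] {S : Set Y} {U : Y → ℂ} (hU : ContinuousOn U S) {z : X → Y}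
    (hz : Measurable z) (hS : ∀ x, z x ∈ S) : Measurable fun x => U (z x) :=
  (continuousOn_iff_continuous_domRestrict.1 hU).measurable.comp (hz.subtype_mk (h := hS))

theorem measurePreserving_pi_cons {n : ℕ} {X : Type*} [MeasurableSpace X] (μ : Measure X)
    [SigmaFinite μ] : MeasurePreserving (fun q : X × (Fin n → X) =>
      (Fin.cons (α := fun _ => X) q.1 q.2 : Fin (n + 1) → X))
      (μ.prod (Measure.pi fun _ => μ)) (Measure.pi fun _ => μ) := by
  have := (measurePreserving_piFinSuccAbove (fun _ : Fin (n + 1) => μ) 0).symm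
  convert this using 1
  ext q j
  simp [MeasurableEquiv.piFinSuccAbove, Fin.insertNthEquiv]

namespace Cycle
variable {l c : ℝ} {n : ℕ} {X Y : Type*} [MeasurableSpace X] [MeasurableSpace Y]
  {μ : Measure X} {ν : Measure Y}

/-- The integrand of a multiple contour integral. -/
def integrand (U : (Fin n → ℂ) → ℂ) (z ω : Fin n → X → ℂ) (x : Fin n → X) : ℂ :=
  U (fun j => z j (x j)) * ∏ j, ω j (x j)

theorem measurable_integrand {U : (Fin n → ℂ) → ℂ} (hU : ContinuousOn U (stripPi n l c))
    {z ω : Fin n → X → ℂ} (h : ∀ j, Cycle l c μ (z j) (ω j)) : Measurable (integrand U z ω) := by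
  refine Measurable.mul (measurable_comp_of_continuousOn hU (measurable_pi_lambda _ fun j =>
    (h j).meas_z.comp (measurable_pi_apply j)) fun x j => (h j).mem _) ?_
  exact Finset.measurable_fun_prod _ fun j _ => (h j).meas_ω.comp (measurable_pi_apply j)

theorem integrable_cons [SigmaFinite μ] [SigmaFinite ν] {U : (Fin (n + 1) → ℂ) → ℂ}
    (hU : ContinuousOn U (stripPi (n + 1) l c)) {C δ : ℝ} (hδ : 0 < δ)
    (hb : ∀ z ∈ stripPi (n + 1) l c, ‖U z‖ ≤ C * ∏ j, exp (-δ * |(z j).im|))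
    {z₀ ω₀ : X → ℂ} (h₀ : Cycle l c μ z₀ ω₀)
    {z ω : Fin n → Y → ℂ} (h : ∀ j, Cycle l c ν (z j) (ω j)) :
    Integrable (fun q : X × (Fin n → Y) => ω₀ q.1 *
      integrand (fun z => U (Fin.cons (α := fun _ => ℂ) (z₀ q.1) z)) z ω q.2)
      (μ.prod (Measure.pi fun _ => ν)) := by
  refine ((((h₀.int δ hδ).mul_prod (Integrable.fintype_prod
    (f := fun j x => exp (-δ * |(z j x).im|) * ‖ω j x‖)
    fun j => (h j).int δ hδ))).const_mul C).mono' ?_ (Eventually.of_forall fun q => ?_)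
  · refine Measurable.aestronglyMeasurable ((h₀.meas_ω.comp measurable_fst).mul (Measurable.mul
      (measurable_comp_of_continuousOn hU (measurable_pi_lambda _ fun j => ?_) fun q j => ?_)
      (Finset.measurable_fun_prod _ fun j _ =>
        (h j).meas_ω.comp ((measurable_pi_apply j).comp measurable_snd))))
    · refine Fin.cases ?_ (fun j => ?_) j
      · exact h₀.meas_z.comp measurable_fst
      · exact (h j).meas_z.comp ((measurable_pi_apply j).comp measurable_snd)
    · refine Fin.cases ?_ (fun j => ?_) j
      · exact h₀.mem _
      · exact (h j).mem _
  · have := hb (Fin.cons (α := fun _ => ℂ) (z₀ q.1) fun j => z j (q.2 j))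
      (Fin.cases (h₀.mem _) fun j => (h j).mem _)
    simp only [Fin.prod_univ_succ, Fin.cons_zero, Fin.cons_succ] at this
    rw [integrand, norm_mul, norm_mul, norm_prod, prod_mul_distrib]
    calc _ ≤ ‖ω₀ q.1‖ * (C * (exp (-δ * |(z₀ q.1).im|) *
          ∏ j, exp (-δ * |(z j (q.2 j)).im|)) * ∏ j, ‖ω j (q.2 j)‖) := by gcongr
      _ = _ := by ring

theorem integral_succ [SigmaFinite μ] {U : (Fin (n + 1) → ℂ) → ℂ}
    (hU : ContinuousOn U (stripPi (n + 1) l c))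
    {z ω : Fin (n + 1) → X → ℂ} (h : ∀ j, Cycle l c μ (z j) (ω j)) :
    ∫ x, integrand U z ω x ∂(Measure.pi fun _ => μ) =
      ∫ q : X × (Fin n → X), ω 0 q.1 * integrand (fun w => U (Fin.cons (α := fun _ => ℂ) (z 0 q.1) w))
        (fun j => z j.succ) (fun j => ω j.succ) q.2 ∂(μ.prod (Measure.pi fun _ => μ)) := by
  rw [← integral_comp_of_measurePreserving (measurePreserving_pi_cons μ)
    (measurable_integrand hU h).aestronglyMeasurable]
  congr 1; funext q
  have : (fun j => z j (Fin.cons (α := fun _ => X) q.1 q.2 j)) =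
      Fin.cons (α := fun _ => ℂ) (z 0 q.1) fun j => z j.succ (q.2 j) := by
    funext j
    refine Fin.cases ?_ (fun j => ?_) j <;> simp
  simp only [integrand, this, Fin.prod_univ_succ, Fin.cons_zero, Fin.cons_succ]
  ring

theorem differentiable_cons_left (w : Fin n → ℂ) :
    Differentiable ℂ fun z : ℂ => (Fin.cons (α := fun _ => ℂ) z w : Fin (n + 1) → ℂ) := by
  refine differentiable_pi.2 fun j => Fin.cases ?_ (fun j => ?_) j
  · simp
  · simp

theorem differentiable_cons_right (z : ℂ) :
    Differentiable ℂ fun w : Fin n → ℂ => (Fin.cons (α := fun _ => ℂ) z w : Fin (n + 1) → ℂ) := by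
  refine differentiable_pi.2 fun j => Fin.cases ?_ (fun j => ?_) j
  · simp
  · simpa using differentiable_apply j

theorem integral_zero [SigmaFinite μ] (U : (Fin 0 → ℂ) → ℂ) (z ω : Fin 0 → X → ℂ) :
    ∫ x, integrand U z ω x ∂(Measure.pi fun _ => μ) = U default := by
  rw [Measure.pi_of_empty (fun _ : Fin 0 => μ) (fun i => i.elim0), integral_dirac]
  simp only [integrand, Finset.univ_eq_empty, Finset.prod_empty, mul_one]
  congr 1; funext j; exact j.elim0

/-- Cycles with the same integrals in one variable give the same multiple integrals. -/
theorem integral_replace [SigmaFinite μ] [SigmaFinite ν] {δ : ℝ} (hδ : 0 < δ) :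
    ∀ {n : ℕ} {z ω : Fin n → X → ℂ} {z' ω' : Fin n → Y → ℂ} (_ : ∀ j, Cycle l c μ (z j) (ω j))
    (_ : ∀ j, Cycle l c ν (z' j) (ω' j))
    (_ : ∀ j g, Dec l c g → ∫ x, g (z j x) * ω j x ∂μ = ∫ y, g (z' j y) * ω' j y ∂ν)
    {U : (Fin n → ℂ) → ℂ} (_ : DifferentiableOn ℂ U (stripPi n l c)) {C : ℝ} (_ : 0 ≤ C)
    (_ : ∀ z ∈ stripPi n l c, ‖U z‖ ≤ C * ∏ j, exp (-δ * |(z j).im|)),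
    ∫ x, integrand U z ω x ∂(Measure.pi fun _ => μ) =
      ∫ y, integrand U z' ω' y ∂(Measure.pi fun _ => ν) := by
  intro n
  induction n with
  | zero =>
    intro z ω z' ω' h h' h1 U hU C hC hb
    rw [integral_zero, integral_zero]
  | succ n ih =>
    intro z ω z' ω' h h' h1 U hU C hC hb
    have hUc := hU.continuousOn
    rw [integral_succ hUc h, integral_succ hUc h',
      integral_prod _ (integrable_cons hUc hδ hb (h 0) fun j => h j.succ)]
    -- With the first variable fixed the induction hypothesis replaces all other cycles; then the
    -- order of integration is reversed and the first cycle is replaced with the others fixed.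
    have step1 : ∀ x, ∫ y, ω 0 x * integrand (fun w => U (Fin.cons (α := fun _ => ℂ) (z 0 x) w))
        (fun j => z j.succ) (fun j => ω j.succ) y ∂(Measure.pi fun _ => μ) =
        ∫ y, ω 0 x * integrand (fun w => U (Fin.cons (α := fun _ => ℂ) (z 0 x) w))
        (fun j => z' j.succ) (fun j => ω' j.succ) y ∂(Measure.pi fun _ => ν) := by
      intro x
      rw [integral_const_mul, integral_const_mul]
      congr 1
      refine ih (fun j => h j.succ) (fun j => h' j.succ) (fun j => h1 j.succ)
        (hU.comp (differentiable_cons_right _).differentiableOn fun w hw =>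
          Fin.cases ((h 0).mem x) hw)
        (C := C * exp (-δ * |(z 0 x).im|)) (by positivity) fun w hw => ?_
      have := hb (Fin.cons (α := fun _ => ℂ) (z 0 x) w) (Fin.cases ((h 0).mem x) hw)
      simpa only [Fin.prod_univ_succ, Fin.cons_zero, Fin.cons_succ, mul_assoc] using this
    rw [integral_congr_ae (Eventually.of_forall step1),
      ← integral_prod _ (integrable_cons hUc hδ hb (h 0) fun j => h' j.succ),
      integral_prod_symm _ (integrable_cons hUc hδ hb (h 0) fun j => h' j.succ),
      integral_prod_symm _ (integrable_cons hUc hδ hb (h' 0) fun j => h' j.succ)]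
    congr 1; funext y
    simp only [integrand]
    have hd : Dec l c fun ζ => U (Fin.cons (α := fun _ => ℂ) ζ fun j => z' j.succ (y j)) := by
      refine ⟨hU.comp (differentiable_cons_left _).differentiableOn fun ζ hζ =>
          Fin.cases hζ fun j => (h' j.succ).mem _,
        C * ∏ j : Fin n, exp (-δ * |(z' j.succ (y j)).im|), δ, by positivity, hδ,
        fun ζ h1 h2 => ?_⟩
      have := hb (Fin.cons (α := fun _ => ℂ) ζ fun j => z' j.succ (y j))
        (Fin.cases ⟨h1, h2⟩ fun j => (h' j.succ).mem _)
      simp only [Fin.prod_univ_succ, Fin.cons_zero, Fin.cons_succ] at this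
      exact this.trans (le_of_eq (by ring))
    have e := congrArg (· * ∏ j : Fin n, ω' j.succ (y j)) (h1 0 _ hd)
    simp only [← integral_mul_const] at e
    refine Eq.trans ?_ (e.trans ?_) <;> (congr 1; funext x; ring)

end Cycle

section
/-! ### Multiple contour integrals depending on parameters -/

theorem exists_one_add_pow_le (d : ℕ) {ε : ℝ} (hε : 0 < ε) :
    ∃ C : ℝ, 0 ≤ C ∧ ∀ x : ℝ, 0 ≤ x → (1 + x) ^ d ≤ C * exp (ε * x) := by
  set η := min 1 (ε / (d + 1))
  have hη : 0 < η := lt_min one_pos (by positivity)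
  refine ⟨(η⁻¹) ^ d, by positivity, fun x hx => ?_⟩
  have h1 : 1 + x ≤ η⁻¹ * exp (η * x) := by
    rw [inv_mul_eq_div, le_div_iff₀ hη]
    have := Real.add_one_le_exp (η * x)
    have : η ≤ 1 := min_le_left _ _
    linarith
  calc (1 + x) ^ d ≤ (η⁻¹ * exp (η * x)) ^ d := by gcongr
    _ = (η⁻¹) ^ d * exp (d * (η * x)) := by rw [mul_pow, Real.exp_nat_mul]
    _ ≤ _ := by
        refine mul_le_mul_of_nonneg_left (Real.exp_le_exp.2 ?_) (by positivity)
        have h2 : η ≤ ε / (d + 1) := min_le_right _ _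
        rw [le_div_iff₀ (by positivity)] at h2
        nlinarith [mul_nonneg hη.le hx]

/-- Subexponential growth. -/
def Growth {E : Type*} [NormedAddCommGroup E] (D : Set E) (f : E → ℂ) : Prop :=
  ∀ ε : ℝ, 0 < ε → ∃ C : ℝ, 0 ≤ C ∧ ∀ s ∈ D, ‖f s‖ ≤ C * exp (ε * ‖s‖)

namespace Growth
variable {E : Type*} [NormedAddCommGroup E] {D : Set E} {f g : E → ℂ}

theorem mul (hf : Growth D f) (hg : Growth D g) : Growth D fun s => f s * g s := by
  intro ε hε
  obtain ⟨C, hC, h⟩ := hf (ε / 2) (half_pos hε)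
  obtain ⟨C', hC', h'⟩ := hg (ε / 2) (half_pos hε)
  refine ⟨C * C', by positivity, fun s hs => ?_⟩
  rw [norm_mul]
  calc _ ≤ (C * exp (ε / 2 * ‖s‖)) * (C' * exp (ε / 2 * ‖s‖)) :=
        mul_le_mul (h s hs) (h' s hs) (norm_nonneg _) (by positivity)
    _ = C * C' * (exp (ε / 2 * ‖s‖) * exp (ε / 2 * ‖s‖)) := by ring
    _ = _ := by rw [← exp_add]; ring_nf

theorem mono {D' : Set E} (hf : Growth D f) (h : D' ⊆ D) : Growth D' f := by
  intro ε hε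
  obtain ⟨C, hC, hb⟩ := hf ε hε
  exact ⟨C, hC, fun s hs => hb s (h hs)⟩

theorem of_bounded {C : ℝ} (hC : 0 ≤ C) (h : ∀ s ∈ D, ‖f s‖ ≤ C) : Growth D f := fun ε hε =>
  ⟨C, hC, fun s hs => (h s hs).trans (le_mul_of_one_le_right hC
    (Real.one_le_exp (by positivity)))⟩

end Growth

variable {E : Type*} [NormedAddCommGroup E] [NormedSpace ℂ E]

theorem PolyLike.growth {f : E → ℂ} (hf : PolyLike f) (D : Set E) : Growth D f := by
  intro ε hε
  obtain ⟨-, C, d, h⟩ := hf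
  obtain ⟨C', hC', h'⟩ := exists_one_add_pow_le d hε
  refine ⟨|C| * C', by positivity, fun s _ => (h s).trans ?_⟩
  calc C * (1 + ‖s‖) ^ d ≤ |C| * (C' * exp (ε * ‖s‖)) :=
        mul_le_mul (le_abs_self C) (h' _ (norm_nonneg _)) (by positivity) (abs_nonneg _)
    _ = _ := by ring

theorem differentiableOn_prod {ι : Type*} [Fintype ι] {f : ι → E → ℂ} {S : Set E}
    (h : ∀ i, DifferentiableOn ℂ (f i) S) : DifferentiableOn ℂ (fun x => ∏ i, f i x) S := by
  classical
  suffices H : ∀ t : Finset ι, DifferentiableOn ℂ (fun x => ∏ i ∈ t, f i x) S from H _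
  intro t
  induction t using Finset.induction_on with
  | empty => simp
  | insert a t ha ih =>
    simp only [Finset.prod_insert ha]
    exact (h a).mul ih

theorem norm_le_of_mem_strip {l c : ℝ} {z : ℂ} (h1 : l < z.re) (h2 : z.re < c) :
    ‖z‖ ≤ |l| + |c| + |z.im| := by
  have h4 := Complex.norm_le_abs_re_add_abs_im z
  have h5 : |z.re| ≤ |l| + |c| := by
    rw [abs_le]
    constructor <;> linarith [neg_abs_le l, neg_abs_le c, le_abs_self c, le_abs_self l,
      abs_nonneg l, abs_nonneg c]
  linarith

theorem PolyLike.exists_strip_bound {f : E → ℂ → ℂ} (hf : PolyLike fun q : E × ℂ => f q.1 q.2)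
    (l c : ℝ) {ε : ℝ} (hε : 0 < ε) : ∃ C : ℝ, 0 ≤ C ∧ ∀ (s : E) (z : ℂ), l < z.re → z.re < c →
      ‖f s z‖ ≤ C * exp (ε * ‖s‖) * exp (ε * |z.im|) := by
  obtain ⟨C, hC, h⟩ := hf.growth univ ε hε
  refine ⟨C * exp (ε * (|l| + |c|)), by positivity, fun s z h1 h2 =>
    (h (s, z) (mem_univ _)).trans ?_⟩
  rw [mul_assoc, mul_assoc, ← exp_add, ← exp_add]
  have h3 := norm_le_of_mem_strip h1 h2
  have h4 : ‖(s, z)‖ ≤ ‖s‖ + ‖z‖ := by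
    rw [Prod.norm_def]; exact max_le_add_of_nonneg (norm_nonneg _) (norm_nonneg _)
  have : ε * ‖(s, z)‖ ≤ ε * (|l| + |c|) + (ε * ‖s‖ + ε * |z.im|) := by nlinarith
  gcongr

theorem Dec.mul_growth {l c : ℝ} {g h : ℂ → ℂ} (hg : Dec l c g) (hh : Differentiable ℂ h)
    (hb : ∀ ε : ℝ, 0 < ε → ∃ C : ℝ, 0 ≤ C ∧ ∀ z : ℂ, l < z.re → z.re < c →
      ‖h z‖ ≤ C * exp (ε * |z.im|)) : Dec l c fun z => g z * h z := by
  obtain ⟨C, δ, hC, hδ, hgb⟩ := hg.bound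
  obtain ⟨C', hC', hb'⟩ := hb (δ / 2) (half_pos hδ)
  refine ⟨hg.diff.mul hh.differentiableOn, C * C', δ / 2, by positivity, half_pos hδ,
    fun z h1 h2 => ?_⟩
  rw [norm_mul]
  calc _ ≤ (C * exp (-δ * |z.im|)) * (C' * exp (δ / 2 * |z.im|)) :=
        mul_le_mul (hgb z h1 h2) (hb' z h1 h2) (norm_nonneg _) (by positivity)
    _ = C * C' * (exp (-δ * |z.im|) * exp (δ / 2 * |z.im|)) := by ring
    _ = _ := by rw [← exp_add]; ring_nf

/-- The union of two vertical lines. -/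
def twoLines (l c : ℝ) (p : ℝ × Bool) : ℂ := (if p.2 then (c : ℂ) else l) + p.1 * I

/-- The measure on two copies of the line. -/
def lineMeasure : Measure (ℝ × Bool) := (volume : Measure ℝ).prod Measure.count

instance : SigmaFinite lineMeasure := by unfold lineMeasure; infer_instance

theorem twoLines_im (l c : ℝ) (p : ℝ × Bool) : (twoLines l c p).im = p.1 := by
  unfold twoLines; split_ifs <;> simp

theorem twoLines_re (l c : ℝ) (p : ℝ × Bool) :
    (twoLines l c p).re = if p.2 then c else l := by
  unfold twoLines; split_ifs <;> simp

theorem measurable_twoLines (l c : ℝ) : Measurable (twoLines l c) := by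
  unfold twoLines
  refine Measurable.add (Measurable.ite ?_ measurable_const measurable_const) (by fun_prop)
  exact measurable_snd (measurableSet_singleton true)

theorem integrable_lineMeasure {F : Type*} [NormedAddCommGroup F] {f : ℝ × Bool → F}
    (hm : AEStronglyMeasurable f lineMeasure)
    (h : ∀ b, Integrable fun t => f (t, b)) : Integrable f lineMeasure := by
  refine (integrable_prod_iff' hm).2 ⟨Eventually.of_forall h, Integrable.of_finite⟩

theorem integral_lineMeasure {f : ℝ × Bool → ℂ} (hm : AEStronglyMeasurable f lineMeasure)
    (h : ∀ b, Integrable fun t => f (t, b)) :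
    ∫ p, f p ∂lineMeasure = (∫ t, f (t, true)) + ∫ t, f (t, false) := by
  have := integrable_lineMeasure hm h
  unfold lineMeasure at *
  rw [integral_prod_symm _ this, integral_fintype Integrable.of_finite]
  simp [Measure.real]

theorem integral_lineMeasure_real {f : ℝ → ℝ} (h : Integrable f) :
    Integrable (fun p : ℝ × Bool => f p.1) lineMeasure ∧
      ∫ p, f p.1 ∂lineMeasure = 2 * ∫ t, f t := by
  have := integrable_lineMeasure (f := fun p : ℝ × Bool => f p.1) (h.aestronglyMeasurable.comp_fst)
    fun _ => h
  refine ⟨this, ?_⟩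
  unfold lineMeasure at *
  rw [integral_prod_symm _ this, integral_fintype Integrable.of_finite]
  simp [Measure.real]

/-- Weights on two lines, depending holomorphically on a parameter. -/
structure Weight (D : Set E) (ω : E → ℝ × Bool → ℂ) : Prop where
  meas : ∀ s ∈ D, Measurable (ω s)
  diff : ∀ p, DifferentiableOn ℂ (fun s => ω s p) D
  bound : ∀ ε : ℝ, 0 < ε → ∃ C : ℝ, 0 ≤ C ∧ ∀ s ∈ D, ∀ p,
    ‖ω s p‖ ≤ C * exp (ε * ‖s‖) * exp (ε * |p.1|)

/-- Functions of a parameter and of `n` variables in a strip, decaying in these variables away from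
a point of at most linear growth in the parameter. -/
structure Kernel (D : Set E) (n : ℕ) (l c : ℝ) (U : E → (Fin n → ℂ) → ℂ) : Prop where
  diff : DifferentiableOn ℂ (fun q : E × (Fin n → ℂ) => U q.1 q.2) (D ×ˢ stripPi n l c)
  bound : ∃ δ : ℝ, 0 < δ ∧ ∃ κ : ℝ, 0 ≤ κ ∧ ∃ m : E → Fin n → ℝ,
    (∀ s ∈ D, ∀ j, |m s j| ≤ κ * (1 + ‖s‖)) ∧ ∀ ε : ℝ, 0 < ε → ∃ C : ℝ, 0 ≤ C ∧
      ∀ s ∈ D, ∀ z ∈ stripPi n l c, ‖U s z‖ ≤ C * exp (ε * ‖s‖) *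
        ∏ j, (exp (ε * |(z j).im|) * exp (-δ * |(z j).im - m s j|))

theorem Kernel.decay {D : Set E} {n : ℕ} {l c : ℝ} {U : E → (Fin n → ℂ) → ℂ}
    (h : Kernel D n l c U) {s : E} (hs : s ∈ D) :
    DifferentiableOn ℂ (U s) (stripPi n l c) ∧ ∃ C δ : ℝ, 0 ≤ C ∧ 0 < δ ∧
      ∀ z ∈ stripPi n l c, ‖U s z‖ ≤ C * ∏ j, exp (-δ * |(z j).im|) := by
  constructor
  · exact h.diff.comp (f := fun z => (s, z)) (by fun_prop) fun z hz => ⟨hs, hz⟩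
  · obtain ⟨δ, hδ, κ, hκ, m, hm, hb⟩ := h.bound
    obtain ⟨C, hC, hb⟩ := hb (δ / 2) (half_pos hδ)
    refine ⟨C * exp (δ / 2 * ‖s‖) * ∏ j, exp (δ * |m s j|), δ / 2, by positivity,
      half_pos hδ, fun z hz => (hb s hs z hz).trans ?_⟩
    rw [mul_assoc _ (∏ j, exp (δ * |m s j|)), ← prod_mul_distrib]
    refine mul_le_mul_of_nonneg_left (Finset.prod_le_prod (fun j _ => by positivity)
      fun j _ => ?_) (by positivity)
    rw [← exp_add, ← exp_add, exp_le_exp]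
    have := abs_sub_abs_le_abs_sub (z j).im (m s j)
    nlinarith

section Holomorphic
variable {D : Set E} {n : ℕ} {l c l' c' : ℝ} {U : E → (Fin n → ℂ) → ℂ}
  {ω : Fin n → E → ℝ × Bool → ℂ}

theorem twoLines_mem (h1 : l < l') (h2 : l' < c') (h3 : c' < c) (p : ℝ × Bool) :
    l < (twoLines l' c' p).re ∧ (twoLines l' c' p).re < c := by
  rw [twoLines_re]
  split_ifs <;> constructor <;> linarith

theorem exists_integrand_bound (h1 : l < l') (h2 : l' < c') (h3 : c' < c) (hU : Kernel D n l c U)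
    (hω : ∀ j, Weight D (ω j)) :
    ∃ δ : ℝ, 0 < δ ∧ ∃ κ : ℝ, 0 ≤ κ ∧ ∃ m : E → Fin n → ℝ, (∀ s ∈ D, ∀ j, |m s j| ≤ κ * (1 + ‖s‖)) ∧
      ∀ ε : ℝ, 0 < ε → ∃ C : ℝ, 0 ≤ C ∧ ∀ s ∈ D, ∀ y : Fin n → ℝ × Bool,
        ‖Cycle.integrand (U s) (fun _ => twoLines l' c') (fun j => ω j s) y‖ ≤
          C * exp (ε * ‖s‖) * ∏ j, exp (-δ * |(y j).1 - m s j|) := by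
  obtain ⟨δ, hδ, κ, hκ, m, hm, hb⟩ := hU.bound
  refine ⟨δ / 2, half_pos hδ, κ, hκ, m, hm, fun ε hε => ?_⟩
  -- Each variable costs `2 ε₀ |Im z|`, traded for `|Im z - m|` at the price `2 ε₀ κ (1 + ‖s‖)`.
  -- Thus `ε₀ ≤ δ / 4` keeps the decay rate `δ / 2`, and the total rate in `‖s‖` is `ε₀ (1 + n + 2 n
  -- κ)`.
  set ε₀ := min (δ / 4) (ε / (1 + n + 2 * n * κ)) with hε₀
  have hpos : 0 < 1 + (n : ℝ) + 2 * n * κ := by positivity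
  have h0 : 0 < ε₀ := lt_min (by positivity) (by positivity)
  have h01 : ε₀ ≤ δ / 4 := min_le_left _ _
  have h02 : ε₀ * (1 + n + 2 * n * κ) ≤ ε := by
    rw [← le_div_iff₀ hpos]; exact min_le_right _ _
  obtain ⟨C, hC, hb⟩ := hb ε₀ h0
  choose K hK hKb using fun j => (hω j).bound ε₀ h0
  refine ⟨C * ∏ j, (K j * exp (2 * ε₀ * κ)), mul_nonneg hC (Finset.prod_nonneg fun j _ =>
    mul_nonneg (hK j) (exp_pos _).le), fun s hs y => ?_⟩
  have hz : (fun j => twoLines l' c' (y j)) ∈ stripPi n l c := fun j => twoLines_mem h1 h2 h3 _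
  rw [Cycle.integrand, norm_mul, norm_prod]
  have e1 := hb s hs _ hz
  simp only [twoLines_im] at e1
  have e2 : ∀ j, (exp (ε₀ * |(y j).1|) * exp (-δ * |(y j).1 - m s j|)) * ‖ω j s (y j)‖ ≤
      (K j * exp (2 * ε₀ * κ)) * exp (ε₀ * (1 + 2 * κ) * ‖s‖) *
        exp (-(δ / 2) * |(y j).1 - m s j|) := by
    intro j
    calc _ ≤ (exp (ε₀ * |(y j).1|) * exp (-δ * |(y j).1 - m s j|)) *
          (K j * exp (ε₀ * ‖s‖) * exp (ε₀ * |(y j).1|)) :=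
          mul_le_mul_of_nonneg_left (hKb j s hs _) (by positivity)
      _ = K j * (exp (ε₀ * |(y j).1|) * exp (-δ * |(y j).1 - m s j|) *
          exp (ε₀ * ‖s‖) * exp (ε₀ * |(y j).1|)) := by ring
      _ = K j * exp (ε₀ * |(y j).1| + -δ * |(y j).1 - m s j| + ε₀ * ‖s‖ + ε₀ * |(y j).1|) := by
          simp only [exp_add]
      _ ≤ K j * exp (2 * ε₀ * κ + ε₀ * (1 + 2 * κ) * ‖s‖ + -(δ / 2) * |(y j).1 - m s j|) := by
          refine mul_le_mul_of_nonneg_left (Real.exp_le_exp.2 ?_) (hK j)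
          have a1 := abs_sub_abs_le_abs_sub (y j).1 (m s j)
          have a2 := hm s hs j
          have a3 : ε₀ * |(y j).1| ≤ ε₀ * |(y j).1 - m s j| + ε₀ * (κ * (1 + ‖s‖)) := by
            rw [← mul_add]; exact mul_le_mul_of_nonneg_left (by linarith) h0.le
          have a4 : ε₀ * |(y j).1 - m s j| ≤ δ / 4 * |(y j).1 - m s j| :=
            mul_le_mul_of_nonneg_right h01 (abs_nonneg _)
          nlinarith
      _ = _ := by simp only [exp_add]; ring
  calc _ ≤ (C * exp (ε₀ * ‖s‖) * ∏ j, (exp (ε₀ * |(y j).1|) *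
        exp (-δ * |(y j).1 - m s j|))) * ∏ j, ‖ω j s (y j)‖ :=
        mul_le_mul_of_nonneg_right e1 (by positivity)
    _ = (C * exp (ε₀ * ‖s‖)) * ∏ j, ((exp (ε₀ * |(y j).1|) *
        exp (-δ * |(y j).1 - m s j|)) * ‖ω j s (y j)‖) := by
        rw [mul_assoc, ← prod_mul_distrib]
    _ ≤ (C * exp (ε₀ * ‖s‖)) * ∏ j, ((K j * exp (2 * ε₀ * κ)) *
        exp (ε₀ * (1 + 2 * κ) * ‖s‖) * exp (-(δ / 2) * |(y j).1 - m s j|)) :=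
        mul_le_mul_of_nonneg_left (Finset.prod_le_prod (fun j _ => by positivity) fun j _ => e2 j)
          (by positivity)
    _ = (C * ∏ j, (K j * exp (2 * ε₀ * κ))) * (exp (ε₀ * ‖s‖) *
        exp (ε₀ * (1 + 2 * κ) * ‖s‖) ^ n) * ∏ j, exp (-(δ / 2) * |(y j).1 - m s j|) := by
        simp only [prod_mul_distrib, prod_const, card_univ, Fintype.card_fin]
        ring
    _ ≤ _ := by
        rw [← Real.exp_nat_mul, ← exp_add]
        refine mul_le_mul_of_nonneg_right (mul_le_mul_of_nonneg_left (Real.exp_le_exp.2 ?_)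
          (mul_nonneg hC (Finset.prod_nonneg fun j _ => mul_nonneg (hK j) (exp_pos _).le)))
          (Finset.prod_nonneg fun j _ => (exp_pos _).le)
        calc _ = ε₀ * (1 + n + 2 * n * κ) * ‖s‖ := by ring
          _ ≤ _ := by gcongr

theorem weight_cycle (h1 : l < l') (h2 : l' < c') (h3 : c' < c) {ω : E → ℝ × Bool → ℂ}
    (hω : Weight D ω) {s : E} (hs : s ∈ D) : Cycle l c lineMeasure (twoLines l' c') (ω s) where
  meas_z := measurable_twoLines l' c'
  meas_ω := hω.meas s hs
  mem := twoLines_mem h1 h2 h3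
  int δ hδ := by
    obtain ⟨C, hC, hb⟩ := hω.bound (δ / 2) (half_pos hδ)
    refine (((integral_lineMeasure_real (integrable_exp_neg_mul_abs (half_pos hδ))).1).const_mul
      (C * exp (δ / 2 * ‖s‖))).mono' ?_ (Eventually.of_forall fun p => ?_)
    · exact ((Complex.measurable_im.comp (measurable_twoLines l' c')).abs.const_mul _).exp.mul
        (hω.meas s hs).norm |>.aestronglyMeasurable
    · rw [norm_mul, norm_norm, Real.norm_of_nonneg (exp_pos _).le, twoLines_im]
      calc _ ≤ exp (-δ * |p.1|) * (C * exp (δ / 2 * ‖s‖) * exp (δ / 2 * |p.1|)) := by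
            gcongr; exact hb s hs p
        _ = C * exp (δ / 2 * ‖s‖) * (exp (-δ * |p.1|) * exp (δ / 2 * |p.1|)) := by
            ring
        _ = _ := by rw [← exp_add]; ring_nf

/-- Locally in `s` the centres of decay are bounded, which yields a dominating function and
holomorphy. For the growth, the integral of `exp (-δ |t - m|)` is independent of `m`, so a moving
centre costs nothing. -/
theorem integral_two_lines [FiniteDimensional ℂ E] (hD : IsOpen D) (h1 : l < l') (h2 : l' < c')
    (h3 : c' < c) (hU : Kernel D n l c U) (hω : ∀ j, Weight D (ω j)) :
    DifferentiableOn ℂ (fun s => ∫ y, Cycle.integrand (U s) (fun _ => twoLines l' c')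
      (fun j => ω j s) y ∂(Measure.pi fun _ => lineMeasure)) D ∧
    Growth D (fun s => ∫ y, Cycle.integrand (U s) (fun _ => twoLines l' c')
      (fun j => ω j s) y ∂(Measure.pi fun _ => lineMeasure)) := by
  obtain ⟨δ, hδ, κ, hκ, m, hm, hb⟩ := exists_integrand_bound h1 h2 h3 hU hω
  have hint : ∀ m : Fin n → ℝ,
      Integrable (fun y : Fin n → ℝ × Bool => ∏ j, exp (-δ * |(y j).1 - m j|))
        (Measure.pi fun _ => lineMeasure) := fun m =>
    Integrable.fintype_prod (f := fun j (p : ℝ × Bool) => exp (-δ * |p.1 - m j|)) fun j =>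
      (integral_lineMeasure_real ((integrable_exp_neg_mul_abs hδ).comp_sub_right (m j))).1
  constructor
  · refine differentiableOn_integral_of_dominated hD (fun s hs => ?_) (fun y => ?_) fun s hs => ?_
    · exact (Cycle.measurable_integrand ((hU.decay hs).1.continuousOn)
        fun j => weight_cycle h1 h2 h3 (hω j) hs).aestronglyMeasurable
    · simp only [Cycle.integrand]
      refine DifferentiableOn.mul ?_ (differentiableOn_prod fun j => (hω j).diff _)
      exact hU.diff.comp (f := fun s => (s, fun j => twoLines l' c' (y j))) (by fun_prop)
        fun s hs => ⟨hs, fun j => twoLines_mem h1 h2 h3 _⟩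
    · obtain ⟨C, hC, hb⟩ := hb 1 one_pos
      refine ⟨1, one_pos, fun y => C * exp (1 * (‖s‖ + 1)) *
        ∏ j : Fin n, (exp (δ * (κ * (1 + (‖s‖ + 1)))) * exp (-δ * |(y j).1 - 0|)), ?_,
        fun s' hs' hs'D y => (hb s' hs'D y).trans ?_⟩
      · simp only [prod_mul_distrib]
        exact ((hint 0).const_mul _).const_mul _
      · have hn : ‖s'‖ ≤ ‖s‖ + 1 := by
          have := norm_sub_norm_le s' s
          rw [Metric.mem_ball, dist_eq_norm] at hs'
          linarith
        refine mul_le_mul (mul_le_mul_of_nonneg_left (Real.exp_le_exp.2 (by linarith)) hC)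
          (Finset.prod_le_prod (fun j _ => (exp_pos _).le) fun j _ => ?_)
          (Finset.prod_nonneg fun j _ => (exp_pos _).le) (by positivity)
        rw [← exp_add]
        refine Real.exp_le_exp.2 ?_
        have a1 := abs_sub_abs_le_abs_sub (y j).1 (m s' j)
        have a2 := hm s' hs'D j
        have a3 : κ * (1 + ‖s'‖) ≤ κ * (1 + (‖s‖ + 1)) := by gcongr
        rw [sub_zero]
        nlinarith
  · intro ε hε
    obtain ⟨C, hC, hb⟩ := hb ε hε
    refine ⟨C * (2 * ∫ t : ℝ, exp (-δ * |t|)) ^ n, ?_, fun s hs => ?_⟩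
    · have : 0 ≤ ∫ t : ℝ, exp (-δ * |t|) := integral_nonneg fun t => (exp_pos _).le
      positivity
    · have e : ∫ y : Fin n → ℝ × Bool, ∏ j, exp (-δ * |(y j).1 - m s j|)
          ∂(Measure.pi fun _ => lineMeasure) = (2 * ∫ t : ℝ, exp (-δ * |t|)) ^ n := by
        rw [integral_fintype_prod_eq_prod (fun j (p : ℝ × Bool) => exp (-δ * |p.1 - m s j|))]
        have : ∀ j, ∫ p : ℝ × Bool, exp (-δ * |p.1 - m s j|) ∂lineMeasure =
            2 * ∫ t : ℝ, exp (-δ * |t|) := fun j => by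
          rw [(integral_lineMeasure_real
            ((integrable_exp_neg_mul_abs hδ).comp_sub_right (m s j))).2,
            integral_sub_right_eq_self (fun t => exp (-δ * |t|))]
        rw [prod_congr rfl fun j _ => this j]
        simp
      refine (norm_integral_le_of_norm_le ((hint (m s)).const_mul (C * exp (ε * ‖s‖)))
        (Eventually.of_forall fun y => hb s hs y)).trans (le_of_eq ?_)
      rw [integral_const_mul, e]
      ring

end Holomorphic

/-- The weight on the left line is `α / B`, on the right line `β / A`. -/
def splitWeight (l' c' : ℝ) (A : ℂ → ℂ) (B α β : E → ℂ → ℂ) (s : E) (p : ℝ × Bool) : ℂ :=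
  I * if p.2 then β s (twoLines l' c' p) * (A (twoLines l' c' p))⁻¹
    else α s (twoLines l' c' p) * (B s (twoLines l' c' p))⁻¹

section Split
variable {l c l' c' : ℝ} {A : ℂ → ℂ} {B α β : E → ℂ → ℂ} {D : Set E}

theorem splitWeight_weight (h1 : l < l') (h2 : l' < c') (h3 : c' < c)
    (hA : Differentiable ℂ A) (hB : Differentiable ℂ fun q : E × ℂ => B q.1 q.2)
    (hα : PolyLike fun q : E × ℂ => α q.1 q.2) (hβ : PolyLike fun q : E × ℂ => β q.1 q.2)
    (hA1 : ∀ z : ℂ, z.re = c' → 1 ≤ ‖A z‖) (hB1 : ∀ s ∈ D, ∀ z : ℂ, z.re = l' → 1 ≤ ‖B s z‖) :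
    Weight D (splitWeight l' c' A B α β) where
  meas s hs := by
    have hz := measurable_twoLines l' c'
    have hc : ∀ {f : E → ℂ → ℂ}, Differentiable ℂ (fun q : E × ℂ => f q.1 q.2) →
        Measurable fun p => f s (twoLines l' c' p) := fun {f} hf =>
      (hf.continuous.comp (Continuous.prodMk_right s)).measurable.comp hz
    unfold splitWeight
    refine Measurable.const_mul (Measurable.ite ?_ ((hc hβ.1).mul
      (hA.continuous.measurable.comp hz).inv) ((hc hα.1).mul (hc hB).inv)) _
    exact measurable_snd (measurableSet_singleton true)
  diff p := by
    unfold splitWeight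
    have hc : ∀ {f : E → ℂ → ℂ}, Differentiable ℂ (fun q : E × ℂ => f q.1 q.2) →
        ∀ z, Differentiable ℂ fun s => f s z := fun {f} hf z =>
      hf.comp (f := fun s => (s, z)) (by fun_prop)
    refine DifferentiableOn.const_mul ?_ _
    by_cases hp : p.2
    · simp only [hp, if_true]
      exact ((hc hβ.1 _).mul_const _).differentiableOn
    · simp only [hp, Bool.false_eq_true, if_false]
      refine (hc hα.1 _).differentiableOn.mul ((hc hB _).differentiableOn.fun_inv fun s hs h0 => ?_)
      have := hB1 s hs (twoLines l' c' p) (by rw [twoLines_re, if_neg hp])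
      rw [h0, norm_zero] at this
      linarith
  bound ε hε := by
    obtain ⟨C₁, hC₁, hb₁⟩ := hα.exists_strip_bound l c hε
    obtain ⟨C₂, hC₂, hb₂⟩ := hβ.exists_strip_bound l c hε
    refine ⟨C₁ + C₂, by positivity, fun s hs p => ?_⟩
    have hm := twoLines_mem h1 h2 h3 p
    have k1 := hb₁ s _ hm.1 hm.2
    have k2 := hb₂ s _ hm.1 hm.2
    rw [twoLines_im] at k1 k2
    rw [splitWeight, norm_mul, Complex.norm_I, one_mul]
    split_ifs with hp
    · rw [norm_mul, norm_inv]
      have := inv_le_one_of_one_le₀ (hA1 (twoLines l' c' p) (by rw [twoLines_re, if_pos hp]))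
      refine (mul_le_of_le_one_right (norm_nonneg _) this).trans (k2.trans ?_)
      gcongr; linarith
    · rw [norm_mul, norm_inv]
      have := inv_le_one_of_one_le₀ (hB1 s hs (twoLines l' c' p) (by rw [twoLines_re, if_neg hp]))
      refine (mul_le_of_le_one_right (norm_nonneg _) this).trans (k1.trans ?_)
      gcongr; linarith

/-- Partial fractions: `R / (A B) = α / B + β / A`. The first term has no pole between `γ` and the
left line, the second none between `γ` and the right line, so the two are moved in opposite
directions and `γ` disappears. -/
theorem integral_split (h1 : l < l') (h2 : l' < c') (h3 : c' < c)
    (hB : Differentiable ℂ fun q : E × ℂ => B q.1 q.2)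
    (hα : PolyLike fun q : E × ℂ => α q.1 q.2) (hβ : PolyLike fun q : E × ℂ => β q.1 q.2)
    {R : E → ℂ} {s : E} (hR : ∀ z, R s = α s z * A z + β s z * B s z) {γ : IndentedLine}
    (hγ : ∀ t, l < (γ.path t).re ∧ (γ.path t).re < c)
    (hdB : Divisor γ (vline l') l c (B s)) (hdA : Divisor γ (vline c') l c A)
    {g : ℂ → ℂ} (hg : Dec l c g) :
    ∫ t, g (γ.path t) * (R s * deriv γ.path t * ((A (γ.path t))⁻¹ * (B s (γ.path t))⁻¹)) =
      ∫ p, g (twoLines l' c' p) * splitWeight l' c' A B α β s p ∂lineMeasure := by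
  have hb : ∀ {f : E → ℂ → ℂ}, PolyLike (fun q : E × ℂ => f q.1 q.2) →
      Dec l c fun z => g z * f s z := fun {f} hf => by
    refine hg.mul_growth (hf.1.comp (f := fun z => (s, z)) (by fun_prop)) fun ε hε => ?_
    obtain ⟨C, hC, h⟩ := hf.exists_strip_bound l c hε
    exact ⟨C * exp (ε * ‖s‖), by positivity, fun z => h s z⟩
  have hγl : ∀ t, l < ((vline l').path t).re ∧ ((vline l').path t).re < c := fun t => by
    rw [vline_path_re]; constructor <;> linarith
  have hγc : ∀ t, l < ((vline c').path t).re ∧ ((vline c').path t).re < c := fun t => by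
    rw [vline_path_re]; constructor <;> linarith
  have e1 := hdB.cint_eq (fun t => (hγ t).1) (fun t => (hγ t).2) (fun t => (hγl t).1)
    (fun t => (hγl t).2) _ (hb hα)
  have e2 := hdA.cint_eq (fun t => (hγ t).1) (fun t => (hγ t).2) (fun t => (hγc t).1)
    (fun t => (hγc t).2) _ (hb hβ)
  have i1 := hdB.integrable_div ((hb hα).integrable_path γ (fun t => (hγ t).1) (fun t => (hγ t).2))
    ((hb hα).integrable_path (vline l') (fun t => (hγl t).1) (fun t => (hγl t).2))
  have i2 := hdA.integrable_div ((hb hβ).integrable_path γ (fun t => (hγ t).1) (fun t => (hγ t).2))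
    ((hb hβ).integrable_path (vline c') (fun t => (hγc t).1) (fun t => (hγc t).2))
  have hsl : ∀ b, Integrable fun t => g (twoLines l' c' (t, b)) *
      splitWeight l' c' A B α β s (t, b) := by
    intro b
    cases b
    · refine i1.2.congr (Eventually.of_forall fun t => ?_)
      simp only [vline_path, deriv_vline, splitWeight, twoLines, Bool.false_eq_true, if_false]
      ring
    · refine i2.2.congr (Eventually.of_forall fun t => ?_)
      simp only [vline_path, deriv_vline, splitWeight, twoLines, if_true]
      ring
  have hm : AEStronglyMeasurable (fun p => g (twoLines l' c' p) * splitWeight l' c' A B α β s p)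
      lineMeasure := by
    have hz := measurable_twoLines l' c'
    have hc : ∀ {f : E → ℂ → ℂ}, Differentiable ℂ (fun q : E × ℂ => f q.1 q.2) →
        Measurable fun p => f s (twoLines l' c' p) := fun {f} hf =>
      (hf.continuous.comp (Continuous.prodMk_right s)).measurable.comp hz
    refine ((measurable_comp_of_continuousOn hg.diff.continuousOn hz
      (twoLines_mem h1 h2 h3)).mul ?_).aestronglyMeasurable
    unfold splitWeight
    refine Measurable.const_mul (Measurable.ite ?_ ((hc hβ.1).mul
      (hdA.differentiable.continuous.measurable.comp hz).inv) ((hc hα.1).mul (hc hB).inv)) _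
    exact measurable_snd (measurableSet_singleton true)
  rw [integral_lineMeasure hm hsl]
  have e3 : ∫ t, g (γ.path t) * (R s * deriv γ.path t * ((A (γ.path t))⁻¹ * (B s (γ.path t))⁻¹)) =
      γ.cint (fun z => g z * β s z * (A z)⁻¹) + γ.cint (fun z => g z * α s z * (B s z)⁻¹) := by
    rw [IndentedLine.cint, IndentedLine.cint, ← integral_add]
    · congr 1; funext t
      rw [hR (γ.path t)]
      have := (hdA.ne_zero t).1
      have := (hdB.ne_zero t).1
      field_simp
      ring
    · exact i2.1.congr (Eventually.of_forall fun t => by ring)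
    · exact i1.1.congr (Eventually.of_forall fun t => by ring)
  rw [e3, e1, e2, IndentedLine.cint, IndentedLine.cint]
  congr 1
  · congr 1; funext t
    simp only [vline_path, deriv_vline, splitWeight, twoLines, if_true]
    ring
  · congr 1; funext t
    simp only [vline_path, deriv_vline, splitWeight, twoLines, Bool.false_eq_true, if_false]
    ring

/-- The split form of a multiple contour integral. -/
def splitIntegral (n : ℕ) (l' c' : ℝ) (U : E → (Fin n → ℂ) → ℂ) (A : Fin n → ℂ → ℂ)
    (B α β : Fin n → E → ℂ → ℂ) (s : E) : ℂ :=
  ∫ y, Cycle.integrand (U s) (fun _ => twoLines l' c')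
    (fun j => splitWeight l' c' (A j) (B j) (α j) (β j) s) y ∂(Measure.pi fun _ => lineMeasure)

/-- Continuation of a multiple contour integral in parameters: the separated poles are removed by
moving a part of the integrand to the far left and the rest to the far right. -/
theorem splitIntegral_spec [FiniteDimensional ℂ E] {n : ℕ} (hD : IsOpen D) (h1 : l < l')
    (h2 : l' < c') (h3 : c' < c) {U : E → (Fin n → ℂ) → ℂ} (hU : Kernel D n l c U)
    {A : Fin n → ℂ → ℂ} {B α β : Fin n → E → ℂ → ℂ} {R : Fin n → E → ℂ}
    (hA : ∀ j, Differentiable ℂ (A j)) (hB : ∀ j, Differentiable ℂ fun q : E × ℂ => B j q.1 q.2)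
    (hα : ∀ j, PolyLike fun q : E × ℂ => α j q.1 q.2)
    (hβ : ∀ j, PolyLike fun q : E × ℂ => β j q.1 q.2)
    (hR : ∀ j s z, R j s = α j s z * A j z + β j s z * B j s z)
    (hA1 : ∀ j, ∀ z : ℂ, z.re = c' → 1 ≤ ‖A j z‖)
    (hB1 : ∀ j, ∀ s ∈ D, ∀ z : ℂ, z.re = l' → 1 ≤ ‖B j s z‖) :
    DifferentiableOn ℂ (splitIntegral n l' c' U A B α β) D ∧
      Growth D (splitIntegral n l' c' U A B α β) ∧
      ∀ s ∈ D, ∀ γ : Fin n → IndentedLine,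
        (∀ j t, l < ((γ j).path t).re ∧ ((γ j).path t).re < c) →
        (∀ j, Divisor (γ j) (vline l') l c (B j s)) →
        (∀ j, Divisor (γ j) (vline c') l c (A j)) →
        splitIntegral n l' c' U A B α β s = (∏ j, R j s) * ∫ t : Fin n → ℝ, U s (fun j => (γ j).path (t j)) *
          ∏ j, (deriv (γ j).path (t j) *
            ((A j ((γ j).path (t j)))⁻¹ * (B j s ((γ j).path (t j)))⁻¹)) := by
  have hw : ∀ j, Weight D (splitWeight l' c' (A j) (B j) (α j) (β j)) := fun j =>
    splitWeight_weight h1 h2 h3 (hA j) (hB j) (hα j) (hβ j) (hA1 j) (hB1 j)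
  obtain ⟨d1, d2⟩ := integral_two_lines hD h1 h2 h3 hU hw
  refine ⟨d1, d2, fun s hs γ hγ hdB hdA => ?_⟩
  obtain ⟨hUd, C, δ, hC, hδ, hUb⟩ := hU.decay hs
  have hcyc : ∀ j, Cycle l c volume (γ j).path fun t => R j s * deriv (γ j).path t *
      ((A j ((γ j).path t))⁻¹ * (B j s ((γ j).path t))⁻¹) := by
    intro j
    have hmγ := (γ j).continuous_path.measurable
    have hm : Measurable fun t => R j s * deriv (γ j).path t *
        ((A j ((γ j).path t))⁻¹ * (B j s ((γ j).path t))⁻¹) :=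
      ((measurable_deriv _).const_mul _).mul
        (((hA j).continuous.measurable.comp hmγ).inv.mul
          ((hdB j).differentiable.continuous.measurable.comp hmγ).inv)
    refine ⟨hmγ, hm, hγ j, fun δ hδ => ?_⟩
    obtain ⟨K, hK0, hK⟩ := (γ j).exists_norm_deriv_le
    obtain ⟨ε₁, hε₁, b1⟩ := (hdA j).exists_le
    obtain ⟨ε₂, hε₂, b2⟩ := (hdB j).exists_le
    obtain ⟨M, hM0, hM⟩ := (γ j).exists_bound
    refine ((integrable_exp_neg_mul_abs hδ).const_mul
      (exp (δ * M) * (‖R j s‖ * K * (ε₁⁻¹ * ε₂⁻¹)))).mono'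
      (((Complex.measurable_im.comp hmγ).abs.const_mul _).exp.mul hm.norm).aestronglyMeasurable
      (Eventually.of_forall fun t => ?_)
    rw [norm_mul, norm_norm, Real.norm_of_nonneg (exp_pos _).le, norm_mul, norm_mul, norm_mul,
      norm_inv, norm_inv]
    have k0 : exp (-δ * |((γ j).path t).im|) ≤ exp (δ * M) * exp (-δ * |t|) := by
      rw [← exp_add, exp_le_exp]
      have a1 := (hM t).2
      have a2 := abs_sub_abs_le_abs_sub t ((γ j).path t).im
      rw [abs_sub_comm] at a2
      nlinarith
    have k1 := inv_anti₀ hε₁ (b1 t).1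
    have k2 := inv_anti₀ hε₂ (b2 t).1
    calc _ ≤ (exp (δ * M) * exp (-δ * |t|)) * (‖R j s‖ * K * (ε₁⁻¹ * ε₂⁻¹)) := by
          gcongr; exact hK t
      _ = _ := by ring
  have key := Cycle.integral_replace hδ hcyc (fun j => weight_cycle h1 h2 h3 (hw j) hs)
    (fun j g hg => integral_split h1 h2 h3 (hB j) (hα j) (hβ j) (hR j s) (hγ j) (hdB j) (hdA j) hg)
    hUd hC hUb
  rw [splitIntegral, ← key, ← integral_const_mul, volume_pi]
  congr 1; funext t
  rw [Cycle.integrand, mul_left_comm, ← prod_mul_distrib]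
  simp only [mul_assoc]

end Split
end

/-! ### Bézout identities for products of linear factors -/

section Bezout
variable {E : Type*} [NormedAddCommGroup E] [NormedSpace ℂ E]

theorem PolyLike.poch {f : E → ℂ} (hf : PolyLike f) (N : ℕ) : PolyLike fun x => poch N (f x) := by
  unfold SOWhittaker.poch
  refine PolyLike.prod _ fun k _ => ?_
  simpa only [div_eq_mul_inv] using (hf.mul (.const 2⁻¹)).add (.const (k : ℂ))

theorem PolyLike.fst_apply {n : ℕ} {F : Type*} [NormedAddCommGroup F] [NormedSpace ℂ F] (j : Fin n) :
    PolyLike fun q : (Fin n → ℂ) × F => q.1 j :=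
  (PolyLike.clm ((ContinuousLinearMap.proj (R := ℂ) (φ := fun _ : Fin n => ℂ) j).comp
    (ContinuousLinearMap.fst ℂ (Fin n → ℂ) F)) :)

theorem PolyLike.snd_apply {n : ℕ} (j : Fin n) : PolyLike fun q : E × (Fin n → ℂ) => q.2 j :=
  (PolyLike.clm ((ContinuousLinearMap.proj (R := ℂ) (φ := fun _ : Fin n => ℂ) j).comp
    (ContinuousLinearMap.snd ℂ E (Fin n → ℂ))) :)

theorem PolyLike.snd : PolyLike fun q : E × ℂ => q.2 :=
  (PolyLike.clm (ContinuousLinearMap.snd ℂ E ℂ) :)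

theorem PolyLike.apply {n : ℕ} (j : Fin n) : PolyLike fun s : Fin n → ℂ => s j :=
  (PolyLike.clm (ContinuousLinearMap.proj (R := ℂ) (φ := fun _ : Fin n => ℂ) j) :)

/-- `R` is a combination of `A` and `B` with coefficients of polynomial type. -/
def Bezout (R A B : E → ℂ) : Prop :=
  ∃ α β : E → ℂ, PolyLike α ∧ PolyLike β ∧ ∀ x, R x = α x * A x + β x * B x

namespace Bezout
variable {R R' A A' B B' : E → ℂ}

theorem symm (h : Bezout R A B) : Bezout R B A := by
  obtain ⟨α, β, hα, hβ, h⟩ := h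
  exact ⟨β, α, hβ, hα, fun x => by rw [h, add_comm]⟩

/-- Expanding the product of two relations, every term except `(β B) (β' B')` contains the common
factor `A`. In this way a relation for products is built from relations between pairs of factors. -/
theorem mul_right (h : Bezout R A B) (h' : Bezout R' A B') (hA : PolyLike A) (hB : PolyLike B)
    (hB' : PolyLike B') : Bezout (fun x => R x * R' x) A fun x => B x * B' x := by
  obtain ⟨α, β, hα, hβ, h⟩ := h
  obtain ⟨α', β', hα', hβ', h'⟩ := h'
  refine ⟨_, _, ((hα.mul hα').mul hA).add (((hα.mul hβ').mul hB').add ((hβ.mul hα').mul hB)),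
    hβ.mul hβ', fun x => ?_⟩
  simp only [h, h']; ring

theorem prod_right {ι : Type*} [Fintype ι] {R B : ι → E → ℂ} (h : ∀ i, Bezout (R i) A (B i))
    (hA : PolyLike A) (hB : ∀ i, PolyLike (B i)) :
    Bezout (fun x => ∏ i, R i x) A fun x => ∏ i, B i x := by
  classical
  suffices H : ∀ t : Finset ι, Bezout (fun x => ∏ i ∈ t, R i x) A fun x => ∏ i ∈ t, B i x from H _
  intro t
  induction t using Finset.induction_on with
  | empty => exact ⟨fun _ => 0, fun _ => 1, .const 0, .const 1, by simp⟩
  | insert a t ha ih =>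
    simp only [Finset.prod_insert ha]
    exact (h a).mul_right ih hA (hB a) (.prod _ fun i _ => hB i)

theorem prod_left {ι : Type*} [Fintype ι] {R A : ι → E → ℂ} (h : ∀ i, Bezout (R i) (A i) B)
    (hA : ∀ i, PolyLike (A i)) (hB : PolyLike B) :
    Bezout (fun x => ∏ i, R i x) (fun x => ∏ i, A i x) B :=
  (prod_right (fun i => (h i).symm) hB hA).symm

/-- A Vandermonde identity. -/
theorem poch {f g : E → ℂ} (hf : PolyLike f) (hg : PolyLike g) : ∀ {M K N : ℕ}, M + 1 = K + N →
    Bezout (fun x => poch M (f x + g x)) (fun x => poch K (f x)) fun x => poch N (g x) := by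
  intro M
  induction M with
  | zero =>
    intro K N h
    rcases Nat.eq_zero_or_pos K with rfl | hK
    · exact ⟨fun _ => 1, fun _ => 0, .const 1, .const 0, by simp [SOWhittaker.poch]⟩
    · obtain rfl : N = 0 := by omega
      exact ⟨fun _ => 0, fun _ => 1, .const 0, .const 1, by simp [SOWhittaker.poch]⟩
  | succ M ih =>
    intro K N h
    rcases K with _ | K
    · exact ⟨_, fun _ => 0, (hf.add hg).poch (M + 1), .const 0, fun x => by simp [SOWhittaker.poch]⟩
    rcases N with _ | N
    · exact ⟨fun _ => 0, _, .const 0, (hf.add hg).poch (M + 1), fun x => by simp [SOWhittaker.poch]⟩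
    -- Since now `M = K + N`, the new factor `(f + g) / 2 + M` is the sum of `f / 2 + K` and `g / 2
    -- + N`. Each summand lengthens one of the two products by one factor, starting from the
    -- hypothesis for `(K, N + 1)` or `(K + 1, N)`.
    obtain ⟨α, β, hα, hβ, h1⟩ := ih (K := K) (N := N + 1) (by omega)
    obtain ⟨α', β', hα', hβ', h2⟩ := ih (K := K + 1) (N := N) (by omega)
    have hu : PolyLike fun x => f x / 2 + K := by
      simpa only [div_eq_mul_inv] using (hf.mul (.const 2⁻¹)).add (.const (K : ℂ))
    have hv : PolyLike fun x => g x / 2 + N := by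
      simpa only [div_eq_mul_inv] using (hg.mul (.const 2⁻¹)).add (.const (N : ℂ))
    refine ⟨_, _, hα.add (hα'.mul hv), (hβ.mul hu).add hβ', fun x => ?_⟩
    have hM : (M : ℂ) = K + N := by
      have : M = K + N := by omega
      exact_mod_cast this
    simp only [poch_succ, hM] at h1 h2 ⊢
    calc _ = SOWhittaker.poch M (f x + g x) * (f x / 2 + K) +
          SOWhittaker.poch M (f x + g x) * (g x / 2 + N) := by ring
      _ = (α x * SOWhittaker.poch K (f x) + β x * SOWhittaker.poch (N + 1) (g x)) * (f x / 2 + K) +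
          (α' x * SOWhittaker.poch (K + 1) (f x) + β' x * SOWhittaker.poch N (g x)) *
            (g x / 2 + N) := by simp only [poch_succ, ← h1, ← h2]
      _ = _ := by rw [poch_succ, poch_succ]; ring

end Bezout
end Bezout

/-! ### Kernels built from gamma factors -/

section GammaKernel
variable {E : Type*} [NormedAddCommGroup E] [NormedSpace ℂ E]

theorem differentiableOn_G_comp {S : Set E} {f : E → ℂ} (hf : DifferentiableOn ℂ f S)
    (h : ∀ x ∈ S, 0 < (f x).re) : DifferentiableOn ℂ (fun x => G (f x)) S := fun x hx =>
  (differentiableAt_G (ne_neg_two_mul_of_re_pos (h x hx))).comp_differentiableWithinAt x (hf x hx)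

theorem differentiableOn_Bt_comp {S : Set E} {f g : E → ℂ} (hf : DifferentiableOn ℂ f S)
    (hg : DifferentiableOn ℂ g S) (h : ∀ x ∈ S, 0 < (f x).re) (h' : ∀ x ∈ S, 0 < (g x).re) :
    DifferentiableOn ℂ (fun x => Bt (f x) (g x)) S := by
  unfold Bt
  exact ((differentiableOn_G_comp hf h).mul (differentiableOn_G_comp hg h')).mul
    (differentiable_G_inv.comp_differentiableOn (hf.add hg))

omit [NormedSpace ℂ E] in
theorem growth_G_comp {S : Set E} {f : E → ℂ} {b : ℝ} (h : ∀ x ∈ S, 1 ≤ (f x).re ∧ (f x).re ≤ b) :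
    Growth S fun x => G (f x) := by
  obtain ⟨C, hC, hb⟩ := exists_norm_G_le (a := 1) (b := b) one_pos
  refine .of_bounded hC.le fun x hx => (hb _ (h x hx).1 (h x hx).2).trans ?_
  exact mul_le_of_le_one_right hC.le (Real.exp_le_one_iff.2 (by
    have := abs_nonneg (f x).im; linarith))

omit [NormedSpace ℂ E] in
theorem growth_Bt_comp {S : Set E} {f g : E → ℂ} (h : ∀ x ∈ S, 1 ≤ (f x).re)
    (h' : ∀ x ∈ S, 1 ≤ (g x).re) : Growth S fun x => Bt (f x) (g x) := by
  obtain ⟨C, hC, hb⟩ := exists_norm_Bt_le one_pos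
  exact .of_bounded hC.le fun x hx => hb _ _ (h x hx) (h' x hx)

omit [NormedSpace ℂ E] in
theorem Growth.prod {ι : Type*} [Fintype ι] {f : ι → E → ℂ} {S : Set E}
    (h : ∀ i, Growth S (f i)) : Growth S fun x => ∏ i, f i x := by
  classical
  suffices H : ∀ t : Finset ι, Growth S (fun x => ∏ i ∈ t, f i x) from H _
  intro t
  induction t using Finset.induction_on with
  | empty => exact .of_bounded zero_le_one fun x _ => by simp
  | insert a t ha ih =>
    simp only [Finset.prod_insert ha]
    exact (h a).mul ih

/-- One Gamma factor per integration variable supplies the decay away from `Im ℓ j s`; the rest need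
only be of subexponential growth. -/
theorem kernel_of_G {D : Set E} {n : ℕ} {l c b κ : ℝ} {ℓ : Fin n → E → ℂ}
    (hℓ : ∀ j, Differentiable ℂ (ℓ j)) (hκ : ∀ j s, ‖ℓ j s‖ ≤ κ * (1 + ‖s‖))
    (hre : ∀ j, ∀ s ∈ D, ∀ z : ℂ, l < z.re → z.re < c → 1 ≤ (ℓ j s - z).re ∧ (ℓ j s - z).re ≤ b)
    {W : E → (Fin n → ℂ) → ℂ}
    (hW : DifferentiableOn ℂ (fun q : E × (Fin n → ℂ) => W q.1 q.2) (D ×ˢ stripPi n l c))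
    (hg : Growth (D ×ˢ stripPi n l c) fun q : E × (Fin n → ℂ) => W q.1 q.2) :
    Kernel D n l c fun s z => (∏ j, G (ℓ j s - z j)) * W s z := by
  refine ⟨DifferentiableOn.mul (differentiableOn_prod fun j => differentiableOn_G_comp
    (((hℓ j).comp differentiable_fst).sub (by fun_prop)).differentiableOn fun q hq =>
      one_pos.trans_le (hre j q.1 hq.1 _ (hq.2 j).1 (hq.2 j).2).1) hW, 1 / 4, by norm_num, |κ|,
    abs_nonneg κ, fun s j => (ℓ j s).im, fun s _ j => ?_, fun ε hε => ?_⟩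
  · refine (Complex.abs_im_le_norm _).trans ((hκ j s).trans ?_)
    gcongr; exact le_abs_self κ
  · obtain ⟨C₁, hC₁, h1⟩ := exists_norm_G_le (a := 1) (b := b) one_pos
    obtain ⟨C₂, hC₂, h2⟩ := hg ε hε
    refine ⟨C₁ ^ n * (C₂ * exp (ε * (|l| + |c|)) ^ n), by positivity, fun s hs z hz => ?_⟩
    have hz' : ‖z‖ ≤ ∑ j, (|l| + |c| + |(z j).im|) := by
      refine (pi_norm_le_iff_of_nonneg (Finset.sum_nonneg fun j _ => by positivity)).2 fun j =>
        (norm_le_of_mem_strip (hz j).1 (hz j).2).trans ?_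
      exact Finset.single_le_sum (f := fun j => |l| + |c| + |(z j).im|)
        (fun j _ => by positivity) (Finset.mem_univ j)
    have h3 : ‖W s z‖ ≤ C₂ * (exp (ε * ‖s‖) * ∏ j, (exp (ε * (|l| + |c|)) *
        exp (ε * |(z j).im|))) := by
      refine (h2 (s, z) ⟨hs, hz⟩).trans (mul_le_mul_of_nonneg_left ?_ hC₂)
      simp only [← exp_add, ← Real.exp_sum]
      rw [exp_le_exp]
      have h4 : ‖(s, z)‖ ≤ ‖s‖ + ‖z‖ := by
        rw [Prod.norm_def]; exact max_le_add_of_nonneg (norm_nonneg _) (norm_nonneg _)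
      simp only [← mul_add, ← Finset.mul_sum]
      exact mul_le_mul_of_nonneg_left (by linarith) hε.le
    have h5 : ∏ j, ‖G (ℓ j s - z j)‖ ≤ ∏ j : Fin n, (C₁ * exp (-(1 / 4) * |(z j).im - (ℓ j s).im|)) := by
      refine Finset.prod_le_prod (fun j _ => norm_nonneg _) fun j _ => ?_
      have hr := hre j s hs _ (hz j).1 (hz j).2
      have := h1 _ hr.1 hr.2
      rwa [sub_im, abs_sub_comm] at this
    rw [norm_mul, norm_prod]
    refine (mul_le_mul h5 h3 (norm_nonneg _) (Finset.prod_nonneg fun j _ => by positivity)).trans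
      (le_of_eq ?_)
    simp only [prod_mul_distrib, prod_const, card_univ, Fintype.card_fin]
    ring

theorem one_le_norm_poch {N : ℕ} {z : ℂ} (hz : 2 ≤ z.re) : 1 ≤ ‖poch N z‖ := by
  rw [poch, norm_prod]
  have : ∀ k ∈ Finset.range N, (1 : ℝ) ≤ ‖z / 2 + k‖ := by
    intro k _
    have h := Complex.re_le_norm (z / 2 + k)
    have h2 : (z / 2 + k).re = z.re / 2 + k := by simp
    have : (0 : ℝ) ≤ k := Nat.cast_nonneg k
    linarith
  calc (1 : ℝ) = ∏ k ∈ Finset.range N, (1 : ℝ) := by simp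
    _ ≤ _ := Finset.prod_le_prod (fun _ _ => zero_le_one) this

theorem one_le_norm_prod {ι : Type*} [Fintype ι] {f : ι → ℂ} (h : ∀ i, 1 ≤ ‖f i‖) :
    1 ≤ ‖∏ i, f i‖ := by
  rw [norm_prod]
  calc (1 : ℝ) = ∏ i : ι, (1 : ℝ) := by simp
    _ ≤ _ := Finset.prod_le_prod (fun _ _ => zero_le_one) fun i _ => h i

theorem Divisor.poch_sub {γ₁ γ₂ : IndentedLine} {l c : ℝ} {a : ℂ} (N : ℕ)
    (h : ∀ k : ℕ, Off γ₁ γ₂ l c (a + 2 * k)) : Divisor γ₁ γ₂ l c fun z => poch N (a - z) := by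
  induction N with
  | zero => simpa [poch] using Divisor.one
  | succ N ih =>
    have := (Divisor.mul_sub (-(1 / 2)) _ (by norm_num) (h N) ih)
    convert this using 2 with z
    rw [poch_succ]; ring

theorem Divisor.poch_add {γ₁ γ₂ : IndentedLine} {l c : ℝ} {a : ℂ} (N : ℕ)
    (h : ∀ k : ℕ, Off γ₁ γ₂ l c (-a - 2 * k)) : Divisor γ₁ γ₂ l c fun z => poch N (z + a) := by
  induction N with
  | zero => simpa [poch] using Divisor.one
  | succ N ih =>
    have := (Divisor.mul_sub (1 / 2) _ (by norm_num) (h N) ih)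
    convert this using 2 with z
    rw [poch_succ]; ring

theorem off_vline_right {x y l c : ℝ} {a : ℂ} (h1 : x < a.re) (h2 : y < a.re) :
    Off (vline x) (vline y) l c a := by
  obtain ⟨X, hX, h⟩ := (vline x).joinedIn_far (ε := 1) (Or.inl rfl) (a := a) (l := y)
    (by simpa using h1) (by simpa using h2) c
  exact Off.of_right hX h

theorem off_vline_left {x y l c : ℝ} {a : ℂ} (h1 : a.re < x) (h2 : a.re < y) :
    Off (vline x) (vline y) l c a := by
  obtain ⟨X, hX, h⟩ := (vline x).joinedIn_far (ε := -1) (Or.inr rfl) (a := a) (l := y)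
    (by simpa using h1) (by simpa using h2) (-l)
  exact Off.of_left hX h

end GammaKernel

/-! ### Meromorphic continuation of the Mellin transform -/

theorem Bezout.mul_poly {E : Type*} [NormedAddCommGroup E] [NormedSpace ℂ E] {R A B f : E → ℂ}
    (h : Bezout R A B) (hf : PolyLike f) : Bezout (fun x => R x * f x) A B := by
  obtain ⟨α, β, hα, hβ, h⟩ := h
  exact ⟨_, _, hα.mul hf, hβ.mul hf, fun x => by simp only [h]; ring⟩

theorem Growth.comp {E F : Type*} [NormedAddCommGroup E] [NormedAddCommGroup F] {D : Set E}
    {f : E → ℂ} (hf : Growth D f) {S : Set F} {L : F → E} (hS : ∀ x ∈ S, L x ∈ D)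
    (hL : ∀ x, ‖L x‖ ≤ ‖x‖) : Growth S fun x => f (L x) := by
  intro ε hε
  obtain ⟨C, hC, h⟩ := hf ε hε
  refine ⟨C, hC, fun x hx => (h _ (hS x hx)).trans ?_⟩
  have := hL x
  gcongr

theorem PolyLike.sh {n : ℕ} {E : Type*} [NormedAddCommGroup E] [NormedSpace ℂ E] (j : Fin n) :
    PolyLike fun q : E × (Fin n → ℂ) => sh q.2 j := by
  cases n with
  | zero => exact j.elim0
  | succ n =>
    refine Fin.cases ?_ (fun j => ?_) j
    · simpa using PolyLike.const 0
    · simpa using PolyLike.snd_apply j.castSucc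

theorem sh_re_lt {n : ℕ} {z : Fin n → ℂ} {c : ℝ} (hc : 0 < c) (h : ∀ j, (z j).re < c) (j : Fin n) :
    (sh z j).re < c := by
  cases n with
  | zero => exact j.elim0
  | succ n =>
    refine Fin.cases ?_ (fun j => ?_) j
    · simpa
    · simpa using h _

/-- The half space `Re s_j > a`. -/
def halfPi (n : ℕ) (a : ℝ) : Set (Fin n → ℂ) := {s | ∀ j, a < (s j).re}

theorem isOpen_halfPi (n : ℕ) (a : ℝ) : IsOpen (halfPi n a) := by
  have : halfPi n a = univ.pi fun _ => {z : ℂ | a < z.re} := by ext z; simp [halfPi]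
  rw [this]
  exact isOpen_set_pi finite_univ fun _ _ => isOpen_lt continuous_const continuous_re

theorem convex_halfPi (n : ℕ) (a : ℝ) : Convex ℝ (halfPi n a) := by
  have : halfPi n a = univ.pi fun _ => {z : ℂ | a < z.re} := by ext z; simp [halfPi]
  rw [this]
  exact convex_pi fun _ _ => convex_halfSpace_re_gt a

theorem mem_stripPi_of_mem_halfPi {n : ℕ} {a : ℝ} {s : Fin n → ℂ} (h : s ∈ halfPi n a) :
    s ∈ stripPi n a (‖s‖ + 1) := fun j =>
  ⟨h j, by linarith [Complex.re_le_norm (s j), norm_le_pi_norm s j]⟩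

/-- The Mellin transform continues meromorphically, with denominators which are products of linear
factors in single variables, with bounded multiplicities, and with moderate growth. -/
def Tame {n : ℕ} (β : Fin n → ℂ) : Prop :=
  ∃ (ι : Type) (_ : Fintype ι) (Λ : ι → ℂ), ∀ N : ℕ, ∃ (K : ℕ) (F : (Fin n → ℂ) → ℂ) (M : ℝ),
    DifferentiableOn ℂ F (halfPi n (-N)) ∧ (∀ R : ℝ, Growth (stripPi n (-N) R) F) ∧
    ∀ s ∈ halfPi n M, F s = v β s * ∏ j, ∏ i, poch K (s j + Λ i)

/-- Poles are split one variable at a time, which asks for the same denominator `∏ i, poch N (s i -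
z j)` in each `z j`; `E` supplies the missing factors. As `sh z 0 = 0`, the first factor on the left
is free of `z` and is set aside as `Q`, which `Q₁` completes to a product over all `s i`. -/
theorem exists_shift_complement (n N K : ℕ) (hK : N ≤ K) :
    ∃ (E : (Fin (n + 1) → ℂ) × (Fin n → ℂ) → ℂ) (Q Q₁ : (Fin (n + 1) → ℂ) → ℂ), PolyLike E ∧
      PolyLike Q₁ ∧ (∀ s z, (∏ j : Fin n, poch N (s j.succ - sh z j)) * E (s, z) =
        Q s * ∏ j : Fin n, ∏ i, poch N (s i - z j)) ∧ ∀ s, Q s * Q₁ s = ∏ i, poch K (s i) := by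
  cases n with
  | zero =>
    exact ⟨fun _ => 1, fun _ => 1, fun s => ∏ i, poch K (s i), .const 1,
      .prod _ fun i _ => (PolyLike.apply i).poch K, by simp, by simp⟩
  | succ n =>
    have hd : ∀ i j, PolyLike fun q : (Fin (n + 1 + 1) → ℂ) × (Fin (n + 1) → ℂ) =>
        poch N (q.1 i - q.2 j) := fun i j => ((PolyLike.fst_apply i).sub (PolyLike.snd_apply j)).poch N
    refine ⟨fun q => (∏ j : Fin n, ∏ i ∈ Finset.univ.erase j.succ.succ, poch N (q.1 i - q.2 j.castSucc)) *
      ∏ i, poch N (q.1 i - q.2 (Fin.last n)), fun s => poch N (s (Fin.succ 0)),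
      fun s => poch (K - N) (s (Fin.succ 0) + 2 * N) *
        ∏ i ∈ Finset.univ.erase (Fin.succ 0), poch K (s i),
      (PolyLike.prod _ fun j _ => .prod _ fun i _ => hd _ _).mul (.prod _ fun i _ => hd _ _),
      (((PolyLike.apply _).add (.const _)).poch _).mul (.prod _ fun i _ => (PolyLike.apply i).poch K),
      fun s z => ?_, fun s => ?_⟩
    · rw [Fin.prod_univ_succ, Fin.prod_univ_castSucc]
      simp only [sh_zero, sub_zero, sh_succ]
      have : ∀ j : Fin n, ∏ i, poch N (s i - z j.castSucc) =
          poch N (s j.succ.succ - z j.castSucc) *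
            ∏ i ∈ Finset.univ.erase j.succ.succ, poch N (s i - z j.castSucc) := fun j =>
        (Finset.mul_prod_erase _ _ (Finset.mem_univ _)).symm
      rw [prod_congr rfl fun j _ => this j, prod_mul_distrib]
      ring
    · rw [← mul_assoc, ← poch_add, Nat.add_sub_cancel' hK,
        Finset.mul_prod_erase Finset.univ (fun i => poch K (s i)) (Finset.mem_univ _)]

/-- The shifts of the poles in the recursion. -/
def shifts (τ : ℂ) : Fin 4 → ℂ := ![0, 0, τ, -τ]

theorem norm_shifts_le (τ : ℂ) (a : Fin 4) : ‖shifts τ a‖ ≤ ‖τ‖ := by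
  fin_cases a <;> simp [shifts]

/-- The same completion for the four families of denominators of `recK`. In the second identity the
factors in `s 0 ± τ` account for the two Gamma functions in front of the recursion. -/
theorem exists_complement (n N K : ℕ) (hK : N ≤ K) (τ : ℂ) :
    ∃ (C : (Fin (n + 1) → ℂ) × (Fin n → ℂ) → ℂ) (Q C₂ : (Fin (n + 1) → ℂ) → ℂ), PolyLike C ∧
      PolyLike C₂ ∧ (∀ s z, (∏ j : Fin n, (poch N (s j.succ - z j - τ) * (poch N (s j.succ - z j + τ) *
        (poch N (s j.succ - sh z j) * poch N (s j.castSucc - z j))))) * C (s, z) =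
        Q s * ∏ j : Fin n, ∏ a, ∏ i, poch N (s i + shifts τ a - z j)) ∧
      ∀ s, poch K (s 0 + τ) * poch K (s 0 - τ) * (Q s * C₂ s) =
        ∏ a, ∏ i, poch K (s i + shifts τ a) := by
  obtain ⟨E, Q, Q₁, hE, hQ₁, h1, h2⟩ := exists_shift_complement n N K hK
  have hd : ∀ (a : ℂ) i j, PolyLike fun q : (Fin (n + 1) → ℂ) × (Fin n → ℂ) =>
      poch N (q.1 i - q.2 j + a) := fun a i j =>
    (((PolyLike.fst_apply i).sub (PolyLike.snd_apply j)).add (.const a)).poch N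
  have hp : ∀ a, PolyLike fun q : (Fin (n + 1) → ℂ) × (Fin n → ℂ) =>
      ∏ j : Fin n, ∏ i ∈ Finset.univ.erase j.succ, poch N (q.1 i - q.2 j + a) := fun a =>
    .prod _ fun j _ => .prod _ fun i _ => hd _ _ _
  have hp' : PolyLike fun q : (Fin (n + 1) → ℂ) × (Fin n → ℂ) =>
      ∏ j : Fin n, ∏ i ∈ Finset.univ.erase j.castSucc, poch N (q.1 i - q.2 j + 0) :=
    .prod _ fun j _ => .prod _ fun i _ => hd _ _ _
  have hq : ∀ a, PolyLike fun s : Fin (n + 1) → ℂ =>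
      ∏ i ∈ Finset.univ.erase 0, poch K (s i + a) := fun a =>
    .prod _ fun i _ => ((PolyLike.apply i).add (.const a)).poch K
  refine ⟨_, Q, _, ((hE.mul hp').mul ((hp τ).mul (hp (-τ)))),
    (hQ₁.mul (PolyLike.prod Finset.univ fun i _ => (PolyLike.apply i).poch K)).mul
      ((hq τ).mul (hq (-τ))), fun s z => ?_, fun s => ?_⟩
  · have e : ∀ (a : ℂ) (f : Fin n → Fin (n + 1)), ∏ j : Fin n, ∏ i, poch N (s i - z j + a) =
        (∏ j : Fin n, poch N (s (f j) - z j + a)) *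
          ∏ j : Fin n, ∏ i ∈ Finset.univ.erase (f j), poch N (s i - z j + a) := fun a f => by
      rw [← prod_mul_distrib]
      exact prod_congr rfl fun j _ =>
        (Finset.mul_prod_erase _ _ (Finset.mem_univ (f j))).symm
    have e1 := e τ Fin.succ
    have e2 := e (-τ) Fin.succ
    have e3 := e 0 Fin.castSucc
    have e4 := h1 s z
    have e5 : ∀ (a : ℂ) i j, s i + a - z j = s i - z j + a := fun a i j => by ring
    simp only [shifts, Fin.prod_univ_four, Matrix.cons_val, e5, prod_mul_distrib, e1, e2]
    simp only [add_zero] at e3 ⊢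
    rw [e3] at e4 ⊢
    simp only [sub_eq_add_neg _ τ]
    linear_combination ((∏ j : Fin n, poch N (s j.succ - z j + -τ)) *
      (∏ j : Fin n, poch N (s j.succ - z j + τ)) * (∏ j : Fin n, poch N (s j.castSucc - z j)) *
      (∏ j : Fin n, ∏ i ∈ Finset.univ.erase j.castSucc, poch N (s i - z j)) *
      (∏ j : Fin n, ∏ i ∈ Finset.univ.erase j.succ, poch N (s i - z j + τ)) *
      (∏ j : Fin n, ∏ i ∈ Finset.univ.erase j.succ, poch N (s i - z j + -τ))) * e4
  · have e : ∀ a : ℂ, ∏ i, poch K (s i + a) = poch K (s 0 + a) *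
        ∏ i ∈ Finset.univ.erase 0, poch K (s i + a) := fun a =>
      (Finset.mul_prod_erase _ _ (Finset.mem_univ _)).symm
    have e4 := h2 s
    simp only [shifts, Fin.prod_univ_four, Matrix.cons_val, e τ, e (-τ), add_zero, ← e4]
    simp only [sub_eq_add_neg _ τ]
    ring

/-- Trades a factor of `recK` for a shifted one that is regular far to the left, at the price of
explicit linear factors. -/
theorem link_shift (N : ℕ) {x₁ x₂ x₃ x₄ : ℂ} (h₁ : 0 < x₁.re) (h₂ : 0 < x₂.re) (h₃ : 0 < x₃.re)
    (h₄ : 0 < x₄.re) : G (x₁ + 2 * N) * (G (x₂ + 2 * N) * (Bt (x₃ + 2 * N) (x₄ + 2 * N) *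
      poch (N + N) (x₃ + x₄))) = (G x₁ * (G x₂ * Bt x₃ x₄)) *
        (poch N x₁ * (poch N x₂ * (poch N x₃ * poch N x₄))) := by
  have i₁ := ne_neg_two_mul_of_re_pos h₁
  have i₂ := ne_neg_two_mul_of_re_pos h₂
  have i₃ := ne_neg_two_mul_of_re_pos h₃
  have i₄ := ne_neg_two_mul_of_re_pos h₄
  rw [G_add N i₁, G_add N i₂, Bt_eq_shift N i₃ i₄]
  have n₃ := poch_ne_zero_of_ne i₃ N
  have n₄ := poch_ne_zero_of_ne i₄ N
  field_simp

theorem tame_zero (β : Fin 0 → ℂ) : Tame β := by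
  refine ⟨Fin 0, inferInstance, fun _ => 0, fun N => ⟨0, v β, 0, ?_, fun R => ?_, fun s _ => by simp⟩⟩
  · have : v β = fun _ => v β 0 := by funext s; rw [Subsingleton.elim s 0]
    rw [this]; exact differentiableOn_const _
  · exact .of_bounded (norm_nonneg (v β 0)) fun s _ => by rw [Subsingleton.elim s 0]

/-- The recursion writes `v` as a contour integral of the transform in one variable less, already
continued. Multiplied by suitable linear factors it becomes a `splitIntegral`, which is holomorphic
of moderate growth in `s` as soon as its left line is to the left of all poles of the kernel and its
right line to the right of all poles of the inner transform. -/
theorem tame_succ {n : ℕ} {β : Fin (n + 1) → ℂ} (h : Tame fun j : Fin n => β j.castSucc) :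
    Tame β := by
  obtain ⟨ι, _, Λ, h⟩ := h
  set τ := -(2 * β (Fin.last n)) with hτ
  set T := ‖τ‖ with hT
  have hT0 : 0 ≤ T := norm_nonneg _
  have hτre : |τ.re| ≤ T := abs_re_le_norm τ
  have hsre : ∀ a, |(shifts τ a).re| ≤ T := fun a =>
    (abs_re_le_norm _).trans (norm_shifts_le τ a)
  set m := absc n fun j => (β j.castSucc).re with hm
  have hm0 : 0 ≤ m := absc_nonneg _
  refine ⟨(Fin n × Fin 4 × ι) ⊕ Fin 4, inferInstance,
    Sum.elim (fun q => shifts τ q.2.1 + Λ q.2.2) (shifts τ), fun N => ?_⟩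
  obtain ⟨N₁, hN₁⟩ := exists_nat_ge ((N : ℝ) + T + 4)
  obtain ⟨K₁, F₁, M₁, hF₁, hg₁, he₁⟩ := h N₁
  have hN0 : (0 : ℝ) ≤ N := Nat.cast_nonneg N
  set L := ∑ i, ‖Λ i‖ with hL
  have hL0 : 0 ≤ L := Finset.sum_nonneg fun i _ => norm_nonneg _
  have hΛ : ∀ i, |(Λ i).re| ≤ L := fun i => (abs_re_le_norm _).trans
    (Finset.single_le_sum (f := fun i => ‖Λ i‖) (fun i _ => norm_nonneg _) (Finset.mem_univ i))
  -- The right line lies beyond `M₁`, beyond the abscissa of convergence `m` and at least `2` beyond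
  -- every root `-Λ i`. The left line `l'` lies at least `2` to the left of every `s i + shifts τ a`
  -- with `Re s i > -N`. The margin `2` gives the lower bound `1` for the linear factors.
  set c' := |M₁| + m + L + T + 3 with hc'
  set c := c' + 1 with hc
  set l' := -((N : ℝ) + T + 3) with hl'
  set l := l' - 1 with hl
  have hM₁ := abs_nonneg M₁
  have hM₁' := le_abs_self M₁
  obtain ⟨N', hN'⟩ := exists_nat_ge ((N : ℝ) + T + c)
  set N₂ := N' + 1 with hN₂d
  have hN₂ : (N : ℝ) + T + c + 1 ≤ N₂ := by rw [hN₂d]; push_cast; linarith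
  have hN₂0 : (0 : ℝ) ≤ N₂ := Nat.cast_nonneg _
  set K := K₁ + N' + 1 with hK
  obtain ⟨C, Q, C₂, hC, hC₂, hCQ, hQC⟩ := exists_complement n N₂ K (by omega) τ
  have hfs : ∀ i, PolyLike fun q : (Fin (n + 1) → ℂ) × ℂ => q.1 i := fun i => PolyLike.fst_apply i
  have hA : PolyLike fun q : (Fin (n + 1) → ℂ) × ℂ => ∏ i, poch K₁ (q.2 + Λ i) :=
    .prod _ fun i _ => (PolyLike.snd.add (.const _)).poch _
  have hB₁ : ∀ i a, PolyLike fun q : (Fin (n + 1) → ℂ) × ℂ => poch N₂ (q.1 i + shifts τ a - q.2) :=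
    fun i a => (((hfs i).add (.const _)).sub PolyLike.snd).poch _
  have hB : PolyLike fun q : (Fin (n + 1) → ℂ) × ℂ => ∏ a, ∏ i, poch N₂ (q.1 i + shifts τ a - q.2) :=
    .prod _ fun a _ => .prod _ fun i _ => hB₁ i a
  have hbez : Bezout (fun q : (Fin (n + 1) → ℂ) × ℂ =>
      ∏ a, ∏ i, ∏ k, poch K (q.1 i + (shifts τ a + Λ k)))
      (fun q => ∏ i, poch K₁ (q.2 + Λ i)) (fun q => ∏ a, ∏ i, poch N₂ (q.1 i + shifts τ a - q.2)) := by
    refine .prod_right (fun a => .prod_right (fun i => .prod_left (fun k => ?_)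
      (fun i => (PolyLike.snd.add (.const _)).poch _) (hB₁ i a)) hA fun i => hB₁ i a) hA
      fun a => .prod _ fun i _ => hB₁ i a
    have hf : PolyLike fun q : (Fin (n + 1) → ℂ) × ℂ => q.2 + Λ k := PolyLike.snd.add (.const _)
    have hg : PolyLike fun q : (Fin (n + 1) → ℂ) × ℂ => q.1 i + shifts τ a - q.2 :=
      ((hfs i).add (.const _)).sub PolyLike.snd
    -- The Vandermonde identity produces one factor less than `poch K`; the missing factor is
    -- multiplied on, so that one `K` serves throughout.
    have h1 := Bezout.poch hf hg (M := K₁ + N') (K := K₁) (N := N₂) (by omega)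
    have h2 : PolyLike fun q : (Fin (n + 1) → ℂ) × ℂ =>
        (q.2 + Λ k + (q.1 i + shifts τ a - q.2)) / 2 + ((K₁ + N' : ℕ) : ℂ) := by
      simpa only [div_eq_mul_inv] using ((hf.add hg).mul (.const 2⁻¹)).add (.const _)
    convert h1.mul_poly h2 using 2 with q
    rw [← poch_succ]
    congr 1; ring
  obtain ⟨α, γ, hα, hγ, hR⟩ := hbez
  set A : ℂ → ℂ := fun z => ∏ i, poch K₁ (z + Λ i) with hAd
  set B : (Fin (n + 1) → ℂ) → ℂ → ℂ := fun s z => ∏ a, ∏ i, poch N₂ (s i + shifts τ a - z) with hBd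
  set W : (Fin (n + 1) → ℂ) → (Fin n → ℂ) → ℂ := fun s z => F₁ z *
    (∏ j : Fin n, (G (s j.succ - z j + τ + 2 * N₂) * (Bt (s j.succ - sh z j + 2 * N₂)
      (s j.castSucc - z j + 2 * N₂) * poch (N₂ + N₂) (s j.succ - sh z j + (s j.castSucc - z j))))) *
      C (s, z) with hW
  set U : (Fin (n + 1) → ℂ) → (Fin n → ℂ) → ℂ := fun s z =>
    (∏ j : Fin n, G (s j.succ - τ + 2 * N₂ - z j)) * W s z with hUd
  set J := splitIntegral n l' c' U (fun _ => A) (fun _ => B) (fun _ s z => α (s, z))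
    (fun _ s z => γ (s, z)) with hJ
  have hcpos : 0 < c := by simp only [hc, hc']; linarith
  have hU : ∀ R : ℝ, Kernel (stripPi (n + 1) (-N) R) n l c U := by
    intro R
    refine kernel_of_G (b := R + T + 2 * N₂ - l) (κ := 1 + T + 2 * N₂) (fun j => by fun_prop)
      (fun j s => ?_) (fun j s hs z hz1 hz2 => ?_) ?_ ?_
    · have h1 := norm_le_pi_norm s j.succ
      have h2 : ‖s j.succ - τ + 2 * (N₂ : ℂ)‖ ≤ ‖s j.succ‖ + T + 2 * N₂ := by
        refine (norm_add_le _ _).trans (add_le_add (norm_sub_le _ _) ?_)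
        simp
      have := norm_nonneg s
      nlinarith [mul_nonneg hT0 this, mul_nonneg hN₂0 this]
    · have h1 := (hs j.succ).1
      have h2 := (hs j.succ).2
      have h3 := abs_le.1 hτre
      simp only [sub_re, add_re, mul_re, Complex.re_ofNat,
        Complex.natCast_re, Complex.im_ofNat, zero_mul, sub_zero]
      constructor <;> linarith
    · have hpl : ∀ j : Fin n, (∀ q ∈ stripPi (n + 1) (-N) R ×ˢ stripPi n l c,
          0 < (q.1 j.succ - q.2 j + τ + 2 * (N₂ : ℂ)).re) ∧
          (∀ q ∈ stripPi (n + 1) (-N) R ×ˢ stripPi n l c,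
          0 < (q.1 j.succ - sh q.2 j + 2 * (N₂ : ℂ)).re) ∧
          (∀ q ∈ stripPi (n + 1) (-N) R ×ˢ stripPi n l c,
          0 < (q.1 j.castSucc - q.2 j + 2 * (N₂ : ℂ)).re) := by
        intro j
        refine ⟨fun q hq => ?_, fun q hq => ?_, fun q hq => ?_⟩ <;>
        · have h1 := (hq.1 j.succ).1
          have h1' := (hq.1 j.castSucc).1
          have h2 := (hq.2 j).2
          have h3 := abs_le.1 hτre
          have h4 := sh_re_lt hcpos (fun j => (hq.2 j).2) j
          simp only [sub_re, add_re, mul_re, Complex.re_ofNat,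
            Complex.natCast_re, Complex.im_ofNat, zero_mul, sub_zero]
          linarith
      refine DifferentiableOn.mul (DifferentiableOn.mul ?_ (differentiableOn_prod fun j => ?_))
        hC.1.differentiableOn
      · refine hF₁.comp differentiable_snd.differentiableOn fun q hq j => ?_
        have := (hq.2 j).1
        linarith
      · have x1 := (PolyLike.fst_apply (F := Fin n → ℂ) j.succ)
        have x2 := (PolyLike.fst_apply (F := Fin n → ℂ) j.castSucc)
        have y1 := (PolyLike.snd_apply (E := Fin (n + 1) → ℂ) j)
        have y2 := (PolyLike.sh (E := Fin (n + 1) → ℂ) j)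
        exact (differentiableOn_G_comp (((x1.sub y1).add (.const τ)).add
          (.const (2 * (N₂ : ℂ)))).1.differentiableOn (hpl j).1).mul
          ((differentiableOn_Bt_comp ((x1.sub y2).add (.const (2 * (N₂ : ℂ)))).1.differentiableOn
          ((x2.sub y1).add (.const (2 * (N₂ : ℂ)))).1.differentiableOn (hpl j).2.1 (hpl j).2.2).mul
          (((x1.sub y2).add (x2.sub y1)).poch _).1.differentiableOn)
    · refine Growth.mul (Growth.mul ?_ (Growth.prod fun j => ?_)) (hC.growth _)
      · refine (hg₁ c).comp (L := fun q : (Fin (n + 1) → ℂ) × (Fin n → ℂ) => q.2)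
          (fun q hq j => ⟨?_, (hq.2 j).2⟩) fun q => norm_snd_le q
        have := (hq.2 j).1
        linarith
      · have x1 := (PolyLike.fst_apply (F := Fin n → ℂ) j.succ)
        have x2 := (PolyLike.fst_apply (F := Fin n → ℂ) j.castSucc)
        have y1 := (PolyLike.snd_apply (E := Fin (n + 1) → ℂ) j)
        have y2 := (PolyLike.sh (E := Fin (n + 1) → ℂ) j)
        refine (growth_G_comp (b := R + T + 2 * N₂ - l) fun q hq => ?_).mul
          ((growth_Bt_comp (fun q hq => ?_) fun q hq => ?_).mul
            ((((x1.sub y2).add (x2.sub y1)).poch _).growth _)) <;>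
        · have h1 := hq.1 j.succ
          have h1' := (hq.1 j.castSucc).1
          have h2 := hq.2 j
          have h3 := abs_le.1 hτre
          have h4 := sh_re_lt hcpos (fun j => (hq.2 j).2) j
          simp only [sub_re, add_re, mul_re, Complex.re_ofNat,
            Complex.natCast_re, Complex.im_ofNat, zero_mul, sub_zero]
          first | linarith | (constructor <;> linarith [h1.1, h1.2, h2.1, h2.2])
  have hspec := fun R : ℝ => splitIntegral_spec (isOpen_stripPi (n + 1) (-N) R) (l := l) (c := c)
    (l' := l') (c' := c') (by linarith) (by linarith) (by linarith)
    (hU R) (A := fun _ => A) (B := fun _ => B) (α := fun _ s z => α (s, z))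
    (β := fun _ s z => γ (s, z))
    (R := fun _ s => ∏ a, ∏ i, ∏ k, poch K (s i + (shifts τ a + Λ k)))
    (fun _ => hA.1.comp (f := fun z => ((0 : Fin (n + 1) → ℂ), z)) (by fun_prop)) (fun _ => hB.1)
    (fun _ => hα) (fun _ => hγ) (fun _ s z => hR (s, z))
    (fun _ z hz => one_le_norm_prod fun i => one_le_norm_poch (by
      have := abs_le.1 (hΛ i)
      rw [add_re, hz]; linarith))
    (fun _ s hs z hz => one_le_norm_prod fun a => one_le_norm_prod fun i => one_le_norm_poch (by
      have := abs_le.1 (hsre a)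
      have := (hs i).1
      rw [sub_re, add_re, hz]; linarith))
  have hK2 : (N : ℝ) + T + 1 ≤ 2 * K := by
    have : (N₂ : ℝ) ≤ K := by exact_mod_cast (by omega : N₂ ≤ K)
    linarith
  have hGpos : ∀ s ∈ halfPi (n + 1) (-(N : ℝ)), 1 ≤ (s 0 + τ + 2 * (K : ℂ)).re ∧
      1 ≤ (s 0 - τ + 2 * (K : ℂ)).re := by
    intro s hs
    have h1 := hs 0
    have h3 := abs_le.1 hτre
    simp only [sub_re, add_re, mul_re, Complex.re_ofNat,
      Complex.natCast_re, Complex.im_ofNat, zero_mul, sub_zero]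
    constructor <;> linarith
  refine ⟨K, fun s => 1 / (4 * Real.pi * I : ℂ) ^ n *
    (G (s 0 + τ + 2 * K) * G (s 0 - τ + 2 * K)) * C₂ s * J s, c' + T + 1, ?_, fun R => ?_,
    fun s hs => ?_⟩
  · have hJd : DifferentiableOn ℂ J (halfPi (n + 1) (-N)) := fun s hs =>
      ((hspec (‖s‖ + 1)).1.differentiableAt ((isOpen_stripPi _ _ _).mem_nhds
        (mem_stripPi_of_mem_halfPi hs))).differentiableWithinAt
    refine ((DifferentiableOn.const_mul ((differentiableOn_G_comp (by fun_prop) fun s hs =>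
      one_pos.trans_le (hGpos s hs).1).mul (differentiableOn_G_comp (by fun_prop) fun s hs =>
      one_pos.trans_le (hGpos s hs).2)) _).mul hC₂.1.differentiableOn).mul hJd
  · refine (((PolyLike.const _).growth _).mul (Growth.mul (growth_G_comp (b := R + T + 2 * K)
      fun s hs => ?_) (growth_G_comp (b := R + T + 2 * K) fun s hs => ?_))).mul (hC₂.growth _)
      |>.mul (hspec R).2.1
    · refine ⟨(hGpos s fun j => (hs j).1).1, ?_⟩
      have h1 := (hs 0).2
      have h3 := abs_le.1 hτre
      simp only [add_re, mul_re, Complex.re_ofNat,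
        Complex.natCast_re, Complex.im_ofNat, zero_mul, sub_zero]
      linarith
    · refine ⟨(hGpos s fun j => (hs j).1).2, ?_⟩
      have h1 := (hs 0).2
      have h3 := abs_le.1 hτre
      simp only [sub_re, add_re, mul_re, Complex.re_ofNat,
        Complex.natCast_re, Complex.im_ofNat, zero_mul, sub_zero]
      linarith
  · have h3 := abs_le.1 hτre
    have hc'0 : 0 ≤ c' := by linarith
    have hsN : s ∈ halfPi (n + 1) (-(N : ℝ)) := fun j => by have := hs j; linarith
    -- For `s` far to the right the recursion holds on the straight lines through `c'`, on which the
    -- `splitIntegral` can also be evaluated; comparison of the two integrands identifies the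
    -- continuation.
    have hrec := rec_identity (s := s) (c := fun _ => c') hτ
      (fun j => by have := hs j.succ; linarith) (fun j => by have := hs j.succ; linarith)
      (fun j => by have := hs j.succ; have := sh_const_re_le c' hc'0 j; linarith)
      (fun j => by have := hs j.castSucc; linarith) (by have := hs 0; linarith)
      (by have := hs 0; linarith) (convAbs_wAbs _ _ fun j => by simp only [ofReal_re]; linarith)
    have hJs := (hspec (‖s‖ + 1)).2.2 s (mem_stripPi_of_mem_halfPi hsN) (fun _ => vline c')
      (fun j t => by rw [vline_path_re]; constructor <;> linarith)
      (fun j => .prod _ fun a _ => .prod _ fun i _ => .poch_sub _ fun k => by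
        have h5 := abs_le.1 (hsre a)
        have h6 := hs i
        have h7 : (0 : ℝ) ≤ k := Nat.cast_nonneg k
        have h8 : (s i + shifts τ a + 2 * (k : ℂ)).re = (s i).re + (shifts τ a).re + 2 * k := by simp
        refine off_vline_right ?_ ?_ <;> rw [h8] <;> linarith)
      (fun j => .prod _ fun i _ => .poch_add _ fun k => by
        have h5 := abs_le.1 (hΛ i)
        have h7 : (0 : ℝ) ≤ k := Nat.cast_nonneg k
        have h8 : (-Λ i - 2 * (k : ℂ)).re = -(Λ i).re - 2 * k := by simp
        refine off_vline_left ?_ ?_ <;> rw [h8] <;> linarith)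
    have hint : ∀ t : Fin n → ℝ, U s (fun j => (vline c').path (t j)) *
        ∏ j, (deriv (vline c').path (t j) * ((A ((vline c').path (t j)))⁻¹ *
          (B s ((vline c').path (t j)))⁻¹)) =
        I ^ n * Q s * (recK τ s (vpt (fun _ => c') t) *
          v (fun j => β j.castSucc) (vpt (fun _ => c') t)) := by
      intro t
      set z := vpt (fun _ => c') t with hz
      have hzre : ∀ j, (z j).re = c' := fun j => by simp [hz, vpt]
      change U s z * ∏ j, (deriv (vline c').path (t j) * ((A (z j))⁻¹ * (B s (z j))⁻¹)) = _
      simp only [deriv_vline, prod_mul_distrib, prod_const, card_univ,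
        Fintype.card_fin, Finset.prod_inv_distrib]
      have hA0 : ∏ j, A (z j) ≠ 0 := Finset.prod_ne_zero_iff.2 fun j _ =>
        Finset.prod_ne_zero_iff.2 fun i _ => poch_ne_zero_of_ne (ne_neg_two_mul_of_re_pos (by
          have := abs_le.1 (hΛ i)
          rw [add_re, hzre]; linarith)) _
      have hB0 : ∏ j, B s (z j) ≠ 0 := Finset.prod_ne_zero_iff.2 fun j _ =>
        Finset.prod_ne_zero_iff.2 fun a _ => Finset.prod_ne_zero_iff.2 fun i _ =>
          poch_ne_zero_of_ne (ne_neg_two_mul_of_re_pos (by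
          have := abs_le.1 (hsre a)
          have := hs i
          rw [sub_re, add_re, hzre]; linarith)) _
      have hF : F₁ z = v (fun j => β j.castSucc) z * ∏ j, A (z j) := he₁ z fun j => by
        rw [hzre]; linarith
      have hshz : ∀ j, (sh z j).re ≤ c' := fun j =>
        le_of_forall_pos_lt_add fun ε hε =>
          sh_re_lt (by linarith) (fun j => by rw [hzre]; linarith) j
      have hlink : (∏ j : Fin n, G (s j.succ - τ + 2 * N₂ - z j)) *
          (∏ j : Fin n, (G (s j.succ - z j + τ + 2 * N₂) * (Bt (s j.succ - sh z j + 2 * N₂)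
          (s j.castSucc - z j + 2 * N₂) * poch (N₂ + N₂) (s j.succ - sh z j + (s j.castSucc - z j)))))
          = recK τ s z * ∏ j : Fin n, (poch N₂ (s j.succ - z j - τ) * (poch N₂ (s j.succ - z j + τ) *
        (poch N₂ (s j.succ - sh z j) * poch N₂ (s j.castSucc - z j)))) := by
        rw [recK, ← prod_mul_distrib, ← prod_mul_distrib]
        refine prod_congr rfl fun j _ => ?_
        rw [← link_shift N₂]
        · congr 2; ring
        all_goals
          have h5 := hs j.succ
          have h6 := hs j.castSucc
          have h7 := hzre j
          have h8 := hshz j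
          simp only [sub_re, add_re]
          linarith
      have hprod := hCQ s z
      have hBp : ∏ j : Fin n, ∏ a, ∏ i, poch N₂ (s i + shifts τ a - z j) = ∏ j, B s (z j) := rfl
      rw [hBp] at hprod
      calc _ = ((∏ j : Fin n, G (s j.succ - τ + 2 * N₂ - z j)) *
          (∏ j : Fin n, (G (s j.succ - z j + τ + 2 * N₂) * (Bt (s j.succ - sh z j + 2 * N₂)
          (s j.castSucc - z j + 2 * N₂) * poch (N₂ + N₂) (s j.succ - sh z j + (s j.castSucc - z j)))))) *
          C (s, z) * F₁ z * (I ^ n * ((∏ j, A (z j))⁻¹ * (∏ j, B s (z j))⁻¹)) := by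
            simp only [hUd, hW]; ring
        _ = recK τ s z * ((∏ j : Fin n, (poch N₂ (s j.succ - z j - τ) * (poch N₂ (s j.succ - z j + τ) *
        (poch N₂ (s j.succ - sh z j) * poch N₂ (s j.castSucc - z j))))) * C (s, z)) * F₁ z *
          (I ^ n * ((∏ j, A (z j))⁻¹ * (∏ j, B s (z j))⁻¹)) := by rw [hlink]; ring
        _ = _ := by rw [hprod, hF]; field_simp
    simp only [hint] at hJs
    rw [integral_const_mul] at hJs
    have hJ' : J s = _ := hJs
    have hg1 := G_add K (z := s 0 + τ) (ne_neg_two_mul_of_re_pos (by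
      have := hs 0; rw [add_re]; linarith))
    have hg2 := G_add K (z := s 0 - τ) (ne_neg_two_mul_of_re_pos (by
      have := hs 0; rw [sub_re]; linarith))
    have hprods : ∏ i, ∏ k : (Fin n × Fin 4 × ι) ⊕ Fin 4, poch K (s i +
        Sum.elim (fun q => shifts τ q.2.1 + Λ q.2.2) (shifts τ) k) =
        (∏ _j : Fin n, ∏ a, ∏ i, ∏ k, poch K (s i + (shifts τ a + Λ k))) *
          ∏ a, ∏ i, poch K (s i + shifts τ a) := by
      simp only [Fintype.prod_sum_type, Sum.elim_inl, Sum.elim_inr, prod_mul_distrib,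
        Fintype.prod_prod_type]
      congr 1
      · rw [Finset.prod_comm]
        refine prod_congr rfl fun _ _ => Finset.prod_comm
      · exact Finset.prod_comm
    simp only
    rw [hprods, ← hQC s, hg1, hg2, hJ', hrec, mul_pow]
    have hI : I ^ n ≠ 0 := pow_ne_zero _ Complex.I_ne_zero
    have hpi : (4 * (Real.pi : ℂ)) ^ n ≠ 0 :=
      pow_ne_zero _ (mul_ne_zero (by norm_num) (by exact_mod_cast pi_ne_zero))
    field_simp

/-- The Mellin transform of the Whittaker function is tame. -/
theorem tame {n : ℕ} (β : Fin n → ℂ) : Tame β := by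
  induction n with
  | zero => exact tame_zero β
  | succ n ih => exact tame_succ (ih _)

section
/-! ### The Whittaker function in logarithmic coordinates -/

variable {n : ℕ}

/-! ### Change of variables from the orthant -/

section Orthant

variable (L : (Fin n → ℝ) ≃L[ℝ] (Fin n → ℝ)) (d : Fin n → ℝ)

/-- Exponential coordinates on the orthant. -/
def expMap (x : Fin n → ℝ) (j : Fin n) : ℝ := exp (L x j + d j)

theorem expMap_pos (x : Fin n → ℝ) (j : Fin n) : 0 < expMap L d x j := exp_pos _

theorem image_expMap : expMap L d '' univ = orthant n := by
  ext y
  simp only [image_univ, mem_range, orthant, mem_univ_pi, mem_Ioi]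
  constructor
  · rintro ⟨x, rfl⟩ j
    exact expMap_pos L d x j
  · intro h
    refine ⟨L.symm fun j => Real.log (y j) - d j, ?_⟩
    ext j
    simp [expMap, exp_log (h j)]

theorem injective_expMap : Function.Injective (expMap L d) := fun x y h => by
  apply L.injective
  ext j
  have := Real.exp_injective (congrFun h j)
  linarith

/-- The derivative of `expMap`. -/
def expMapDeriv (x : Fin n → ℝ) : (Fin n → ℝ) →L[ℝ] (Fin n → ℝ) :=
  (ContinuousLinearMap.pi fun j => (expMap L d x j • ContinuousLinearMap.id ℝ ℝ).comp
    (ContinuousLinearMap.proj j)).comp (L : (Fin n → ℝ) →L[ℝ] (Fin n → ℝ))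

theorem hasFDerivAt_expMap (x : Fin n → ℝ) : HasFDerivAt (expMap L d) (expMapDeriv L d x) x := by
  rw [hasFDerivAt_pi']
  intro j
  have h1 : HasFDerivAt (fun x => L x j + d j)
      ((ContinuousLinearMap.proj j).comp (L : (Fin n → ℝ) →L[ℝ] (Fin n → ℝ))) x :=
    ((ContinuousLinearMap.proj (R := ℝ) (φ := fun _ : Fin n => ℝ) j).comp
      (L : (Fin n → ℝ) →L[ℝ] (Fin n → ℝ))).hasFDerivAt.add_const _
  exact h1.exp

theorem abs_det_expMapDeriv (x : Fin n → ℝ) : |(expMapDeriv L d x).det| =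
    |(L : (Fin n → ℝ) →L[ℝ] (Fin n → ℝ)).det| * ∏ j, expMap L d x j := by
  have h : (expMapDeriv L d x).det = (∏ j, expMap L d x j) *
      (L : (Fin n → ℝ) →L[ℝ] (Fin n → ℝ)).det := by
    refine (LinearMap.det_comp _ _).trans (congrArg (· * _) ?_)
    refine (ContinuousLinearMap.det_pi fun j => expMap L d x j • ContinuousLinearMap.id ℝ ℝ).trans ?_
    simp [ContinuousLinearMap.det]
  rw [h, abs_mul, mul_comm, abs_of_pos (Finset.prod_pos fun j _ => expMap_pos L d x j)]

theorem integral_orthant (f : (Fin n → ℝ) → ℂ) : ∫ t in orthant n, f t =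
    |(L : (Fin n → ℝ) →L[ℝ] (Fin n → ℝ)).det| *
      ∫ x, (∏ j, (expMap L d x j : ℂ)) * f (expMap L d x) := by
  rw [← image_expMap L d, integral_image_eq_integral_abs_det_fderiv_smul volume
    MeasurableSet.univ (fun x _ => (hasFDerivAt_expMap L d x).hasFDerivWithinAt)
    (injective_expMap L d).injOn, Measure.restrict_univ, ← integral_const_mul]
  refine integral_congr_ae (Eventually.of_forall fun x => ?_)
  simp [abs_det_expMapDeriv, mul_assoc]

theorem abs_det_pos : 0 < |(L : (Fin n → ℝ) →L[ℝ] (Fin n → ℝ)).det| :=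
  abs_pos.2 L.toLinearEquiv.isUnit_det'.ne_zero

theorem integrableOn_orthant_iff (f : (Fin n → ℝ) → ℂ) : IntegrableOn f (orthant n) ↔
    Integrable fun x => (∏ j, (expMap L d x j : ℂ)) * f (expMap L d x) := by
  rw [← image_expMap L d, integrableOn_image_iff_integrableOn_abs_det_fderiv_smul volume
    MeasurableSet.univ (fun x _ => (hasFDerivAt_expMap L d x).hasFDerivWithinAt)
    (injective_expMap L d).injOn, integrableOn_univ]
  have h : (fun x => |(expMapDeriv L d x).det| • f (expMap L d x)) = fun x =>
      ((|(L : (Fin n → ℝ) →L[ℝ] (Fin n → ℝ)).det| : ℝ) : ℂ) *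
        ((∏ j, (expMap L d x j : ℂ)) * f (expMap L d x)) := by
    ext x; simp [abs_det_expMapDeriv, mul_assoc]
  rw [h, integrable_const_mul_iff]
  exact (Complex.ofReal_ne_zero.2 (abs_det_pos L).ne').isUnit

theorem integral_orthant_add (d : Fin n → ℝ) (f : (Fin n → ℝ) → ℂ) : ∫ t in orthant n, f t =
    ∫ x : Fin n → ℝ, (∏ j, (exp (x j + d j) : ℂ)) * f fun j => exp (x j + d j) := by
  rw [integral_orthant (ContinuousLinearEquiv.refl ℝ _) d]
  simp [expMap, ContinuousLinearMap.det]
  rfl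

theorem integral_orthant_neg_add (d : Fin n → ℝ) (f : (Fin n → ℝ) → ℂ) : ∫ t in orthant n, f t =
    ∫ x : Fin n → ℝ, (∏ j, (exp (-x j + d j) : ℂ)) * f fun j => exp (-x j + d j) := by
  rw [integral_orthant (ContinuousLinearEquiv.neg ℝ) d]
  have : |((ContinuousLinearEquiv.neg ℝ : (Fin n → ℝ) ≃L[ℝ] (Fin n → ℝ)) :
      (Fin n → ℝ) →L[ℝ] (Fin n → ℝ)).det| = 1 := by
    have h : (((ContinuousLinearEquiv.neg ℝ : (Fin n → ℝ) ≃L[ℝ] (Fin n → ℝ)) :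
      (Fin n → ℝ) →L[ℝ] (Fin n → ℝ)) : (Fin n → ℝ) →ₗ[ℝ] (Fin n → ℝ)) = (-1 : ℝ) • LinearMap.id := by
      ext; simp
    rw [ContinuousLinearMap.det, h, LinearMap.det_smul]
    simp [abs_pow]
  rw [this]
  simp [expMap]
  rfl

end Orthant

/-- The following entry, with `0` after the last entry. -/
def nxt (x : Fin n → ℝ) (j : Fin n) : ℝ := (Fin.snoc (α := fun _ => ℝ) x 0 : Fin (n + 1) → ℝ) j.succ

@[simp] theorem nxt_castSucc (x : Fin (n + 1) → ℝ) (j : Fin n) : nxt x j.castSucc = x j.succ := by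
  rw [nxt, Fin.succ_castSucc, Fin.snoc_castSucc]

@[simp] theorem nxt_last (x : Fin (n + 1) → ℝ) : nxt x (Fin.last n) = 0 := by
  rw [nxt, Fin.succ_last, Fin.snoc_last]

/-- The point of the orthant with logarithmic coordinates `x`, i.e. `(π y_j)² = e^{x_j - x_{j+1}}`. -/
def ypt (x : Fin n → ℝ) (j : Fin n) : ℝ := exp ((x j - nxt x j) / 2) / Real.pi

theorem pi_mul_ypt (x : Fin n → ℝ) (j : Fin n) :
    Real.pi * ypt x j = exp ((x j - nxt x j) / 2) := by
  rw [ypt]; field_simp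

theorem sq_pi_mul_ypt (x : Fin n → ℝ) (j : Fin n) :
    (Real.pi * ypt x j) ^ 2 = exp (x j - nxt x j) := by
  rw [pi_mul_ypt, ← Real.exp_nat_mul]; congr 1; push_cast; ring

theorem sum_nxt (x : Fin (n + 1) → ℝ) : ∑ j, (x j - nxt x j) = x 0 := by
  rw [sum_sub_distrib, Fin.sum_univ_succ, Fin.sum_univ_castSucc (f := nxt x)]
  simp

/-- The substitution behind the logarithmic form is `t_j = e^{a_j - x_j}` and `u_j = e^{a_{j+1} -
z_j}`. The radicand becomes the exponential of a difference of successive differences of `z` and of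
`x`, and the appended entries `1` match the zero appended to `x` and `z`. -/
theorem inner_argument (x a : Fin (n + 2) → ℝ) (z : Fin (n + 1) → ℝ) (j : Fin (n + 1)) :
    ypt x j.succ * Real.sqrt (exp (a j.succ + -x j.succ) *
      (Fin.snoc (α := fun _ => ℝ) (fun j => exp (-z j + a j.succ)) 1 : Fin (n + 2) → ℝ) j.succ /
        ((Fin.snoc (α := fun _ => ℝ) (fun j => exp (a j + -x j)) 1 : Fin (n + 3) → ℝ)
          j.succ.succ * exp (-z j + a j.succ))) = ypt z j := by
  have h : ∀ (e l : ℝ), e = exp l → Real.sqrt e = exp (l / 2) := by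
    rintro e l rfl
    rw [← Real.sqrt_sq (exp_pos (l / 2)).le, ← Real.exp_nat_mul]
    congr 2; push_cast; ring
  rw [h _ (z j - nxt z j - (x j.succ - nxt x j.succ)), ypt, ypt, div_mul_eq_mul_div, ← exp_add]
  · congr 2; ring
  · refine Fin.lastCases ?_ (fun i => ?_) j
    · rw [Fin.succ_last, Fin.succ_last, Fin.snoc_last, Fin.snoc_last, nxt_last, nxt_last, mul_one,
        one_mul, ← Real.exp_sub]
      congr 1; ring
    · rw [Fin.succ_castSucc, Fin.snoc_castSucc, Fin.succ_castSucc, Fin.snoc_castSucc, nxt_castSucc,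
        nxt_castSucc, ← exp_add, ← exp_add, ← Real.exp_sub]
      congr 1; ring

/-- The kernel in the definition of `What`, in logarithmic coordinates. -/
theorem kernel_eq (c : ℂ) (x a : Fin (n + 2) → ℝ) (z : Fin (n + 1) → ℝ) :
    (∏ j, (exp (-(Real.pi * ypt x j) ^ 2 * exp (a j + -x j) - 1 / exp (a j + -x j)) : ℂ) *
      ((Real.pi * ypt x j : ℝ) : ℂ) ^ c) *
    (∏ j : Fin (n + 1), (exp (-(Real.pi * ypt x j.castSucc) ^ 2 *
        (exp (a j.castSucc + -x j.castSucc) / exp (a j.succ + -x j.succ)) *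
          exp (-z j + a j.succ) - 1 / exp (-z j + a j.succ)) : ℂ) *
      ((exp (a j.succ + -x j.succ) * exp (-z j + a j.succ) : ℝ) : ℂ) ^ (c / 2)) *
    ((exp (a 0 + -x 0) : ℝ) : ℂ) ^ c = kl (-(c / 2)) x z a := by
  have p1 : ∀ j, ((Real.pi * ypt x j : ℝ) : ℂ) ^ c = Complex.exp (c * ((x j - nxt x j) / 2 : ℝ)) :=
    fun j => by rw [pi_mul_ypt, ofReal_exp_cpow]
  simp only [p1, sq_pi_mul_ypt, ← exp_add, ofReal_exp_cpow]
  simp only [Complex.ofReal_exp (_ - _), ← Complex.exp_sum, ← Complex.exp_add, kl]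
  congr 1
  have e1 : ∑ j, (-exp (x j - nxt x j) * exp (a j + -x j) - 1 / exp (a j + -x j)) +
      ∑ j : Fin (n + 1), (-exp (x j.castSucc - nxt x j.castSucc) *
        (exp (a j.castSucc + -x j.castSucc) / exp (a j.succ + -x j.succ)) *
          exp (-z j + a j.succ) - 1 / exp (-z j + a j.succ)) = -lE x z a := by
    have t1 : ∀ j, -exp (x j - nxt x j) * exp (a j + -x j) - 1 / exp (a j + -x j) =
        -(exp (-nxt x j) * exp (a j)) - exp (x j) * exp (-a j) := fun j => by
      rw [neg_mul, one_div, ← exp_add, ← exp_neg, ← exp_add, ← exp_add]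
      congr 3 <;> ring
    have t2 : ∀ j : Fin (n + 1), -exp (x j.castSucc - nxt x j.castSucc) *
        (exp (a j.castSucc + -x j.castSucc) / exp (a j.succ + -x j.succ)) *
          exp (-z j + a j.succ) - 1 / exp (-z j + a j.succ) =
        -(exp (-z j) * exp (a j.castSucc)) - exp (z j) * exp (-a j.succ) :=
      fun j => by
        rw [nxt_castSucc, neg_mul, neg_mul, one_div, ← Real.exp_sub, ← exp_neg, ← exp_add,
          ← exp_add, ← exp_add, ← exp_add]
        congr 3 <;> ring
    simp only [t1, t2, lE_expand, sum_sub_distrib, Finset.sum_neg_distrib]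
    rw [Fin.sum_univ_castSucc (f := fun j => exp (-nxt x j) * exp (a j)),
      Fin.sum_univ_succ (f := fun j => exp (x j) * exp (-a j))]
    simp only [nxt_castSucc, nxt_last, neg_zero, Real.exp_zero, one_mul]
    ring
  have e2 : ∑ j, (x j - nxt x j) / 2 * 2 + ∑ j : Fin (n + 1), (a j.succ + -x j.succ + (-z j + a j.succ)) +
      2 * (a 0 + -x 0) = -llin x z a := by
    have : ∑ j, (x j - nxt x j) / 2 * 2 = x 0 := by
      rw [← sum_nxt x]; exact sum_congr rfl fun j _ => by ring
    rw [this, llin, Fin.sum_univ_succ (f := x), Fin.sum_univ_succ (f := a)]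
    simp only [sum_add_distrib, Finset.sum_neg_distrib]
    ring
  have e1' := congrArg (fun r : ℝ => (r : ℂ)) e1
  have e2' := congrArg (fun r : ℝ => c / 2 * (r : ℂ)) e2
  simp only [sum_add_distrib, ← Finset.mul_sum, ← Complex.ofReal_sum] at e1' e2' ⊢
  simp only [Complex.ofReal_add, Complex.ofReal_mul, Complex.ofReal_neg, Complex.ofReal_ofNat,
    ← Finset.sum_mul] at e1' e2' ⊢
  linear_combination e1' + e2'

/-- The Jacobians of the two exponential substitutions cancel the products of `t_j⁻¹` and `u_j⁻¹`,
and the remaining weight is `kl` by `kernel_eq`. -/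
theorem What_ypt (b : Fin (n + 2) → ℂ) (x : Fin (n + 2) → ℝ) : What (n + 2) b (ypt x) =
    ∫ a, ∫ z, kl (-(b (Fin.last (n + 1)) / 2)) x z a * What (n + 1) (fun j => b j.castSucc) (ypt z) := by
  rw [What, integral_orthant_add fun j => -x j]
  refine integral_congr_ae (Eventually.of_forall fun a => ?_)
  simp only
  rw [integral_orthant_neg_add fun j => a j.succ, ← integral_const_mul]
  refine integral_congr_ae (Eventually.of_forall fun z => ?_)
  simp only [inner_argument, Finset.prod_inv_distrib]
  rw [← kernel_eq]
  have h1 : ∏ j, (exp (a j + -x j) : ℂ) ≠ 0 :=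
    Finset.prod_ne_zero_iff.2 fun j _ => Complex.ofReal_ne_zero.2 (exp_pos _).ne'
  have h2 : ∏ j : Fin (n + 1), (exp (-z j + a j.succ) : ℂ) ≠ 0 :=
    Finset.prod_ne_zero_iff.2 fun j _ => Complex.ofReal_ne_zero.2 (exp_pos _).ne'
  field_simp

/-- The Bessel integral in exponential coordinates, recentred by `x 0 / 2`; the integral over the
empty tuple `z` is an evaluation. -/
theorem What_one_ypt (b : Fin 1 → ℂ) (x : Fin 1 → ℝ) : What 1 b (ypt x) =
    ∫ a, ∫ z, kl (-(b (Fin.last 0) / 2)) x z a * w 0 (fun j => b j.castSucc / 2) z := by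
  have h0 : ypt x 0 = exp (x 0 / 2) / Real.pi := by
    rw [ypt, show nxt x 0 = 0 from nxt_last x, sub_zero]
  have h1 : ∀ a : Fin 1 → ℝ, ∫ z, kl (-(b (Fin.last 0) / 2)) x z a * w 0 (fun j => b j.castSucc / 2) z =
      Complex.exp (b 0 * (a 0 - x 0 / 2) - exp (x 0 - a 0) - exp (a 0)) := fun a => by
    have l1 : llin (n := 0) x 0 a = x 0 - 2 * a 0 := by simp [llin]
    have l2 : lE (n := 0) x 0 a = exp (x 0 - a 0) + exp (a 0) := by
      rw [lE_expand, sub_eq_add_neg, exp_add]; simp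
    simp only [w, mul_one, Measure.volume_pi_eq_dirac (0 : Fin 0 → ℝ), integral_dirac, kl, l1, l2]
    congr 1
    push_cast
    ring
  simp only [h1]
  have h4 := (volume_preserving_funUnique (Fin 1) ℝ).integral_comp' fun t : ℝ =>
    Complex.exp (b 0 * (t - x 0 / 2) - exp (x 0 - t) - exp t)
  refine Eq.trans ?_ h4.symm
  rw [What, h0, besselK, integral_Ioi_eq_integral_exp,
    ← integral_sub_right_eq_self _ (x 0 / 2), ← mul_assoc, mul_one_div, div_self two_ne_zero, one_mul]
  refine integral_congr_ae (Eventually.of_forall fun t => ?_)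
  simp only [ofReal_exp_cpow]
  have h2 : -(2 * Real.pi * (exp (x 0 / 2) / Real.pi) / 2) *
      (exp (t - x 0 / 2) + 1 / exp (t - x 0 / 2)) = -exp (x 0 - t) - exp t := by
    have : 2 * Real.pi * (exp (x 0 / 2) / Real.pi) / 2 = exp (x 0 / 2) := by field_simp
    rw [this, one_div, ← exp_neg, neg_mul, mul_add, ← exp_add, ← exp_add]
    ring_nf
  rw [h2]
  have h3 : (exp (t - x 0 / 2) : ℂ) ≠ 0 := Complex.ofReal_ne_zero.2 (exp_pos _).ne'
  field_simp
  rw [Complex.ofReal_exp, ← Complex.exp_add]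
  congr 1
  push_cast
  ring

theorem ae_wAbs_lt_top (β : Fin n → ℝ) : ∀ᵐ x, wAbs n β x < ⊤ := by
  have h := convAbs_wAbs β (fun _ => ((absc n β + 1 : ℝ) : ℂ)) fun j => by simp
  filter_upwards [ae_lt_top (by fun_prop) h] with x hx
  by_contra htop
  rw [not_lt_top_iff.1 htop, ENNReal.top_mul] at hx
  · exact absurd hx (lt_irrefl _)
  · simp only [ne_eq, ENNReal.ofReal_eq_zero, not_le]
    exact exp_pos _

theorem w_eq_iterated {β : Fin (n + 1) → ℂ} {x : Fin (n + 1) → ℝ}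
    (hx : wAbs (n + 1) (fun j => (β j).re) x < ⊤) : w (n + 1) β x =
    ∫ a, ∫ z, kl (-β (Fin.last n)) x z a * w n (fun j => β j.castSucc) z := by
  rw [w, Measure.volume_eq_prod]
  refine integral_prod (fun p : (Fin (n + 1) → ℝ) × (Fin n → ℝ) =>
    kl (-β (Fin.last n)) x p.2 p.1 * w n (fun j => β j.castSucc) p.2)
    ⟨Measurable.aestronglyMeasurable (by fun_prop), lt_of_le_of_lt (lintegral_mono fun p => ?_) hx⟩
  rw [enorm_mul, enorm_kl]
  exact mul_le_mul' (by simp) (enorm_w_le _ _)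

/-- `What` is defined by iterated integrals and `w` by integrals over a product; they agree where
the absolute integral is finite. Agreement almost everywhere suffices, since both are only
integrated afterwards. -/
theorem What_ypt_eq_w (b : Fin (n + 1) → ℂ) : ∀ᵐ x, What (n + 1) b (ypt x) = w (n + 1) (fun j => b j / 2) x := by
  induction n with
  | zero =>
    filter_upwards [ae_wAbs_lt_top fun j => (b j / 2).re] with x hx
    rw [w_eq_iterated hx, What_one_ypt]
  | succ n ih =>
    filter_upwards [ae_wAbs_lt_top fun j => (b j / 2).re] with x hx
    rw [w_eq_iterated hx, What_ypt]
    refine integral_congr_ae (Eventually.of_forall fun a => ?_)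
    refine integral_congr_ae ?_
    filter_upwards [ih fun j => b j.castSucc] with z hz
    rw [hz]

/-- The linear part of the logarithmic coordinates. -/
def ylin (n : ℕ) : (Fin n → ℝ) →ₗ[ℝ] (Fin n → ℝ) where
  toFun x j := (x j - nxt x j) / 2
  map_add' x y := by
    ext j
    cases n with
    | zero => exact j.elim0
    | succ n => refine Fin.lastCases ?_ (fun j => ?_) j <;> simp <;> ring
  map_smul' c x := by
    ext j
    cases n with
    | zero => exact j.elim0
    | succ n => refine Fin.lastCases ?_ (fun j => ?_) j <;> simp <;> ring

theorem ylin_injective : Function.Injective (ylin n) := by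
  rw [injective_iff_map_eq_zero]
  intro x hx
  have h : ∀ j : Fin (n + 1), (Fin.snoc (α := fun _ => ℝ) x 0 : Fin (n + 1) → ℝ) j = 0 := by
    refine Fin.reverseInduction (by simp) fun j hj => ?_
    have := congrFun hx j
    simp only [ylin, nxt, LinearMap.coe_mk, AddHom.coe_mk, Pi.zero_apply, hj] at this
    rw [Fin.snoc_castSucc]
    linarith
  ext j
  simpa using h j.castSucc

/-- The logarithmic coordinates, up to a translation. -/
def yequiv (n : ℕ) : (Fin n → ℝ) ≃L[ℝ] (Fin n → ℝ) :=
  (LinearEquiv.ofInjectiveEndo (ylin n) ylin_injective).toContinuousLinearEquiv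

theorem expMap_yequiv (x : Fin n → ℝ) : expMap (yequiv n) (fun _ => -Real.log Real.pi) x = ypt x := by
  ext j
  rw [expMap, exp_add, exp_neg, exp_log Real.pi_pos]
  rfl

theorem prod_ypt (s : Fin n → ℂ) (x : Fin n → ℝ) :
    (∏ j, (ypt x j : ℂ)) * ∏ j, ((ypt x j : ℂ) ^ s j / (ypt x j : ℂ)) =
    (∏ j, (Real.pi : ℂ) ^ (-s j)) * vexp s x := by
  have h : ∀ j, (ypt x j : ℂ) * ((ypt x j : ℂ) ^ s j / (ypt x j : ℂ)) =
      (Real.pi : ℂ) ^ (-s j) * Complex.exp (s j * ((x j - nxt x j) / 2 : ℝ)) := fun j => by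
    have h1 : (ypt x j : ℂ) ≠ 0 := Complex.ofReal_ne_zero.2 (by rw [← expMap_yequiv]; exact (expMap_pos _ _ _ _).ne')
    rw [mul_div_cancel₀ _ h1, ypt, Complex.ofReal_div, Complex.div_cpow_ofReal_nonneg (exp_pos _).le
      Real.pi_pos.le, ofReal_exp_cpow, Complex.cpow_neg]
    ring
  rw [← prod_mul_distrib, prod_congr rfl fun j _ => h j, prod_mul_distrib,
    ← Complex.exp_sum, vexp]
  congr 2
  cases n with
  | zero => simp
  | succ n =>
    rw [Fin.sum_univ_castSucc, Fin.sum_univ_succ (f := fun j => (x j : ℂ) * dlt s j)]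
    have e1 := Fin.sum_univ_castSucc (fun j => s j * (x j : ℂ))
    have e2 := Fin.sum_univ_succ (fun j => s j * (x j : ℂ))
    simp only [nxt_castSucc, nxt_last, dlt, sh_zero, sh_succ]
    push_cast
    simp only [mul_sub, sub_div, sum_sub_distrib, mul_div_assoc', ← Finset.sum_div]
    simp only [mul_comm (s _)] at e1 e2 ⊢
    linear_combination (e2 - e1) / 2

/-- In logarithmic coordinates the measure `∏ dy_j / y_j` is a constant multiple of Lebesgue
measure, and the division by `π` in `ypt` accounts for the powers of `π`. -/
theorem mellin_link (b s : Fin (n + 1) → ℂ) :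
    (MellinConverges b s ↔ Integrable fun x => w (n + 1) (fun j => b j / 2) x * vexp s x) ∧
    mellinW b s = |(yequiv (n + 1) : (Fin (n + 1) → ℝ) →L[ℝ] (Fin (n + 1) → ℝ)).det| *
      (∏ j, (Real.pi : ℂ) ^ (-s j)) * v (fun j => b j / 2) s := by
  have h : ∀ᵐ x, (∏ j, (expMap (yequiv (n + 1)) (fun _ => -Real.log Real.pi) x j : ℂ)) *
      mellinIntegrand b s (expMap (yequiv (n + 1)) (fun _ => -Real.log Real.pi) x) =
      (∏ j, (Real.pi : ℂ) ^ (-s j)) * (w (n + 1) (fun j => b j / 2) x * vexp s x) := by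
    filter_upwards [What_ypt_eq_w b] with x hx
    rw [expMap_yequiv, mellinIntegrand, hx, mul_left_comm, prod_ypt]
    ring
  have h0 : (∏ j, (Real.pi : ℂ) ^ (-s j)) ≠ 0 := Finset.prod_ne_zero_iff.2 fun j _ => by
    simp [Complex.cpow_eq_zero_iff, pi_ne_zero]
  refine ⟨?_, ?_⟩
  · rw [MellinConverges, integrableOn_orthant_iff (yequiv (n + 1)) (fun _ => -Real.log Real.pi),
      integrable_congr h, integrable_const_mul_iff h0.isUnit]
  · rw [mellinW, integral_orthant (yequiv (n + 1)) (fun _ => -Real.log Real.pi), integral_congr_ae h,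
      integral_const_mul, v, mul_assoc]
end

section
/-! ### Meromorphic continuation of the Mellin transform -/

variable {n : ℕ}

/-- The factor between the Mellin transforms in the two coordinate systems. -/
def mfac (n : ℕ) (s : Fin n → ℂ) : ℂ :=
  |(yequiv n : (Fin n → ℝ) →L[ℝ] (Fin n → ℝ)).det| * ∏ j, (Real.pi : ℂ) ^ (-s j)

theorem differentiable_mfac : Differentiable ℂ (mfac n) := by
  have : ∀ j : Fin n, Differentiable ℂ fun s : Fin n → ℂ => (Real.pi : ℂ) ^ (-s j) := fun j =>
    Differentiable.const_cpow (by fun_prop) (Or.inl (by simp [pi_ne_zero]))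
  unfold mfac
  fun_prop

theorem mfac_ne_zero (s : Fin n → ℂ) : mfac n s ≠ 0 :=
  mul_ne_zero (Complex.ofReal_ne_zero.2 (abs_det_pos _).ne') (Finset.prod_ne_zero_iff.2 fun j _ => by
    simp [Complex.cpow_eq_zero_iff, pi_ne_zero])

theorem integrable_w_mul_vexp (β : Fin n → ℂ) {s : Fin n → ℂ}
    (hs : s ∈ halfPi n (absc n fun j => (β j).re)) : Integrable fun x => w n β x * vexp s x := by
  refine ⟨Measurable.aestronglyMeasurable (by fun_prop), lt_of_le_of_lt (lintegral_mono fun x => ?_)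
    (convAbs_wAbs (fun j => (β j).re) s hs).lt_top⟩
  rw [enorm_mul, enorm_vexp]
  exact mul_le_mul' (enorm_w_le _ _) le_rfl

theorem halfPi_mono {a a' : ℝ} (h : a ≤ a') : halfPi n a' ⊆ halfPi n a := fun _ hs j => h.trans_lt (hs j)

theorem const_mem_halfPi {a x : ℝ} (h : a < x) : (fun _ => (x : ℂ)) ∈ halfPi n a := fun _ => by simpa

section

variable (b : Fin (n + 1) → ℂ)

theorem exists_converges : ∃ M, ∀ s ∈ halfPi (n + 1) M,
    MellinConverges b s ∧ mellinW b s = mfac (n + 1) s * v (fun j => b j / 2) s :=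
  ⟨_, fun s hs => ⟨(mellin_link b s).1.2 (integrable_w_mul_vexp (fun j => b j / 2) hs), (mellin_link b s).2⟩⟩

variable {b}

/-- The exponents are differences of consecutive entries, so a common translation affects only the
first of them. -/
theorem vexp_add_const (s : Fin (n + 1) → ℂ) (t : ℂ) (x : Fin (n + 1) → ℝ) :
    vexp (fun j => s j + t) x = vexp s x * Complex.exp (t * (x 0 / 2)) := by
  rw [vexp, vexp, ← Complex.exp_add, Fin.sum_univ_succ,
    Fin.sum_univ_succ (f := fun j => (x j : ℂ) * dlt s j)]
  congr 1
  simp only [dlt, sh_zero, sh_succ, add_sub_add_right_eq_sub]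
  ring

/-- `Represents` speaks of every point of absolute convergence, also outside the known half-space.
From such a point `z`, translate all coordinates by `t`: the integrand is multiplied by `e^{t x_0 /
2}`, so convergence at `z` and at a point `z + T` of the half-space gives convergence in between.
The transform is holomorphic for `0 < Re t < T` and continuous down to `t = 0`, whence the identity
theorem followed by a limit. -/
theorem eq_mul_mellinW {F g : (Fin (n + 1) → ℂ) → ℂ} (hF : Differentiable ℂ F)
    (hg : Differentiable ℂ g) {M : ℝ}
    (h : ∀ s ∈ halfPi (n + 1) M, F s = g s * (mfac (n + 1) s * v (fun j => b j / 2) s))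
    {z : Fin (n + 1) → ℂ} (hz : MellinConverges b z) : F z = g z * mellinW b z := by
  rw [(mellin_link b z).2]
  change F z = g z * (mfac (n + 1) z * v (fun j => b j / 2) z)
  set β := fun j => b j / 2
  have h0 := (mellin_link b z).1.1 hz
  set M' := max M (absc (n + 1) fun j => (β j).re)
  set T : ℝ := 1 + ∑ j, |M' - (z j).re| with hT
  have hTj : ∀ j, M' + 1 ≤ (z j).re + T := fun j => by
    have h1 := Finset.single_le_sum (f := fun j => |M' - (z j).re|) (fun j _ => abs_nonneg _)
      (Finset.mem_univ j)
    have h2 := le_abs_self (M' - (z j).re)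
    linarith
  have hT0 : 0 < T := by positivity
  have hT1 := integrable_w_mul_vexp β (s := fun j => z j + T) fun j => by
    have := hTj j
    have : absc (n + 1) (fun j => (β j).re) ≤ M' := le_max_right _ _
    simp only [add_re, ofReal_re]
    linarith
  have hint := h0.norm.add hT1.norm
  have hv : ∀ t : ℂ, v β (fun j => z j + t) =
      ∫ x, w (n + 1) β x * vexp z x * Complex.exp (t * (x 0 / 2)) := fun t => by
    simp only [v, vexp_add_const, mul_assoc]
  have hbound : ∀ t : ℂ, 0 ≤ t.re → t.re ≤ T → ∀ x : Fin (n + 1) → ℝ,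
      ‖w (n + 1) β x * vexp z x * Complex.exp (t * (x 0 / 2))‖ ≤
      ‖w (n + 1) β x * vexp z x‖ + ‖w (n + 1) β x * vexp (fun j => z j + T) x‖ := by
    intro t ht0 htT x
    rw [vexp_add_const, ← mul_assoc, norm_mul _ (Complex.exp _), norm_mul _ (Complex.exp _),
      norm_exp, norm_exp, ← mul_one_add]
    refine mul_le_mul_of_nonneg_left ?_ (norm_nonneg _)
    have e : ∀ t : ℂ, (t * (x 0 / 2)).re = t.re * (x 0 / 2) := fun t => by simp
    rw [e, e, ofReal_re]
    rcases le_total (x 0) 0 with hx | hx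
    · exact le_add_of_le_of_nonneg (Real.exp_le_one_iff.2 (mul_nonpos_of_nonneg_of_nonpos ht0
        (by linarith))) (exp_pos _).le
    · exact le_add_of_nonneg_of_le zero_le_one (Real.exp_le_exp.2
        (mul_le_mul_of_nonneg_right htT (by linarith)))
  have hvd : DifferentiableOn ℂ (fun t : ℂ => v β fun j => z j + t) {t | 0 < t.re ∧ t.re < T} := by
    have hU : IsOpen {t : ℂ | 0 < t.re ∧ t.re < T} :=
      (isOpen_lt continuous_const continuous_re).inter (isOpen_lt continuous_re
        continuous_const)
    simp only [hv]
    exact differentiableOn_integral_of_dominated hU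
      (fun t _ => Measurable.aestronglyMeasurable (by fun_prop))
      (fun x => Differentiable.differentiableOn (by fun_prop))
      fun t _ => ⟨1, one_pos, _, hint, fun t' _ ht' x => hbound t' ht'.1.le ht'.2.le x⟩
  have hvc : ContinuousOn (fun t : ℝ => v β fun j => z j + t) (Icc 0 T) := by
    simp only [hv]
    refine continuousOn_of_dominated (fun t _ => Measurable.aestronglyMeasurable (by fun_prop))
      (fun t ht => Eventually.of_forall fun x => hbound t (by simpa using ht.1) (by simpa using ht.2) x) hint
      (Eventually.of_forall fun x => Continuous.continuousOn (by fun_prop))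
  have hU : IsOpen {t : ℂ | 0 < t.re ∧ t.re < T} :=
    (isOpen_lt continuous_const continuous_re).inter (isOpen_lt continuous_re
      continuous_const)
  have hUc : Convex ℝ {t : ℂ | 0 < t.re ∧ t.re < T} :=
    (convex_halfSpace_re_gt 0).inter (convex_halfSpace_re_lt T)
  have hmf := differentiable_mfac (n := n + 1)
  have hT1' : 1 ≤ T := by
    rw [hT]; exact le_add_of_nonneg_right (Finset.sum_nonneg fun j _ => abs_nonneg _)
  have heq : EqOn (fun t : ℝ => F fun j => z j + t)
      (fun t : ℝ => g (fun j => z j + t) * (mfac (n + 1) (fun j => z j + t) * v β fun j => z j + t))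
      (Ioo 0 T) := by
    intro t ht
    refine eq_of_eventuallyEq_convex hU hUc (f := fun t : ℂ => F fun j => z j + t)
      (g := fun t : ℂ => g (fun j => z j + t) * (mfac (n + 1) (fun j => z j + t) * v β fun j => z j + t))
      (Differentiable.differentiableOn (by fun_prop)) (DifferentiableOn.mul
        (Differentiable.differentiableOn (by fun_prop)) (DifferentiableOn.mul
        (Differentiable.differentiableOn (by fun_prop)) hvd)) (a := ((T - 1 / 2 : ℝ) : ℂ)) (b := t)
      (by simp only [Set.mem_ofPred_eq, ofReal_re]; constructor <;> linarith) (by simpa using ht) ?_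
    have : Continuous fun t : ℂ => fun j => z j + t := by fun_prop
    filter_upwards [this.continuousAt.preimage_mem_nhds ((isOpen_halfPi (n + 1) M).mem_nhds
      (x := fun j => z j + ((T - 1 / 2 : ℝ) : ℂ)) fun j => by
        have := hTj j
        have : M ≤ M' := le_max_left _ _
        rw [add_re, ofReal_re]
        linarith)] with t ht
    exact h _ ht
  have := heq.of_subset_closure (t := Icc 0 T) (Continuous.continuousOn (by
      have := hF.continuous; fun_prop)) ?_ Ioo_subset_Icc_self
    (by rw [closure_Ioo hT0.ne]) (left_mem_Icc.2 hT0.le)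
  · simpa using this
  · have h1 := hF.continuous
    have h2 := hg.continuous
    have h3 := hmf.continuous
    exact (Continuous.continuousOn (by fun_prop)).mul ((Continuous.continuousOn (by fun_prop)).mul hvc)

theorem Represents.exists_eq {s : Fin (n + 1) → ℂ} {F g : (Fin (n + 1) → ℂ) → ℂ}
    (h : Represents b s F g) : ∃ M, ∀ z ∈ halfPi (n + 1) M,
      F z = g z * (mfac (n + 1) z * v (fun j => b j / 2) z) := by
  obtain ⟨M, hM⟩ := exists_converges b
  exact ⟨M, fun z hz => by rw [h.2.2.2 z (hM z hz).1, (hM z hz).2]⟩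

/-- The identity theorem on convex domains meeting all translates of the positive orthant. -/
theorem eqOn_of_eqOn_halfPi {Ω : Set (Fin n → ℂ)} (hΩ : IsOpen Ω) (hc : Convex ℝ Ω)
    (hne : ∀ M : ℝ, (Ω ∩ halfPi n M).Nonempty) {f g : (Fin n → ℂ) → ℂ} (hf : DifferentiableOn ℂ f Ω)
    (hg : DifferentiableOn ℂ g Ω) {M : ℝ} (h : ∀ s ∈ Ω, s ∈ halfPi n M → f s = g s)
    {s : Fin n → ℂ} (hs : s ∈ Ω) : f s = g s := by
  obtain ⟨a, ha, haM⟩ := hne M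
  refine eq_of_eventuallyEq_convex hΩ hc hf hg ha hs ?_
  filter_upwards [hΩ.mem_nhds ha, (isOpen_halfPi n M).mem_nhds haM] with z hz hz'
  exact h z hz hz'

theorem nonempty_halfPi (n : ℕ) (a M : ℝ) : (halfPi n a ∩ halfPi n M).Nonempty :=
  ⟨fun _ => ((max a M + 1 : ℝ) : ℂ), const_mem_halfPi (by linarith [le_max_left a M]),
    const_mem_halfPi (by linarith [le_max_right a M])⟩

theorem nonempty_univ_inter_halfPi (n : ℕ) (M : ℝ) : (univ ∩ halfPi n M).Nonempty := by
  simpa using nonempty_halfPi n M M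

/-- After cross-multiplication two representations agree on a half-space and hence everywhere, so
the choice in the definition of `V` is immaterial. -/
theorem V_eq {s : Fin (n + 1) → ℂ} {F g : (Fin (n + 1) → ℂ) → ℂ} (h : Represents b s F g) :
    V b s = F s / g s := by
  rw [V]
  split_ifs with hc hr
  · rw [h.2.2.2 s hc, mul_div_cancel_left₀ _ h.2.2.1]
  · have h' := hr.choose_spec.choose_spec
    rw [div_eq_div_iff h'.2.2.1 h.2.2.1]
    obtain ⟨M, hM⟩ := exists_converges b
    refine eqOn_of_eqOn_halfPi isOpen_univ convex_univ (nonempty_univ_inter_halfPi _)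
      (f := fun s => hr.choose s * g s) (g := fun s => F s * hr.choose_spec.choose s) (M := M)
      (h'.1.mul h.2.1).differentiableOn (h.1.mul h'.2.1).differentiableOn (fun z _ hz => ?_) (mem_univ s)
    rw [h'.2.2.2 z (hM z hz).1, h.2.2.2 z (hM z hz).1]
    ring
  · exact absurd ⟨F, g, h⟩ hr

/-- A product of linear factors in single variables. -/
def linProd (ℓ : List (Fin n × ℂ)) (s : Fin n → ℂ) : ℂ := (ℓ.map fun e => s e.1 - e.2).prod

theorem differentiable_linProd (ℓ : List (Fin n × ℂ)) : Differentiable ℂ (linProd ℓ) := by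
  induction ℓ with
  | nil => exact (differentiable_const (1 : ℂ) : Differentiable ℂ fun _ : Fin n → ℂ => (1 : ℂ))
  | cons e ℓ ih =>
    have : linProd (e :: ℓ) = fun s : Fin n → ℂ => (s e.1 - e.2) * linProd ℓ s := by ext; simp [linProd]
    rw [this]
    fun_prop

theorem linProd_eq_zero_iff {ℓ : List (Fin n × ℂ)} {s : Fin n → ℂ} :
    linProd ℓ s = 0 ↔ ∃ e ∈ ℓ, s e.1 = e.2 := by
  simp [linProd, sub_eq_zero]

theorem exists_linProd_prod {ι : Type*} (S : Finset ι) (f : ι → (Fin n → ℂ) → ℂ)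
    (h : ∀ i ∈ S, ∃ (ℓ : List (Fin n × ℂ)) (c : ℂ), c ≠ 0 ∧ ∀ s, f i s = c * linProd ℓ s) :
    ∃ (ℓ : List (Fin n × ℂ)) (c : ℂ), c ≠ 0 ∧ ∀ s, ∏ i ∈ S, f i s = c * linProd ℓ s := by
  classical
  induction S using Finset.induction_on with
  | empty => exact ⟨[], 1, one_ne_zero, fun s => by simp [linProd]⟩
  | insert i S hi ih =>
    obtain ⟨ℓ, c, hc, h1⟩ := ih fun i hi => h i (Finset.mem_insert_of_mem hi)
    obtain ⟨ℓ', c', hc', h2⟩ := h i (Finset.mem_insert_self _ _)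
    refine ⟨ℓ' ++ ℓ, c' * c, mul_ne_zero hc' hc, fun s => ?_⟩
    rw [Finset.prod_insert hi, h1, h2, linProd, linProd, linProd, List.map_append, List.prod_append]
    ring

theorem exists_linProd_poch {ι : Type*} [Fintype ι] (Λ : ι → ℂ) (K : ℕ) :
    ∃ (ℓ : List (Fin n × ℂ)) (c : ℂ), c ≠ 0 ∧ ∀ s : Fin n → ℂ,
      ∏ j, ∏ i, poch K (s j + Λ i) = c * linProd ℓ s := by
  refine exists_linProd_prod _ _ fun j _ => exists_linProd_prod _ (fun i s => poch K (s j + Λ i))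
    fun i _ => exists_linProd_prod (Finset.range K) (fun k s => (s j + Λ i) / 2 + k) fun k _ =>
      ⟨[(j, -Λ i - 2 * k)], 1 / 2, by norm_num, fun s => ?_⟩
  simp only [linProd, List.map_cons, List.map_nil, List.prod_cons, List.prod_nil]
  ring

/-- A regular point `s'` on the hyperplane comes with a quotient `F / g`, `g s' ≠ 0`. By the
identity theorem `E g` equals, up to a non-vanishing factor, a product containing `s_j - x`, so `E g
= 0` on the hyperplane. If `E s ≠ 0`, then `g` vanishes near `s` on the line from `s` to `s'`, hence
at `s'`. -/
theorem eq_zero_of_not_polar {Ω : Set (Fin (n + 1) → ℂ)} (hΩ : IsOpen Ω) (hc : Convex ℝ Ω)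
    (hne : ∀ M : ℝ, (Ω ∩ halfPi (n + 1) M).Nonempty) {E H : (Fin (n + 1) → ℂ) → ℂ}
    (hE : DifferentiableOn ℂ E Ω) (hH : Differentiable ℂ H) {ℓ : List (Fin (n + 1) × ℂ)} {M : ℝ}
    (h : ∀ s ∈ Ω, s ∈ halfPi (n + 1) M → E s = v (fun j => b j / 2) s * H s * linProd ℓ s)
    {e : Fin (n + 1) × ℂ} (he : e ∈ ℓ) (hpol : ¬ PolarHyperplane b e.1 e.2) {s : Fin (n + 1) → ℂ}
    (hs : s ∈ Ω) (hse : s e.1 = e.2) : E s = 0 := by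
  simp only [PolarHyperplane, not_forall, not_not] at hpol
  obtain ⟨s', hs', F, g, hr⟩ := hpol
  obtain ⟨M', hM'⟩ := hr.exists_eq
  have key : ∀ z ∈ Ω, z e.1 = e.2 → E z * g z = 0 := fun z hz hze => by
    have h1 := eqOn_of_eqOn_halfPi hΩ hc hne (f := fun z => E z * g z * mfac (n + 1) z)
      (g := fun z => F z * H z * linProd ℓ z) (M := max M M')
      ((hE.mul hr.2.1.differentiableOn).mul differentiable_mfac.differentiableOn)
      ((hr.1.mul hH).mul (differentiable_linProd ℓ)).differentiableOn
      (fun z hz hzM => by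
        rw [h z hz (halfPi_mono (le_max_left _ _) hzM), hM' z (halfPi_mono (le_max_right _ _) hzM)]
        ring) hz
    simp only [linProd_eq_zero_iff.2 ⟨e, he, hze⟩, mul_zero] at h1
    exact (mul_eq_zero.1 h1).resolve_right (mfac_ne_zero z)
  by_contra hE0
  have hline : Differentiable ℂ fun t : ℂ => s + t • (s' - s) := by fun_prop
  refine hr.2.2.1 ?_
  have h2 := eq_of_eventuallyEq_convex isOpen_univ convex_univ (a := (0 : ℂ)) (b := 1)
    (f := fun t : ℂ => g (s + t • (s' - s))) (g := fun _ => 0)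
    (hr.2.1.comp hline).differentiableOn (differentiableOn_const _) (mem_univ _) (mem_univ _) ?_
  · simpa using h2
  · have h3 : ContinuousAt (fun t : ℂ => E (s + t • (s' - s))) 0 :=
      ContinuousAt.comp (by simpa using (hE.differentiableAt (hΩ.mem_nhds hs)).continuousAt)
        hline.continuous.continuousAt
    filter_upwards [hline.continuous.continuousAt.preimage_mem_nhds (t := Ω) (by simpa using hΩ.mem_nhds hs),
      h3.eventually_ne (by simpa using hE0)] with t ht ht'
    exact (mul_eq_zero.1 (key _ ht (by simp [hse, hs']))).resolve_left ht'

/-- Factors whose hyperplane is not polar divide `E` and are removed one after another. The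
predicate `P` carries along a property stable under such divisions, namely growth. -/
theorem exists_reduced_of_list {Ω : Set (Fin (n + 1) → ℂ)} (hΩ : IsOpen Ω) (hc : Convex ℝ Ω)
    (hne : ∀ M : ℝ, (Ω ∩ halfPi (n + 1) M).Nonempty) {P : ((Fin (n + 1) → ℂ) → ℂ) → Prop}
    (hP : ∀ E q j x, P E → DifferentiableOn ℂ q Ω → (∀ s ∈ Ω, E s = (s j - x) * q s) → P q)
    {H : (Fin (n + 1) → ℂ) → ℂ} (hH : Differentiable ℂ H) (k : ℕ) :
    ∀ (ℓ : List (Fin (n + 1) × ℂ)) (E : (Fin (n + 1) → ℂ) → ℂ) (M : ℝ), ℓ.length = k →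
      DifferentiableOn ℂ E Ω → P E →
      (∀ s ∈ Ω, s ∈ halfPi (n + 1) M → E s = v (fun j => b j / 2) s * H s * linProd ℓ s) →
    ∃ (ℓ : List (Fin (n + 1) × ℂ)) (E : (Fin (n + 1) → ℂ) → ℂ) (M : ℝ),
      (∀ e ∈ ℓ, PolarHyperplane b e.1 e.2) ∧ DifferentiableOn ℂ E Ω ∧ P E ∧
      ∀ s ∈ Ω, s ∈ halfPi (n + 1) M → E s = v (fun j => b j / 2) s * H s * linProd ℓ s := by
  classical
  induction k with
  | zero =>
    intro ℓ E M hk hE hPE h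
    rw [List.length_eq_zero_iff] at hk
    exact ⟨ℓ, E, M, by simp [hk], hE, hPE, h⟩
  | succ k ih =>
    intro ℓ E M hk hE hPE h
    by_cases hpol : ∀ e ∈ ℓ, PolarHyperplane b e.1 e.2
    · exact ⟨ℓ, E, M, hpol, hE, hPE, h⟩
    push Not at hpol
    obtain ⟨e, he, hpol⟩ := hpol
    obtain ⟨q, hq, hEq⟩ := exists_differentiableOn_div hΩ hE e.1 e.2 fun s hs hse =>
      eq_zero_of_not_polar hΩ hc hne hE hH h he hpol hs hse
    -- Raising the abscissa beyond `e.2.re` keeps the cancelled factor away from zero.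
    refine ih (ℓ.erase e) q (max M e.2.re) (by rw [List.length_erase_of_mem he, hk]; rfl) hq
      (hP E q _ _ hPE hq hEq) fun s hs hsM => ?_
    have h1 : s e.1 - e.2 ≠ 0 := fun h0 => by
      have h2 := hsM e.1
      rw [sub_eq_zero.1 h0] at h2
      exact absurd (le_max_right M e.2.re) (not_le.2 h2)
    refine mul_left_cancel₀ h1 ?_
    rw [← hEq s hs, h s hs (halfPi_mono (le_max_left _ _) hsM), linProd,
      ((List.perm_cons_erase he).map _).prod_eq, List.map_cons, List.prod_cons, linProd]
    ring

end
end

/-! ### Growth after division, and holomorphy off the polar hyperplanes -/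

section
variable {n : ℕ}

/-- Moderate growth on all bounded strips inside the half-space. -/
def StripGrowth (a : ℝ) (E : (Fin n → ℂ) → ℂ) : Prop := ∀ a' > a, ∀ R, Growth (stripPi n a' R) E

/-- Away from the hyperplane one divides by a factor of size at least `ρ`. Within distance `ρ` of it
the maximum principle on a disc of radius `2 ρ` in the `j`-th variable reduces to the boundary
circle, where the factor is again at least `ρ`. -/
theorem StripGrowth.div {a : ℝ} {E q : (Fin n → ℂ) → ℂ} {j : Fin n} {x : ℂ} (hE : StripGrowth a E)
    (hq : DifferentiableOn ℂ q (halfPi n a)) (h : ∀ s ∈ halfPi n a, E s = (s j - x) * q s) :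
    StripGrowth a q := by
  classical
  intro a' ha' R ε hε
  set ρ := (a' - a) / 4 with hρ
  have hρ0 : 0 < ρ := by rw [hρ]; linarith
  obtain ⟨C, hC, hCE⟩ := hE (a' - 3 * ρ) (by linarith) (R + 3 * ρ) ε hε
  have key : ∀ s ∈ stripPi n (a' - 3 * ρ) (R + 3 * ρ), ρ ≤ ‖s j - x‖ →
      ‖q s‖ ≤ C / ρ * exp (ε * ‖s‖) := fun s hs hsx => by
    have h1 := hCE s hs
    rw [h s fun j => by have := (hs j).1; linarith, norm_mul] at h1
    rw [div_mul_eq_mul_div, le_div_iff₀ hρ0]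
    calc ‖q s‖ * ρ ≤ ‖q s‖ * ‖s j - x‖ := by gcongr
      _ ≤ _ := by rwa [mul_comm]
  have hup : ∀ (s : Fin n → ℂ) (z : ℂ), ‖z - s j‖ ≤ 2 * ρ → (s ∈ stripPi n a' R) →
      Function.update s j z ∈ stripPi n (a' - 3 * ρ) (R + 3 * ρ) := fun s z hz hs i => by
    have h1 := hs i
    rcases eq_or_ne i j with rfl | hij
    · have h2 := (abs_le.1 ((abs_re_le_norm _).trans hz))
      rw [sub_re] at h2
      rw [Function.update_self]
      constructor <;> linarith
    · rw [Function.update_of_ne hij]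
      constructor <;> linarith
  refine ⟨C / ρ * exp (ε * (2 * ρ)), by positivity, fun s hs => ?_⟩
  by_cases hsx : ρ ≤ ‖s j - x‖
  · refine (key s (fun i => ⟨by linarith [(hs i).1], by linarith [(hs i).2]⟩) hsx).trans ?_
    rw [mul_assoc]
    gcongr
    exact le_mul_of_one_le_left (exp_pos _).le (Real.one_le_exp (by positivity))
  push Not at hsx
  have hcl : ∀ z ∈ Metric.closedBall (s j) (2 * ρ), ‖z - s j‖ ≤ 2 * ρ := fun z hz => by
    rwa [Metric.mem_closedBall, dist_eq_norm] at hz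
  have hd : DiffContOnCl ℂ (fun z => q (Function.update s j z)) (Metric.ball (s j) (2 * ρ)) := by
    refine DifferentiableOn.diffContOnCl ?_
    rw [closure_ball _ (by positivity)]
    refine hq.comp (fun z _ =>
      (hasFDerivAt_update s z).differentiableAt.differentiableWithinAt) fun z hz i => ?_
    have := (hup s z (hcl z hz) hs i).1
    linarith
  have h2 := Complex.norm_le_of_forall_mem_frontier_norm_le Metric.isBounded_ball hd
    (C := C / ρ * exp (ε * (2 * ρ)) * exp (ε * ‖s‖)) (fun z hz => ?_)
    (subset_closure (Metric.mem_ball_self (by positivity : 0 < 2 * ρ)))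
  · simpa using h2
  · rw [frontier_ball _ (by positivity), mem_sphere_iff_norm] at hz
    refine (key _ (hup s z hz.le hs) ?_).trans ?_
    · rw [Function.update_self]
      have : z - s j = (z - x) - (s j - x) := by ring
      rw [this] at hz
      linarith [norm_sub_le (z - x) (s j - x)]
    · rw [mul_assoc, ← exp_add, ← mul_add]
      gcongr
      have h3 : ‖Function.update s j z - s‖ ≤ 2 * ρ := by
        rw [pi_norm_le_iff_of_nonneg (by positivity)]
        intro i
        rcases eq_or_ne i j with rfl | hij
        · simp [hz]
        · simp [hij, hρ0.le]
      have h4 : Function.update s j z = (Function.update s j z - s) + s := by abel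
      rw [h4]
      exact (norm_add_le _ _).trans (by linarith)

theorem differentiable_prod_G_inv {ι : Type*} [Fintype ι] (Λ : ι → ℂ) (K : ℕ) :
    Differentiable ℂ fun s : Fin n → ℂ => ∏ j, ∏ i, (G (s j + Λ i + 2 * K))⁻¹ := by
  refine differentiableOn_univ.1 (differentiableOn_prod fun j => differentiableOn_prod fun i => ?_)
  exact (differentiable_G_inv.comp (f := fun s : Fin n → ℂ => s j + Λ i + 2 * (K : ℂ))
    (by fun_prop)).differentiableOn

/-- The Mellin transform times reciprocal Gamma factors is entire. -/
theorem exists_entire (β : Fin n → ℂ) : ∃ (ι : Type) (_ : Fintype ι) (Λ : ι → ℂ)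
    (F : (Fin n → ℂ) → ℂ) (M : ℝ), Differentiable ℂ F ∧
    ∀ s ∈ halfPi n M, F s = v β s * ∏ j, ∏ i, (G (s j + Λ i))⁻¹ := by
  obtain ⟨ι, hι, Λ, h⟩ := tame β
  choose K F M hF _ hM using h
  refine ⟨ι, hι, Λ, ?_⟩
  -- One function for each half-space. They agree on overlaps, so an entire function results from
  -- choosing the index according to `‖s‖`.
  let T : ℕ → (Fin n → ℂ) → ℂ := fun N s => F N s * ∏ j, ∏ i, (G (s j + Λ i + 2 * K N))⁻¹
  have hT : ∀ N, DifferentiableOn ℂ (T N) (halfPi n (-N)) := fun N => (hF N).mul (differentiable_prod_G_inv Λ (K N)).differentiableOn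
  have hTM : ∀ N, ∀ s ∈ halfPi n (M N), T N s = v β s * ∏ j, ∏ i, (G (s j + Λ i))⁻¹ := fun N s hs => by
    simp only [T]
    rw [hM N s hs, mul_assoc, ← prod_mul_distrib]
    simp only [← prod_mul_distrib, ← G_inv_eq]
  have heq : ∀ N N' : ℕ, N ≤ N' → ∀ s ∈ halfPi n (-N), T N s = T N' s := fun N N' hN s hs =>
    eqOn_of_eqOn_halfPi (isOpen_halfPi n (-N)) (convex_halfPi _ _) (nonempty_halfPi _ _) (hT N)
      ((hT N').mono (halfPi_mono (neg_le_neg (Nat.cast_le.2 hN)))) (M := max (M N) (M N'))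
      (fun z _ hz => by rw [hTM N z (halfPi_mono (le_max_left _ _) hz),
        hTM N' z (halfPi_mono (le_max_right _ _) hz)]) hs
  have hmem : ∀ s : Fin n → ℂ, s ∈ halfPi n (-((⌈‖s‖⌉₊ + 1 : ℕ) : ℝ)) := fun s j => by
    have h1 := Nat.le_ceil ‖s‖
    have h2 := (abs_le.1 ((abs_re_le_norm (s j)).trans (norm_le_pi_norm s j))).1
    push_cast
    linarith
  have heq' : ∀ N : ℕ, ∀ s ∈ halfPi n (-N), T (⌈‖s‖⌉₊ + 1) s = T N s := fun N s hs => by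
    rcases le_total N (⌈‖s‖⌉₊ + 1) with h | h
    · exact (heq _ _ h s hs).symm
    · exact heq _ _ h s (hmem s)
  refine ⟨fun s => T (⌈‖s‖⌉₊ + 1) s, max (M 0) 0, fun s => ?_, fun s hs => ?_⟩
  · have h1 := (isOpen_halfPi n _).mem_nhds (hmem s)
    refine ((hT (⌈‖s‖⌉₊ + 1)).differentiableAt h1).congr_of_eventuallyEq ?_
    filter_upwards [h1] with z hz
    exact heq' _ z hz
  · rw [← hTM 0 s (halfPi_mono (le_max_left _ _) hs)]
    exact heq' 0 s (halfPi_mono (by simp) hs)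

variable {b : Fin (n + 1) → ℂ}

theorem represents_of_eq {E H : (Fin (n + 1) → ℂ) → ℂ} (hE : Differentiable ℂ E)
    (hH : Differentiable ℂ H) {M : ℝ}
    (h : ∀ s ∈ halfPi (n + 1) M, E s = v (fun j => b j / 2) s * H s) {p : Fin (n + 1) → ℂ}
    (hp : H p ≠ 0) : Represents b p (fun s => mfac (n + 1) s * E s) H :=
  ⟨differentiable_mfac.mul hE, hH, hp, fun z hz => eq_mul_mellinW (b := b) (M := M)
    (F := fun s => mfac (n + 1) s * E s) (differentiable_mfac.mul hE) hH
    (fun s hs => by rw [h s hs]; ring) hz⟩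

/-- The entire function `v ∏∏ 1/Γ` is divided by the reciprocal Gamma factors, split as `poch K`
times a shifted factor that does not vanish at `p`. In `poch K` only polar hyperplanes survive
reduction, and none of them passes through `p`. -/
theorem regular_of_not_polar {p : Fin (n + 1) → ℂ} (hp : ∀ j, ¬ PolarHyperplane b j (p j)) :
    Regular b p := by
  obtain ⟨ι, hι, Λ, F, M, hF, hM⟩ := exists_entire fun j => b j / 2
  obtain ⟨K, hK⟩ := exists_nat_gt (∑ j, ∑ i, |(p j + Λ i).re|)
  obtain ⟨ℓ, c, hc, hℓ⟩ := exists_linProd_poch (n := n + 1) Λ K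
  set H : (Fin (n + 1) → ℂ) → ℂ := fun s => c * ∏ j, ∏ i, (G (s j + Λ i + 2 * K))⁻¹ with hHd
  have hH : Differentiable ℂ H := (differentiable_prod_G_inv Λ K).const_mul c
  have hHp : H p ≠ 0 := mul_ne_zero hc (Finset.prod_ne_zero_iff.2 fun j _ =>
    Finset.prod_ne_zero_iff.2 fun i _ => inv_ne_zero (G_ne_zero (ne_neg_two_mul_of_re_pos (by
      have h1 := (Finset.single_le_sum (f := fun i => |(p j + Λ i).re|) (fun _ _ => abs_nonneg _)
        (Finset.mem_univ i)).trans (Finset.single_le_sum (f := fun j => ∑ i, |(p j + Λ i).re|)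
        (fun _ _ => Finset.sum_nonneg fun _ _ => abs_nonneg _) (Finset.mem_univ j))
      have h2 := (abs_le.1 (h1.trans hK.le)).1
      have h3 : (p j + Λ i + 2 * (K : ℂ)).re = (p j + Λ i).re + 2 * K := by simp
      have h4 : (0 : ℝ) < K := (Finset.sum_nonneg fun _ _ =>
        Finset.sum_nonneg fun _ _ => abs_nonneg _).trans_lt hK
      rw [h3]; linarith))))
  obtain ⟨ℓ', E, M', hpol, hE, -, hEM⟩ := exists_reduced_of_list (b := b) isOpen_univ convex_univ
    (nonempty_univ_inter_halfPi _) (P := fun _ => True) (fun _ _ _ _ _ _ _ => trivial) hH _ ℓ F M rfl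
    hF.differentiableOn trivial fun s _ hs => by
      rw [hM s hs, mul_assoc]
      have h1 : ∏ j, ∏ i, (G (s j + Λ i))⁻¹ =
          (∏ j, ∏ i, poch K (s j + Λ i)) * ∏ j, ∏ i, (G (s j + Λ i + 2 * K))⁻¹ := by
        rw [← prod_mul_distrib]
        refine prod_congr rfl fun j _ => ?_
        rw [← prod_mul_distrib]
        exact prod_congr rfl fun i _ => G_inv_eq K _
      rw [h1, hℓ]
      simp only [hHd]
      ring
  exact ⟨_, _, represents_of_eq (b := b) (p := p) (H := fun s => H s * linProd ℓ' s)
    (differentiableOn_univ.1 hE) (hH.mul (differentiable_linProd _))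
    (fun s hs => by rw [hEM s (mem_univ s) hs, mul_assoc])
    (mul_ne_zero hHp fun h0 => by
      obtain ⟨e, he, hpe⟩ := linProd_eq_zero_iff.1 h0
      exact hp e.1 (hpe ▸ hpol e he))⟩

/-- The denominators from `tame` may contain superfluous factors. Paths are known to separate only
genuine polar hyperplanes, so the denominator has to be reduced to these, without losing the growth
bound. -/
theorem exists_reduced (b : Fin (n + 1) → ℂ) (N : ℕ) :
    ∃ (ℓ : List (Fin (n + 1) × ℂ)) (E : (Fin (n + 1) → ℂ) → ℂ) (M : ℝ),
      (∀ e ∈ ℓ, PolarHyperplane b e.1 e.2) ∧ DifferentiableOn ℂ E (halfPi (n + 1) (-N)) ∧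
      StripGrowth (-N) E ∧ (∀ s ∈ halfPi (n + 1) M, E s = v (fun j => b j / 2) s * linProd ℓ s) ∧
      ∀ s ∈ halfPi (n + 1) (-N), (∀ j, ¬ PolarHyperplane b j (s j)) →
        V b s * linProd ℓ s = mfac (n + 1) s * E s := by
  obtain ⟨ι, hι, Λ, h⟩ := tame fun j => b j / 2
  obtain ⟨K, F, M, hF, hg, hM⟩ := h N
  obtain ⟨ℓ, c, hc, hℓ⟩ := exists_linProd_poch (n := n + 1) Λ K
  obtain ⟨ℓ', E, M', hpol, hE, hgE, hEM⟩ := exists_reduced_of_list (b := b)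
    (isOpen_halfPi (n + 1) (-N)) (convex_halfPi _ _) (nonempty_halfPi _ _) (P := StripGrowth (-N))
    (fun _ _ _ _ h1 h2 h3 => h1.div h2 h3) (differentiable_const c) _ ℓ F M rfl hF
    (fun a' ha' R => (hg R).mono fun s hs j => ⟨ha'.trans (hs j).1, (hs j).2⟩)
    fun s _ hs => by rw [hM s hs, hℓ]; ring
  have hM'' : ∀ s ∈ halfPi (n + 1) (max M' (-N)),
      c⁻¹ * E s = v (fun j => b j / 2) s * linProd ℓ' s := fun s hs => by
    rw [hEM s (halfPi_mono (le_max_right _ _) hs) (halfPi_mono (le_max_left _ _) hs)]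
    field_simp
  refine ⟨ℓ', fun s => c⁻¹ * E s, max M' (-N), hpol, hE.const_mul _,
    fun a' ha' R => ((PolyLike.const _).growth _).mul (hgE a' ha' R), hM'', fun s hs hps => ?_⟩
  obtain ⟨F', g, hr⟩ := regular_of_not_polar hps
  obtain ⟨M₁, hM₁⟩ := hr.exists_eq
  rw [V_eq hr, div_mul_eq_mul_div, div_eq_iff hr.2.2.1]
  exact eqOn_of_eqOn_halfPi (isOpen_halfPi (n + 1) (-N)) (convex_halfPi _ _) (nonempty_halfPi _ _)
    (f := fun s => F' s * linProd ℓ' s) (g := fun s => mfac (n + 1) s * (c⁻¹ * E s) * g s)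
    (M := max M₁ (max M' (-N))) (hr.1.mul (differentiable_linProd _)).differentiableOn
    ((differentiable_mfac.differentiableOn.mul (hE.const_mul _)).mul hr.2.1.differentiableOn)
    (fun z _ hz => by
      rw [hM₁ z (halfPi_mono (le_max_left _ _) hz), hM'' z (halfPi_mono (le_max_right _ _) hz)]
      ring) hs
end

/-! ### Contour integrals with parameters -/

namespace IndentedLine
variable {γ : IndentedLine} {z : ℂ}

theorem HasOnRight.notMem_range (h : γ.HasOnRight z) : z ∉ range γ.path := by
  obtain ⟨x, -, hJ⟩ := h
  exact hJ.source_mem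

theorem HasOnLeft.notMem_range (h : γ.HasOnLeft z) : z ∉ range γ.path := by
  obtain ⟨x, -, hJ⟩ := h
  exact hJ.source_mem

theorem hasOnRight_of_lt {B : ℝ} (hB : ∀ t, (γ.path t).re ≤ B) (hz : B < z.re) : γ.HasOnRight z := by
  refine ⟨z.re, fun t => (hB t).trans_lt hz, ?_⟩
  refine (((convex_halfSpace_re_gt B).isPathConnected ⟨z, hz⟩).joinedIn z hz (z.re : ℂ)
    (by simpa using hz)).mono fun w hw => ?_
  rintro ⟨t, rfl⟩
  exact absurd (hB t) (not_le.2 hw)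

theorem HasOnLeft.re_le {B : ℝ} (hB : ∀ t, (γ.path t).re ≤ B) (hz : γ.HasOnLeft z) : z.re ≤ B :=
  not_lt.1 fun h => not_left_and_right hz (hasOnRight_of_lt hB h)

end IndentedLine

theorem Divisor.poch_one {γ₁ γ₂ : IndentedLine} {l c : ℝ} {a : ℂ} (h : Off γ₁ γ₂ l c a) :
    Divisor γ₁ γ₂ l c fun z => poch 1 (z - a) := by
  have := Divisor.mul_sub (1 / 2) _ (by norm_num) h .one
  convert this using 2 with z
  simp [poch]; ring

/-- Integral over a product of paths. -/
def contour {n : ℕ} (γ : Fin n → IndentedLine) (f : (Fin n → ℂ) → ℂ) : ℂ :=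
  ∫ t : Fin n → ℝ, f (fun j => (γ j).path (t j)) * ∏ j, deriv (γ j).path (t j)

theorem contour_vline {n : ℕ} (c : ℝ) (f : (Fin n → ℂ) → ℂ) : contour (fun _ => vline c) f =
    I ^ n * ∫ t, f (vpt (fun _ => c) t) := by
  simp only [contour, deriv_vline, prod_const, card_univ, Fintype.card_fin]
  rw [integral_mul_const, mul_comm]
  rfl

/-- Sequences of poles of a product of Gamma functions and Beta functions, moving to the right with
the parameter. -/
structure Poles (n : ℕ) (S P : Type) where
  /-- the variable -/
  coord : S ⊕ P ⊕ P → Fin n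
  /-- the first pole -/
  root : Fin n ⊕ S ⊕ P ⊕ P → ℂ
  /-- the velocity -/
  weight : Fin n ⊕ S ⊕ P ⊕ P → ℝ
  one_le : ∀ i, 1 ≤ weight i

namespace Poles
variable {n : ℕ} {S P : Type} (F : Poles n S P)

/-- The variable of a sequence of poles. -/
def var : Fin n ⊕ S ⊕ P ⊕ P → Fin n := Sum.elim id F.coord

/-- The argument of a Gamma function. -/
def arg (i : Fin n ⊕ S ⊕ P ⊕ P) (η : ℂ) (z : Fin n → ℂ) : ℂ := F.root i + F.weight i * η - z (F.var i)

variable [Fintype S] [Fintype P]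

/-- The product of Gamma functions and Beta functions. -/
def ker (η : ℂ) (z : Fin n → ℂ) : ℂ :=
  (∏ j, G (F.arg (.inl j) η z)) * ((∏ a, G (F.arg (.inr (.inl a)) η z)) *
    ∏ a, Bt (F.arg (.inr (.inr (.inl a))) η z) (F.arg (.inr (.inr (.inr a))) η z))

/-- The factors of the kernel of bounded growth, with shifted arguments. -/
def kerBdd (K : ℕ) (η : ℂ) (z : Fin n → ℂ) : ℂ :=
  (∏ a, G (F.arg (.inr (.inl a)) η z + 2 * K)) *
    ∏ a, (Bt (F.arg (.inr (.inr (.inl a))) η z + 2 * K) (F.arg (.inr (.inr (.inr a))) η z + 2 * K) *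
      poch (K + K) (F.arg (.inr (.inr (.inl a))) η z + F.arg (.inr (.inr (.inr a))) η z))

/-- Concentrates all poles in one finite product of linear factors, while the shifted Gamma and Beta
factors are regular in the region under consideration. -/
theorem ker_eq_shift (K : ℕ) {η : ℂ} {z : Fin n → ℂ} (h : ∀ i (k : ℕ), F.arg i η z ≠ -(2 * k)) :
    F.ker η z = (∏ j, G (F.root (.inl j) + F.weight (.inl j) * η + 2 * K - z j)) * F.kerBdd K η z *
      (∏ i, poch K (F.arg i η z))⁻¹ := by
  have hp : ∀ i, poch K (F.arg i η z) ≠ 0 := fun i => poch_ne_zero_of_ne (h i) K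
  have hG : ∀ i, G (F.arg i η z) = G (F.arg i η z + 2 * K) * (poch K (F.arg i η z))⁻¹ := fun i => by
    rw [G_add K (h i), mul_comm (poch _ _), mul_assoc, mul_inv_cancel₀ (hp i), mul_one]
  have hl : ∀ j, F.root (.inl j) + F.weight (.inl j) * η + 2 * K - z j = F.arg (.inl j) η z + 2 * K :=
    fun j => by rw [arg, var, Sum.elim_inl, id]; ring
  simp only [hl, ker, kerBdd, Fintype.prod_sum_type, mul_inv]
  rw [prod_congr rfl fun j _ => hG (.inl j), prod_congr rfl fun a _ => hG (.inr (.inl a)),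
    prod_congr rfl fun a _ => Bt_eq_shift K (h (.inr (.inr (.inl a)))) (h (.inr (.inr (.inr a))))]
  simp only [prod_mul_distrib, Finset.prod_inv_distrib]
  ring

omit [Fintype S] [Fintype P] in
theorem polyLike_arg (i) : PolyLike fun q : ℂ × (Fin n → ℂ) => F.arg i q.1 q.2 :=
  ((PolyLike.const _).add ((PolyLike.const _).mul
    (PolyLike.clm (ContinuousLinearMap.fst ℂ ℂ (Fin n → ℂ)) :))).sub (PolyLike.snd_apply _)

/-- The lower bound on `K` makes every shifted argument have real part at least `1` for `Re η > -1`,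
so that `η = 0` is an interior point. -/
theorem kernel {T l c : ℝ} {K : ℕ} (hK : ∀ i, 1 + c + F.weight i ≤ (F.root i).re + 2 * K)
    {E : (Fin n → ℂ) → ℂ} (hE : DifferentiableOn ℂ E (stripPi n l c)) (hg : Growth (stripPi n l c) E) :
    Kernel {η : ℂ | -1 < η.re ∧ η.re < T} n l c fun η z =>
      (∏ j, G (F.root (.inl j) + F.weight (.inl j) * η + 2 * K - z j)) * (F.kerBdd K η z * E z) := by
  have hw := F.one_le
  obtain ⟨κ, hκ⟩ := Finite.exists_le fun i => ‖F.root i‖ + F.weight i + 2 * K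
  obtain ⟨b, hb⟩ := Finite.exists_le fun i => (F.root i).re + F.weight i * |T| + 2 * K - l
  have hre : ∀ i (η : ℂ), -1 < η.re → η.re < T → ∀ z : ℂ, l < z.re → z.re < c →
      1 ≤ (F.root i + F.weight i * η - z + 2 * K).re ∧
        (F.root i + F.weight i * η - z + 2 * K).re ≤ b := by
    intro i η h1 h2 z hz1 hz2
    have e : (F.root i + F.weight i * η - z + 2 * K).re =
        (F.root i).re + F.weight i * η.re - z.re + 2 * K := by simp
    have h3 := hK i
    have h4 := hb i
    have h5 := hw i
    have h6 : F.weight i * η.re ≤ F.weight i * |T| :=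
      mul_le_mul_of_nonneg_left (h2.le.trans (le_abs_self T)) (by linarith)
    have h7 : F.weight i * -1 ≤ F.weight i * η.re := mul_le_mul_of_nonneg_left h1.le (by linarith)
    rw [e]
    constructor <;> linarith
  set D : Set (ℂ × (Fin n → ℂ)) := {η : ℂ | -1 < η.re ∧ η.re < T} ×ˢ stripPi n l c
  have hre' : ∀ i, ∀ q ∈ D, 1 ≤ (F.arg i q.1 q.2 + 2 * K).re ∧ (F.arg i q.1 q.2 + 2 * K).re ≤ b :=
    fun i q hq => hre i q.1 hq.1.1 hq.1.2 _ (hq.2 _).1 (hq.2 _).2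
  have hd : ∀ i, DifferentiableOn ℂ (fun q : ℂ × (Fin n → ℂ) => F.arg i q.1 q.2 + 2 * K) D := fun i =>
    ((F.polyLike_arg i).add (.const _)).1.differentiableOn
  refine kernel_of_G (b := b) (κ := κ) (fun j => by fun_prop) (fun j η => ?_) (fun j η hη z h1 h2 => ?_)
    (DifferentiableOn.mul (DifferentiableOn.mul (differentiableOn_prod fun a => ?_)
      (differentiableOn_prod fun a => DifferentiableOn.mul ?_ ?_)) ?_)
    (Growth.mul (Growth.mul (Growth.prod fun a => growth_G_comp (hre' _))
      (Growth.prod fun a => Growth.mul (growth_Bt_comp (fun q hq => (hre' _ q hq).1)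
        fun q hq => (hre' _ q hq).1) ?_)) ?_)
  · have h1 := hκ (.inl j)
    have h2 := norm_nonneg η
    have h3 : ‖(F.weight (.inl j) : ℂ) * η‖ = F.weight (.inl j) * ‖η‖ := by
      rw [norm_mul, Complex.norm_real, Real.norm_of_nonneg (zero_le_one.trans (hw _))]
    have h4 := norm_add₃_le (a := F.root (.inl j)) (b := F.weight (.inl j) * η) (c := 2 * (K : ℂ))
    have h5 : ‖2 * (K : ℂ)‖ = 2 * K := by simp
    have h6 : (0 : ℝ) ≤ K := Nat.cast_nonneg K
    have h7 := mul_le_mul_of_nonneg_right h1 h2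
    have h8 := norm_nonneg (F.root (.inl j))
    have h9 := hw (.inl j)
    nlinarith [mul_nonneg h8 h2, mul_nonneg h6 h2]
  · have := hre (.inl j) η hη.1 hη.2 z h1 h2
    rwa [sub_add_eq_add_sub] at this
  · exact differentiableOn_G_comp (hd _) fun q hq => one_pos.trans_le (hre' _ q hq).1
  · exact differentiableOn_Bt_comp (hd _) (hd _) (fun q hq => one_pos.trans_le (hre' _ q hq).1)
      fun q hq => one_pos.trans_le (hre' _ q hq).1
  · exact (((F.polyLike_arg _).add (F.polyLike_arg _)).poch _).1.differentiableOn
  · exact hE.comp differentiable_snd.differentiableOn fun q hq => hq.2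
  · exact (((F.polyLike_arg _).add (F.polyLike_arg _)).poch _).growth _
  · exact hg.comp (L := fun q : ℂ × (Fin n → ℂ) => q.2) (fun q hq => hq.2) fun q => norm_snd_le q

set_option maxHeartbeats 1000000 in
/-- A formula for an integral over straight lines, valid when the poles to the right are far away,
continues to arbitrary separating paths. -/
theorem contour_eq {γ : Fin n → IndentedLine} (hγ : ∀ i (k : ℕ), (γ (F.var i)).HasOnRight (F.root i + 2 * k))
    {Q : Fin n → ℂ → Prop} (hQ : ∀ j x, Q j x → (γ j).HasOnLeft x) {W : (Fin n → ℂ) → ℂ}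
    (hW : ∀ N : ℕ, ∃ (ℓ : List (Fin n × ℂ)) (E : (Fin n → ℂ) → ℂ), (∀ e ∈ ℓ, Q e.1 e.2) ∧
      DifferentiableOn ℂ E (halfPi n (-N)) ∧ StripGrowth (-N) E ∧
      ∀ s ∈ halfPi n (-N), (∀ j, ¬ Q j (s j)) → W s * linProd ℓ s = E s)
    {X Y : ℂ → ℂ} (hX : Differentiable ℂ X) (hY : Differentiable ℂ Y)
    (h : ∃ M : ℝ, ∀ c ≥ M, ∃ T : ℝ, ∀ η : ℂ, T ≤ η.re →
      X η = Y η * ∫ t, F.ker η (vpt (fun _ => c) t) * W (vpt (fun _ => c) t)) :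
    X 0 = Y 0 * (1 / I ^ n * contour γ fun z => F.ker 0 z * W z) := by
  have hw := F.one_le
  choose B hB0 hB using fun j => (γ j).exists_bound
  choose l₀ hl₀ using fun i => IndentedLine.exists_joinedIn_progression (γ := γ (F.var i)) (Or.inl rfl) (F.root i)
    (fun _ => True) fun k _ => by simpa using (hγ i k).onSide
  obtain ⟨B₁, hB₁⟩ := Finite.exists_le B
  obtain ⟨l₁, hl₁⟩ := Finite.exists_ge l₀
  obtain ⟨l₂, hl₂⟩ := Finite.exists_ge fun i => (F.root i).re - F.weight i - 2
  -- The left line: to the left of all paths, at distance at least `2` from the poles of the kernel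
  -- for `Re η > -1`, and disjoint from the arcs witnessing that these poles at `η = 0` lie to the
  -- right of `γ`.
  obtain ⟨l', hl'⟩ : ∃ l', l' ≤ l₁ ∧ l' ≤ l₂ ∧ l' ≤ -B₁ :=
    ⟨min l₁ (min l₂ (-B₁)), by simp, by simp, by simp⟩
  obtain ⟨N, hN⟩ := exists_nat_gt (-(l' - 1))
  obtain ⟨ℓ, E, hℓQ, hEd, hEg, hE⟩ := hW N
  have hQ' : ∀ e : Fin ℓ.length, Q ℓ[e].1 ℓ[e].2 := fun e => hℓQ _ (List.getElem_mem _)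
  choose c₀ hc₀ using fun e : Fin ℓ.length => (hQ _ _ (hQ' e)).onSide.exists_joinedIn (Or.inr rfl)
  obtain ⟨c₁, hc₁⟩ := Finite.exists_ge c₀
  obtain ⟨c₂, hc₂⟩ := Finite.exists_le fun e : Fin ℓ.length => ℓ[e].2.re + 2
  obtain ⟨M, hM⟩ := h
  -- The right line: to the right of all paths, at distance at least `2` beyond the left poles,
  -- disjoint from their witnessing arcs, and beyond `M`, where the straight formula is given.
  obtain ⟨c', hc'⟩ : ∃ c', -c₁ ≤ c' ∧ c₂ ≤ c' ∧ B₁ + 1 ≤ c' ∧ M ≤ c' ∧ l' + 1 ≤ c' :=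
    ⟨max (-c₁) (max c₂ (max (B₁ + 1) (max M (l' + 1)))), by simp, by simp, by simp, by simp, by simp⟩
  obtain ⟨T₀, hT₀⟩ := hM c' hc'.2.2.2.1
  obtain ⟨T₁, hT₁⟩ := Finite.exists_le fun i => c' + 1 - (F.root i).re
  -- Every velocity is at least `1`, so for `Re η ≥ T` all poles of the kernel have passed to the
  -- right of `c'`.
  obtain ⟨T, hT⟩ : ∃ T, T₀ ≤ T ∧ T₁ ≤ T ∧ 0 ≤ T := ⟨max T₀ (max T₁ 0), by simp, by simp, by simp⟩
  obtain ⟨K₁, hK₁⟩ := Finite.exists_le fun i => 1 + (c' + 1) + F.weight i - (F.root i).re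
  obtain ⟨K, hK⟩ := exists_nat_gt K₁
  have hQc : ∀ j x, Q j x → x.re < c' := fun j x hx => by
    have := (hQ j x hx).re_le (B := B₁) fun t => (abs_le.1 (hB j t).1).2.trans (hB₁ j)
    linarith [hc'.2.2.1]
  have hl1 : l' - 1 < l' := by linarith
  have hc1 : c' < c' + 1 := by linarith
  have hker := F.kernel (T := T + 2) (l := l' - 1) (c := c' + 1) (K := K) (fun i => by
    have := hK₁ i
    have : (0 : ℝ) ≤ K := Nat.cast_nonneg K
    linarith) (hEd.mono fun s hs j => by linarith [(hs j).1]) (hEg _ (by linarith) _)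
  set U : ℂ → (Fin n → ℂ) → ℂ := fun η z =>
    (∏ j, G (F.root (.inl j) + F.weight (.inl j) * η + 2 * K - z j)) * (F.kerBdd K η z * E z) with hU
  set A : Fin n → ℂ → ℂ := fun j z => ∏ e : {e : Fin ℓ.length // ℓ[e].1 = j}, poch 1 (z - ℓ[e.1].2) with hA
  set Bf : Fin n → ℂ → ℂ → ℂ := fun j η z =>
    ∏ i : {i // F.var i = j}, poch K (F.root i + F.weight i * η - z) with hBf
  set R : Fin n → ℂ → ℂ := fun j η => ∏ e : {e : Fin ℓ.length // ℓ[e].1 = j},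
    ∏ i : {i // F.var i = j}, poch K (F.root i + F.weight i * η - ℓ[e.1].2) with hR
  have p2 : PolyLike fun q : ℂ × ℂ => q.2 := PolyLike.snd
  have p1 : PolyLike fun q : ℂ × ℂ => q.1 := (PolyLike.clm (ContinuousLinearMap.fst ℂ ℂ ℂ) :)
  have pg : ∀ i, PolyLike fun q : ℂ × ℂ => F.root i + F.weight i * q.1 - q.2 := fun i =>
    ((PolyLike.const _).add ((PolyLike.const _).mul p1)).sub p2
  -- For each pair consisting of a left root and a right sequence, the variable cancels in the sum
  -- of the two arguments. Hence `R j` depends on `η` alone.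
  have hbez : ∀ j, Bezout (fun q : ℂ × ℂ => R j q.1) (fun q => A j q.2) fun q => Bf j q.1 q.2 := by
    intro j
    refine Bezout.prod_left (fun e => ?_) (fun e => (p2.sub (.const _)).poch _)
      (.prod _ fun i _ => (pg _).poch _)
    refine Bezout.prod_right (fun i => ?_) ((p2.sub (.const _)).poch _) fun i => (pg _).poch _
    have := Bezout.poch (p2.sub (.const ℓ[e.1].2)) (pg i.1) (M := K) (K := 1) (N := K) (add_comm _ _)
    convert this using 3
    ring
  choose α β hα hβ hαβ using hbez
  have hAd : ∀ j, Differentiable ℂ (A j) := fun j => by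
    have : Differentiable ℂ fun z : ℂ => ((0 : ℂ), z) := by fun_prop
    exact (PolyLike.prod (E := ℂ × ℂ) Finset.univ fun (e : {e : Fin ℓ.length // ℓ[e].1 = j}) _ =>
      (p2.sub (.const ℓ[e.1].2)).poch 1).1.comp this
  have hspec := splitIntegral_spec (isOpen_strip (-1) (T + 2)) hl1 (by linarith : l' < c') hc1 hker
    (A := A) (B := Bf) (α := fun j s z => α j (s, z)) (β := fun j s z => β j (s, z)) (R := R) hAd
    (fun j => (PolyLike.prod _ fun i _ => (pg _).poch _).1) hα hβ (fun j s z => hαβ j (s, z))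
    (fun j z hz => one_le_norm_prod fun e => one_le_norm_poch (by
      have := hc₂ e.1
      rw [sub_re, hz]; linarith))
    (fun j s hs z hz => one_le_norm_prod fun i => one_le_norm_poch (by
      have h1 := hl₂ i.1
      have h2 : F.weight i * -1 ≤ F.weight i * s.re :=
        mul_le_mul_of_nonneg_left hs.1.le (by linarith [hw i.1])
      have h3 : (F.root i + F.weight i * s - z).re = (F.root i).re + F.weight i * s.re - z.re := by simp
      rw [h3, hz]; linarith))
  set Φ := splitIntegral n l' c' U A Bf (fun j s z => α j (s, z)) (fun j s z => β j (s, z))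
  -- The integrand before splitting, identified with the original one on any path free of poles. It
  -- is used for the given paths at `η = 0` and for the line `c'` at large `η`.
  have heval : ∀ (γ' : Fin n → IndentedLine) (η : ℂ),
      (∀ j t, l' - 1 < ((γ' j).path t).re ∧ ((γ' j).path t).re < c' + 1) →
      (∀ i (k : ℕ), F.root i + F.weight i * η + 2 * k ∉ range (γ' (F.var i)).path) →
      (∀ j t, ¬ Q j ((γ' j).path t)) →
      ∫ t : Fin n → ℝ, U η (fun j => (γ' j).path (t j)) * ∏ j, (deriv (γ' j).path (t j) *
        ((A j ((γ' j).path (t j)))⁻¹ * (Bf j η ((γ' j).path (t j)))⁻¹)) =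
      2 ^ ℓ.length * contour γ' fun z => F.ker η z * W z := by
    intro γ' η hs hr hq
    rw [contour, ← integral_const_mul]
    refine integral_congr_ae (Eventually.of_forall fun t => ?_)
    set z : Fin n → ℂ := fun j => (γ' j).path (t j) with hz
    have harg : ∀ i (k : ℕ), F.arg i η z ≠ -(2 * k) := fun i k h0 => hr i k ⟨t (F.var i), by
      have : F.root i + F.weight i * η - z (F.var i) = -(2 * k) := h0
      linear_combination -this⟩
    have hBz : ∏ j, Bf j η (z j) = ∏ i, poch K (F.arg i η z) := by
      rw [← Fintype.prod_fiberwise F.var]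
      refine prod_congr rfl fun j _ => prod_congr rfl fun i _ => ?_
      rw [arg, i.2]
    have hAz : linProd ℓ z = 2 ^ ℓ.length * ∏ j, A j (z j) := by
      have h1 : ∏ j, A j (z j) = ∏ e : Fin ℓ.length, ((z ℓ[e].1 - ℓ[e].2) / 2) := by
        rw [← Fintype.prod_fiberwise fun e : Fin ℓ.length => ℓ[e].1]
        refine prod_congr rfl fun j _ => prod_congr rfl fun e _ => ?_
        rw [e.2]
        simp [poch]
      rw [h1, Finset.prod_div_distrib, prod_const, card_univ, Fintype.card_fin,
        mul_div_cancel₀ _ (pow_ne_zero _ two_ne_zero), linProd, ← Fin.prod_univ_fun_getElem]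
      rfl
    have hE0 : linProd ℓ z ≠ 0 := fun h0 => by
      obtain ⟨e, he, hze⟩ := linProd_eq_zero_iff.1 h0
      exact hq e.1 (t e.1) (by have := hℓQ e he; rwa [← hze] at this)
    have hEz := hE z (fun j => by have := (hs j (t j)).1; simp only [hz]; linarith) fun j => hq j (t j)
    rw [hAz] at hE0 hEz
    change U η z * ∏ j, (deriv (γ' j).path (t j) * ((A j (z j))⁻¹ * (Bf j η (z j))⁻¹)) =
      2 ^ ℓ.length * (F.ker η z * W z * _)
    simp only [prod_mul_distrib, Finset.prod_inv_distrib]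
    rw [hBz, F.ker_eq_shift K harg, hU]
    simp only
    rw [← hEz]
    have := (mul_ne_zero_iff.1 hE0).2
    generalize (∏ j, G (F.root (.inl j) + F.weight (.inl j) * η + 2 * K - z j)) = g₀
    field_simp
  have hstrip0 : ∀ j t, l' - 1 < ((γ j).path t).re ∧ ((γ j).path t).re < c' + 1 := fun j t => by
    have h1 := abs_le.1 (hB j t).1
    have h2 := hB₁ j
    constructor <;> linarith [hl'.2.2, hc'.2.2.1]
  have h0 := hspec.2.2 0 ⟨by simp, by simp; linarith⟩ γ hstrip0
    (fun j => .prod _ fun i _ => .poch_sub _ fun k => by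
      obtain ⟨i, rfl⟩ := i
      obtain ⟨X, hX, hJ⟩ := hl₀ i l' (by rw [one_mul]; exact hl'.1.trans (hl₁ i)) (c' + 1) k trivial
      simpa using Off.of_right hX hJ)
    fun j => .prod _ fun e _ => by
      obtain ⟨e, rfl⟩ := e
      obtain ⟨X, hX, hJ⟩ := hc₀ e c' (by linarith [hc₁ e]) (-(l' - 1))
      exact .poch_one (Off.of_left hX hJ)
  rw [heval γ 0 hstrip0 (fun i k => by simpa using (hγ i k).notMem_range)
    fun j t hq => (hQ j _ hq).notMem_range ⟨t, rfl⟩] at h0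
  -- A zero would identify a point to the left of a path with a point to its right.
  have hR0 : ∏ j, R j 0 ≠ 0 := Finset.prod_ne_zero_iff.2 fun j _ => Finset.prod_ne_zero_iff.2 fun e _ =>
    Finset.prod_ne_zero_iff.2 fun i _ => poch_ne_zero_of_ne (fun k hk => by
      have h1 := hγ i.1 k
      rw [i.2] at h1
      have h2 := hQ _ _ (hQ' e.1)
      rw [e.2] at h2
      refine IndentedLine.not_left_and_right h2 ?_
      convert h1 using 1
      linear_combination -hk) _
  have hRd : Differentiable ℂ fun η => ∏ j, R j η := by
    have pid : PolyLike fun η : ℂ => η := (PolyLike.clm (ContinuousLinearMap.id ℂ ℂ) :)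
    refine differentiableOn_univ.1 (differentiableOn_prod fun j => differentiableOn_prod fun e =>
      differentiableOn_prod fun i => ?_)
    exact ((((PolyLike.const _).add ((PolyLike.const _).mul pid)).sub (.const _)).poch K).1.differentiableOn
  -- Identity theorem in `η` on a strip containing `0` and `T + 1`; near the latter the straight
  -- formula applies.
  have key := eq_of_eventuallyEq_convex (isOpen_strip (-1) (T + 2)) (convex_strip (-1) (T + 2))
    (f := fun η => X η * (2 ^ ℓ.length * I ^ n * ∏ j, R j η)) (g := fun η => Y η * Φ η)
    (hX.mul (hRd.const_mul _)).differentiableOn (hY.differentiableOn.mul hspec.1)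
    (a := ((T + 1 : ℝ) : ℂ)) (b := 0) (by constructor <;> simp only [ofReal_re] <;> linarith)
    (by constructor <;> simp only [Complex.zero_re] <;> linarith) ?_
  · simp only [h0] at key
    have : (I ^ n : ℂ) ≠ 0 := pow_ne_zero _ Complex.I_ne_zero
    have h2 : (2 ^ ℓ.length : ℂ) ≠ 0 := pow_ne_zero _ two_ne_zero
    field_simp
    refine mul_right_cancel₀ (mul_ne_zero h2 hR0) ?_
    linear_combination key
  · filter_upwards [(isOpen_strip T (T + 2)).mem_nhds (x := ((T + 1 : ℝ) : ℂ))
      (by constructor <;> simp only [ofReal_re] <;> linarith)] with η hη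
    have hrt : ∀ i (k : ℕ), c' < (F.root i + F.weight i * η + 2 * k).re := fun i k => by
      have h1 : (F.root i + F.weight i * η + 2 * k).re = (F.root i).re + F.weight i * η.re + 2 * k := by simp
      have h2 := hT₁ i
      have h3 : T ≤ F.weight i * η.re := hη.1.le.trans
        (le_mul_of_one_le_left (hT.2.2.trans hη.1.le) (hw i))
      have h4 : (0 : ℝ) ≤ k := Nat.cast_nonneg k
      rw [h1]; linarith [hT.2.1]
    have hstrip1 : ∀ (j : Fin n) t, l' - 1 < ((vline c').path t).re ∧ ((vline c').path t).re < c' + 1 :=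
      fun j t => by rw [vline_path_re]; constructor <;> linarith [hc'.2.2.2.2]
    have h1 := hspec.2.2 η ⟨by linarith [hη.1], hη.2⟩ (fun _ => vline c') hstrip1
      (fun j => .prod _ fun i _ => .poch_sub _ fun k => off_vline_right (hrt i k)
        ((by linarith [hc'.2.2.2.2] : l' < c').trans (hrt i k)))
      fun j => .prod _ fun e _ => by
        have h2 := hc₂ e.1
        exact .poch_one (off_vline_left (by linarith) (by linarith))
    rw [heval (fun _ => vline c') η hstrip1 (fun i k => by
      rintro ⟨t, ht⟩
      have := hrt i k
      rw [← ht, vline_path_re] at this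
      exact lt_irrefl _ this) (fun j t hq => by
      have := hQc j _ hq
      rw [vline_path_re] at this
      exact lt_irrefl _ this), contour_vline] at h1
    rw [hT₀ η (hT.1.trans hη.1.le)]
    change _ = Y η * Φ η
    rw [h1]
    ring

end Poles

/-! ### Barnes' first lemma -/

theorem integral_fin_one (f : ℝ → ℂ) : ∫ t : Fin 1 → ℝ, f (t 0) = ∫ t, f t :=
  (volume_preserving_funUnique (Fin 1) ℝ).integral_comp' f

/-- The recursion without integration variables; this is the Mellin transform of the Bessel
function. -/
theorem v_one (β s : Fin 1 → ℂ) (h1 : 0 < (s 0).re + 2 * (β 0).re) (h2 : 0 < (s 0).re - 2 * (β 0).re) :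
    v β s = G (s 0 - 2 * β 0) * G (s 0 + 2 * β 0) := by
  have e : (-(2 * β 0)).re = -(2 * (β 0).re) := by simp
  have h := rec_identity (n := 0) (τ := -(2 * β 0)) (s := s) (c := fun _ => 0) (β := β) rfl (fun j => j.elim0)
    (fun j => j.elim0) (fun j => j.elim0) (fun j => j.elim0) (by rw [e]; linarith) (by rw [e]; linarith)
    (convAbs_wAbs _ _ fun j => j.elim0)
  have h0 : ∀ x : Fin 0 → ℝ, vexp (fun j => j.elim0) x = 1 := fun x => by simp [vexp]
  rw [h, Measure.volume_pi_eq_dirac (0 : Fin 0 → ℝ), integral_dirac, v,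
    Measure.volume_pi_eq_dirac (0 : Fin 0 → ℝ), integral_dirac]
  simp [recK, w, vexp, sub_eq_add_neg]

/-- This is `star_identity` for `n = 1`, with `v` explicit by `v_one`. The translation by the mean
`μ` of `b₁`, `b₂` and the choice `β = (b₁ - b₂) / 4` accommodate four independent parameters. -/
theorem barnes_straight {a₁ a₂ b₁ b₂ : ℂ} {c : ℝ} (h1 : b₁.re + 1 < c) (h2 : b₂.re + 1 < c)
    (h3 : c < a₁.re) (h4 : c < a₂.re) :
    G (a₁ - b₁) * G (a₁ - b₂) * G (a₂ - b₁) * G (a₂ - b₂) * (4 * Real.pi) = G (a₁ + a₂ - b₁ - b₂) *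
      ∫ t : ℝ, G (a₁ - (c + t * I)) * G (a₂ - (c + t * I)) *
        (G ((c + t * I) - b₁) * G ((c + t * I) - b₂)) := by
  set μ : ℂ := (b₁ + b₂) / 2 with hμ
  set β : Fin 1 → ℂ := fun _ => (b₁ - b₂) / 4 with hβ
  have hμre : μ.re = (b₁.re + b₂.re) / 2 := by simp [hμ]
  have hβre : ∀ j, (β j).re = (b₁.re - b₂.re) / 4 := fun j => by simp [hβ]
  have hβabs : 2 * |(b₁.re - b₂.re) / 4| < c - μ.re - 1 := by
    rw [hμre]
    have := abs_lt.2 (⟨by linarith, by linarith⟩ : -((c - (b₁.re + b₂.re) / 2 - 1) / 2) <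
      (b₁.re - b₂.re) / 4 ∧ (b₁.re - b₂.re) / 4 < (c - (b₁.re + b₂.re) / 2 - 1) / 2)
    linarith
  have habs := abs_nonneg ((b₁.re - b₂.re) / 4)
  have habs' := abs_le.1 (le_refl |(b₁.re - b₂.re) / 4|)
  have hab : absc 1 (fun j => (β j).re) < c - μ.re := by
    simp only [absc, hβre]; linarith
  have h := star_identity (n := 1) (σ := a₂ - μ) (p := fun _ => a₁ - μ) (c := fun _ => c - μ.re) (β := β)
    (fun j => by rw [hβre j, sub_re]; linarith) (fun j => by rw [sub_re]; linarith)
    (fun j => by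
      rw [Subsingleton.elim j 0, sh_zero, sub_re, sub_re, Complex.zero_re]; linarith)
    (fun j => by
      rw [Subsingleton.elim j 0, sh_zero, Complex.zero_re, sub_re]; linarith)
    (by rw [sub_re]; linarith) (convAbs_wAbs _ _ fun j => by rw [ofReal_re]; exact hab)
    (convAbs_wAbs _ _ fun j => by rw [sub_re]; linarith)
  have hv : ∀ s : Fin 1 → ℂ, c - μ.re ≤ (s 0).re → v β s = G (s 0 + μ - b₁) * G (s 0 + μ - b₂) :=
    fun s hs => by
      rw [v_one β s (by rw [hβre 0]; linarith) (by rw [hβre 0]; linarith)]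
      simp only [hβ, hμ]
      congr 2 <;> ring
  rw [hv _ (by rw [sub_re]; linarith)] at h
  have hint : ∀ t : Fin 1 → ℝ, starK (a₂ - μ) (fun _ => a₁ - μ) (vpt (fun _ => c - μ.re) t) *
      v β (vpt (fun _ => c - μ.re) t) = G (a₁ + a₂ - b₁ - b₂) *
      (G (a₁ - (c + ((t 0 + μ.im : ℝ) : ℂ) * I)) * G (a₂ - (c + ((t 0 + μ.im : ℝ) : ℂ) * I)) *
        (G ((c + ((t 0 + μ.im : ℝ) : ℂ) * I) - b₁) *
          G ((c + ((t 0 + μ.im : ℝ) : ℂ) * I) - b₂))) := fun t => by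
    set r := vpt (fun _ => c - μ.re) t with hr
    have hr0 : r 0 + μ = c + ((t 0 + μ.im : ℝ) : ℂ) * I := by
      conv_lhs => rw [← Complex.re_add_im μ]
      simp only [hr, vpt]; push_cast; ring
    have hrre : (r 0).re = c - μ.re := by simp [hr, vpt]
    rw [hv r hrre.ge, ← hr0, starK, Fin.prod_univ_one, sh_zero, sh_zero, Bt]
    have e1 : a₁ - μ - 0 + (a₂ - μ) + (0 - r 0 + (a₂ - μ)) = a₁ - μ - r 0 + 2 * (a₂ - μ) := by ring
    have e2 : a₁ - μ - 0 + (a₂ - μ) = a₁ + a₂ - b₁ - b₂ := by rw [hμ]; ring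
    have hG0 : G (a₁ - μ - r 0 + 2 * (a₂ - μ)) ≠ 0 := G_ne_zero (ne_neg_two_mul_of_re_pos (by
      have : (a₁ - μ - r 0 + 2 * (a₂ - μ)).re = a₁.re - μ.re - (r 0).re + 2 * (a₂.re - μ.re) := by simp
      rw [this, hrre]; linarith))
    rw [e1, e2, show a₁ - (r 0 + μ) = a₁ - μ - r 0 by ring, show a₂ - (r 0 + μ) = 0 - r 0 + (a₂ - μ) by ring]
    field_simp
  simp only [hint] at h
  rw [integral_const_mul, integral_fin_one fun t => G (a₁ - (c + ((t + μ.im : ℝ) : ℂ) * I)) *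
      G (a₂ - (c + ((t + μ.im : ℝ) : ℂ) * I)) * (G ((c + ((t + μ.im : ℝ) : ℂ) * I) - b₁) *
        G ((c + ((t + μ.im : ℝ) : ℂ) * I) - b₂)),
    integral_add_right_eq_self (fun t : ℝ => G (a₁ - (c + t * I)) * G (a₂ - (c + t * I)) *
        (G ((c + t * I) - b₁) * G ((c + t * I) - b₂))) μ.im, Fin.prod_univ_one, pow_one] at h
  have e3 : Gamma ((a₂ - μ) / 2 + β 0) = G (a₂ - b₂) := by
    rw [G]; congr 1; simp only [hβ, hμ]; ring
  have e4 : Gamma ((a₂ - μ) / 2 - β 0) = G (a₂ - b₁) := by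
    rw [G]; congr 1; simp only [hβ, hμ]; ring
  rw [e3, e4, sub_add_cancel] at h
  have hpi : (Real.pi : ℂ) ≠ 0 := Complex.ofReal_ne_zero.2 pi_ne_zero
  generalize (∫ t : ℝ, G (a₁ - (c + t * I)) * G (a₂ - (c + t * I)) *
    (G ((c + t * I) - b₁) * G ((c + t * I) - b₂))) = J at h ⊢
  field_simp at h
  linear_combination h

/-- The linear factors cancelling the first poles of `G (z - b)`. -/
def rootList (b : ℂ) (K : ℕ) : List (Fin 1 × ℂ) := (List.range K).map fun k : ℕ => (0, b - 2 * k)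

theorem linProd_rootList (b : ℂ) (K : ℕ) (s : Fin 1 → ℂ) :
    linProd (rootList b K) s = 2 ^ K * poch K (s 0 - b) := by
  induction K with
  | zero => simp [linProd, rootList, poch]
  | succ K ih =>
    rw [poch_succ, pow_succ, show linProd (rootList b (K + 1)) s =
      linProd (rootList b K) s * (s 0 - (b - 2 * K)) by simp [linProd, rootList, List.range_succ], ih]
    ring

/-- Barnes' first lemma for an indented line. -/
theorem barnes {γ : IndentedLine} {a₁ a₂ b₁ b₂ : ℂ} (ha₁ : ∀ k : ℕ, γ.HasOnRight (a₁ + 2 * k))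
    (ha₂ : ∀ k : ℕ, γ.HasOnRight (a₂ + 2 * k)) (hb₁ : ∀ k : ℕ, γ.HasOnLeft (b₁ - 2 * k))
    (hb₂ : ∀ k : ℕ, γ.HasOnLeft (b₂ - 2 * k)) :
    ∫ t, G (a₁ - γ.path t) * G (a₂ - γ.path t) * (G (γ.path t - b₁) * G (γ.path t - b₂)) *
      deriv γ.path t = 4 * Real.pi * I * (G (a₁ - b₁) * G (a₁ - b₂) * G (a₂ - b₁) * G (a₂ - b₂) *
        (G (a₁ + a₂ - b₁ - b₂))⁻¹) := by
  -- Both `a₁` and `a₂` move with velocity `1`. The two Gamma functions in `z - b₁`, `z - b₂` play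
  -- the role of the function `W` with poles on the left, and no Beta factor occurs.
  let F : Poles 1 Unit Empty := ⟨fun _ => 0, Sum.elim (fun _ => a₁) fun _ => a₂, fun _ => 1, fun _ => le_rfl⟩
  have hker : ∀ η z, F.ker η z = G (a₁ + η - z 0) * G (a₂ + η - z 0) := fun η z => by
    simp [F, Poles.ker, Poles.arg, Poles.var]
  let W : (Fin 1 → ℂ) → ℂ := fun z => G (z 0 - b₁) * G (z 0 - b₂)
  have hN : ∀ a b : ℂ, (∀ k : ℕ, γ.HasOnRight (a + 2 * k)) → (∀ k : ℕ, γ.HasOnLeft (b - 2 * k)) →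
      G (a - b) ≠ 0 := fun a b ha hb => G_ne_zero fun k hk => by
    have h1 := ha k
    have h2 := hb 0
    rw [show a + 2 * (k : ℂ) = b - 2 * (0 : ℕ) by push_cast; linear_combination hk] at h1
    exact IndentedLine.not_left_and_right h2 h1
  have hd : ∀ (u x : ℂ), Differentiable ℂ fun η : ℂ => (G (x + u * η))⁻¹ := fun u x =>
    differentiable_G_inv.comp (f := fun η : ℂ => x + u * η) (by fun_prop)
  have key := F.contour_eq (γ := fun _ => γ) (Q := fun _ x => ∃ k : ℕ, x = b₁ - 2 * k ∨ x = b₂ - 2 * k) (W := W)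
    (X := fun η => 4 * Real.pi * (G (a₁ + a₂ - b₁ - b₂ + 2 * η))⁻¹)
    (Y := fun η => (G (a₁ - b₁ + 1 * η))⁻¹ * (G (a₁ - b₂ + 1 * η))⁻¹ * (G (a₂ - b₁ + 1 * η))⁻¹ *
      (G (a₂ - b₂ + 1 * η))⁻¹) ?_ ?_ ?_ ((hd _ _).const_mul _)
    ((((hd _ _).mul (hd _ _)).mul (hd _ _)).mul (hd _ _)) ⟨max b₁.re b₂.re + 2, fun c hc =>
      ⟨max (c + 1 - a₁.re) (c + 1 - a₂.re), fun η hη => ?_⟩⟩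
  · rw [contour] at key
    have h1 : ∀ t : Fin 1 → ℝ, F.ker 0 (fun j => γ.path (t j)) * W (fun j => γ.path (t j)) *
        ∏ j, deriv γ.path (t j) = (fun t => G (a₁ - γ.path t) * G (a₂ - γ.path t) *
          (G (γ.path t - b₁) * G (γ.path t - b₂)) * deriv γ.path t) (t 0) := fun t => by
      simp [hker, W]
    simp only [h1] at key
    rw [integral_fin_one fun t => G (a₁ - γ.path t) * G (a₂ - γ.path t) *
          (G (γ.path t - b₁) * G (γ.path t - b₂)) * deriv γ.path t] at key
    simp only [mul_zero, add_zero, pow_one] at key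
    have n1 := hN a₁ b₁ ha₁ hb₁
    have n2 := hN a₁ b₂ ha₁ hb₂
    have n3 := hN a₂ b₁ ha₂ hb₁
    have n4 := hN a₂ b₂ ha₂ hb₂
    generalize (G (a₁ + a₂ - b₁ - b₂))⁻¹ = g at key ⊢
    have := Complex.I_ne_zero
    generalize (∫ t, G (a₁ - γ.path t) * G (a₂ - γ.path t) * (G (γ.path t - b₁) * G (γ.path t - b₂)) *
      deriv γ.path t) = J at key ⊢
    field_simp at key
    linear_combination -key
  · rintro (j | _ | e | e) k
    · simpa [F] using ha₁ k
    · simpa [F] using ha₂ k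
    · exact e.elim
    · exact e.elim
  · rintro j x ⟨k, rfl | rfl⟩
    exacts [hb₁ k, hb₂ k]
  · intro N
    -- After `K` poles of each factor have been cleared, the shifted Gamma functions are regular and
    -- bounded on the strips inside `Re z > -N`.
    obtain ⟨K, hK⟩ := exists_nat_gt (N + 1 + |b₁.re| + |b₂.re|)
    have e : ∀ (s : Fin 1 → ℂ) (b : ℂ), (s 0 - b + 2 * (K : ℂ)).re = (s 0).re - b.re + 2 * K := by simp
    have hK0 : (0 : ℝ) ≤ N := Nat.cast_nonneg N
    have i1 := abs_le.1 (le_refl |b₁.re|)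
    have i2 := abs_le.1 (le_refl |b₂.re|)
    refine ⟨rootList b₁ K ++ rootList b₂ K, fun s => 2 ^ K * 2 ^ K * (G (s 0 - b₁ + 2 * K) *
      G (s 0 - b₂ + 2 * K)), ?_, ?_, fun a' ha' R => ?_, fun s _ hs => ?_⟩
    · intro e he
      simp only [rootList, List.mem_append, List.mem_map, List.mem_range] at he
      obtain ⟨k, -, rfl⟩ | ⟨k, -, rfl⟩ := he
      exacts [⟨k, Or.inl rfl⟩, ⟨k, Or.inr rfl⟩]
    · refine DifferentiableOn.const_mul ((differentiableOn_G_comp (by fun_prop) fun s hs => ?_).mul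
        (differentiableOn_G_comp (by fun_prop) fun s hs => ?_)) _ <;>
      · have := hs 0
        rw [e]; linarith
    · refine ((PolyLike.const _).growth _).mul ((growth_G_comp (b := R + |b₁.re| + |b₂.re| + 2 * K)
        fun s hs => ?_).mul (growth_G_comp (b := R + |b₁.re| + |b₂.re| + 2 * K) fun s hs => ?_)) <;>
      · have := hs 0
        rw [e]; constructor <;> linarith
    · have h1 : ∀ k : ℕ, s 0 - b₁ ≠ -(2 * k) := fun k hk => hs 0 ⟨k, Or.inl (by linear_combination hk)⟩
      have h2 : ∀ k : ℕ, s 0 - b₂ ≠ -(2 * k) := fun k hk => hs 0 ⟨k, Or.inr (by linear_combination hk)⟩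
      have : linProd (rootList b₁ K ++ rootList b₂ K) s =
          linProd (rootList b₁ K) s * linProd (rootList b₂ K) s := by simp [linProd]
      beta_reduce
      rw [this, linProd_rootList, linProd_rootList, G_add K h1, G_add K h2]
      simp only [W]
      ring
  · have m1 := le_max_left b₁.re b₂.re
    have m2 := le_max_right b₁.re b₂.re
    have m3 := (le_max_left _ _).trans hη
    have m4 := (le_max_right _ _).trans hη
    have h1 := barnes_straight (a₁ := a₁ + η) (a₂ := a₂ + η) (b₁ := b₁) (b₂ := b₂) (c := c) (by linarith)
      (by linarith) (by rw [add_re]; linarith) (by rw [add_re]; linarith)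
    have h2 : ∀ t : Fin 1 → ℝ, F.ker η (vpt (fun _ => c) t) * W (vpt (fun _ => c) t) =
        (fun t : ℝ => G (a₁ + η - (c + t * I)) * G (a₂ + η - (c + t * I)) *
        (G ((c + t * I) - b₁) * G ((c + t * I) - b₂))) (t 0) := fun t => by
      simp [hker, W, vpt]
    simp only [h2]
    rw [integral_fin_one fun t : ℝ => G (a₁ + η - (c + t * I)) * G (a₂ + η - (c + t * I)) *
        (G ((c + t * I) - b₁) * G ((c + t * I) - b₂))]
    have n : ∀ a b : ℂ, b.re < a.re + η.re → G (a - b + 1 * η) ≠ 0 := fun a b h =>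
      G_ne_zero (ne_neg_two_mul_of_re_pos (by simp; linarith))
    have n1 := n a₁ b₁ (by linarith)
    have n2 := n a₁ b₂ (by linarith)
    have n3 := n a₂ b₁ (by linarith)
    have n4 := n a₂ b₂ (by linarith)
    have n5 : G (a₁ + a₂ - b₁ - b₂ + 2 * η) ≠ 0 :=
      G_ne_zero (ne_neg_two_mul_of_re_pos (by simp; linarith))
    rw [show a₁ + η - b₁ = a₁ - b₁ + 1 * η by ring, show a₁ + η - b₂ = a₁ - b₂ + 1 * η by ring,
      show a₂ + η - b₁ = a₂ - b₁ + 1 * η by ring, show a₂ + η - b₂ = a₂ - b₂ + 1 * η by ring,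
      show a₁ + η + (a₂ + η) - b₁ - b₂ = a₁ + a₂ - b₁ - b₂ + 2 * η by ring] at h1
    generalize (∫ t : ℝ, G (a₁ + η - (c + t * I)) * G (a₂ + η - (c + t * I)) *
      (G ((c + t * I) - b₁) * G ((c + t * I) - b₂))) = J at h1 ⊢
    simp only [one_mul] at h1 n1 n2 n3 n4 ⊢
    field_simp
    linear_combination h1

section
/-! ### The kernel after integrating out the first set of variables -/

/-- An arc from `x` to the far right avoiding `Γ` consists of points to the right of `Γ`, whereas
`γ` translated by `-δ` consists of points to its left. As the sides are disjoint, the arc translated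
by `δ` avoids `γ`. -/
theorem IndentedLine.HasOnRight.of_left_translates {γ Γ : IndentedLine} {x : ℂ} (hx : Γ.HasOnRight x) (δ : ℂ)
    (h : ∀ t, Γ.HasOnLeft (γ.path t - δ)) : γ.HasOnRight (x + δ) := by
  obtain ⟨B, -, hB⟩ := γ.exists_bound
  have hγB : ∀ t, (γ.path t).re ≤ B := fun t => (abs_le.1 (hB t).1).2
  obtain ⟨X, hX, hJ⟩ := hx
  set Y : ℝ := max X (B + 1 - δ.re)
  have hXY : JoinedIn (range Γ.path)ᶜ (X : ℂ) (Y : ℂ) := by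
    refine (((convex_halfSpace_re_ge X).isPathConnected ⟨X, by simp⟩).joinedIn (X : ℂ) (by simp) (Y : ℂ)
      (by simp [Y])).mono fun w hw => ?_
    rintro ⟨t, rfl⟩
    exact absurd (hX t) (not_lt.2 hw)
  have hxY := hJ.trans hXY
  have hP := (isPathConnected_pathComponentIn hJ.source_mem).joinedIn x
    (mem_pathComponentIn_self hJ.source_mem) Y hxY
  have hm := (hP.map (f := fun z => z + δ) (by fun_prop)).mono (V := (range γ.path)ᶜ) (by
    rintro _ ⟨z, hz, rfl⟩ ⟨t, ht⟩
    have h1 := h t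
    rw [show γ.path t - δ = z by simp [ht]] at h1
    exact IndentedLine.not_left_and_right h1 ⟨X, hX, JoinedIn.trans (JoinedIn.symm hz) hJ⟩)
  obtain ⟨Z, hZ, hYZ⟩ := IndentedLine.hasOnRight_of_lt hγB (z := Y + δ) (by
    have := le_max_right X (B + 1 - δ.re)
    simp only [add_re, ofReal_re, Y]
    linarith)
  exact ⟨Z, hZ, hm.trans hYZ⟩

variable {m : ℕ}

/-- The poles of the kernel of the Baxter identity. -/
def starPoles (σ : ℂ) (p : Fin (m + 1) → ℂ) : Poles (m + 1) (Fin (m + 1)) (Fin m) where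
  coord := Sum.elim id (Sum.elim Fin.castSucc Fin.succ)
  root := Sum.elim p (Sum.elim (Fin.cases σ fun j => p j.succ + 2 * σ)
    (Sum.elim (fun j => p j.succ + σ) fun j => p j.castSucc + σ))
  weight := Sum.elim (fun _ => 1) (Sum.elim (Fin.cases 1 fun _ => 3) fun _ => 2)
  one_le := by
    rintro (j | j | j)
    · exact le_rfl
    · refine Fin.cases ?_ (fun j => ?_) j <;> norm_num
    · norm_num

theorem starPoles_ker (σ : ℂ) (p : Fin (m + 1) → ℂ) (η : ℂ) (z : Fin (m + 1) → ℂ) :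
    (starPoles σ p).ker η z = (∏ j, G (p j + η - z j)) * ((G (σ + η - z 0) *
      ∏ j : Fin m, G (p j.succ + 2 * σ + 3 * η - z j.succ)) *
      ∏ j : Fin m, Bt (p j.succ + σ + 2 * η - z j.castSucc) (p j.castSucc + σ + 2 * η - z j.succ)) := by
  simp [starPoles, Poles.ker, Poles.arg, Poles.var, Fin.prod_univ_succ]

/-- In the first site the Gamma function in the denominator of the Beta factor cancels one of the
numerators, leaving `G (p 0 + σ)`, independent of `z`, and `G (σ - z 0)`. The velocities `1`, `3`,
`2` of `starPoles` record the effect of translating `σ` and `p` by `η`. -/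
theorem starK_eq (σ : ℂ) (p : Fin (m + 1) → ℂ) (η : ℂ) (z : Fin (m + 1) → ℂ)
    (h : G (p 0 + η - z 0 + 2 * (σ + η)) ≠ 0) :
    starK (σ + η) (fun j => p j + η) z = G (p 0 + σ + 2 * η) * (starPoles σ p).ker η z := by
  rw [starPoles_ker, starK, prod_mul_distrib, prod_mul_distrib,
    Fin.prod_univ_succ fun j => G (p j + η - z j + 2 * (σ + η)),
    Fin.prod_univ_succ fun j => Bt (p j + η - sh z j + (σ + η)) (sh (fun j => p j + η) j - z j + (σ + η))]
  simp only [sh_zero, sh_succ]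
  have e1 : ∀ j : Fin m, p j.succ + η - z j.succ + 2 * (σ + η) = p j.succ + 2 * σ + 3 * η - z j.succ :=
    fun j => by ring
  have e2 : ∀ j : Fin m, p j.succ + η - z j.castSucc + (σ + η) = p j.succ + σ + 2 * η - z j.castSucc :=
    fun j => by ring
  have e3 : ∀ j : Fin m, p j.castSucc + η - z j.succ + (σ + η) = p j.castSucc + σ + 2 * η - z j.succ :=
    fun j => by ring
  have e4 : p 0 + η - 0 + (σ + η) + (0 - z 0 + (σ + η)) = p 0 + η - z 0 + 2 * (σ + η) := by ring
  simp only [e1, e2, e3]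
  rw [Bt, e4, show p 0 + η - 0 + (σ + η) = p 0 + σ + 2 * η by ring, show 0 - z 0 + (σ + η) = σ + η - z 0 by ring]
  field_simp

variable {b : Fin (m + 1) → ℂ} {σ : ℂ} {p : Fin (m + 1) → ℂ} {γq : Fin m → IndentedLine}
  {γr : Fin (m + 1) → IndentedLine}

namespace Separates

/-- Except for the last index this is not among the separation hypotheses; it follows through the
`q`-path between `p j` and the path of `r j`. -/
theorem p_right (h : Separates b σ p γq γr) (j : Fin (m + 1)) (k : ℕ) : (γr j).HasOnRight (p j + 2 * k) := by
  induction j using Fin.lastCases with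
  | last => exact h.p_sub_r k
  | cast j =>
    have := (h.p_sub_q j k).of_left_translates (γ := γr j.castSucc) 0 fun t => by
      have := h.q_sub_r j 0 t
      rwa [Nat.cast_zero, mul_zero] at this
    rwa [add_zero] at this

/-- Each sequence of poles present after the `q`-integration is either separated by hypothesis or
obtained by passing from a `q`-path to an adjacent `r`-path, with shift `0` or `σ`. -/
theorem starPoles_right (h : Separates b σ p γq γr) (i) (k : ℕ) :
    (γr ((starPoles σ p).var i)).HasOnRight ((starPoles σ p).root i + 2 * k) := by
  have h1 : ∀ j t, (γq j).HasOnLeft ((γr j.castSucc).path t - 0) := fun j t => by simpa using h.q_sub_r j 0 t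
  have h2 : ∀ j t, (γq j).HasOnLeft ((γr j.succ).path t - σ) := fun j t => by simpa using h.q_sub_r' j 0 t
  rcases i with j | j | j | j
  · exact h.p_right j k
  · refine Fin.cases (h.sigma_sub_r k) (fun j => ?_) j
    change (γr j.succ).HasOnRight (p j.succ + 2 * σ + 2 * k)
    convert (h.p_sub_q' j k).of_left_translates σ (h2 j) using 1
    ring
  · change (γr j.castSucc).HasOnRight (p j.succ + σ + 2 * k)
    convert (h.p_sub_q' j k).of_left_translates 0 (h1 j) using 1
    ring
  · change (γr j.succ).HasOnRight (p j.castSucc + σ + 2 * k)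
    convert (h.p_sub_q j k).of_left_translates σ (h2 j) using 1
    ring

theorem regular (h : Separates b σ p γq γr) : Regular b p := regular_of_not_polar fun j hj =>
  IndentedLine.not_left_and_right (h.polar j _ hj) (by simpa using h.p_right j 0)

theorem not_polar (h : Separates b σ p γq γr) (t : Fin (m + 1) → ℝ) (j : Fin (m + 1)) :
    ¬ PolarHyperplane b j ((γr j).path (t j)) := fun hj =>
  (h.polar j _ hj).notMem_range ⟨t j, rfl⟩

/-- With `σ` and all `p j` translated by a large `η` this is `star_identity`; `contour_eq` continues
it to `η = 0`. Gamma factors enter `X` and `Y` as reciprocals to keep these entire, and at `η = 0`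
the hypotheses on `σ ± b j` and `p 0 + σ` allow dividing them out again. -/
theorem baxter (h : Separates b σ p γq γr)
    (hσ : ∀ (j : Fin (m + 1)) (k : ℕ), σ + b j ≠ -(2 * k) ∧ σ - b j ≠ -(2 * k))
    (hp : ∀ k : ℕ, p 0 + σ ≠ -(2 * k)) :
    (∏ j, G (σ + b j) * G (σ - b j)) * V b p = mfac (m + 1) p * (G (p 0 + σ) *
      (1 / (4 * Real.pi * I) ^ (m + 1) *
        contour γr fun r => (starPoles σ p).ker 0 r * (V b r / mfac (m + 1) r))) := by
  obtain ⟨F, g, hr⟩ := h.regular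
  obtain ⟨M₁, hM₁⟩ := hr.exists_eq
  obtain ⟨M₂, hM₂⟩ := exists_converges b
  set β : Fin (m + 1) → ℂ := fun j => b j / 2 with hβ
  obtain ⟨T₁, hT₁⟩ := Finite.exists_ge fun j => (p j).re
  obtain ⟨T₂, hT₂⟩ := Finite.exists_le fun j => |(β j).re|
  have hd : ∀ (u x : ℂ), Differentiable ℂ fun η : ℂ => (G (x + u * η))⁻¹ := fun u x =>
    differentiable_G_inv.comp (f := fun η : ℂ => x + u * η) (by fun_prop)
  have hpη : Differentiable ℂ fun η : ℂ => fun j => p j + η := by fun_prop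
  have key := (starPoles σ p).contour_eq (γ := γr) h.starPoles_right h.polar
    (W := fun r => V b r / mfac (m + 1) r)
    (X := fun η => F (fun j => p j + η) * (4 * Real.pi) ^ (m + 1) * (G (p 0 + σ + 2 * η))⁻¹)
    (Y := fun η => g (fun j => p j + η) * mfac (m + 1) (fun j => p j + η) *
      ∏ j, ((G (σ + b j + 1 * η))⁻¹ * (G (σ - b j + 1 * η))⁻¹)) (fun N => by
        obtain ⟨ℓ, E, M, h1, h2, h3, -, h4⟩ := exists_reduced b N
        refine ⟨ℓ, E, h1, h2, h3, fun s hs hQ => ?_⟩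
        rw [div_mul_eq_mul_div, h4 s hs hQ, mul_div_cancel_left₀ _ (mfac_ne_zero s)])
    (((hr.1.comp hpη).mul_const _).mul (hd _ _))
    (((hr.2.1.comp hpη).mul (differentiable_mfac.comp hpη)).mul (differentiableOn_univ.1
      (differentiableOn_prod fun j => ((hd _ _).mul (hd _ _)).differentiableOn)))
    ⟨max (absc (m + 1) (fun j => (β j).re) + 1) (M₂ + 1), fun c hc =>
      ⟨max (c + 1 + |M₁| + |T₁|) (2 * T₂ + c + 1) + |σ.re|, fun η hη => ?_⟩⟩
  · simp only [mul_zero, add_zero] at key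
    have hG : ∀ j, G (σ + b j) ≠ 0 ∧ G (σ - b j) ≠ 0 := fun j =>
      ⟨G_ne_zero fun k => (hσ j k).1, G_ne_zero fun k => (hσ j k).2⟩
    have hG' : ∏ j, G (σ + b j) * G (σ - b j) ≠ 0 :=
      Finset.prod_ne_zero_iff.2 fun j _ => mul_ne_zero (hG j).1 (hG j).2
    have hG0 : G (p 0 + σ) ≠ 0 := G_ne_zero hp
    have e : ∏ j, ((G (σ + b j))⁻¹ * (G (σ - b j))⁻¹) = (∏ j, G (σ + b j) * G (σ - b j))⁻¹ := by
      rw [← Finset.prod_inv_distrib]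
      exact prod_congr rfl fun j _ => (mul_inv _ _).symm
    rw [e] at key
    rw [V_eq hr, mul_pow _ I]
    have hpi : (4 * Real.pi : ℂ) ^ (m + 1) ≠ 0 :=
      pow_ne_zero _ (mul_ne_zero (by norm_num) (Complex.ofReal_ne_zero.2 pi_ne_zero))
    have hI : I ^ (m + 1) ≠ 0 := pow_ne_zero _ Complex.I_ne_zero
    have hg : g p ≠ 0 := hr.2.2.1
    generalize contour γr _ = J at key ⊢
    generalize ∏ j, G (σ + b j) * G (σ - b j) = q at key hG' ⊢
    generalize (4 * Real.pi : ℂ) ^ (m + 1) = u at key hpi ⊢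
    generalize I ^ (m + 1) = w at key hI ⊢
    generalize G (p 0 + σ) = g₀ at key hG0 ⊢
    change F p * u * g₀⁻¹ = g p * mfac (m + 1) p * q⁻¹ * _ at key
    field_simp at key ⊢
    linear_combination key
  · have a0 := absc_nonneg fun j => (β j).re
    have c1 := (le_max_left _ _).trans hc
    have c2 := (le_max_right _ _).trans hc
    have n1 := le_max_left (c + 1 + |M₁| + |T₁|) (2 * T₂ + c + 1)
    have n2 := le_max_right (c + 1 + |M₁| + |T₁|) (2 * T₂ + c + 1)
    have s1 := abs_le.1 (le_refl |σ.re|)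
    have s2 := abs_le.1 (le_refl |T₁|)
    have s3 := abs_le.1 (le_refl |M₁|)
    have hT0 : 0 ≤ T₂ := (abs_nonneg _).trans (hT₂ 0)
    have pc : ∀ j, c < (p j + η).re ∧ M₁ < (p j + η).re := fun j => by
      have := hT₁ j
      rw [add_re]; constructor <;> linarith [abs_nonneg σ.re]
    have σc : c < (σ + η).re ∧ 2 * T₂ < (σ + η).re := by
      rw [add_re]; constructor <;> linarith
    have h1 := star_identity (σ := σ + η) (p := fun j => p j + η) (c := fun _ => c) (β := β)
      (fun j => by linarith [hT₂ j]) (fun j => (pc j).1)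
      (fun j => by linarith [sh_const_re_le c (by linarith) j, (pc j).1])
      (fun j => by
        refine Fin.cases ?_ (fun j => ?_) j
        · rw [sh_zero, Complex.zero_re]; linarith
        · rw [sh_succ]; linarith [(pc j.castSucc).1]) (by linarith)
      (convAbs_wAbs _ _ fun j => by rw [ofReal_re]; linarith)
      (convAbs_wAbs _ _ fun j => by linarith [(pc j).1])
    have h2 : ∀ t, starK (σ + η) (fun j => p j + η) (vpt (fun _ => c) t) * v β (vpt (fun _ => c) t) =
        G (p 0 + σ + 2 * η) * ((starPoles σ p).ker η (vpt (fun _ => c) t) *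
          (V b (vpt (fun _ => c) t) / mfac (m + 1) (vpt (fun _ => c) t))) := fun t => by
      have hre : ∀ j, (vpt (fun _ => c) t j : ℂ).re = c := fun j => by simp [vpt]
      have hz := hM₂ (vpt (fun _ => c) t) fun j => by rw [hre]; linarith
      rw [starK_eq _ _ _ _ (G_ne_zero (ne_neg_two_mul_of_re_pos (by
        have h3 : (p 0 + η - vpt (fun _ => c) t 0 + 2 * (σ + η)).re = (p 0 + η).re - c + 2 * (σ + η).re := by
          rw [add_re, sub_re, hre]; simp
        rw [h3]; linarith [(pc 0).1]))), V, if_pos hz.1, hz.2, mul_div_cancel_left₀ _ (mfac_ne_zero _),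
        mul_assoc]
    simp only [h2] at h1
    rw [integral_const_mul] at h1
    have h3 : ∀ j, Gamma ((σ + η) / 2 + β j) = G (σ + b j + 1 * η) := fun j => by
      rw [G]; congr 1; simp only [hβ]; ring
    have h4 : ∀ j, Gamma ((σ + η) / 2 - β j) = G (σ - b j + 1 * η) := fun j => by
      rw [G]; congr 1; simp only [hβ]; ring
    simp only [h3, h4] at h1
    have hb : ∀ j, (b j).re = 2 * (β j).re := fun j => by simp [hβ]; ring
    have hG' : ∏ j, G (σ + b j + 1 * η) * G (σ - b j + 1 * η) ≠ 0 := Finset.prod_ne_zero_iff.2 fun j _ => by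
      have h5 := abs_le.1 (hT₂ j)
      have h6 := σc.2
      rw [add_re] at h6
      exact mul_ne_zero (G_ne_zero (ne_neg_two_mul_of_re_pos (by
        rw [one_mul, add_re, add_re, hb]; linarith)))
        (G_ne_zero (ne_neg_two_mul_of_re_pos (by
        rw [one_mul, add_re, sub_re, hb]; linarith)))
    have e : ∏ j, ((G (σ + b j + 1 * η))⁻¹ * (G (σ - b j + 1 * η))⁻¹) =
        (∏ j, G (σ + b j + 1 * η) * G (σ - b j + 1 * η))⁻¹ := by
      rw [← Finset.prod_inv_distrib]
      exact prod_congr rfl fun j _ => (mul_inv _ _).symm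
    have hG0 : G (p 0 + σ + 2 * η) ≠ 0 := G_ne_zero (ne_neg_two_mul_of_re_pos (by
      rw [show p 0 + σ + 2 * η = (p 0 + η) + (σ + η) by ring, add_re]
      linarith [(pc 0).1]))
    have hpi : (4 * Real.pi : ℂ) ^ (m + 1) ≠ 0 :=
      pow_ne_zero _ (mul_ne_zero (by norm_num) (Complex.ofReal_ne_zero.2 pi_ne_zero))
    rw [e, hM₁ _ fun j => (pc j).2]
    generalize (∫ t, (starPoles σ p).ker η (vpt (fun _ => c) t) *
      (V b (vpt (fun _ => c) t) / mfac (m + 1) (vpt (fun _ => c) t))) = J at h1 ⊢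
    generalize ∏ j, G (σ + b j + 1 * η) * G (σ - b j + 1 * η) = q at h1 hG' ⊢
    generalize (4 * Real.pi : ℂ) ^ (m + 1) = u at h1 hpi ⊢
    generalize G (p 0 + σ + 2 * η) = g₀ at h1 hG0 ⊢
    field_simp at h1 ⊢
    linear_combination g (fun j => p j + η) * mfac (m + 1) (fun j => p j + η) * h1

end Separates
end

section
/-! ### Decay of Gamma functions along paths -/

/-- A shift by `2 K` leads to the half-plane where the decay is known; the linear factors picked up
are bounded below because the values stay away from each pole. -/
theorem exists_norm_G_comp_le {X : Type*} {Z : X → ℂ} {B : ℝ} (hB : ∀ x, |(Z x).re| ≤ B)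
    (h : ∀ k : ℕ, ∃ ε > 0, ∀ x, ε ≤ ‖Z x + 2 * k‖) :
    ∃ C : ℝ, 0 ≤ C ∧ ∀ x, ‖G (Z x)‖ ≤ C * exp (-(1 / 4) * |(Z x).im|) := by
  obtain ⟨K, hK⟩ := exists_nat_gt (B + 1)
  have hpoch : ∃ ε > 0, ∀ x, ε ≤ ‖poch K (Z x)‖ := by
    clear hK
    induction K with
    | zero => exact ⟨1, one_pos, fun x => by simp [poch]⟩
    | succ K ih =>
      obtain ⟨ε, hε, h1⟩ := ih
      obtain ⟨ε', hε', h2⟩ := h K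
      refine ⟨ε * (ε' / 2), by positivity, fun x => ?_⟩
      rw [poch_succ, norm_mul]
      refine mul_le_mul (h1 x) ?_ (by positivity) (norm_nonneg _)
      rw [show Z x / 2 + K = (Z x + 2 * K) / 2 by ring, norm_div, Complex.norm_ofNat]
      linarith [h2 x]
  obtain ⟨ε, hε, h1⟩ := hpoch
  obtain ⟨C, hC, h2⟩ := exists_norm_G_le (a := 1) (b := B + 2 * K) one_pos
  refine ⟨C / ε, by positivity, fun x => ?_⟩
  have h3 := G_add (z := Z x) K fun k hk => by
    obtain ⟨ε', hε', h4⟩ := h k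
    have := h4 x
    rw [hk, neg_add_cancel, norm_zero] at this
    linarith
  have e : (Z x + 2 * (K : ℂ)).re = (Z x).re + 2 * K := by simp
  have e' : (Z x + 2 * (K : ℂ)).im = (Z x).im := by simp
  have hx := abs_le.1 (hB x)
  have h5 := h2 (Z x + 2 * K) (by rw [e]; linarith) (by rw [e]; linarith)
  rw [h3, norm_mul, e'] at h5
  rw [div_mul_eq_mul_div, le_div_iff₀ hε, mul_comm]
  exact (mul_le_mul_of_nonneg_right (h1 x) (norm_nonneg _)).trans h5

namespace IndentedLine

theorem exists_norm_G_sub_le (γ : IndentedLine) {a : ℂ} (h : ∀ k : ℕ, γ.HasOnRight (a + 2 * k)) :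
    ∃ C : ℝ, 0 ≤ C ∧ ∀ t, ‖G (a - γ.path t)‖ ≤ C * exp (-(1 / 4) * |t|) := by
  obtain ⟨B, hB0, hB⟩ := γ.exists_bound
  obtain ⟨C, hC, h1⟩ := exists_norm_G_comp_le (Z := fun t => a - γ.path t) (B := |a.re| + B)
    (fun t => by rw [sub_re]; exact (abs_sub _ _).trans (by linarith [(hB t).1])) fun k => by
      obtain ⟨ε, hε, h2⟩ := γ.exists_dist_le (h k).notMem_range
      refine ⟨ε, hε, fun t => ?_⟩
      rw [← norm_neg, show -(a - γ.path t + 2 * k) = γ.path t - (a + 2 * k) by ring]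
      exact h2 t
  refine ⟨C * exp ((1 / 4) * (|a.im| + B)), by positivity, fun t => (h1 t).trans ?_⟩
  rw [mul_assoc, ← exp_add]
  gcongr
  have h2 : |t| ≤ |(a - γ.path t).im| + (|a.im| + B) := by
    have : t = -(a - γ.path t).im + (a.im - ((γ.path t).im - t)) := by rw [sub_im]; ring
    calc |t| = |-(a - γ.path t).im + (a.im - ((γ.path t).im - t))| := by rw [← this]
      _ ≤ _ := (abs_add_le _ _).trans (by
        rw [abs_neg]
        linarith [abs_sub a.im ((γ.path t).im - t), (hB t).2])
  linarith

/-- The point needing care is a lower bound for the distance to the poles uniform in both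
parameters. For `|s - t|` large the imaginary part suffices; otherwise the difference of the paths
is constant in `t` along the vertical ends, so a compact range of parameters decides. -/
theorem exists_norm_G_path_sub_le (γ₁ γ₂ : IndentedLine) {δ : ℂ}
    (h : ∀ (k : ℕ) t, γ₁.HasOnLeft (γ₂.path t - δ - 2 * k)) :
    ∃ C : ℝ, 0 ≤ C ∧ ∀ t s, ‖G (γ₁.path t - (γ₂.path s - δ))‖ ≤ C * exp (-(1 / 4) * |t - s|) := by
  obtain ⟨B₁, hB₁0, hB₁⟩ := γ₁.exists_bound
  obtain ⟨B₂, hB₂0, hB₂⟩ := γ₂.exists_bound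
  have him : ∀ t s, |t - s| ≤ |(γ₁.path t - (γ₂.path s - δ)).im| + (B₁ + B₂ + |δ.im|) := fun t s => by
    have h1 := abs_le.1 (hB₁ t).2
    have h2 := abs_le.1 (hB₂ s).2
    have h3 := abs_le.1 (le_refl |δ.im|)
    have h4 := abs_le.1 (le_refl |(γ₁.path t - (γ₂.path s - δ)).im|)
    have h5 : (γ₁.path t - (γ₂.path s - δ)).im = (γ₁.path t).im - (γ₂.path s).im + δ.im := by simp; ring
    rw [abs_le]
    constructor <;> linarith
  obtain ⟨C, hC, h1⟩ := exists_norm_G_comp_le (Z := fun x : ℝ × ℝ => γ₁.path x.1 - (γ₂.path x.2 - δ))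
    (B := B₁ + (B₂ + |δ.re|)) (fun x => by
      rw [sub_re, sub_re]
      refine (abs_sub _ _).trans (add_le_add (hB₁ _).1 ((abs_sub _ _).trans ?_))
      linarith [(hB₂ x.2).1]) fun k => by
    obtain ⟨c₁, T₁, hv₁⟩ := γ₁.vertical
    obtain ⟨c₂, T₂, hv₂⟩ := γ₂.vertical
    set R := B₁ + B₂ + |δ.im| + 1
    set T := |T₁| + |T₂| + R
    have hR : 0 < R := by positivity
    have hT : 0 ≤ T := by positivity
    set f : ℝ × ℝ → ℝ := fun x => ‖γ₁.path x.1 - (γ₂.path (x.1 + x.2) - δ) + 2 * k‖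
    have hf : Continuous f := by
      have := γ₁.continuous_path
      have := γ₂.continuous_path
      fun_prop
    obtain ⟨x₀, -, hx₀⟩ := (isCompact_Icc.prod (isCompact_Icc (a := -R) (b := R)) :
      IsCompact (Icc (-T) T ×ˢ Icc (-R) R)).exists_isMinOn ⟨(0, 0), by simp [hT, hR.le]⟩ hf.continuousOn
    have hpos : 0 < f x₀ := norm_pos_iff.2 fun h0 => (h k (x₀.1 + x₀.2)).notMem_range ⟨x₀.1, by
      linear_combination h0⟩
    have hfar : ∀ t u, T ≤ |t| → |u| ≤ R → γ₁.path t - (γ₂.path (t + u) - δ) = c₁ - c₂ - u * I + δ :=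
      fun t u ht hu => by
        rw [hv₁ t (by linarith [le_abs_self T₁, abs_nonneg T₂]), hv₂ (t + u) (by
          have := abs_sub_abs_le_abs_sub t (-u)
          rw [abs_neg, sub_neg_eq_add] at this
          linarith [le_abs_self T₂, abs_nonneg T₁])]
        push_cast; ring
    refine ⟨min (f x₀) 1, lt_min hpos one_pos, fun x => ?_⟩
    rcases le_or_gt |x.2 - x.1| R with hu | hu
    · refine (min_le_left _ _).trans ?_
      have hu' := abs_le.1 hu
      have hx : x.1 + (x.2 - x.1) = x.2 := by ring
      rcases le_or_gt |x.1| T with ht | ht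
      · have := hx₀ (show (x.1, x.2 - x.1) ∈ Icc (-T) T ×ˢ Icc (-R) R from ⟨abs_le.1 ht, hu'⟩)
        simpa only [f, hx, mem_ofPred_eq] using this
      · have := hx₀ (show (T, x.2 - x.1) ∈ Icc (-T) T ×ˢ Icc (-R) R from ⟨⟨by linarith, le_rfl⟩, hu'⟩)
        simp only [f, mem_ofPred_eq] at this
        rwa [hfar T _ (le_abs_self T) hu, ← hfar x.1 _ ht.le hu, hx] at this
    · refine (min_le_right _ _).trans ?_
      have h2 := him x.1 x.2
      rw [abs_sub_comm] at h2
      have h3 := Complex.abs_im_le_norm (γ₁.path x.1 - (γ₂.path x.2 - δ) + 2 * k)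
      rw [add_im, show (2 * (k : ℂ)).im = 0 by simp, add_zero] at h3
      linarith
  refine ⟨C * exp ((1 / 4) * (B₁ + B₂ + |δ.im|)), by positivity, fun t s => (h1 (t, s)).trans ?_⟩
  rw [mul_assoc, ← exp_add]
  gcongr
  linarith [him t s]

end IndentedLine

/-! ### The iterated Barnes integral -/

variable {m : ℕ} {b : Fin (m + 1) → ℂ} {σ : ℂ} {p : Fin (m + 1) → ℂ} {γq : Fin m → IndentedLine}
  {γr : Fin (m + 1) → IndentedLine}

/-- The factors depending on one of the variables `q`. -/
def link (σ : ℂ) (p : Fin (m + 1) → ℂ) (j : Fin m) (q r r' : ℂ) : ℂ :=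
  G (p j.castSucc - q) * G (p j.succ + σ - q) * (G (q - r) * G (q - (r' - σ)))

/-- The factors independent of the variables `q`. -/
def ends (b : Fin (m + 1) → ℂ) (σ : ℂ) (p r : Fin (m + 1) → ℂ) : ℂ :=
  V b r / mfac (m + 1) r * (G (σ - r 0) * G (p (Fin.last m) - r (Fin.last m)))

/-- The power of `π` in a Gamma factor. -/
def piPow (s : ℂ) : ℂ := (Real.pi : ℂ) ^ (-s / 2)

theorem piPow_add (s t : ℂ) : piPow (s + t) = piPow s * piPow t := by
  rw [piPow, piPow, piPow, ← Complex.cpow_add _ _ (Complex.ofReal_ne_zero.2 pi_ne_zero)]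
  congr 1; ring

theorem piPow_ne_zero (s : ℂ) : piPow s ≠ 0 := fun h =>
  Complex.ofReal_ne_zero.2 pi_ne_zero ((Complex.cpow_eq_zero_iff _ _).1 h).1

theorem Gammaℝ_eq (s : ℂ) : Complex.Gammaℝ s = piPow s * G s := Complex.Gammaℝ_def s

/-- The powers of `π` from the variables `q` cancel in pairs, those from `r` are cancelled by
`mfac`, and those from `p` are collected in `mfac` at `p`; each of the `n` factors with `σ` leaves
`π^{-σ}`. -/
theorem barnesIntegrand_eq (q : Fin m → ℂ) (r : Fin (m + 1) → ℂ) : barnesIntegrand b σ p q r =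
    mfac (m + 1) p * piPow (2 * σ) ^ (m + 1) * G (p 0 + σ) *
      ((∏ j, link σ p j (q j) (r j.castSucc) (r j.succ)) * ends b σ p r) := by
  have hsub : ∀ s t, piPow (s - t) = piPow s * (piPow t)⁻¹ := fun s t => by
    rw [eq_mul_inv_iff_mul_eq₀ (piPow_ne_zero t), ← piPow_add, sub_add_cancel]
  have h1 : ∀ s t u, Complex.Gammaℝ (s - t) * Complex.Gammaℝ (t - u) =
      piPow s * (piPow u)⁻¹ * (G (s - t) * G (t - u)) := fun s t u => by
    rw [Gammaℝ_eq, Gammaℝ_eq, hsub, hsub]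
    field_simp [piPow_ne_zero t]
  have h2 : ∀ s t u, Complex.Gammaℝ (s - t + σ) * Complex.Gammaℝ (t - u + σ) =
      piPow s * (piPow u)⁻¹ * piPow (2 * σ) * (G (s - t + σ) * G (t - u + σ)) := fun s t u => by
    rw [Gammaℝ_eq, Gammaℝ_eq, piPow_add, piPow_add, hsub, hsub, two_mul, piPow_add]
    field_simp [piPow_ne_zero t]
  have h3 : ∀ s : ℂ, (Real.pi : ℂ) ^ (-s) = piPow s * piPow s := fun s => by
    rw [← piPow_add, piPow]; congr 1; ring
  have hP : ∏ j, piPow (r j) ≠ 0 := Finset.prod_ne_zero_iff.2 fun j _ => piPow_ne_zero _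
  have hD := mfac_ne_zero (0 : Fin (m + 1) → ℂ)
  rw [mfac] at hD
  replace hD := (mul_ne_zero_iff.1 hD).1
  have e1 : ∏ j : Fin (m + 1), (G (p j - (Fin.cons (α := fun _ => ℂ) 0 q : Fin (m + 1) → ℂ) j + σ) *
      G ((Fin.cons (α := fun _ => ℂ) 0 q : Fin (m + 1) → ℂ) j - r j + σ)) = G (p 0 + σ) * G (σ - r 0) *
      ((∏ j : Fin m, G (p j.succ + σ - q j)) * ∏ j : Fin m, G (q j - (r j.succ - σ))) := by
    rw [Fin.prod_univ_succ, ← prod_mul_distrib]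
    simp only [Fin.cons_zero, Fin.cons_succ]
    congr 1
    · rw [sub_zero, show 0 - r 0 + σ = σ - r 0 by ring]
    · refine prod_congr rfl fun j _ => ?_
      rw [show p j.succ - q j + σ = p j.succ + σ - q j by ring, show q j - r j.succ + σ = q j - (r j.succ - σ) by ring]
  simp only [barnesIntegrand, h1, h2, ends, mfac, h3]
  rw [prod_mul_distrib, prod_mul_distrib (f := fun j => piPow (p j) * _ * _), e1, Gammaℝ_eq, hsub]
  simp only [link, prod_mul_distrib, prod_const, card_univ, Fintype.card_fin,
    Finset.prod_inv_distrib]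
  rw [Fin.prod_univ_castSucc fun j => piPow (r j)] at hP ⊢
  rw [Fin.prod_univ_castSucc fun j => piPow (p j)]
  obtain ⟨hP1, hP2⟩ := mul_ne_zero_iff.1 hP
  generalize V b r = x₀
  generalize ∏ j : Fin m, G (p j.castSucc - q j) = x₁
  generalize ∏ j : Fin m, G (q j - r j.castSucc) = x₂
  generalize ∏ j : Fin m, G (p j.succ + σ - q j) = x₃
  generalize ∏ j : Fin m, G (q j - (r j.succ - σ)) = x₄
  generalize piPow (2 * σ) ^ (m + 1) = x₅
  generalize G (p 0 + σ) = x₆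
  generalize G (σ - r 0) = x₇
  generalize G (p (Fin.last m) - r (Fin.last m)) = x₈
  generalize ∏ j : Fin m, piPow (r j.castSucc) = x₉ at hP1 ⊢
  generalize piPow (r (Fin.last m)) = x₁₀ at hP2 ⊢
  generalize ∏ j : Fin m, piPow (p j.castSucc) = x₁₁
  generalize piPow (p (Fin.last m)) = x₁₂
  generalize Complex.ofReal _ = x₁₃ at hD ⊢
  field_simp

namespace Separates

/-- Barnes' first lemma with `a₁ = p_j`, `a₂ = p_{j+1} + σ`, `b₁ = r_j`, `b₂ = r_{j+1} - σ`; three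
of the Gamma functions in its value form the Beta factor. -/
theorem integral_link (h : Separates b σ p γq γr) (j : Fin m) (t t' : ℝ) :
    ∫ q, link σ p j ((γq j).path q) ((γr j.castSucc).path t) ((γr j.succ).path t') * deriv (γq j).path q =
      4 * Real.pi * I * (G (p j.castSucc - (γr j.castSucc).path t) *
        G (p j.succ + 2 * σ - (γr j.succ).path t') *
        Bt (p j.succ + σ - (γr j.castSucc).path t) (p j.castSucc + σ - (γr j.succ).path t')) := by
  refine (barnes (h.p_sub_q j) (h.p_sub_q' j) (fun k => h.q_sub_r j k t) fun k => h.q_sub_r' j k t').trans ?_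
  rw [Bt, show p j.castSucc - ((γr j.succ).path t' - σ) = p j.castSucc + σ - (γr j.succ).path t' by ring,
    show p j.succ + σ - ((γr j.succ).path t' - σ) = p j.succ + 2 * σ - (γr j.succ).path t' by ring,
    show p j.castSucc + (p j.succ + σ) - (γr j.castSucc).path t - ((γr j.succ).path t' - σ) =
      p j.succ + σ - (γr j.castSucc).path t + (p j.castSucc + σ - (γr j.succ).path t') by ring]
  ring

/-- The four Gamma factors decay at rate `1/4` in `q`, `q`, `q - t` and `q - t'`. Half of one rate
in `q` and half of each of the last two are used for `t`, and likewise for `t'` by the triangle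
inequality, leaving rates `1/4`, `1/8`, `1/8`. -/
theorem exists_norm_link_le (h : Separates b σ p γq γr) (j : Fin m) : ∃ C : ℝ, 0 ≤ C ∧ ∀ q t t' : ℝ,
    ‖link σ p j ((γq j).path q) ((γr j.castSucc).path t) ((γr j.succ).path t')‖ ≤
      C * (exp (-(1 / 4) * |q|) * (exp (-(1 / 8) * |t|) * exp (-(1 / 8) * |t'|))) := by
  obtain ⟨C₁, hC₁, h1⟩ := (γq j).exists_norm_G_sub_le (h.p_sub_q j)
  obtain ⟨C₂, hC₂, h2⟩ := (γq j).exists_norm_G_sub_le (h.p_sub_q' j)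
  obtain ⟨C₃, hC₃, h3⟩ := (γq j).exists_norm_G_path_sub_le (γr j.castSucc) (δ := 0) fun k t => by
    rw [sub_zero]; exact h.q_sub_r j k t
  obtain ⟨C₄, hC₄, h4⟩ := (γq j).exists_norm_G_path_sub_le (γr j.succ) (h.q_sub_r' j)
  refine ⟨C₁ * C₂ * (C₃ * C₄), by positivity, fun q t t' => ?_⟩
  have h3' := h3 q t
  rw [sub_zero] at h3'
  rw [link, norm_mul, norm_mul, norm_mul]
  refine (mul_le_mul (mul_le_mul (h1 q) (h2 q) (norm_nonneg _) (by positivity))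
    (mul_le_mul h3' (h4 q t') (norm_nonneg _) (by positivity)) (by positivity) (by positivity)).trans ?_
  rw [show ∀ a b c d : ℝ, C₁ * a * (C₂ * b) * (C₃ * c * (C₄ * d)) = C₁ * C₂ * (C₃ * C₄) * (a * b * (c * d)) by
    intros; ring]
  simp only [← exp_add]
  refine mul_le_mul_of_nonneg_left (Real.exp_le_exp.2 ?_) (by positivity)
  have i1 := abs_sub_abs_le_abs_sub t q
  have i2 := abs_sub_abs_le_abs_sub t' q
  rw [abs_sub_comm] at i1 i2
  have i3 := abs_nonneg (q - t)
  have i4 := abs_nonneg (q - t')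
  linarith

end Separates
end

/-! ### Absolute convergence and evaluation of the iterated integral -/

section
variable {m : ℕ} {b : Fin (m + 1) → ℂ} {σ : ℂ} {p : Fin (m + 1) → ℂ} {γq : Fin m → IndentedLine}
  {γr : Fin (m + 1) → IndentedLine}

namespace Separates

theorem exists_le_norm_linProd (h : Separates b σ p γq γr) (ℓ : List (Fin (m + 1) × ℂ))
    (hℓ : ∀ e ∈ ℓ, PolarHyperplane b e.1 e.2) :
    ∃ ε > 0, ∀ t : Fin (m + 1) → ℝ, ε ≤ ‖linProd ℓ fun j => (γr j).path (t j)‖ := by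
  induction ℓ with
  | nil => exact ⟨1, one_pos, fun t => by simp [linProd]⟩
  | cons e ℓ ih =>
    obtain ⟨ε, hε, h1⟩ := ih fun e he => hℓ e (List.mem_cons_of_mem _ he)
    obtain ⟨ε', hε', h2⟩ := (γr e.1).exists_dist_le (h.polar _ _ (hℓ e List.mem_cons_self)).notMem_range
    refine ⟨ε' * ε, by positivity, fun t => ?_⟩
    rw [linProd, List.map_cons, List.prod_cons, norm_mul]
    exact mul_le_mul (h2 _) (h1 t) hε.le (norm_nonneg _)

/-- Continuity and growth of the Mellin transform on the paths. -/
theorem V_path (h : Separates b σ p γq γr) :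
    Continuous (fun t : Fin (m + 1) → ℝ =>
      V b (fun j => (γr j).path (t j)) / mfac (m + 1) fun j => (γr j).path (t j)) ∧
    ∃ C : ℝ, 0 ≤ C ∧ ∀ t : Fin (m + 1) → ℝ,
      ‖V b (fun j => (γr j).path (t j)) / mfac (m + 1) fun j => (γr j).path (t j)‖ ≤
        C * (∏ j, exp (-(1 / 8) * |t j|))⁻¹ := by
  choose B hB0 hB using fun j => (γr j).exists_bound
  obtain ⟨B₁, hB₁⟩ := Finite.exists_le B
  obtain ⟨N, hN⟩ := exists_nat_gt (B₁ + 1)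
  obtain ⟨ℓ, E, M, hℓ, hEd, hEg, -, hE⟩ := exists_reduced b N
  have hre : ∀ (t : Fin (m + 1) → ℝ) j, -B₁ ≤ ((γr j).path (t j)).re ∧ ((γr j).path (t j)).re ≤ B₁ :=
    fun t j => abs_le.1 ((hB j (t j)).1.trans (hB₁ j))
  have hmem : ∀ t : Fin (m + 1) → ℝ, (fun j => (γr j).path (t j)) ∈ halfPi (m + 1) (-N) := fun t j => by
    linarith [(hre t j).1]
  obtain ⟨ε, hε, hl⟩ := h.exists_le_norm_linProd ℓ hℓ
  have hl0 : ∀ t : Fin (m + 1) → ℝ, linProd ℓ (fun j => (γr j).path (t j)) ≠ 0 := fun t =>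
    norm_pos_iff.1 (hε.trans_le (hl t))
  -- On the paths the continued transform is a holomorphic function of moderate growth divided by
  -- polar factors, and the latter are bounded below since polar points lie off the paths.
  have hV : ∀ t : Fin (m + 1) → ℝ,
      V b (fun j => (γr j).path (t j)) / mfac (m + 1) (fun j => (γr j).path (t j)) =
        E (fun j => (γr j).path (t j)) / linProd ℓ fun j => (γr j).path (t j) := fun t => by
    rw [div_eq_div_iff (mfac_ne_zero _) (hl0 t), hE _ (hmem t) (h.not_polar t), mul_comm]
  have hc : Continuous fun (t : Fin (m + 1) → ℝ) j => (γr j).path (t j) :=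
    continuous_pi fun j => (γr j).continuous_path.comp (continuous_apply j)
  simp only [hV]
  refine ⟨(hEd.continuousOn.comp_continuous hc hmem).div ((differentiable_linProd ℓ).continuous.comp hc) hl0, ?_⟩
  obtain ⟨C, hC, hg⟩ := hEg (-B₁ - 1) (by linarith) (B₁ + 1) (1 / 8) (by norm_num)
  refine ⟨C * exp ((1 / 8) * ∑ j, 2 * B j) / ε, by positivity, fun t => ?_⟩
  have h1 := hg (fun j => (γr j).path (t j)) fun j => by
    constructor <;> linarith [(hre t j).1, (hre t j).2]
  have h2 : ‖fun j => (γr j).path (t j)‖ ≤ (∑ j, 2 * B j) + ∑ j, |t j| := by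
    rw [← sum_add_distrib]
    have h0 : ∀ j, 0 ≤ 2 * B j + |t j| := fun j => by linarith [hB0 j, abs_nonneg (t j)]
    refine (pi_norm_le_iff_of_nonneg (Finset.sum_nonneg fun j _ => h0 j)).2 fun j => ?_
    refine le_trans ?_ (Finset.single_le_sum (f := fun j => 2 * B j + |t j|) (fun j _ => h0 j) (Finset.mem_univ j))
    have h3 := abs_add_le (((γr j).path (t j)).im - t j) (t j)
    rw [sub_add_cancel] at h3
    linarith [Complex.norm_le_abs_re_add_abs_im ((γr j).path (t j)), (hB j (t j)).1, (hB j (t j)).2]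
  have h3 : exp ((1 / 8) * ∑ j, |t j|) = (∏ j, exp (-(1 / 8) * |t j|))⁻¹ := by
    rw [← Real.exp_sum, ← exp_neg, ← Finset.mul_sum]
    congr 1; ring
  rw [norm_div, div_mul_eq_mul_div, ← h3, mul_assoc, ← exp_add, ← mul_add]
  refine div_le_div₀ (by positivity) (h1.trans ?_) hε (hl t)
  gcongr

/-- Each `r_j` receives the decay rate `1/8` twice, from its two neighbouring `q`-links, or from the
end factors for the first and the last variable. One of the two pays for the growth of `V`, the
other ensures integrability. -/
theorem integrable_link_mul_ends (h : Separates b σ p γq γr) :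
    Integrable fun x : (Fin m → ℝ) × (Fin (m + 1) → ℝ) =>
      (∏ j, link σ p j ((γq j).path (x.1 j)) ((γr j.castSucc).path (x.2 j.castSucc))
        ((γr j.succ).path (x.2 j.succ)) * deriv (γq j).path (x.1 j)) *
      (ends b σ p (fun j => (γr j).path (x.2 j)) * ∏ j, deriv (γr j).path (x.2 j)) := by
  choose C₁ hC₁ h1 using h.exists_norm_link_le
  choose D₁ hD₁ d1 using fun j => (γq j).exists_norm_deriv_le
  choose D₂ hD₂ d2 using fun j => (γr j).exists_norm_deriv_le
  obtain ⟨hVc, C₂, hC₂, h2⟩ := h.V_path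
  obtain ⟨C₃, hC₃, h3⟩ := (γr 0).exists_norm_G_sub_le h.sigma_sub_r
  obtain ⟨C₄, hC₄, h4⟩ := (γr (Fin.last m)).exists_norm_G_sub_le h.p_sub_r
  have hint : ∀ (n : ℕ) (δ : ℝ), 0 < δ → Integrable fun t : Fin n → ℝ => ∏ j, exp (-δ * |t j|) :=
    fun n δ hδ => Integrable.fintype_prod (f := fun _ t => exp (-δ * |t|))
      fun _ => integrable_exp_neg_mul_abs hδ
  have hq : ∀ j, Measurable (γq j).path := fun j => (γq j).continuous_path.measurable
  have hr : ∀ j, Measurable (γr j).path := fun j => (γr j).continuous_path.measurable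
  refine Integrable.mono' (((hint m (1 / 4) (by norm_num)).mul_prod (hint (m + 1) (1 / 8) (by norm_num))).const_mul
    ((∏ j, C₁ j * D₁ j) * (C₂ * (C₃ * C₄) * ∏ j, D₂ j))) (Measurable.aestronglyMeasurable ?_)
    (Eventually.of_forall fun x => ?_)
  · refine (Finset.measurable_prod _ fun j _ => ?_).mul (((hVc.measurable.comp measurable_snd).mul
      ((measurable_G_comp ?_).mul (measurable_G_comp ?_))).mul (Finset.measurable_prod _ fun j _ => ?_))
    · have := measurable_deriv (γq j).path
      have := hq j
      have := hr j.castSucc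
      have := hr j.succ
      exact (((measurable_G_comp (by fun_prop)).mul (measurable_G_comp (by fun_prop))).mul
        ((measurable_G_comp (by fun_prop)).mul (measurable_G_comp (by fun_prop)))).mul (by fun_prop)
    · have := hr 0
      fun_prop
    · have := hr (Fin.last m)
      fun_prop
    · have := measurable_deriv (γr j).path
      fun_prop
  · obtain ⟨q, t⟩ := x
    have i1 : ‖∏ j, link σ p j ((γq j).path (q j)) ((γr j.castSucc).path (t j.castSucc))
        ((γr j.succ).path (t j.succ)) * deriv (γq j).path (q j)‖ ≤ (∏ j, C₁ j * D₁ j) *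
        ((∏ j, exp (-(1 / 4) * |q j|)) * ((∏ j : Fin m, exp (-(1 / 8) * |t j.castSucc|)) *
          ∏ j : Fin m, exp (-(1 / 8) * |t j.succ|))) := by
      rw [norm_prod]
      refine (Finset.prod_le_prod (fun _ _ => norm_nonneg _) fun j _ => (norm_mul_le _ _).trans
        (mul_le_mul (h1 j (q j) (t j.castSucc) (t j.succ)) (d1 j (q j)) (norm_nonneg _)
          (mul_nonneg (hC₁ j) (by positivity)))).trans_eq ?_
      simp only [prod_mul_distrib]
      ring
    have i2 : ‖ends b σ p fun j => (γr j).path (t j)‖ ≤ C₂ * (∏ j, exp (-(1 / 8) * |t j|))⁻¹ *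
        (C₃ * exp (-(1 / 8) * |t 0|) * (C₄ * exp (-(1 / 8) * |t (Fin.last m)|))) := by
      have e : ∀ s : ℝ, exp (-(1 / 4) * |s|) ≤ exp (-(1 / 8) * |s|) := fun s =>
        Real.exp_le_exp.2 (by linarith [abs_nonneg s])
      rw [ends, norm_mul, norm_mul]
      refine mul_le_mul (h2 t) (mul_le_mul ((h3 _).trans ?_) ((h4 _).trans ?_) (norm_nonneg _) (by positivity))
        (by positivity) (by positivity)
      · exact mul_le_mul_of_nonneg_left (e _) hC₃
      · exact mul_le_mul_of_nonneg_left (e _) hC₄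
    have i3 : ‖∏ j, deriv (γr j).path (t j)‖ ≤ ∏ j, D₂ j := by
      rw [norm_prod]
      exact Finset.prod_le_prod (fun _ _ => norm_nonneg _) fun j _ => d2 j _
    have n1 : 0 ≤ ∏ j, C₁ j * D₁ j := Finset.prod_nonneg fun j _ => mul_nonneg (hC₁ j) (hD₁ j)
    have n2 : 0 ≤ ∏ j, D₂ j := Finset.prod_nonneg fun j _ => hD₂ j
    refine (norm_mul_le _ _).trans ((mul_le_mul i1 ((norm_mul_le _ _).trans (mul_le_mul i2 i3 (norm_nonneg _)
      (by positivity))) (norm_nonneg _) (by positivity)).trans_eq ?_)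
    have f1 := Fin.prod_univ_castSucc fun j => exp (-(1 / 8) * |t j|)
    have f2 := Fin.prod_univ_succ fun j => exp (-(1 / 8) * |t j|)
    have f3 : ∏ j, exp (-(1 / 8) * |t j|) ≠ 0 := Finset.prod_ne_zero_iff.2 fun j _ => Real.exp_ne_zero _
    generalize ∏ j, exp (-(1 / 8) * |t j|) = a at f1 f2 f3 ⊢
    generalize ∏ j : Fin m, exp (-(1 / 8) * |t j.castSucc|) = a₁ at f1 ⊢
    generalize ∏ j : Fin m, exp (-(1 / 8) * |t j.succ|) = a₂ at f2 ⊢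
    generalize exp (-(1 / 8) * |t 0|) = a₃ at f2 ⊢
    generalize exp (-(1 / 8) * |t (Fin.last m)|) = a₄ at f1 ⊢
    -- The bookkeeping of these rates: `a₁ a₄` and `a₃ a₂` are both the full product `a`, and one of
    -- them cancels `a⁻¹`.
    have f4 : a₁ * a₂ * (a⁻¹ * (a₃ * a₄)) = a := by
      rw [show a₁ * a₂ * (a⁻¹ * (a₃ * a₄)) = (a₁ * a₄) * (a₃ * a₂) * a⁻¹ by ring, ← f1, ← f2,
        mul_assoc, mul_inv_cancel₀ f3, mul_one]
    linear_combination (∏ j, C₁ j * D₁ j) * (C₂ * (C₃ * C₄) * ∏ j, D₂ j) *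
      (∏ j, exp (-(1 / 4) * |q j|)) * f4

/-- By Fubini the variables `q` are integrated first; for fixed `r` their integrand is a product
over `j`, so Barnes' first lemma applies to each separately and assembles the kernel of the Baxter
identity. -/
theorem integral_link_mul_ends (h : Separates b σ p γq γr) :
    ∫ x : (Fin m → ℝ) × (Fin (m + 1) → ℝ),
      (∏ j, link σ p j ((γq j).path (x.1 j)) ((γr j.castSucc).path (x.2 j.castSucc))
        ((γr j.succ).path (x.2 j.succ)) * deriv (γq j).path (x.1 j)) *
      (ends b σ p (fun j => (γr j).path (x.2 j)) * ∏ j, deriv (γr j).path (x.2 j)) =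
    (4 * Real.pi * I) ^ m *
      contour γr fun r => (starPoles σ p).ker 0 r * (V b r / mfac (m + 1) r) := by
  have hi := h.integrable_link_mul_ends
  rw [Measure.volume_eq_prod] at hi ⊢
  rw [integral_prod_symm _ hi, contour, ← integral_const_mul]
  refine integral_congr_ae (Eventually.of_forall fun t => ?_)
  dsimp only
  rw [integral_mul_const, integral_fintype_prod_volume_eq_prod fun j q =>
    link σ p j ((γq j).path q) ((γr j.castSucc).path (t j.castSucc)) ((γr j.succ).path (t j.succ)) *
      deriv (γq j).path q]
  simp only [h.integral_link]
  rw [prod_mul_distrib (f := fun _ => 4 * (Real.pi : ℂ) * I), prod_const,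
    card_univ, Fintype.card_fin, starPoles_ker, ends]
  simp only [prod_mul_distrib, mul_zero, add_zero]
  rw [Fin.prod_univ_castSucc fun j => G (p j - (γr j).path (t j))]
  ring

end Separates
end

end SOWhittaker
end

/-! ### Conclusion -/

theorem proposition1p8 (m : ℕ) (b : Fin (m + 1) → ℂ) (σ : ℂ) (p : Fin (m + 1) → ℂ)
    (hσ : ∀ (j : Fin (m + 1)) (k : ℕ), σ + b j ≠ -(2 * k) ∧ σ - b j ≠ -(2 * k))
    (hp : ∀ k : ℕ, p 0 + σ ≠ -(2 * k))
    (γq : Fin m → SOWhittaker.IndentedLine) (γr : Fin (m + 1) → SOWhittaker.IndentedLine)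
    (hsep : SOWhittaker.Separates b σ p γq γr) :
    SOWhittaker.Regular b p ∧
    (∀ t : Fin (m + 1) → ℝ, SOWhittaker.Regular b (fun j => (γr j).path (t j))) ∧
    MeasureTheory.Integrable (SOWhittaker.pulledBack b σ p γq γr) ∧
    SOWhittaker.V b p =
      1 / (∏ j, Complex.Gammaℝ (σ + b j) * Complex.Gammaℝ (σ - b j)) *
        (1 / (4 * (Real.pi : ℂ) * Complex.I) ^ (2 * m + 1)) *
        ∫ x : (Fin m → ℝ) × (Fin (m + 1) → ℝ), SOWhittaker.pulledBack b σ p γq γr x := by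
  have hpull : SOWhittaker.pulledBack b σ p γq γr = fun x => SOWhittaker.mfac (m + 1) p *
      SOWhittaker.piPow (2 * σ) ^ (m + 1) * SOWhittaker.G (p 0 + σ) *
      ((∏ j, SOWhittaker.link σ p j ((γq j).path (x.1 j)) ((γr j.castSucc).path (x.2 j.castSucc))
        ((γr j.succ).path (x.2 j.succ)) * deriv (γq j).path (x.1 j)) *
      (SOWhittaker.ends b σ p (fun j => (γr j).path (x.2 j)) * ∏ j, deriv (γr j).path (x.2 j))) := by
    funext x
    rw [SOWhittaker.pulledBack, SOWhittaker.barnesIntegrand_eq, Finset.prod_mul_distrib]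
    ring
  refine ⟨hsep.regular, fun t => SOWhittaker.regular_of_not_polar (hsep.not_polar t), ?_, ?_⟩
  · rw [hpull]
    exact hsep.integrable_link_mul_ends.const_mul _
  · have hG : ∏ j, SOWhittaker.G (σ + b j) * SOWhittaker.G (σ - b j) ≠ 0 := Finset.prod_ne_zero_iff.2
      fun j _ => mul_ne_zero (SOWhittaker.G_ne_zero fun k => (hσ j k).1) (SOWhittaker.G_ne_zero fun k => (hσ j k).2)
    -- The powers of `π` in `σ + b j` and `σ - b j` combine to one independent of `b`, the same as
    -- in the integrand.
    have hΓ : ∏ j, Complex.Gammaℝ (σ + b j) * Complex.Gammaℝ (σ - b j) = SOWhittaker.piPow (2 * σ) ^ (m + 1) *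
        ∏ j, SOWhittaker.G (σ + b j) * SOWhittaker.G (σ - b j) := by
      have : ∀ j, Complex.Gammaℝ (σ + b j) * Complex.Gammaℝ (σ - b j) = SOWhittaker.piPow (2 * σ) *
          (SOWhittaker.G (σ + b j) * SOWhittaker.G (σ - b j)) := fun j => by
        have h := SOWhittaker.piPow_add (σ + b j) (σ - b j)
        rw [show σ + b j + (σ - b j) = 2 * σ by ring] at h
        rw [SOWhittaker.Gammaℝ_eq, SOWhittaker.Gammaℝ_eq, h]
        ring
      simp only [this]
      rw [Finset.prod_mul_distrib, Finset.prod_const, Finset.card_univ, Fintype.card_fin]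
    have key := hsep.baxter hσ hp
    -- The exponent `2 m + 1` consists of `m` factors from Barnes' lemma in the `q`-integrals and `m
    -- + 1` from the Baxter identity.
    rw [hpull, MeasureTheory.integral_const_mul, hsep.integral_link_mul_ends, hΓ,
      ← mul_right_inj' hG, key, show 2 * m + 1 = m + (m + 1) by ring, pow_add _ m (m + 1)]
    have h4 : 4 * (Real.pi : ℂ) * Complex.I ≠ 0 := mul_ne_zero
      (mul_ne_zero (by norm_num) (Complex.ofReal_ne_zero.2 Real.pi_ne_zero)) Complex.I_ne_zero
    have h5 := pow_ne_zero m h4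
    have h6 := pow_ne_zero (m + 1) h4
    have h7 := pow_ne_zero (m + 1) (SOWhittaker.piPow_ne_zero (2 * σ))
    generalize (4 * (Real.pi : ℂ) * Complex.I) ^ m = x at h5 ⊢
    generalize (4 * (Real.pi : ℂ) * Complex.I) ^ (m + 1) = y at h6 ⊢
    generalize SOWhittaker.piPow (2 * σ) ^ (m + 1) = z at h7 ⊢
    generalize ∏ j, SOWhittaker.G (σ + b j) * SOWhittaker.G (σ - b j) = w at hG ⊢
    generalize SOWhittaker.contour γr _ = c
    field_simp
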